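/- **Setting.** Fix $k\in\mathbb N_0$, $\beta>0$ and $\eta\in(0,1/4)$. Let $D=[0,1]^k$ with periodic boundary conditions, $S=\mathbb R\times D$, and let $g$ be the Green's function of $-\Delta$ on $S$ (free in $x$, periodic in $y$), $$g(x,y)=-\tfrac{|x|}2+\sum_{n\in\mathbb Z^k\setminus\{0\}}\frac{e^{-|x|\sqrt{\lambda_n}}}{2\sqrt{\lambda_n}}\cos(2\pi n\cdot y),\qquad \lambda_n=4\pi^2|n|^2 .$$ Let $\delta^\eta_z$ be the uniform probability measure on the sphere of radius $\eta$ around $z$ in $S$. A bridge is a continuous path $b=(b_x,b_y):[0,\beta]\to S$ with $b(0)=b(\beta)$. A configuration $\omega$ is a countable set of bridges such that every compact subset of $S$ contains only finitely many of their starting points $b(0)$ (the sets $\{b\in\omega:b(0)\in K\}$, $K$ compact, are finite). Put $\omega_A=\{b\in\omega: b(0)\in A\}$; $\mathrm{Conf}(A)$ is the set of configurations with all starting points in $A$, and $\mathrm{Neut}(A)=\{\omega\in \mathrm{Conf}(A):\#\omega=|A|\}$. Let $$V_t(z,\omega,\Lambda)=\sum_{b\in\omega_\Lambda}\int_S g(z-z')\,\delta^\eta_{b(t)}(dz')-\int_\Lambda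 g(z-z')\,dz'.$$ For $K=[a,b]\times D$ put $K^-=[a+\lceil (b-a)^{7/8}\rceil,\,b-\lceil (b-a)^{7/8}\rceil]\times D$, and let $\Theta(K)$ be the set of configurations in which no bridge starting outside $K$ ever meets $K^-$. Define $$\widetilde H_K(\omega)=\inf \frac1{2\beta}\int_{K\times[0,\beta]}|\nabla V_t(z,\tilde\omega,\Lambda)|^2\,d(z,t),$$ the infimum being over $\Lambda=[L_1,L_2]\times D\supseteq K$ with $L_1,L_2\in\mathbb Z$ and $\tilde\omega\in\mathrm{Neut}(\Lambda)\cap\Theta(K)$ with $\tilde\omega_K=\omega_K$. For $R\in\mathbb N$ let $\Lambda_R=[0,R]\times D$, and let $\psi(b)=\max_t|b_x(t)-b_x(0)|$. A configuration $\omega\in\mathrm{Conf}(\Lambda_R)$ is $(M,\varepsilon)$-regular if $\widetilde H_{\Lambda_R}(\omega)+\varepsilon<MR$ and $\sum_{b\in\omega}(\psi(b)^{7/6}-\varepsilon^{-7/3})_+<\varepsilon R/2$. **Proposition.** There are a function $\varphi(\varepsilon,R)\in[0,\infty)$ with $$\limsup_{\varepsilon\downarrow0}\ \limsup_{R\to\infty}\varphi(\varepsilon,R)=0$$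 and a functional $\varphi_0(F,\varepsilon,R,x_0)\in[0,\infty)$ of a vector field $F:S\to\mathbb R^{k+1}$ and of $\varepsilon,R,x_0$ (both depending only on $k,\beta,\eta$) such that the following holds. Let $M>2$, $\varepsilon\in(0,1/M^2)$, $R\in\mathbb N$ with $R>(2/\varepsilon)^8$, let $\omega\in\mathrm{Conf}(\Lambda_R)$ be $(M,\varepsilon)$-regular, and let $(\Lambda,\tilde\omega)$ be any admissible pair in the infimum defining $\widetilde H_{\Lambda_R}(\omega)$ whose field $\widetilde E_t=\nabla V_t(\cdot,\tilde\omega,\Lambda)$ is near-optimal, i.e. $\frac1{2\beta}\int_{\Lambda_R\times[0,\beta]}|\widetilde E_t(z)|^2\,d(z,t)\le\widetilde H_{\Lambda_R}(\omega)+\varepsilon$. Then there are $x_0\in[6\varepsilon R,10\varepsilon R]$, a configuration $\omega^{\mathrm{scr}}\in\mathrm{Neut}(\Lambda_R)$ and a field $E^{\mathrm{scr}}:[0,\beta]\times\Lambda_R\to\mathbb R^{k+1}$, measurable in $(t,z)$ for the completed Lebesgue measure, such that: (a) $\omega$ and $\omega^{\mathrm{scr}}$ coincide on $[10\varepsilon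 R,R-10\varepsilon R]\times D$: $\ \omega_{[10\varepsilon R,R-10\varepsilon R]\times D}=\omega^{\mathrm{scr}}_{[10\varepsilon R,R-10\varepsilon R]\times D}$. (b) For every $t\in[0,\beta]$, $E^{\mathrm{scr}}_t$ is integrable on $\Lambda_R$ and $\nabla\cdot E^{\mathrm{scr}}_t=-\sum_{b\in\omega^{\mathrm{scr}}}\delta^\eta_{b(t)}+1$ in the sense of distributions in $(0,R)\times D$. (c) For every $t\in[0,\beta]$, $E_t^{\mathrm{scr}}$ is continuous on $\Lambda_R$ near the faces $x=0$ and $x=R$, and its normal component vanishes there: $E_t^{\mathrm{scr}}(0,y)\cdot\vec e_x=E_t^{\mathrm{scr}}(R,y)\cdot\vec e_x=0$ for all $y\in D$. (d) For every $t\in[0,\beta]$, $\int_{\Lambda_R}|E^{\mathrm{scr}}_t(z)|^2\,dz\le\varphi_0(\widetilde E_t,\varepsilon,R,x_0)$, where $t\mapsto\varphi_0(\widetilde E_t,\varepsilon,R,x_0)$ is measurable and $$\frac1{2R\beta}\int_0^\beta\varphi_0(\widetilde E_t,\varepsilon,R,x_0)\,dt\le\frac1{2R\beta}\int_{\Lambda_R\times[0,\beta]}|\widetilde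 E_t(z)|^2\,d(z,t)+\varphi(\varepsilon,R)\,M .$$ -/

import Mathlib

open MeasureTheory Filter Topology Set
open scoped ENNReal NNReal

namespace Jellium

noncomputable section

/-- The infinite cylinder `S = ℝ × D`, where `D = [0,1]^k` carries periodic boundary conditions,
that is, `D` is the flat torus `(ℝ/ℤ)^k`. Its `volume` is Lebesgue measure, and `|D| = 1`. -/
abbrev Cyl (k : ℕ) : Type := ℝ × UnitAddTorus (Fin k)

/-- The Euclidean space `ℝ^{k+1}` of vectors; coordinate `0` is the `x`-direction. -/
abbrev Vec (k : ℕ) : Type := EuclideanSpace ℝ (Fin (k + 1))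

/-- The covering map `ℝ^{k+1} → S`. -/
def toCyl {k : ℕ} (v : Vec k) : Cyl k := (v 0, fun i => ((v i.succ : ℝ) : UnitAddCircle))

/-- The slab `[a, b] × D`. -/
def slab (k : ℕ) (a b : ℝ) : Set (Cyl k) := {z | z.1 ∈ Icc a b}

/-- The gradient of a scalar function on `S`, computed in the flat coordinates around `z`. -/
def grad {k : ℕ} (f : Cyl k → ℝ) (z : Cyl k) : Vec k :=
  gradient (fun v : Vec k => f (z + toCyl v)) 0

/-! ### Green's function, smeared charges and the electrostatic potential -/

/-- The eigenvalue of `-Δ` on the torus `D` for the eigenfunction `y ↦ exp (2πi n·y)`. -/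
def torusEigenvalue {k : ℕ} (n : Fin k → ℤ) : ℝ := ∑ i, (2 * Real.pi * (n i : ℝ)) ^ 2

/-- Green's function `g` of `-Δ` on `S` (free in `x`, periodic in `y`) through its eigenfunction
expansion. The series converges absolutely for `x ≠ 0`; the values on the null set `x = 0` are
irrelevant, as `g` is only used under integrals. -/
def green {k : ℕ} (z : Cyl k) : ℝ :=
  -|z.1| / 2 + ∑' n : {n : Fin k → ℤ // n ≠ 0},
    (2 * √(torusEigenvalue n.1))⁻¹ * Real.exp (-(|z.1| * √(torusEigenvalue n.1)))
      * (UnitAddTorus.mFourier n.1 z.2).re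

/-- The uniform probability measure on the unit sphere of `ℝ^{k+1}`. -/
def unifSphere (k : ℕ) : Measure (Metric.sphere (0 : Vec k) 1) :=
  ((volume : Measure (Vec k)).toSphere univ)⁻¹ • (volume : Measure (Vec k)).toSphere

/-- The smeared unit point charge `δ_z^η`: the uniform probability measure on the sphere of
radius `η` around `z` in `S`. -/
def smear {k : ℕ} (η : ℝ) (z : Cyl k) : Measure (Cyl k) :=
  (unifSphere k).map (fun u : Metric.sphere (0 : Vec k) 1 => z + toCyl (η • (u : Vec k)))

/-- A bridge: a continuous path `[0, β] → S` with the times `0` and `β` identified, that is, a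
continuous map from the circle `ℝ / βℤ`. Its position at time `t ∈ [0, β]` is `b t`. -/
abbrev Bridge (k : ℕ) (β : ℝ) : Type := C(AddCircle β, Cyl k)

/-- The projection `ω_A` keeps the bridges of `ω` whose starting point lies in `A`. -/
def proj {k : ℕ} {β : ℝ} (ω : Set (Bridge k β)) (A : Set (Cyl k)) : Set (Bridge k β) :=
  {b | b ∈ ω ∧ b 0 ∈ A}

/-- Bridge configurations: countable collections of bridges with locally finite starting points. -/
def IsConf {k : ℕ} {β : ℝ} (ω : Set (Bridge k β)) : Prop :=
  ω.Countable ∧ ∀ K : Set (Cyl k), IsCompact K → (proj ω K).Finite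

/-- `ω ∈ Conf(A)`: a configuration all of whose starting points lie in `A`. -/
def IsConfOn {k : ℕ} {β : ℝ} (A : Set (Cyl k)) (ω : Set (Bridge k β)) : Prop :=
  IsConf ω ∧ ∀ b ∈ ω, b 0 ∈ A

/-- `ω ∈ Neut(A)`: charge-neutral configurations, `#ω = |A|`. -/
def IsNeutral {k : ℕ} {β : ℝ} (A : Set (Cyl k)) (ω : Set (Bridge k β)) : Prop :=
  IsConfOn A ω ∧ (ω.encard : ℝ≥0∞) = volume A

/-- The potential `V_t(z, ω, A)` of the smeared charges at the time-`t` positions of the bridges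
of `ω_A`, together with the opposing homogeneous background on `A`. -/
def potential {k : ℕ} {β : ℝ} (η : ℝ) (ω : Set (Bridge k β)) (A : Set (Cyl k)) (t : ℝ)
    (z : Cyl k) : ℝ :=
  (∑ᶠ b ∈ proj ω A, ∫ z', green (z - z') ∂(smear η (b (t : AddCircle β))))
    - ∫ z' in A, green (z - z')

/-- The electric field `∇V_t(·, ω, A)`. -/
def elField {k : ℕ} {β : ℝ} (η : ℝ) (ω : Set (Bridge k β)) (A : Set (Cyl k)) (t : ℝ) :
    Cyl k → Vec k :=
  grad (potential η ω A t)

/-! ### Relaxed energy and regularity -/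

/-- The energy `(2β)⁻¹ ∫_{K × [0, β]} |E_t(z)|² d(z, t)` of a time-dependent field on `K`. -/
def fieldEnergy {k : ℕ} (β : ℝ) (E : ℝ → Cyl k → Vec k) (K : Set (Cyl k)) : ℝ≥0∞ :=
  ENNReal.ofReal (1 / (2 * β)) * ∫⁻ t in Icc 0 β, ∫⁻ z in K, ‖E t z‖ₑ ^ 2

/-- The eroded slab `K⁻` of `K = [a, b] × D`. -/
def erodedSlab (k : ℕ) (a b : ℝ) : Set (Cyl k) :=
  slab k (a + (⌈(b - a) ^ (7 / 8 : ℝ)⌉ : ℤ)) (b - (⌈(b - a) ^ (7 / 8 : ℝ)⌉ : ℤ))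

/-- `ω ∈ Θ([a, b] × D)`: bridges starting outside of the slab never meet the eroded slab. -/
def InTheta {k : ℕ} {β : ℝ} (a b : ℝ) (ω : Set (Bridge k β)) : Prop :=
  ∀ γ ∈ ω, γ 0 ∉ slab k a b → ∀ t : AddCircle β, γ t ∉ erodedSlab k a b

/-- `(Λ, ω')` with `Λ = [L₁, L₂] × D` competes in the infimum that defines the relaxed energy of
`ω` on `K = [a, b] × D`: `K ⊆ Λ`, `ω' ∈ Neut(Λ) ∩ Θ(K)` and `ω'_K = ω_K`. -/
structure IsCompetitor {k : ℕ} {β : ℝ} (a b : ℝ) (ω : Set (Bridge k β)) (L₁ L₂ : ℤ)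
    (ω' : Set (Bridge k β)) : Prop where
  left_le : (L₁ : ℝ) ≤ a
  le_right : b ≤ (L₂ : ℝ)
  neutral : IsNeutral (slab k L₁ L₂) ω'
  theta : InTheta a b ω'
  agree : proj ω' (slab k a b) = proj ω (slab k a b)

/-- The relaxed energy of `ω` on `K = [a, b] × D`: the infimum over all competitors `(Λ, ω')` of
`(2β)⁻¹ ∫_{K × [0, β]} |∇V_t(z, ω', Λ)|² d(z, t)`. -/
def relaxedEnergy {k : ℕ} {β : ℝ} (η a b : ℝ) (ω : Set (Bridge k β)) : ℝ≥0∞ :=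
  ⨅ (L₁ : ℤ) (L₂ : ℤ) (ω' : Set (Bridge k β)) (_ : IsCompetitor a b ω L₁ L₂ ω'),
    fieldEnergy β (elField η ω' (slab k L₁ L₂)) (slab k a b)

/-- The `x`-range `ψ(b) = max_t |b_x(t) - b_x(0)|` of a bridge. -/
def xRange {k : ℕ} {β : ℝ} (b : Bridge k β) : ℝ := ⨆ t : AddCircle β, |(b t).1 - (b 0).1|

/-- `(M, ε)`-regularity of a bridge configuration `ω ∈ Conf([0, R] × D)`. -/
structure IsBridgeRegular {k : ℕ} {β : ℝ} (η M ε : ℝ) (R : ℕ) (ω : Set (Bridge k β)) : Prop where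
  conf : IsConfOn (slab k 0 R) ω
  energy : relaxedEnergy η 0 R ω + ENNReal.ofReal ε < ENNReal.ofReal (M * R)
  range : ∑ᶠ b ∈ ω, max (xRange b ^ (7 / 6 : ℝ) - ε ^ (-(7 / 3) : ℝ)) 0 < ε * R / 2

/-- `(Λ, ω')`, `Λ = [L₁, L₂] × D`, is a competitor for the relaxed energy of `ω` on `[0, R] × D`
that is optimal up to `ε`. -/
structure IsNearOptimal {k : ℕ} {β : ℝ} (η ε : ℝ) (R : ℕ) (ω : Set (Bridge k β)) (L₁ L₂ : ℤ)
    (ω' : Set (Bridge k β)) : Prop where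
  competitor : IsCompetitor 0 R ω L₁ L₂ ω'
  energy_le : fieldEnergy β (elField η ω' (slab k L₁ L₂)) (slab k 0 R)
    ≤ relaxedEnergy η 0 R ω + ENNReal.ofReal ε

/-! ### Compatible and screened fields -/

/-- `f` is a test function on `U ⊆ S`: smooth, with compact support contained in `U`. -/
structure IsTestFunction {k : ℕ} (U : Set (Cyl k)) (f : Cyl k → ℝ) : Prop where
  smooth : ContDiff ℝ ((⊤ : ℕ∞) : WithTop ℕ∞) (fun v : Vec k => f (toCyl v))
  compact : HasCompactSupport f
  support : tsupport f ⊆ U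

/-- `E` is compatible with `ω` in `Λ_R = [0, R] × D`: for every `t ∈ [0, β]`,
`∇ · E_t = - ∑_{b ∈ ω} δ^η_{b(t)} + 1` in the sense of distributions in the interior of `Λ_R`. -/
def IsCompatible {k : ℕ} {β : ℝ} (η : ℝ) (R : ℕ) (ω : Set (Bridge k β))
    (E : ℝ → Cyl k → Vec k) : Prop :=
  ∀ t ∈ Icc 0 β, IntegrableOn (E t) (slab k 0 R) ∧
    ∀ f : Cyl k → ℝ, IsTestFunction {z | z.1 ∈ Ioo (0 : ℝ) R} f →
      -∫ z in slab k 0 R, inner ℝ (E t z) (grad f z)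
        = -(∑ᶠ b ∈ ω, ∫ z, f z ∂(smear η (b (t : AddCircle β)))) + ∫ z in slab k 0 R, f z

/-- `E` is screened: for every `t ∈ [0, β]` its normal component vanishes on the faces `x = 0` and
`x = R`. These faces are null sets, so `E_t` is also required to be continuous on `Λ_R` near them,
which makes the pointwise values there the boundary values of the field. -/
def IsScreened {k : ℕ} (β : ℝ) (R : ℕ) (E : ℝ → Cyl k → Vec k) : Prop :=
  ∀ t ∈ Icc 0 β,
    (∃ δ > 0, ContinuousOn (E t) (slab k 0 δ) ∧ ContinuousOn (E t) (slab k (R - δ) R)) ∧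
    ∀ y : UnitAddTorus (Fin k), E t (0, y) 0 = 0 ∧ E t ((R : ℝ), y) 0 = 0

end

end Jellium

open Jellium

namespace Jellium

noncomputable section

section
variable {k : ℕ}

/-! ### Lattice sums -/

/-! The electric field of a neutral configuration has a form in which it can be cut. Surround a
smeared unit charge by a smooth radial shell of the opposite charge. Sphere and shell together have
the compactly supported bounded field `shellField`; what remains is the potential of a smooth
density, with continuous gradient `potGrad`. Redistributing the shell density over its slices splits
the field of one charge into `chargeField + remField + e_x / 2`. Here `chargeField` carries the
whole charge, vanishes to its left and equals `-e_x` to its right, while `remField` is continuous,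
divergence-free and has zero flux through every slice. Adding the background of `[L₁, L₂] × D` and
using neutrality gives `(x - L₁) e_x + chargeSum + remSum` almost everywhere (`elField_eq`). The
long-range part is thus explicit and one-dimensional, and the remainder can be cut off without
changing any flux.

This splitting has to be derived from the Fourier series of Green's function. Poisson summation
makes the torus heat kernel nonnegative, subordination carries this over to the Poisson kernel, and
so `green` decreases in `|x|`. The regularization `greenS s` replaces `|x|` by `|x| + s`, which
makes the series converge well. Testing it mode by mode against a weak equation `-Δ f = μ + ρ`
yields the Poisson average of `f`. As `s ↓ 0`, monotone and dominated convergence give the potential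
of a smeared charge at every point (`integral_green_smear`) and the inversion of `-Δ` on test
functions (`IsTestFunction.integral_greenM_lap`).

For the screening itself, `CutData` collects what regularity provides: bridges that enter the bulk
start in `Λ_R`, their ranges are at most `(ε R)^(6/7)`, and the integrated squared field is at most
`β R / ε`. Gauss's law averaged over windows of width `ε R` shows that at most `R` bridges stay in
the interior (`CutData.card_interior_le`). By pigeonhole, among the candidate cuts `s` in `[6 ε R, 7
ε R]` there is one near which both the number of bridges and the energy are bounded in terms of `ε`
alone (`CutData.exists_cut`). The bridges meeting `[s - 2, R - s + 2] × D` are kept. All others are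
replaced by constant bridges at unit spacing near the faces: `m` on the left, where `m` is `L₁` plus
the number of old bridges to the left, and as many on the right as neutrality demands. Gauss's law
at the cut shows that both numbers equal `s` up to a constant depending on `ε`
(`CutData.exists_screenData`).

With this `m` the old field `F` and the new explicit field `A` satisfy `F = A + remSum` between the
cuts. The screened field is `A` plus a cutoff of `remSum`. The cutoff creates a charge density of
zero mean on every slice, which the transversal field `divSolve` removes at a cost bounded by the
`L²` norm of that density. Hence the additional energy is controlled by that of `F` in the cut zones
and that of `A` near the faces (`exists_lintegral_cutField_le`). There `A` is bounded by an absolute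
constant except within `O((ε R)^(6/7))` of the cuts, up to a constant depending on `ε`, where it is
bounded in terms of `ε`. The relative error therefore tends to `O(ε)` as `R → ∞`.

If `ε > 1/20`, or if `R` is not large enough for the given `ε`, the value of the error does not
affect the iterated limit superior. Then `exists_crude_screening` puts all missing charges next to
the left face and uses a trivial energy bound. -/

lemma summable_and_hasSum_pi_prod (f : Fin k → ℤ → ℂ) (hf : ∀ i, Summable (fun n => ‖f i n‖)) :
    Summable (fun n : Fin k → ℤ => ‖∏ i, f i (n i)‖) ∧
      HasSum (fun n : Fin k → ℤ => ∏ i, f i (n i)) (∏ i, ∑' n, f i n) := by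
  induction k with
  | zero =>
    refine ⟨Summable.of_finite, ?_⟩
    convert hasSum_unique (fun n : Fin 0 → ℤ => ∏ i, f i (n i)) using 1
    simp
  | succ k ih =>
    obtain ⟨h1, h2⟩ := ih (fun i => f i.succ) (fun i => hf i.succ)
    have hs : Summable (fun p : ℤ × (Fin k → ℤ) => ‖f 0 p.1 * ∏ i, f i.succ (p.2 i)‖) :=
      Summable.mul_norm (f := f 0) (g := fun n : Fin k → ℤ => ∏ i, f (Fin.succ i) (n i)) (hf 0) h1
    have hh : HasSum (fun p : ℤ × (Fin k → ℤ) => f 0 p.1 * ∏ i, f i.succ (p.2 i))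
        ((∑' n, f 0 n) * ∏ i, ∑' n, f (Fin.succ i) n) := by
      exact HasSum.mul (f := f 0) (g := fun n : Fin k → ℤ => ∏ i, f (Fin.succ i) (n i))
        (hf 0).of_norm.hasSum h2 hs.of_norm
    have key : (fun p : ℤ × (Fin k → ℤ) => f 0 p.1 * ∏ i, f i.succ (p.2 i))
        = (fun n : Fin (k + 1) → ℤ => ∏ i, f i (n i)) ∘ (Fin.consEquiv (fun _ : Fin (k + 1) => ℤ)) := by
      funext p
      simp [Fin.prod_univ_succ, Fin.consEquiv]
    constructor
    · rw [← (Fin.consEquiv (fun _ : Fin (k + 1) => ℤ)).summable_iff]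
      convert hs using 1
      funext p
      have := congrFun key p
      simp only [Function.comp_apply] at this ⊢
      rw [← this]
    · rw [key] at hh
      rw [Fin.prod_univ_succ]
      exact (Fin.consEquiv (fun _ : Fin (k + 1) => ℤ)).hasSum_iff.1 hh

lemma torusEigenvalue_nonneg (n : Fin k → ℤ) : 0 ≤ torusEigenvalue n :=
  Finset.sum_nonneg fun _ _ => sq_nonneg _

lemma le_sqrt_torusEigenvalue (n : Fin k → ℤ) (i : Fin k) :
    2 * Real.pi * |(n i : ℝ)| ≤ √(torusEigenvalue n) := by
  apply Real.le_sqrt_of_sq_le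
  have : (2 * Real.pi * |(n i : ℝ)|) ^ 2 = (2 * Real.pi * (n i : ℝ)) ^ 2 := by
    rw [mul_pow, sq_abs, ← mul_pow]
  rw [this]
  exact Finset.single_le_sum (f := fun i => (2 * Real.pi * (n i : ℝ)) ^ 2)
    (fun _ _ => sq_nonneg _) (Finset.mem_univ i)

lemma two_pi_le_sqrt_torusEigenvalue {n : Fin k → ℤ} (hn : n ≠ 0) :
    2 * Real.pi ≤ √(torusEigenvalue n) := by
  obtain ⟨i, hi⟩ := Function.ne_iff.1 hn
  refine le_trans ?_ (le_sqrt_torusEigenvalue n i)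
  have : (1 : ℝ) ≤ |(n i : ℝ)| := by
    have : (1 : ℤ) ≤ |n i| := Int.one_le_abs hi
    exact_mod_cast this
  nlinarith [Real.pi_pos]

lemma sqrt_torusEigenvalue_pos {n : Fin k → ℤ} (hn : n ≠ 0) :
    0 < √(torusEigenvalue n) :=
  lt_of_lt_of_le (by positivity) (two_pi_le_sqrt_torusEigenvalue hn)

lemma summable_int_exp_neg_abs {a : ℝ} (ha : 0 < a) :
    Summable (fun n : ℤ => Real.exp (-(a * |(n : ℝ)|))) := by
  have h : Summable (fun n : ℕ => Real.exp (-(a * (n : ℝ)))) := by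
    have := Real.summable_exp_nat_mul_iff (a := -a)
    have h2 := this.2 (by linarith)
    refine h2.congr fun n => ?_
    ring_nf
  apply Summable.of_nat_of_neg
  · simpa using h
  · simpa using h

/-- Every `2π |n i|` is at most `√λ_n`, so an average of these bounds dominates the summand by a
product of one-dimensional geometric terms. Dividing by `k + 1` instead of `k` covers `k = 0`. -/
lemma summable_exp_neg_sqrt {s : ℝ} (hs : 0 < s) :
    Summable (fun n : Fin k → ℤ => Real.exp (-(s * √(torusEigenvalue n)))) := by
  have ha : 0 < s * (2 * Real.pi) / (k + 1) := by positivity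
  have h := (summable_and_hasSum_pi_prod (k := k)
    (fun _ n => ((Real.exp (-(s * (2 * Real.pi) / (k + 1) * |(n : ℝ)|)) : ℝ) : ℂ))
    (fun i => by
      refine (summable_int_exp_neg_abs ha).congr fun n => ?_
      rw [Complex.norm_real, Real.norm_eq_abs, abs_of_pos (Real.exp_pos _)])).1
  refine Summable.of_nonneg_of_le (fun _ => (Real.exp_pos _).le) (fun n => ?_) h
  rw [norm_prod]
  simp only [Complex.norm_real, Real.norm_eq_abs, abs_of_pos (Real.exp_pos _)]
  rw [← Real.exp_sum]
  apply Real.exp_le_exp.2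
  rw [Finset.sum_neg_distrib, neg_le_neg_iff]
  have h1 : ∑ i, s * (2 * Real.pi) / (k + 1) * |(n i : ℝ)|
      ≤ ∑ i : Fin k, s * √(torusEigenvalue n) / (k + 1) := by
    apply Finset.sum_le_sum
    intro i _
    have := le_sqrt_torusEigenvalue n i
    rw [div_mul_eq_mul_div, mul_assoc]
    gcongr
  refine h1.trans ?_
  rw [Finset.sum_const, Finset.card_univ, Fintype.card_fin, nsmul_eq_mul]
  have h0 : 0 ≤ s * √(torusEigenvalue n) := by positivity
  rw [mul_div_assoc', div_le_iff₀ (by positivity)]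
  nlinarith

/-! ### The heat kernel of the torus -/

/-- Poisson summation turns the theta series into a positive multiple of a sum of Gaussians centred
at the integers. -/
lemma theta_hasSum_nonneg {t : ℝ} (ht : 0 < t) (y : UnitAddCircle) :
    ∃ c : ℝ, 0 ≤ c ∧ (∑' n : ℤ, ((Real.exp (-(t * (2 * Real.pi * (n : ℝ)) ^ 2)) : ℝ) : ℂ)
      * fourier n y) = (c : ℂ) := by
  obtain ⟨y, rfl⟩ := QuotientAddGroup.mk_surjective y
  have hpos : 0 < 4 * Real.pi * t := by positivity
  have h := Complex.tsum_exp_neg_quadratic (a := ((4 * Real.pi * t : ℝ) : ℂ))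
    (by rw [Complex.ofReal_re]; exact hpos) (Complex.I * y)
  refine ⟨1 / (4 * Real.pi * t) ^ (1 / 2 : ℝ) *
    ∑' n : ℤ, Real.exp (-Real.pi / (4 * Real.pi * t) * (n - y) ^ 2), ?_, ?_⟩
  · exact mul_nonneg (by positivity) (tsum_nonneg fun n => (Real.exp_pos _).le)
  · calc _ = ∑' n : ℤ, Complex.exp (-Real.pi * ((4 * Real.pi * t : ℝ) : ℂ) * n ^ 2
            + 2 * Real.pi * (Complex.I * y) * n) := by
          congr 1; funext n
          have : fourier n ((y : ℝ) : UnitAddCircle) = Complex.exp (2 * Real.pi * Complex.I * n * y) := by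
            rw [fourier_coe_apply]; simp
          erw [this]
          rw [Complex.ofReal_exp, ← Complex.exp_add]
          congr 1
          push_cast
          ring
      _ = _ := by
          rw [h]
          push_cast
          congr 1
          · rw [Complex.ofReal_cpow hpos.le]; push_cast; rfl
          · congr 1; funext n
            congr 2
            rw [← mul_assoc, Complex.I_mul_I]; ring

lemma summable_int_exp_neg_sq {t : ℝ} (ht : 0 < t) :
    Summable (fun n : ℤ => Real.exp (-(t * (2 * Real.pi * (n : ℝ)) ^ 2))) := by
  refine Summable.of_nonneg_of_le (fun _ => (Real.exp_pos _).le) (fun n => ?_)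
    (summable_int_exp_neg_abs (a := t * (2 * Real.pi) ^ 2) (by positivity))
  apply Real.exp_le_exp.2
  rw [neg_le_neg_iff, mul_pow (2 * Real.pi), mul_assoc]
  have : |(n : ℝ)| ≤ (n : ℝ) ^ 2 := by
    have h : |n| ≤ n ^ 2 := by
      rw [← sq_abs]; nlinarith [abs_nonneg n, Int.one_le_abs (z := n), sq_nonneg (|n|), abs_eq_zero (a := n), le_self_pow₀ (a := |n|) (n := 2), Int.le_self_sq (|n|)]
    exact_mod_cast h
  gcongr

lemma heat_eq_prod (t : ℝ) (n : Fin k → ℤ) (y : UnitAddTorus (Fin k)) :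
    ((Real.exp (-(t * torusEigenvalue n)) : ℝ) : ℂ) * UnitAddTorus.mFourier n y
      = ∏ i, ((Real.exp (-(t * (2 * Real.pi * (n i : ℝ)) ^ 2)) : ℝ) : ℂ) * fourier (n i) (y i) := by
  rw [Finset.prod_mul_distrib]
  congr 1
  rw [torusEigenvalue, Finset.mul_sum, ← Finset.sum_neg_distrib, Real.exp_sum, Complex.ofReal_prod]

lemma abs_re_mFourier_le (n : Fin k → ℤ) (y : UnitAddTorus (Fin k)) :
    |(UnitAddTorus.mFourier n y).re| ≤ 1 := by
  refine (Complex.abs_re_le_norm _).trans ?_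
  exact (ContinuousMap.norm_coe_le_norm (UnitAddTorus.mFourier n) y).trans
    UnitAddTorus.mFourier_norm.le

/-- Exponential and character both factor over the coordinates, so the heat kernel is a product of
one-dimensional theta functions. -/
lemma heat_nonneg {t : ℝ} (ht : 0 < t) (y : UnitAddTorus (Fin k)) :
    0 ≤ ∑' n : Fin k → ℤ, Real.exp (-(t * torusEigenvalue n)) * (UnitAddTorus.mFourier n y).re := by
  obtain ⟨h1, h2⟩ := summable_and_hasSum_pi_prod (k := k)
    (fun i n => ((Real.exp (-(t * (2 * Real.pi * (n : ℝ)) ^ 2)) : ℝ) : ℂ) * fourier n (y i))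
    (fun i => by
      refine (summable_int_exp_neg_sq ht).congr fun n => ?_
      rw [norm_mul, Complex.norm_real, Real.norm_eq_abs, abs_of_pos (Real.exp_pos _)]
      rw [fourier_apply, Circle.norm_coe, mul_one])
  simp_rw [← heat_eq_prod] at h2
  choose c hc0 hc using fun i => theta_hasSum_nonneg ht (y i)
  simp_rw [hc] at h2
  rw [← Complex.ofReal_prod] at h2
  have h3 := (Complex.hasSum_re h2)
  simp only [Complex.re_ofReal_mul, Complex.ofReal_re] at h3
  rw [h3.tsum_eq]
  exact Finset.prod_nonneg fun i _ => hc0 i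

/-! ### The subordination formula -/

/-- The map `q ↦ q - b/q` is an increasing bijection of `(0, ∞)` onto `ℝ` with derivative `1 +
b/q²`, so the integrand weighted by this derivative has the full Gaussian integral. The substitution
`q ↦ b/q` reverses the sign of `q - b/q` and exchanges the weights `1` and `b/q²`; each therefore
carries half. -/
lemma integral_exp_neg_sub_inv_sq {b : ℝ} (hb : 0 < b) :
    IntegrableOn (fun q : ℝ => Real.exp (-(q - b / q) ^ 2)) (Ioi 0) ∧
    ∫ q in Ioi (0 : ℝ), Real.exp (-(q - b / q) ^ 2) = √Real.pi / 2 := by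
  have hd : ∀ q ∈ Ioi (0 : ℝ), HasDerivWithinAt (fun q : ℝ => q - b / q) (1 + b / q ^ 2) (Ioi 0) q := by
    intro q hq
    have hq' : q ≠ 0 := (ne_of_gt hq)
    have := ((hasDerivAt_id' q).sub ((hasDerivAt_const q b).div (hasDerivAt_id' q) hq')).hasDerivWithinAt (s := Ioi 0)
    refine this.congr_deriv ?_
    ring
  have hmono : StrictMonoOn (fun q : ℝ => q - b / q) (Ioi 0) := by
    intro x hx y hy hxy
    have : b / y < b / x := div_lt_div_of_pos_left hb hx hxy
    simp only; linarith
  have himg : (fun q : ℝ => q - b / q) '' Ioi 0 = univ := by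
    apply eq_univ_of_forall
    intro y
    have hs : 0 < √(y ^ 2 + 4 * b) := Real.sqrt_pos.2 (by positivity)
    have hlt : |y| < √(y ^ 2 + 4 * b) := by
      rw [← Real.sqrt_sq_eq_abs]; exact Real.sqrt_lt_sqrt (sq_nonneg _) (by linarith)
    have hsq : √(y ^ 2 + 4 * b) ^ 2 = y ^ 2 + 4 * b := Real.sq_sqrt (by positivity)
    have hp : 0 < (y + √(y ^ 2 + 4 * b)) / 2 := by
      have := neg_abs_le y; linarith
    refine ⟨(y + √(y ^ 2 + 4 * b)) / 2, hp, ?_⟩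
    simp only
    rw [sub_eq_iff_eq_add, ← sub_eq_iff_eq_add', eq_div_iff hp.ne']
    nlinarith
  have hg : Integrable (fun y : ℝ => Real.exp (-y ^ 2)) := by
    simpa using integrable_exp_neg_mul_sq (b := 1) one_pos
  have hI : ∫ y : ℝ, Real.exp (-y ^ 2) = √Real.pi := by
    simpa using integral_gaussian 1
  have h1 : IntegrableOn (fun q : ℝ => |1 + b / q ^ 2| • Real.exp (-(q - b / q) ^ 2)) (Ioi 0) := by
    have := (integrableOn_image_iff_integrableOn_abs_deriv_smul measurableSet_Ioi hd hmono.injOn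
      (fun y => Real.exp (-y ^ 2))).1 (by rw [himg]; exact hg.integrableOn)
    exact this
  have h2 : ∫ q in Ioi (0 : ℝ), |1 + b / q ^ 2| • Real.exp (-(q - b / q) ^ 2) = √Real.pi := by
    have := integral_image_eq_integral_abs_deriv_smul measurableSet_Ioi hd hmono.injOn
      (fun y => Real.exp (-y ^ 2))
    rw [himg, setIntegral_univ, hI] at this
    exact this.symm
  have habs : ∀ q ∈ Ioi (0 : ℝ), |1 + b / q ^ 2| • Real.exp (-(q - b / q) ^ 2)
      = Real.exp (-(q - b / q) ^ 2) + b / q ^ 2 * Real.exp (-(q - b / q) ^ 2) := by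
    intro q hq
    rw [abs_of_pos (by positivity), smul_eq_mul]; ring
  have hmeas : AEStronglyMeasurable (fun q : ℝ => Real.exp (-(q - b / q) ^ 2)) (volume.restrict (Ioi 0)) := by
    have : Measurable (fun q : ℝ => Real.exp (-(q - b / q) ^ 2)) := by measurability
    exact this.aestronglyMeasurable
  have hint : IntegrableOn (fun q : ℝ => Real.exp (-(q - b / q) ^ 2)) (Ioi 0) := by
    refine Integrable.mono' h1 hmeas ?_
    filter_upwards [ae_restrict_mem measurableSet_Ioi] with q hq
    rw [Real.norm_eq_abs, abs_of_pos (Real.exp_pos _), habs q hq]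
    have : 0 ≤ b / q ^ 2 * Real.exp (-(q - b / q) ^ 2) := by positivity
    linarith
  refine ⟨hint, ?_⟩
  -- the substitution `q ↦ b / q`
  have hd' : ∀ q ∈ Ioi (0 : ℝ), HasDerivWithinAt (fun q : ℝ => b / q) (-(b / q ^ 2)) (Ioi 0) q := by
    intro q hq
    have hq' : q ≠ 0 := (ne_of_gt hq)
    have := ((hasDerivAt_const q b).div (hasDerivAt_id' q) hq').hasDerivWithinAt (s := Ioi 0)
    refine this.congr_deriv ?_
    ring
  have hinj : InjOn (fun q : ℝ => b / q) (Ioi 0) := by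
    intro x hx y hy hxy
    simp only at hxy
    have hx' : x ≠ 0 := ne_of_gt hx
    have hy' : y ≠ 0 := ne_of_gt hy
    field_simp at hxy
    exact hxy.symm
  have himg' : (fun q : ℝ => b / q) '' Ioi 0 = Ioi 0 := by
    ext y; constructor
    · rintro ⟨q, hq, rfl⟩; exact div_pos hb hq
    · intro hy
      refine ⟨b / y, div_pos hb hy, ?_⟩
      have hy' : y ≠ 0 := ne_of_gt hy
      simp only; field_simp
  have h3 := integral_image_eq_integral_abs_deriv_smul measurableSet_Ioi hd' hinj
      (fun q => Real.exp (-(q - b / q) ^ 2))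
  rw [himg'] at h3
  have h4 : ∫ q in Ioi (0 : ℝ), |-(b / q ^ 2)| • Real.exp (-(b / q - b / (b / q)) ^ 2)
      = ∫ q in Ioi (0 : ℝ), b / q ^ 2 * Real.exp (-(q - b / q) ^ 2) := by
    apply setIntegral_congr_fun measurableSet_Ioi
    intro q hq
    have hq' : q ≠ 0 := (ne_of_gt hq)
    have : b / (b / q) = q := by field_simp
    simp only
    have hp : 0 < b / q ^ 2 := div_pos hb (pow_pos hq 2)
    rw [this, abs_neg, abs_of_pos hp, smul_eq_mul]
    congr 2; ring
  rw [h4] at h3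
  rw [setIntegral_congr_fun measurableSet_Ioi habs, integral_add hint, ← h3] at h2
  · linarith
  · have : IntegrableOn (fun q : ℝ => |1 + b / q ^ 2| • Real.exp (-(q - b / q) ^ 2)
        - Real.exp (-(q - b / q) ^ 2)) (Ioi 0) := h1.sub hint
    refine this.congr ?_
    filter_upwards [ae_restrict_mem measurableSet_Ioi] with q hq
    rw [habs q hq]; ring

/-- Completing the square: `q² + b²/q² = (q - b/q)² + 2b`. -/
lemma subordination {b : ℝ} (hb : 0 ≤ b) :
    IntegrableOn (fun q : ℝ => Real.exp (-q ^ 2 - b ^ 2 / q ^ 2)) (Ioi 0) ∧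
    ∫ q in Ioi (0 : ℝ), Real.exp (-q ^ 2 - b ^ 2 / q ^ 2) = √Real.pi / 2 * Real.exp (-(2 * b)) := by
  rcases hb.eq_or_lt with rfl | hb
  · constructor
    · simpa using (integrable_exp_neg_mul_sq (b := 1) one_pos).integrableOn (s := Ioi 0)
    · simpa using integral_gaussian_Ioi 1
  · obtain ⟨h1, h2⟩ := integral_exp_neg_sub_inv_sq hb
    have h : EqOn (fun q : ℝ => Real.exp (-q ^ 2 - b ^ 2 / q ^ 2))
        (fun q => Real.exp (-(q - b / q) ^ 2) * Real.exp (-(2 * b))) (Ioi 0) := by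
      intro q hq
      have hq' : q ≠ 0 := ne_of_gt hq
      simp only
      rw [← Real.exp_add]; congr 1; field_simp; ring
    constructor
    · exact IntegrableOn.congr_fun (Integrable.mul_const h1 _) h.symm measurableSet_Ioi
    · rw [setIntegral_congr_fun measurableSet_Ioi h, integral_mul_const, h2]

/-! ### The Poisson kernel of the torus -/

/-- The Poisson kernel of the half-cylinder `(0, ∞) × D`. -/
def poisson (s : ℝ) (y : UnitAddTorus (Fin k)) : ℝ :=
  ∑' n : Fin k → ℤ, Real.exp (-(s * √(torusEigenvalue n))) * (UnitAddTorus.mFourier n y).re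

/-- Subordination with `b = s √λ_n / 2` exhibits the Poisson kernel as a mixture of heat kernels
with positive weights. This positivity is the source of the monotonicity of Green's function in
`|x|`, and it makes the kernel an approximate identity. -/
lemma poisson_nonneg {s : ℝ} (hs : 0 < s) (y : UnitAddTorus (Fin k)) : 0 ≤ poisson s y := by
  set F : (Fin k → ℤ) → ℝ → ℝ := fun n q =>
    Real.exp (-q ^ 2 - (s * √(torusEigenvalue n) / 2) ^ 2 / q ^ 2) * (UnitAddTorus.mFourier n y).re with hF
  have hb : ∀ n : Fin k → ℤ, 0 ≤ s * √(torusEigenvalue n) / 2 := fun n => by positivity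
  have hint : ∀ n, Integrable (F n) (volume.restrict (Ioi 0)) := fun n =>
    (subordination (hb n)).1.mul_const _
  have hval : ∀ n, ∫ q in Ioi (0 : ℝ), F n q
      = √Real.pi / 2 * (Real.exp (-(s * √(torusEigenvalue n))) * (UnitAddTorus.mFourier n y).re) := by
    intro n
    rw [hF]; simp only
    rw [integral_mul_const, (subordination (hb n)).2, mul_div_cancel₀ _ two_ne_zero]; ring
  -- The modes are at most `1` in absolute value, so the norms integrate to at most a multiple of
  -- `exp (-s √λ_n)`.
  have hnorm : Summable fun n => ∫ q in Ioi (0 : ℝ), ‖F n q‖ := by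
    refine Summable.of_nonneg_of_le (fun n => integral_nonneg fun _ => norm_nonneg _) (fun n => ?_)
      ((summable_exp_neg_sqrt (k := k) hs).mul_left (√Real.pi / 2))
    have h := (subordination (hb n)).2
    rw [mul_div_cancel₀ _ two_ne_zero] at h
    rw [← h]
    refine integral_mono (hint n).norm (subordination (hb n)).1 fun q => ?_
    simp only [hF, norm_mul, Real.norm_eq_abs, abs_of_pos (Real.exp_pos _)]
    exact mul_le_of_le_one_right (Real.exp_pos _).le (abs_re_mFourier_le n y)
  have hsum := integral_tsum_of_summable_integral_norm hint hnorm
  simp_rw [hval] at hsum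
  rw [tsum_mul_left] at hsum
  have hpos : 0 ≤ ∫ q in Ioi (0 : ℝ), ∑' n, F n q := by
    apply setIntegral_nonneg measurableSet_Ioi
    intro q hq
    have hq' : (0 : ℝ) < q := hq
    have : ∑' n, F n q = Real.exp (-q ^ 2) * ∑' n : Fin k → ℤ,
        Real.exp (-(s ^ 2 / (4 * q ^ 2) * torusEigenvalue n)) * (UnitAddTorus.mFourier n y).re := by
      rw [← tsum_mul_left]
      congr 1; funext n
      rw [hF]; simp only
      rw [← mul_assoc, ← Real.exp_add]
      congr 2
      rw [div_pow, mul_pow, Real.sq_sqrt (torusEigenvalue_nonneg n)]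
      field_simp
      ring
    rw [this]
    exact mul_nonneg (Real.exp_pos _).le (heat_nonneg (by positivity) y)
  rw [← hsum] at hpos
  have h2 : 0 < √Real.pi / 2 := by have := Real.pi_pos; positivity
  exact nonneg_of_mul_nonneg_right hpos h2

/-! ### Calculus on the cylinder -/

instance : Measure.IsAddHaarMeasure (volume : Measure (UnitAddTorus (Fin k))) := by
  rw [volume_pi]; infer_instance

instance : Measure.IsNegInvariant (volume : Measure (UnitAddTorus (Fin k))) := by
  rw [volume_pi]
  exact Measure.pi.isNegInvariant (fun _ : Fin k => (volume : Measure UnitAddCircle))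

instance : IsProbabilityMeasure (volume : Measure (UnitAddTorus (Fin k))) := by
  refine ⟨?_⟩
  rw [volume_pi, Measure.pi_univ]
  simp

instance : Measure.IsAddHaarMeasure (volume : Measure (Cyl k)) := by
  rw [Measure.volume_eq_prod]; infer_instance

instance : Measure.IsNegInvariant (volume : Measure (Cyl k)) :=
  ⟨((Measure.measurePreserving_neg (volume : Measure ℝ)).prod
    (Measure.measurePreserving_neg (volume : Measure (UnitAddTorus (Fin k))))).map_eq⟩

/-- The `j`-th coordinate vector. -/
abbrev bvec (j : Fin (k + 1)) : Vec k := EuclideanSpace.single j (1 : ℝ)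

lemma toCyl_add (v w : Vec k) : toCyl (v + w) = toCyl v + toCyl w := by
  refine Prod.ext ?_ ?_
  · simp [toCyl]
  · funext i; simp [toCyl]

lemma toCyl_neg (v : Vec k) : toCyl (-v) = -toCyl v := by
  refine Prod.ext ?_ ?_
  · simp [toCyl]
  · funext i; simp [toCyl]

@[simp] lemma toCyl_zero : toCyl (0 : Vec k) = 0 := by
  refine Prod.ext ?_ ?_
  · simp [toCyl]
  · funext i; simp [toCyl]

@[simp] lemma toCyl_fst (v : Vec k) : (toCyl v).1 = v 0 := rfl

@[simp] lemma toCyl_snd (v : Vec k) (i : Fin k) :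
    (toCyl v).2 i = ((v i.succ : ℝ) : UnitAddCircle) := rfl

lemma continuous_toCyl : Continuous (toCyl : Vec k → Cyl k) := by
  refine Continuous.prodMk (by fun_prop) (continuous_pi fun i => ?_)
  exact (AddCircle.continuous_mk' 1).comp (by fun_prop)

lemma toCyl_surjective : Function.Surjective (toCyl : Vec k → Cyl k) := by
  rintro ⟨x, y⟩
  choose w hw using fun i => QuotientAddGroup.mk_surjective (y i)
  refine ⟨WithLp.toLp 2 (Fin.cons x w), ?_⟩
  refine Prod.ext ?_ ?_
  · simp [toCyl]
  · funext i; simpa [toCyl] using hw i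

lemma norm_bvec (j : Fin (k + 1)) : ‖(bvec j : Vec k)‖ = 1 := by simp

lemma abs_coord_le_norm (v : Vec k) (j : Fin (k + 1)) : |v j| ≤ ‖v‖ := by
  simpa using PiLp.norm_apply_le v j

lemma toCyl_smul_bvec_zero (τ : ℝ) : toCyl (τ • (bvec 0 : Vec k)) = (τ, 0) := by
  refine Prod.ext ?_ ?_
  · simp [toCyl]
  · funext i; simp [toCyl]

lemma isCompact_slab (a b : ℝ) : IsCompact (slab k a b) := by
  have : slab k a b = Icc a b ×ˢ univ := by ext z; simp [slab]
  rw [this]; exact isCompact_Icc.prod isCompact_univ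

lemma measurableSet_slab (a b : ℝ) : MeasurableSet (slab k a b) :=
  (isCompact_slab a b).isClosed.measurableSet

lemma volume_slab (a b : ℝ) : volume (slab k a b) = ENNReal.ofReal (b - a) := by
  have : slab k a b = Icc a b ×ˢ univ := by ext z; simp [slab]
  rw [this, Measure.volume_eq_prod, Measure.prod_prod]
  simp

lemma hasCompactSupport_of_fst {E : Type*} [Zero E] {f : Cyl k → E} {X : ℝ}
    (hf : ∀ z, X < |z.1| → f z = 0) : HasCompactSupport f :=
  HasCompactSupport.intro (isCompact_slab (-X) X) fun z hz => hf z (by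
    by_contra h
    exact hz (abs_le.1 (not_lt.1 h)))

lemma integrable_of_fst {f : Cyl k → ℝ} {X : ℝ} (hc : Continuous f)
    (hf : ∀ z, X < |z.1| → f z = 0) : Integrable f :=
  hc.integrable_of_hasCompactSupport (hasCompactSupport_of_fst hf)

lemma volume_fst_eq (c : ℝ) : (volume : Measure (Cyl k)) {z | z.1 = c} = 0 := by
  have : {z : Cyl k | z.1 = c} = {c} ×ˢ univ := by ext z; simp
  rw [this, Measure.volume_eq_prod, Measure.prod_prod]; simp

lemma ae_fst_ne (c : ℝ) : ∀ᵐ z : Cyl k, z.1 ≠ c := by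
  rw [ae_iff]; simpa using volume_fst_eq c

/-- Differentiation under the integral, dominated by the Lipschitz constant on a slab slightly
larger than the support. A derivative almost everywhere is enough, which admits the kinks of the
Green modes at `x = 0` and of the shell potential on the charged sphere. Its measurability comes
from the difference quotients. -/
lemma hasDerivAt_setIntegral_shift {F F' : Cyl k → ℝ} {w : Vec k} {C X : ℝ} {A : Set (Cyl k)}
    (hw : ‖w‖ ≤ 1) (hF : Continuous F)
    (hl : ∀ z τ, |τ| ≤ 1 → |F (z + toCyl (τ • w)) - F z| ≤ C * |τ|)
    (hs : ∀ z, X < |z.1| → F z = 0)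
    (hd : ∀ᵐ z, HasDerivAt (fun τ : ℝ => F (z + toCyl (τ • w))) (F' z) 0) :
    Integrable F' ∧ HasDerivAt (fun τ : ℝ => ∫ z in A, F (z + toCyl (τ • w))) (∫ z in A, F' z) 0 := by
  have hcont : ∀ τ : ℝ, Continuous fun z => F (z + toCyl (τ • w)) := fun τ => by fun_prop
  have hC : 0 ≤ C := by
    have := hl 0 1 (by simp); simp at this; exact (abs_nonneg _).trans this
  have hmeas : AEStronglyMeasurable F' volume := by
    have hlim : ∀ᵐ z, Tendsto (fun n : ℕ => ((1 : ℝ) / (n + 1))⁻¹ * (F (z + toCyl (((1 : ℝ) / (n + 1)) • w)) - F z))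
        atTop (𝓝 (F' z)) := by
      filter_upwards [hd] with z hz
      have h1 := hz.tendsto_slope_zero
      have h2 : Tendsto (fun n : ℕ => (1 : ℝ) / (n + 1)) atTop (𝓝[≠] 0) := by
        rw [tendsto_nhdsWithin_iff]
        exact ⟨tendsto_one_div_add_atTop_nhds_zero_nat, Eventually.of_forall fun n => by
          simp only [mem_compl_iff, mem_singleton_iff]; positivity⟩
      have := h1.comp h2
      refine this.congr fun n => ?_
      simp
    exact aestronglyMeasurable_of_tendsto_ae atTop
      (fun n => ((hcont _).sub hF).aestronglyMeasurable.const_mul _) hlim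
  set bd : Cyl k → ℝ := (slab k (-(X + 1)) (X + 1)).indicator fun _ => C with hbd
  have hbi : Integrable bd := by
    rw [integrable_indicator_iff (measurableSet_slab _ _)]
    apply integrableOn_const
    · rw [volume_slab]; exact ENNReal.ofReal_ne_top
    · simp
  have hshift : ∀ (z : Cyl k) (τ : ℝ), |τ| < 1 / 2 → X + 1 < |z.1| → F (z + toCyl (τ • w)) = 0 := by
    intro z τ hτ hz
    apply hs
    have : (z + toCyl (τ • w)).1 = z.1 + τ * w 0 := by simp
    rw [this]
    have h1 := abs_coord_le_norm w 0
    have h2 : |τ * w 0| ≤ 1 := by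
      rw [abs_mul]; nlinarith [abs_nonneg τ, abs_nonneg (w 0)]
    have h3 := abs_sub_abs_le_abs_sub z.1 (-(τ * w 0))
    rw [abs_neg, sub_neg_eq_add] at h3
    linarith
  have hlip : ∀ z, LipschitzOnWith (Real.nnabs (bd z)) (fun τ : ℝ => F (z + toCyl (τ • w)))
      (Metric.ball 0 (1 / 2)) := by
    intro z
    apply LipschitzOnWith.of_dist_le_mul
    intro τ hτ σ hσ
    rw [mem_ball_zero_iff, Real.norm_eq_abs] at hτ hσ
    rw [Real.dist_eq, Real.dist_eq, Real.coe_nnabs]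
    by_cases hz : X + 1 < |z.1|
    · rw [hshift z τ hτ hz, hshift z σ hσ hz]; simp; positivity
    · have hmem : z ∈ slab k (-(X + 1)) (X + 1) := abs_le.1 (not_lt.1 hz)
      rw [hbd, indicator_of_mem hmem, abs_of_nonneg hC]
      have h := hl (z + toCyl (σ • w)) (τ - σ) (by
        have := abs_sub τ σ; linarith)
      have h2 : z + toCyl (σ • w) + toCyl ((τ - σ) • w) = z + toCyl (τ • w) := by
        rw [add_assoc, ← toCyl_add, ← add_smul]; congr 3; ring
      rwa [h2] at h
  have := fun (A : Set (Cyl k)) => hasDerivAt_integral_of_dominated_loc_of_lip (𝕜 := ℝ) (μ := volume.restrict A)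
    (F := fun (τ : ℝ) z => F (z + toCyl (τ • w))) (F' := F') (x₀ := 0) (bound := bd)
    (Metric.ball_mem_nhds 0 (by norm_num : (0 : ℝ) < 1 / 2))
    (Eventually.of_forall fun τ => (hcont τ).aestronglyMeasurable)
    (by simpa [IntegrableOn] using (integrable_of_fst hF hs).integrableOn (s := A))
    hmeas.restrict (Eventually.of_forall hlip) hbi.integrableOn (ae_restrict_of_ae hd)
  refine ⟨?_, (this A).2⟩
  simpa using (this univ).1

/-- By translation invariance the integral of a shifted function is constant in the shift. -/
lemma integral_deriv_eq_zero {F F' : Cyl k → ℝ} {w : Vec k} {C X : ℝ}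
    (hw : ‖w‖ ≤ 1) (hF : Continuous F)
    (hl : ∀ z τ, |τ| ≤ 1 → |F (z + toCyl (τ • w)) - F z| ≤ C * |τ|)
    (hs : ∀ z, X < |z.1| → F z = 0)
    (hd : ∀ᵐ z, HasDerivAt (fun τ : ℝ => F (z + toCyl (τ • w))) (F' z) 0) :
    Integrable F' ∧ ∫ z, F' z = 0 := by
  obtain ⟨h1, h2⟩ := hasDerivAt_setIntegral_shift (A := univ) hw hF hl hs hd
  refine ⟨h1, ?_⟩
  simp only [setIntegral_univ, integral_add_right_eq_self (μ := volume) F] at h2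
  exact h2.unique (hasDerivAt_const _ _)

lemma integral_eq_iterated {f : Cyl k → ℝ} (hf : Integrable f) :
    ∫ z, f z = ∫ x : ℝ, ∫ y, f (x, y) := by
  rw [Measure.volume_eq_prod] at hf ⊢
  exact integral_prod f hf

lemma setIntegral_halfspace_eq_iterated {f : Cyl k → ℝ} (hf : Integrable f) (c : ℝ) :
    ∫ z in {z : Cyl k | c < z.1}, f z = ∫ x in Ioi c, ∫ y, f (x, y) := by
  have : {z : Cyl k | c < z.1} = Ioi c ×ˢ univ := by ext z; simp
  rw [this, Measure.volume_eq_prod, setIntegral_prod]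
  · simp [Measure.restrict_univ]
  · rw [← Measure.volume_eq_prod]; exact hf.integrableOn

/-- Shifting the function amounts to shifting the half-space, so the derivative is that of an
integral of slice averages over a moving half-line. -/
lemma setIntegral_halfspace_deriv {F F' : Cyl k → ℝ} {C X : ℝ} (c : ℝ)
    (hF : Continuous F)
    (hl : ∀ z τ, |τ| ≤ 1 → |F (z + toCyl (τ • (bvec 0 : Vec k))) - F z| ≤ C * |τ|)
    (hs : ∀ z, X < |z.1| → F z = 0)
    (hd : ∀ᵐ z, HasDerivAt (fun τ : ℝ => F (z + toCyl (τ • (bvec 0 : Vec k)))) (F' z) 0) :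
    ∫ z in {z : Cyl k | c < z.1}, F' z = - ∫ y, F (c, y) := by
  obtain ⟨h1, h2⟩ := hasDerivAt_setIntegral_shift (A := {z : Cyl k | c < z.1}) (norm_bvec 0).le hF hl hs hd
  set Φ : ℝ → ℝ := fun x => ∫ y, F (x, y) with hΦ
  have hΦc : Continuous Φ := by
    have := continuous_parametric_integral_of_continuous (μ := (volume : Measure (UnitAddTorus (Fin k))))
      (f := fun x y => F (x, y)) (by fun_prop) (s := univ) isCompact_univ
    simpa using this
  have hΦs : ∀ x, X < |x| → Φ x = 0 := by
    intro x hx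
    simp only [hΦ]
    simp [hs (x, _) hx]
  have hΦi : Integrable Φ := hΦc.integrable_of_hasCompactSupport
    (HasCompactSupport.intro (isCompact_Icc (a := -X) (b := X)) fun x hx => hΦs x (by
      by_contra h; exact hx (abs_le.1 (not_lt.1 h))))
  have hI : ∀ τ : ℝ, ∫ z in {z : Cyl k | c < z.1}, F (z + toCyl (τ • (bvec 0 : Vec k)))
      = (∫ x in Ioi c, Φ x) - ∫ x in c..(c + τ), Φ x := by
    intro τ
    have hint : Integrable (fun z : Cyl k => F (z + toCyl (τ • (bvec 0 : Vec k)))) :=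
      (integrable_of_fst hF hs).comp_add_right _
    rw [setIntegral_halfspace_eq_iterated hint]
    have : ∀ x, ∫ y, F ((x, y) + toCyl (τ • (bvec 0 : Vec k))) = Φ (x + τ) := by
      intro x; simp only [hΦ, toCyl_smul_bvec_zero]; simp
    simp_rw [this]
    have h3 : ∫ x in Ioi c, Φ (x + τ) = ∫ x in Ioi (c + τ), Φ x := by
      have hm := (measurePreserving_add_right volume τ).setIntegral_preimage_emb
        (measurableEmbedding_addRight τ) Φ (Ioi (c + τ))
      rw [← hm]
      congr 2
      ext x; simp
    rw [h3]
    have h4 := intervalIntegral.integral_Ioi_sub_Ioi' (f := Φ) (μ := volume) (a := c) (b := c + τ)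
      hΦi.integrableOn hΦi.integrableOn
    linarith
  have h5 : HasDerivAt (fun τ : ℝ => (∫ x in Ioi c, Φ x) - ∫ x in c..(c + τ), Φ x) (0 - Φ (c + 0)) 0 := by
    refine (hasDerivAt_const _ _).sub ?_
    have h6 : HasDerivAt (fun u : ℝ => ∫ x in c..u, Φ x) (Φ (c + 0)) (c + 0) :=
      intervalIntegral.integral_hasDerivAt_right (hΦc.intervalIntegrable _ _)
        (hΦc.stronglyMeasurableAtFilter _ _) hΦc.continuousAt
    exact HasDerivAt.comp_const_add c 0 h6
  simp_rw [hI] at h2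
  rw [h2.unique h5]; simp [hΦ]

/-! ### Lipschitz functions with almost everywhere gradients -/

/-- `f` is Lipschitz on the cylinder, vanishes for `|x| > X`, and has the coordinate derivatives
`Df` almost everywhere. -/
structure LipGrad (f : Cyl k → ℝ) (Df : Cyl k → Vec k) (C X : ℝ) : Prop where
  lip : ∀ z v, |f (z + toCyl v) - f z| ≤ C * ‖v‖
  supp : ∀ z, X < |z.1| → f z = 0
  cont : Continuous f
  der : ∀ᵐ z, ∀ j, HasDerivAt (fun τ : ℝ => f (z + toCyl (τ • (bvec j : Vec k)))) (Df z j) 0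

lemma LipGrad.C_nonneg {f : Cyl k → ℝ} {Df : Cyl k → Vec k} {C X : ℝ} (h : LipGrad f Df C X) :
    0 ≤ C := by
  have := h.lip 0 (bvec 0)
  rw [norm_bvec, mul_one] at this
  exact (abs_nonneg _).trans this

lemma LipGrad.exists_bound {f : Cyl k → ℝ} {Df : Cyl k → Vec k} {C X : ℝ}
    (h : LipGrad f Df C X) : ∃ B, 0 ≤ B ∧ ∀ z, |f z| ≤ B := by
  obtain ⟨B, hB⟩ := (hasCompactSupport_of_fst h.supp).exists_bound_of_continuous h.cont
  exact ⟨B, (norm_nonneg _).trans (hB 0), fun z => by simpa using hB z⟩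

/-- Multiplying a Lipschitz function supported in `|x| ≤ X` by a locally Lipschitz function. -/
lemma lip_mul {f G : Cyl k → ℝ} {w : Vec k} {C X B L : ℝ} (hw : ‖w‖ ≤ 1)
    (hfl : ∀ z τ, |τ| ≤ 1 → |f (z + toCyl (τ • w)) - f z| ≤ C * |τ|) (hfs : ∀ z, X < |z.1| → f z = 0)
    (hfb : ∃ A, 0 ≤ A ∧ ∀ z, |f z| ≤ A)
    (hGb : ∀ z : Cyl k, |z.1| ≤ X + 1 → |G z| ≤ B)
    (hGl : ∀ z τ, |τ| ≤ 1 → |z.1| ≤ X → |G (z + toCyl (τ • w)) - G z| ≤ L * |τ|) :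
    ∃ C', ∀ z τ, |τ| ≤ 1 → |f (z + toCyl (τ • w)) * G (z + toCyl (τ • w)) - f z * G z| ≤ C' * |τ| := by
  obtain ⟨A, hA0, hA⟩ := hfb
  refine ⟨|C| * |B| + A * |L|, fun z τ hτ => ?_⟩
  set z' := z + toCyl (τ • w) with hz'
  have h1 : z'.1 = z.1 + τ * w 0 := by simp [hz']
  have h2 : |τ * w 0| ≤ 1 := by
    rw [abs_mul]; have := abs_coord_le_norm w 0; nlinarith [abs_nonneg τ, abs_nonneg (w 0)]
  have hf := hfl z τ hτ
  have hf' : |f z' - f z| ≤ |C| * |τ| := hf.trans (by gcongr; exact le_abs_self C)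
  have hsplit : f z' * G z' - f z * G z = (f z' - f z) * G z' + f z * (G z' - G z) := by ring
  by_cases hz : |z.1| ≤ X
  · have hz1 : |z'.1| ≤ X + 1 := by
      rw [h1]; exact (abs_add_le _ _).trans (by linarith)
    rw [hsplit]
    refine (abs_add_le _ _).trans ?_
    rw [abs_mul, abs_mul, add_mul]
    have e1 : |G z'| ≤ |B| := (hGb z' hz1).trans (le_abs_self B)
    have e2 : |G z' - G z| ≤ |L| * |τ| := (hGl z τ hτ hz).trans (by gcongr; exact le_abs_self L)
    have e3 : |f z' - f z| * |G z'| ≤ (|C| * |τ|) * |B| := by gcongr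
    have e4 : |f z| * |G z' - G z| ≤ A * (|L| * |τ|) := by gcongr; exact hA z
    nlinarith
  -- Outside the support only the shifted point can contribute, and then it lies inside, where `G`
  -- is bounded.
  · rw [hfs z (not_le.1 hz)] at hf' hsplit ⊢
    have : 0 ≤ A * |L| * |τ| := by positivity
    by_cases hz1 : |z'.1| ≤ X
    · have e1 : |G z'| ≤ |B| := (hGb z' (by linarith)).trans (le_abs_self B)
      rw [zero_mul, sub_zero, abs_mul]
      rw [sub_zero] at hf'
      have e3 : |f z'| * |G z'| ≤ (|C| * |τ|) * |B| := by gcongr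
      nlinarith
    · rw [hfs z' (not_le.1 hz1)]; simp; positivity

lemma LipGrad.lip_dir {f : Cyl k → ℝ} {Df : Cyl k → Vec k} {C X : ℝ} (h : LipGrad f Df C X)
    {w : Vec k} (hw : ‖w‖ ≤ 1) (z : Cyl k) (τ : ℝ) : |f (z + toCyl (τ • w)) - f z| ≤ C * |τ| := by
  refine (h.lip z _).trans ?_
  rw [norm_smul, Real.norm_eq_abs]
  exact mul_le_mul_of_nonneg_left (mul_le_of_le_one_right (abs_nonneg _) hw) h.C_nonneg

/-- Convolutions with Green's function are computed in the reflected variable `z₀ - z`; the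
reflection reverses the gradient and enlarges the support by `|z₀.1|`. -/
lemma LipGrad.comp_const_sub {f : Cyl k → ℝ} {Df : Cyl k → Vec k} {C X : ℝ}
    (h : LipGrad f Df C X) (z₀ : Cyl k) :
    LipGrad (fun z => f (z₀ - z)) (fun z => -Df (z₀ - z)) C (X + |z₀.1|) where
  lip z v := by
    have := h.lip (z₀ - z) (-v)
    rw [toCyl_neg, norm_neg] at this
    convert this using 4; abel
  supp z hz := by
    apply h.supp
    rw [Prod.fst_sub]
    have := abs_sub_abs_le_abs_sub z.1 z₀.1
    rw [abs_sub_comm]; linarith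
  cont := h.cont.comp (by fun_prop)
  der := by
    have hmp : MeasurePreserving (fun z : Cyl k => z₀ - z) volume volume :=
      (measurePreserving_add_left volume z₀).comp
        (Measure.measurePreserving_neg volume) |> fun h => by
          simpa [Function.comp_def, sub_eq_add_neg] using h
    filter_upwards [hmp.quasiMeasurePreserving.ae h.der] with z hz j
    have h1 := hz j
    have h2 : HasDerivAt (fun τ : ℝ => -τ) (-1) 0 := hasDerivAt_neg 0
    have h1' : HasDerivAt (fun τ : ℝ => f (z₀ - z + toCyl (τ • (bvec j : Vec k)))) (Df (z₀ - z) j) (-0) := by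
      simpa using h1
    have h3 := h1'.comp 0 h2
    refine (h3.congr_deriv (by simp)).congr_of_eventuallyEq (Eventually.of_forall fun τ => ?_)
    simp only [Function.comp_apply, neg_smul, toCyl_neg]
    congr 1; abel

/-! ### Fourier modes on the cylinder -/

/-- The real part of the Fourier character. -/
def cosm (n : Fin k → ℤ) (y : UnitAddTorus (Fin k)) : ℝ := (UnitAddTorus.mFourier n y).re

/-- The imaginary part of the Fourier character. -/
def sinm (n : Fin k → ℤ) (y : UnitAddTorus (Fin k)) : ℝ := (UnitAddTorus.mFourier n y).im

/-- The phase `2π n·v` of a Fourier character along `v`. -/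
def phase (n : Fin k → ℤ) (v : Vec k) : ℝ := ∑ i, 2 * Real.pi * (n i : ℝ) * v i.succ

lemma continuous_cosm (n : Fin k → ℤ) : Continuous (cosm n) :=
  Complex.continuous_re.comp (UnitAddTorus.mFourier n).continuous

lemma continuous_sinm (n : Fin k → ℤ) : Continuous (sinm n) :=
  Complex.continuous_im.comp (UnitAddTorus.mFourier n).continuous

lemma abs_cosm_le (n : Fin k → ℤ) (y : UnitAddTorus (Fin k)) : |cosm n y| ≤ 1 :=
  abs_re_mFourier_le n y

lemma norm_mFourier_apply (n : Fin k → ℤ) (y : UnitAddTorus (Fin k)) :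
    ‖UnitAddTorus.mFourier n y‖ = 1 := by
  simp only [UnitAddTorus.mFourier, ContinuousMap.coe_mk, norm_prod]
  exact Finset.prod_eq_one fun i _ => by rw [fourier_apply, Circle.norm_coe]

lemma abs_sinm_le (n : Fin k → ℤ) (y : UnitAddTorus (Fin k)) : |sinm n y| ≤ 1 :=
  (Complex.abs_im_le_norm _).trans (norm_mFourier_apply n y).le

lemma cosm_neg (n : Fin k → ℤ) (y : UnitAddTorus (Fin k)) : cosm n (-y) = cosm n y := by
  have : UnitAddTorus.mFourier n (-y) = (starRingEnd ℂ) (UnitAddTorus.mFourier n y) := by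
    simp only [UnitAddTorus.mFourier, ContinuousMap.coe_mk, Pi.neg_apply, map_prod]
    exact Finset.prod_congr rfl fun i _ => by
      rw [← fourier_neg, fourier_apply, fourier_apply, smul_neg, neg_smul]
  rw [cosm, cosm, this, Complex.conj_re]

lemma cosm_zero_left (y : UnitAddTorus (Fin k)) : cosm 0 y = 1 := by
  rw [cosm, UnitAddTorus.mFourier_zero]; simp

lemma mFourier_add_right (n : Fin k → ℤ) (y y' : UnitAddTorus (Fin k)) :
    UnitAddTorus.mFourier n (y + y') = UnitAddTorus.mFourier n y * UnitAddTorus.mFourier n y' := by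
  simp only [UnitAddTorus.mFourier, ContinuousMap.coe_mk, Pi.add_apply, ← Finset.prod_mul_distrib]
  exact Finset.prod_congr rfl fun i _ => by
    rw [fourier_apply, fourier_apply, fourier_apply, smul_add, AddCircle.toCircle_add, Circle.coe_mul]

lemma mFourier_toCyl (n : Fin k → ℤ) (v : Vec k) :
    UnitAddTorus.mFourier n (toCyl v).2 = Complex.exp (Complex.I * (phase n v : ℝ)) := by
  simp only [UnitAddTorus.mFourier, ContinuousMap.coe_mk, toCyl_snd, phase]
  rw [Complex.ofReal_sum, Finset.mul_sum, Complex.exp_sum]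
  refine Finset.prod_congr rfl fun i _ => ?_
  rw [fourier_coe_apply]
  congr 1; push_cast; ring

lemma phase_smul (n : Fin k → ℤ) (τ : ℝ) (v : Vec k) : phase n (τ • v) = τ * phase n v := by
  simp only [phase, Finset.mul_sum, PiLp.smul_apply, smul_eq_mul]
  exact Finset.sum_congr rfl fun i _ => by ring

lemma mFourier_shift (n : Fin k → ℤ) (z : Cyl k) (v : Vec k) :
    UnitAddTorus.mFourier n (z + toCyl v).2
      = UnitAddTorus.mFourier n z.2 * Complex.exp (Complex.I * (phase n v : ℝ)) := by
  rw [Prod.snd_add, mFourier_add_right, mFourier_toCyl]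

lemma norm_mFourier_shift_sub_le (n : Fin k → ℤ) (z : Cyl k) (v : Vec k) :
    ‖UnitAddTorus.mFourier n (z + toCyl v).2 - UnitAddTorus.mFourier n z.2‖ ≤ |phase n v| := by
  rw [mFourier_shift, ← mul_sub_one, norm_mul, norm_mFourier_apply, one_mul]
  exact Real.norm_exp_I_mul_ofReal_sub_one_le

lemma abs_cosm_shift_sub_le (n : Fin k → ℤ) (z : Cyl k) (v : Vec k) :
    |cosm n (z + toCyl v).2 - cosm n z.2| ≤ |phase n v| := by
  refine le_trans ?_ (norm_mFourier_shift_sub_le n z v)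
  rw [cosm, cosm, ← Complex.sub_re]; exact Complex.abs_re_le_norm _

lemma abs_sinm_shift_sub_le (n : Fin k → ℤ) (z : Cyl k) (v : Vec k) :
    |sinm n (z + toCyl v).2 - sinm n z.2| ≤ |phase n v| := by
  refine le_trans ?_ (norm_mFourier_shift_sub_le n z v)
  rw [sinm, sinm, ← Complex.sub_im]; exact Complex.abs_im_le_norm _

lemma hasDerivAt_mFourier_shift (n : Fin k → ℤ) (z : Cyl k) (v : Vec k) :
    HasDerivAt (fun τ : ℝ => UnitAddTorus.mFourier n (z + toCyl (τ • v)).2)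
      (UnitAddTorus.mFourier n z.2 * (Complex.I * (phase n v : ℝ))) 0 := by
  simp_rw [mFourier_shift, phase_smul]
  have h : HasDerivAt (fun τ : ℝ => Complex.I * ((τ * phase n v : ℝ) : ℂ)) (Complex.I * (phase n v : ℝ)) 0 := by
    have := ((hasDerivAt_id (0 : ℝ)).mul_const (phase n v)).ofReal_comp.const_mul Complex.I
    simpa using this
  have h2 := (h.cexp).const_mul (UnitAddTorus.mFourier n z.2)
  simpa using h2

lemma hasDerivAt_cosm_shift (n : Fin k → ℤ) (z : Cyl k) (v : Vec k) :
    HasDerivAt (fun τ : ℝ => cosm n (z + toCyl (τ • v)).2) (-(phase n v * sinm n z.2)) 0 := by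
  have h := Complex.reCLM.hasFDerivAt.comp_hasDerivAt 0 (hasDerivAt_mFourier_shift n z v)
  refine h.congr_deriv ?_
  simp [sinm, mul_comm]

lemma hasDerivAt_sinm_shift (n : Fin k → ℤ) (z : Cyl k) (v : Vec k) :
    HasDerivAt (fun τ : ℝ => sinm n (z + toCyl (τ • v)).2) (phase n v * cosm n z.2) 0 := by
  have h := Complex.imCLM.hasFDerivAt.comp_hasDerivAt 0 (hasDerivAt_mFourier_shift n z v)
  refine h.congr_deriv ?_
  simp [cosm, mul_comm]

lemma phase_bvec_succ (n : Fin k → ℤ) (i : Fin k) :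
    phase n (bvec i.succ : Vec k) = 2 * Real.pi * n i := by
  simp only [phase]
  rw [Finset.sum_eq_single i]
  · simp
  · intro j _ hj; simp [hj]
  · simp

lemma phase_bvec_zero (n : Fin k → ℤ) : phase n (bvec 0 : Vec k) = 0 := by
  simp [phase, Fin.succ_ne_zero]

lemma hasDerivAt_abs_fst_shift {α : ℝ → ℝ} {α' : ℝ} (z : Cyl k) (v : Vec k)
    (hz : z.1 ≠ 0 ∨ v 0 = 0) (hα : HasDerivAt α α' |z.1|) :
    HasDerivAt (fun τ : ℝ => α |(z + toCyl (τ • v)).1|) (α' * (Real.sign z.1 * v 0)) 0 := by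
  have he : ∀ τ : ℝ, (z + toCyl (τ • v)).1 = z.1 + τ * v 0 := fun τ => by simp
  simp_rw [he]
  rcases eq_or_ne (v 0) 0 with h0 | h0
  · simp only [h0, mul_zero, add_zero]; exact hasDerivAt_const _ _
  · have hz' : z.1 ≠ 0 := by tauto
    have h1 : HasDerivAt (fun τ : ℝ => z.1 + τ * v 0) (v 0) 0 := by
      simpa using ((hasDerivAt_id (0 : ℝ)).mul_const (v 0)).const_add z.1
    have h2 : HasDerivAt (fun x : ℝ => |x|) (Real.sign z.1) (z.1 + 0 * v 0) := by
      rw [zero_mul, add_zero]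
      rcases lt_or_gt_of_ne hz' with h | h
      · rw [Real.sign_of_neg h]; exact hasDerivAt_abs_neg h
      · rw [Real.sign_of_pos h]; exact hasDerivAt_abs_pos h
    have h3 := h2.comp (0 : ℝ) h1
    have hα' : HasDerivAt α α' (((fun x : ℝ => |x|) ∘ fun τ : ℝ => z.1 + τ * v 0) 0) := by simpa using hα
    exact hα'.comp (0 : ℝ) h3

/-- The mode `a(|x|) cos(2π n·y)`. -/
def modeFun (n : Fin k → ℤ) (a : ℝ → ℝ) (z : Cyl k) : ℝ := a |z.1| * cosm n z.2

/-- The gradient of the mode `a(|x|) cos(2π n·y)`, where `a' = -b/2`. -/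
def modeGrad (n : Fin k → ℤ) (a b : ℝ → ℝ) (z : Cyl k) : Vec k :=
  WithLp.toLp 2 (Fin.cons (-(Real.sign z.1 * b |z.1| * cosm n z.2) / 2)
    fun i => -(a |z.1| * (2 * Real.pi * n i) * sinm n z.2))

lemma inner_modeGrad (n : Fin k → ℤ) (a b : ℝ → ℝ) (z : Cyl k) (v : Vec k) :
    inner ℝ v (modeGrad n a b z)
      = v 0 * (-(Real.sign z.1 * b |z.1| * cosm n z.2) / 2)
        + ∑ i : Fin k, v i.succ * -(a |z.1| * (2 * Real.pi * n i) * sinm n z.2) := by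
  rw [PiLp.inner_apply, Fin.sum_univ_succ]
  simp [modeGrad, mul_comm]

lemma hasDerivAt_modeFun (n : Fin k → ℤ) {a b : ℝ → ℝ} (z : Cyl k) (v : Vec k)
    (hz : z.1 ≠ 0 ∨ v 0 = 0) (ha : ∀ x, HasDerivAt a (-(b x) / 2) x) :
    HasDerivAt (fun τ : ℝ => modeFun n a (z + toCyl (τ • v))) (inner ℝ v (modeGrad n a b z)) 0 := by
  have h1 := hasDerivAt_abs_fst_shift z v hz (ha |z.1|)
  have h2 := h1.mul (hasDerivAt_cosm_shift n z v)
  refine h2.congr_deriv ?_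
  rw [inner_modeGrad]
  simp only [zero_smul, toCyl_zero, add_zero, phase]
  rw [Finset.sum_mul, ← Finset.sum_neg_distrib, Finset.mul_sum]
  congr 1
  · ring
  · exact Finset.sum_congr rfl fun i _ => by ring

/-- This supplies the two hypotheses of `lip_mul` for products `α(|x|) c(y)`. Lipschitz continuity
of `α` is required on the half-line only, because the exponentials in the Green modes are not
Lipschitz on all of `ℝ`. -/
lemma lip_abs_fst_mul {α : ℝ → ℝ} {K : ℝ} {c : UnitAddTorus (Fin k) → ℝ} {P : ℝ} {w : Vec k}
    (hw : ‖w‖ ≤ 1) (hα : ∀ x x', 0 ≤ x → 0 ≤ x' → |α x - α x'| ≤ K * |x - x'|)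
    (hc : ∀ y, |c y| ≤ 1)
    (hcl : ∀ (z : Cyl k) (τ : ℝ), |c (z + toCyl (τ • w)).2 - c z.2| ≤ P * |τ|) (X : ℝ) :
    (∀ z : Cyl k, |z.1| ≤ X + 1 → |α |z.1| * c z.2| ≤ |α 0| + |K| * (X + 1)) ∧
    ∀ (z : Cyl k) (τ : ℝ), |τ| ≤ 1 → |z.1| ≤ X →
      |α |(z + toCyl (τ • w)).1| * c (z + toCyl (τ • w)).2 - α |z.1| * c z.2|
        ≤ (|K| + (|α 0| + |K| * (X + 1)) * |P|) * |τ| := by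
  have hb : ∀ x, 0 ≤ x → |α x| ≤ |α 0| + |K| * x := by
    intro x hx
    have h1 := hα x 0 hx le_rfl
    rw [sub_zero, abs_of_nonneg hx] at h1
    have h2 := abs_sub_abs_le_abs_sub (α x) (α 0)
    have h3 : K * x ≤ |K| * x := by gcongr; exact le_abs_self K
    linarith
  have hb' : ∀ z : Cyl k, |z.1| ≤ X + 1 → |(α |z.1|)| ≤ |α 0| + |K| * (X + 1) := fun z hz => by
    refine (hb _ (abs_nonneg _)).trans ?_
    gcongr
  refine ⟨fun z hz => ?_, fun z τ _ hz => ?_⟩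
  · rw [abs_mul]
    have h0 : 0 ≤ |(α |z.1|)| := abs_nonneg _
    have := hb' z hz
    nlinarith [hc z.2, abs_nonneg (c z.2)]
  · set z' := z + toCyl (τ • w) with hz'
    have h1 : z'.1 = z.1 + τ * w 0 := by simp [hz']
    have h2 : |((|z'.1|) - (|z.1|))| ≤ |τ| := by
      refine (abs_abs_sub_abs_le _ _).trans ?_
      rw [h1, add_sub_cancel_left, abs_mul]
      exact mul_le_of_le_one_right (abs_nonneg _) ((abs_coord_le_norm w 0).trans hw)
    have h3 : |(α |z'.1| - α |z.1|)| ≤ |K| * |τ| := by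
      refine (hα _ _ (abs_nonneg _) (abs_nonneg _)).trans ?_
      have : K * |((|z'.1|) - (|z.1|))| ≤ |K| * |((|z'.1|) - (|z.1|))| := by gcongr; exact le_abs_self K
      refine this.trans ?_
      gcongr
    have h4 : |c z'.2 - c z.2| ≤ |P| * |τ| := (hcl z τ).trans (by gcongr; exact le_abs_self P)
    have h5 := hb' z (by linarith)
    have hs : α |z'.1| * c z'.2 - α |z.1| * c z.2
        = (α |z'.1| - α |z.1|) * c z'.2 + α |z.1| * (c z'.2 - c z.2) := by ring
    rw [hs]
    refine (abs_add_le _ _).trans ?_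
    rw [abs_mul, abs_mul, add_mul]
    have e1 : |(α |z'.1| - α |z.1|)| * |c z'.2| ≤ |K| * |τ| * 1 := by gcongr; exact hc _
    have e2 : |(α |z.1|)| * |c z'.2 - c z.2| ≤ (|α 0| + |K| * (X + 1)) * (|P| * |τ|) := by
      gcongr
      exact (abs_nonneg _).trans h5
    nlinarith

lemma continuous_comp_abs_fst {α : ℝ → ℝ} {K : ℝ}
    (hα : ∀ x x', 0 ≤ x → 0 ≤ x' → |α x - α x'| ≤ K * |x - x'|) :
    Continuous fun z : Cyl k => α |z.1| := by
  have h : ContinuousOn α (Ici 0) := by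
    have : LipschitzOnWith K.toNNReal α (Ici 0) := by
      apply LipschitzOnWith.of_dist_le_mul
      intro x hx y hy
      rw [Real.dist_eq, Real.dist_eq]
      refine (hα x y hx hy).trans ?_
      gcongr; exact Real.le_coe_toNNReal K
    exact this.continuousOn
  exact h.comp_continuous (by fun_prop) fun z => mem_Ici.2 (abs_nonneg _)

/-- Testing the gradient of `f` against the gradient of a Green mode returns the Fourier
coefficient of `f` on the section `x = 0`. -/
lemma integral_inner_modeGrad {f : Cyl k → ℝ} {Df : Cyl k → Vec k} {C X : ℝ}
    (h : LipGrad f Df C X) (n : Fin k → ℤ) {a b : ℝ → ℝ} {κ K : ℝ}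
    (hb : ∀ x, HasDerivAt b (-(κ * b x)) x)
    (hl : ∀ x, torusEigenvalue n * a x = κ * b x / 2)
    (ha : ∀ x, HasDerivAt a (-(b x) / 2) x)
    (haL : ∀ x x', 0 ≤ x → 0 ≤ x' → |a x - a x'| ≤ K * |x - x'|)
    (hbL : ∀ x x', 0 ≤ x → 0 ≤ x' → |b x - b x'| ≤ K * |x - x'|) :
    Integrable (fun z => inner ℝ (Df z) (modeGrad n a b z)) ∧
    ∫ z, inner ℝ (Df z) (modeGrad n a b z) = b 0 * ∫ y, f (0, y) * cosm n y := by
  have hcb := continuous_comp_abs_fst (k := k) hbL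
  have hca := continuous_comp_abs_fst (k := k) haL
  have hc1 := continuous_cosm n
  have hc2 := continuous_sinm n
  have hfc := h.cont
  have hsz : ∀ g : Cyl k → ℝ, ∀ z : Cyl k, X < |z.1| → f z * g z = 0 := fun g z hz => by
    rw [h.supp z hz, zero_mul]
  -- the `x`-derivative
  set F : Cyl k → ℝ := fun z => f z * (b |z.1| * cosm n z.2) with hF
  set F' : Cyl k → ℝ := fun z => Df z 0 * (b |z.1| * cosm n z.2)
    + f z * (-(κ * b |z.1|) * Real.sign z.1 * cosm n z.2) with hF'
  have hFc : Continuous F := hfc.mul (hcb.mul (hc1.comp continuous_snd))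
  have hFd : ∀ᵐ z, HasDerivAt (fun τ : ℝ => F (z + toCyl (τ • (bvec 0 : Vec k)))) (F' z) 0 := by
    filter_upwards [h.der, ae_fst_ne (k := k) 0] with z hz hz0
    have h1 := hasDerivAt_abs_fst_shift z (bvec 0) (Or.inl hz0) (hb |z.1|)
    have h2 := (hz 0).mul (h1.mul (hasDerivAt_cosm_shift n z (bvec 0)))
    refine h2.congr_deriv ?_
    simp only [hF', zero_smul, toCyl_zero, add_zero, phase_bvec_zero]
    simp
  obtain ⟨B1, hB1⟩ := lip_mul (norm_bvec 0).le (fun z τ _ => h.lip_dir (norm_bvec 0).le z τ) h.supp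
    h.exists_bound
    (lip_abs_fst_mul (P := 0) (norm_bvec 0).le hbL (abs_cosm_le n) (fun z τ => by
      refine (abs_cosm_shift_sub_le n z _).trans ?_
      rw [phase_smul, phase_bvec_zero]; simp) X).1
    (lip_abs_fst_mul (P := 0) (norm_bvec 0).le hbL (abs_cosm_le n) (fun z τ => by
      refine (abs_cosm_shift_sub_le n z _).trans ?_
      rw [phase_smul, phase_bvec_zero]; simp) X).2
  obtain ⟨hFi, hF0⟩ := integral_deriv_eq_zero (norm_bvec 0).le hFc hB1 (hsz _) hFd
  have hFp := setIntegral_halfspace_deriv 0 hFc hB1 (hsz _) hFd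
  have hA : MeasurableSet {z : Cyl k | 0 < z.1} := measurableSet_lt measurable_const measurable_fst
  have hFm : ∫ z in {z : Cyl k | 0 < z.1}ᶜ, F' z = ∫ y, F (0, y) := by
    have := integral_add_compl hA hFi
    linarith
  -- The two half-spaces have opposite boundary terms, and the sign change adds them up instead of
  -- cancelling them. This is the source on the section `x = 0` that the kink of the mode produces.
  have hsgn : Integrable (fun z => Real.sign z.1 * F' z) ∧
      ∫ z, Real.sign z.1 * F' z = -(2 * ∫ y, F (0, y)) := by
    have e1 : ∀ z ∈ {z : Cyl k | 0 < z.1}, F' z = Real.sign z.1 * F' z := fun z hz => by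
      rw [Real.sign_of_pos hz, one_mul]
    have e2 : ∀ᵐ z : Cyl k, z ∈ {z : Cyl k | 0 < z.1}ᶜ → -F' z = Real.sign z.1 * F' z := by
      filter_upwards [ae_fst_ne (k := k) 0] with z hz hz2
      rw [Real.sign_of_neg (lt_of_le_of_ne (not_lt.1 hz2) hz), neg_one_mul]
    have i1 : IntegrableOn (fun z => Real.sign z.1 * F' z) {z : Cyl k | 0 < z.1} :=
      hFi.integrableOn.congr_fun e1 hA
    have i2 : IntegrableOn (fun z => Real.sign z.1 * F' z) {z : Cyl k | 0 < z.1}ᶜ :=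
      Integrable.congr hFi.neg.integrableOn ((ae_restrict_iff' hA.compl).2 e2)
    have hi : Integrable (fun z => Real.sign z.1 * F' z) := by
      rw [← integrableOn_univ, ← union_compl_self {z : Cyl k | 0 < z.1}]
      exact i1.union i2
    refine ⟨hi, ?_⟩
    rw [← integral_add_compl hA hi, ← setIntegral_congr_fun hA e1,
      ← setIntegral_congr_ae hA.compl e2, integral_neg, hFp, hFm]
    ring
  have hfbc : Integrable (fun z => f z * (b |z.1| * cosm n z.2)) := integrable_of_fst hFc (hsz _)
  -- As `sign² = 1` off the section, the `x`-part of the inner product is `-1/2` times the signed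
  -- derivative of `F`, up to a term without derivatives of `f`.
  have hx : (fun z => Df z 0 * (-(Real.sign z.1 * b |z.1| * cosm n z.2) / 2))
      =ᵐ[volume] fun z => -(1 / 2) * (Real.sign z.1 * F' z) - κ / 2 * (f z * (b |z.1| * cosm n z.2)) := by
    filter_upwards [ae_fst_ne (k := k) 0] with z hz
    have : Real.sign z.1 * Real.sign z.1 = 1 := by
      rcases lt_or_gt_of_ne hz with h | h
      · rw [Real.sign_of_neg h]; norm_num
      · rw [Real.sign_of_pos h]; norm_num
    simp only [hF']
    linear_combination (-(1 / 2) * f z * κ * b |z.1| * cosm n z.2) * this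
  have hxi : Integrable (fun z => Df z 0 * (-(Real.sign z.1 * b |z.1| * cosm n z.2) / 2)) :=
    ((hsgn.1.const_mul _).sub (hfbc.const_mul _)).congr hx.symm
  have hxv : ∫ z, Df z 0 * (-(Real.sign z.1 * b |z.1| * cosm n z.2) / 2)
      = b 0 * (∫ y, f (0, y) * cosm n y) - κ / 2 * ∫ z, f z * (b |z.1| * cosm n z.2) := by
    rw [integral_congr_ae hx, integral_sub (hsgn.1.const_mul _) (hfbc.const_mul _),
      integral_const_mul, integral_const_mul, hsgn.2]
    have : ∫ y, F (0, y) = b 0 * ∫ y, f (0, y) * cosm n y := by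
      rw [← integral_const_mul]; congr 1; funext y; simp [hF]; ring
    rw [this]; ring
  -- the `y`-derivatives
  have hfac : Integrable (fun z => f z * (a |z.1| * cosm n z.2)) :=
    integrable_of_fst (hfc.mul (hca.mul (hc1.comp continuous_snd))) (hsz _)
  have hy : ∀ i : Fin k, Integrable (fun z => Df z i.succ * (a |z.1| * sinm n z.2)) ∧
      ∫ z, Df z i.succ * (a |z.1| * sinm n z.2)
        = -(2 * Real.pi * n i * ∫ z, f z * (a |z.1| * cosm n z.2)) := by
    intro i
    have hP : ∀ (z : Cyl k) (τ : ℝ), |sinm n (z + toCyl (τ • (bvec i.succ : Vec k))).2 - sinm n z.2|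
        ≤ |2 * Real.pi * n i| * |τ| := fun z τ => by
      refine (abs_sinm_shift_sub_le n z _).trans ?_
      rw [phase_smul, phase_bvec_succ, abs_mul, mul_comm]
    obtain ⟨B2, hB2⟩ := lip_mul (norm_bvec i.succ).le (fun z τ _ => h.lip_dir (norm_bvec i.succ).le z τ) h.supp
      h.exists_bound
      (lip_abs_fst_mul (norm_bvec i.succ).le haL (abs_sinm_le n) hP X).1
      (lip_abs_fst_mul (norm_bvec i.succ).le haL (abs_sinm_le n) hP X).2
    have hd : ∀ᵐ z, HasDerivAt (fun τ : ℝ => f (z + toCyl (τ • (bvec i.succ : Vec k)))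
        * (a |(z + toCyl (τ • (bvec i.succ : Vec k))).1| * sinm n (z + toCyl (τ • (bvec i.succ : Vec k))).2))
        (Df z i.succ * (a |z.1| * sinm n z.2) + 2 * Real.pi * n i * (f z * (a |z.1| * cosm n z.2))) 0 := by
      filter_upwards [h.der] with z hz
      have h1 := hasDerivAt_abs_fst_shift z (bvec i.succ) (Or.inr (by simp)) (ha |z.1|)
      have h2 := (hz i.succ).mul (h1.mul (hasDerivAt_sinm_shift n z (bvec i.succ)))
      refine h2.congr_deriv ?_
      simp only [zero_smul, toCyl_zero, add_zero, phase_bvec_succ]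
      simp; ring
    obtain ⟨hi, h0⟩ := integral_deriv_eq_zero (F := fun z => f z * (a |z.1| * sinm n z.2))
      (norm_bvec i.succ).le (hfc.mul (hca.mul (hc2.comp continuous_snd))) hB2 (hsz _) hd
    have hi2 : Integrable (fun z => Df z i.succ * (a |z.1| * sinm n z.2)) := by
      refine (hi.sub (hfac.const_mul (2 * Real.pi * n i))).congr (Eventually.of_forall fun z => ?_)
      simp
    refine ⟨hi2, ?_⟩
    rw [integral_add hi2 (hfac.const_mul _), integral_const_mul] at h0
    linarith
  have hsum : ∀ z, inner ℝ (Df z) (modeGrad n a b z)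
      = Df z 0 * (-(Real.sign z.1 * b |z.1| * cosm n z.2) / 2)
        + ∑ i : Fin k, -(2 * Real.pi * n i) * (Df z i.succ * (a |z.1| * sinm n z.2)) := by
    intro z
    rw [inner_modeGrad]
    congr 1
    exact Finset.sum_congr rfl fun i _ => by ring
  simp_rw [hsum]
  have hyi : Integrable (fun z => ∑ i : Fin k, -(2 * Real.pi * n i) * (Df z i.succ * (a |z.1| * sinm n z.2))) :=
    integrable_finsetSum _ fun i _ => (hy i).1.const_mul _
  refine ⟨hxi.add hyi, ?_⟩
  rw [integral_add hxi hyi, integral_finsetSum _ fun i _ => (hy i).1.const_mul _, hxv]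
  rw [Finset.sum_congr rfl fun i _ => by rw [integral_const_mul, (hy i).2]]
  have e1 : ∑ i : Fin k, -(2 * Real.pi * (n i : ℝ)) * -(2 * Real.pi * n i * ∫ z, f z * (a |z.1| * cosm n z.2))
      = torusEigenvalue n * ∫ z, f z * (a |z.1| * cosm n z.2) := by
    rw [torusEigenvalue, Finset.sum_mul]
    exact Finset.sum_congr rfl fun i _ => by ring
  rw [e1]
  -- By `hl` the mode is harmonic off the section, so the transversal derivatives cancel the term
  -- left over from the `x`-derivative.
  have e2 : ∀ z, torusEigenvalue n * (f z * (a |z.1| * cosm n z.2))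
      = κ / 2 * (f z * (b |z.1| * cosm n z.2)) := fun z => by
    linear_combination (f z * cosm n z.2) * hl |z.1|
  have e3 : torusEigenvalue n * ∫ z, f z * (a |z.1| * cosm n z.2)
      = κ / 2 * ∫ z, f z * (b |z.1| * cosm n z.2) := by
    rw [← integral_const_mul, ← integral_const_mul]
    exact integral_congr_ae (Eventually.of_forall e2)
  rw [e3]; ring

/-! ### Fourier integrals on the torus -/

lemma integrable_torus {f : UnitAddTorus (Fin k) → ℝ} (hf : Continuous f) : Integrable f :=
  hf.integrable_of_hasCompactSupport (HasCompactSupport.of_compactSpace f)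

/-- If `n i ≠ 0`, the translation by `1 / (2 n i)` in direction `i` reverses the sign of the mode.
-/
lemma integral_cosm (n : Fin k → ℤ) : ∫ y, cosm n y = if n = 0 then 1 else 0 := by
  split_ifs with hn
  · subst hn; simp [cosm_zero_left]
  · obtain ⟨i, hi⟩ := Function.ne_iff.1 hn
    have hi' : (n i : ℝ) ≠ 0 := by simpa using hi
    set v : Vec k := (1 / (2 * (n i : ℝ))) • bvec i.succ
    have h1 : ∀ y : UnitAddTorus (Fin k), cosm n (y + (toCyl v).2) = -cosm n y := by
      intro y
      rw [cosm, mFourier_add_right, mFourier_toCyl, phase_smul, phase_bvec_succ]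
      have : 1 / (2 * (n i : ℝ)) * (2 * Real.pi * n i) = Real.pi := by field_simp
      rw [this, mul_comm Complex.I, Complex.exp_pi_mul_I]
      simp [cosm]
    have h2 := integral_add_right_eq_self (μ := volume) (cosm n) (toCyl v).2
    simp_rw [h1, integral_neg] at h2
    linarith

lemma cosm_mul_cosm (n m : Fin k → ℤ) (y : UnitAddTorus (Fin k)) :
    cosm n y * cosm m y = (cosm (n + m) y + cosm (n - m) y) / 2 := by
  have h1 : UnitAddTorus.mFourier (n + m) y = UnitAddTorus.mFourier n y * UnitAddTorus.mFourier m y :=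
    UnitAddTorus.mFourier_add
  have h2 : UnitAddTorus.mFourier (n - m) y
      = UnitAddTorus.mFourier n y * (starRingEnd ℂ) (UnitAddTorus.mFourier m y) := by
    rw [sub_eq_add_neg, UnitAddTorus.mFourier_add, UnitAddTorus.mFourier_neg]
  simp only [cosm, h1, h2, Complex.mul_re, Complex.conj_re, Complex.conj_im]
  ring

lemma integral_cosm_mul_cosm (n m : Fin k → ℤ) :
    ∫ y, cosm n y * cosm m y = ((if n = -m then 1 else 0) + (if n = m then 1 else 0)) / 2 := by
  simp_rw [cosm_mul_cosm]
  rw [integral_div, integral_add (integrable_torus (continuous_cosm _))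
    (integrable_torus (continuous_cosm _)), integral_cosm, integral_cosm]
  simp only [add_eq_zero_iff_eq_neg, sub_eq_zero]

lemma continuous_poisson {s : ℝ} (hs : 0 < s) :
    Continuous (poisson s : UnitAddTorus (Fin k) → ℝ) := by
  refine continuous_tsum (fun n => continuous_const.mul (continuous_cosm n)) (summable_exp_neg_sqrt hs)
    fun n y => ?_
  rw [norm_mul, Real.norm_eq_abs, Real.norm_eq_abs, abs_of_pos (Real.exp_pos _)]
  exact mul_le_of_le_one_right (Real.exp_pos _).le (abs_re_mFourier_le n y)

lemma integral_poisson_mul {s : ℝ} (hs : 0 < s) {φ : UnitAddTorus (Fin k) → ℝ}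
    (hφ : Continuous φ) :
    ∫ y, poisson s y * φ y
      = ∑' n : Fin k → ℤ, Real.exp (-(s * √(torusEigenvalue n))) * ∫ y, cosm n y * φ y := by
  obtain ⟨B, hB⟩ := (HasCompactSupport.of_compactSpace φ).exists_bound_of_continuous hφ
  have h := integral_tsum_of_summable_integral_norm (μ := (volume : Measure (UnitAddTorus (Fin k))))
    (F := fun (n : Fin k → ℤ) y => Real.exp (-(s * √(torusEigenvalue n))) * (cosm n y * φ y))
    (fun n => (integrable_torus ((continuous_cosm n).mul hφ)).const_mul _) (by
      refine Summable.of_nonneg_of_le (fun n => integral_nonneg fun _ => norm_nonneg _) (fun n => ?_)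
        ((summable_exp_neg_sqrt (k := k) hs).mul_right B)
      refine (integral_mono_of_nonneg (Eventually.of_forall fun _ => norm_nonneg _)
        (integrable_const (Real.exp (-(s * √(torusEigenvalue n))) * B))
        (Eventually.of_forall fun y => ?_)).trans_eq (by simp)
      simp only [norm_mul, Real.norm_eq_abs, abs_of_pos (Real.exp_pos _)]
      have h1 := hB y
      rw [Real.norm_eq_abs] at h1
      have h2 := abs_cosm_le n y
      have : |cosm n y| * |φ y| ≤ 1 * B := by gcongr
      rw [one_mul] at this
      gcongr)
  simp_rw [integral_const_mul] at h
  rw [h]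
  congr 1; funext y
  rw [poisson, ← tsum_mul_right]
  congr 1; funext n
  rw [cosm]; ring

lemma integral_poisson {s : ℝ} (hs : 0 < s) :
    ∫ y, (poisson s y : ℝ) ∂(volume : Measure (UnitAddTorus (Fin k))) = 1 := by
  have h := integral_poisson_mul (k := k) hs (φ := fun _ => 1) continuous_const
  simp only [mul_one, integral_cosm, mul_ite, mul_zero] at h
  rw [h, tsum_ite_eq]
  simp [torusEigenvalue]

lemma sqrt_torusEigenvalue_single (i : Fin k) :
    √(torusEigenvalue (Pi.single i 1 : Fin k → ℤ)) = 2 * Real.pi := by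
  have : torusEigenvalue (Pi.single i 1 : Fin k → ℤ) = (2 * Real.pi) ^ 2 := by
    rw [torusEigenvalue, Finset.sum_eq_single i]
    · simp
    · intro j _ hj; simp [hj]
    · simp
  rw [this, Real.sqrt_sq (by positivity)]

lemma torusEigenvalue_neg (n : Fin k → ℤ) : torusEigenvalue (-n) = torusEigenvalue n := by
  simp [torusEigenvalue]

/-- A real mode pairs with the two frequencies `± single i 1`, each with weight one half and with
the same eigenvalue. -/
lemma integral_poisson_mul_cosm {s : ℝ} (hs : 0 < s) (i : Fin k) :
    ∫ y, poisson s y * cosm (Pi.single i 1 : Fin k → ℤ) y = Real.exp (-(s * (2 * Real.pi))) := by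
  rw [integral_poisson_mul hs (continuous_cosm _)]
  simp_rw [integral_cosm_mul_cosm]
  have h : ∀ n : Fin k → ℤ, Real.exp (-(s * √(torusEigenvalue n)))
      * (((if n = -Pi.single i 1 then 1 else 0) + (if n = Pi.single i 1 then 1 else 0)) / 2)
      = (if n = -Pi.single i 1 then Real.exp (-(s * √(torusEigenvalue n))) / 2 else 0)
        + (if n = Pi.single i 1 then Real.exp (-(s * √(torusEigenvalue n))) / 2 else 0) := by
    intro n; split_ifs <;> ring
  simp_rw [h]
  have hsum : ∀ m : Fin k → ℤ, Summable fun n : Fin k → ℤ =>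
      if n = m then Real.exp (-(s * √(torusEigenvalue n))) / 2 else 0 := fun m =>
    summable_of_ne_finset_zero (s := {m}) fun n hn => if_neg (by simpa using hn)
  rw [(hsum _).tsum_add (hsum _), tsum_ite_eq, tsum_ite_eq, torusEigenvalue_neg,
    sqrt_torusEigenvalue_single]
  ring

/-- For the representative with `|x| ≤ 1/2` one has `1 - cos 2πx = 2 sin² πx`, and concavity of the
sine gives `|sin πx| ≥ 2 |x|`. -/
lemma norm_sq_le_one_sub_cosm (i : Fin k) (y : UnitAddTorus (Fin k)) :
    8 * ‖y i‖ ^ 2 ≤ 1 - cosm (Pi.single i 1 : Fin k → ℤ) y := by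
  obtain ⟨x, hx, hxn⟩ : ∃ x : ℝ, ((x : ℝ) : UnitAddCircle) = y i ∧ ‖y i‖ = |x| := by
    obtain ⟨x, hx⟩ := QuotientAddGroup.mk_surjective (y i)
    refine ⟨x - round x, ?_, ?_⟩
    · rw [← hx]
      have : ((round x : ℝ) : UnitAddCircle) = 0 := by
        rw [AddCircle.coe_eq_zero_iff]; exact ⟨round x, by simp⟩
      rw [AddCircle.coe_sub, this, sub_zero]
    · rw [← hx]; exact UnitAddCircle.norm_eq
  have hx2 : |x| ≤ 1 / 2 := by
    rw [← hxn]
    have := AddCircle.norm_le_half_period (1 : ℝ) one_ne_zero (x := y i)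
    simpa using this
  have hc : cosm (Pi.single i 1 : Fin k → ℤ) y = Real.cos (2 * Real.pi * x) := by
    rw [cosm]
    have : UnitAddTorus.mFourier (Pi.single i 1 : Fin k → ℤ) y = fourier 1 (y i) :=
      UnitAddTorus.mFourier_single y i
    rw [this, ← hx, fourier_coe_apply]
    have : (2 * Real.pi * Complex.I * ((1 : ℤ) : ℂ) * (x : ℂ) / ((1 : ℝ) : ℂ))
        = ((2 * Real.pi * x : ℝ) : ℂ) * Complex.I := by push_cast; ring
    rw [this, Complex.exp_ofReal_mul_I_re]
  rw [hc, hxn]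
  have h1 : Real.cos (2 * Real.pi * x) = 1 - 2 * Real.sin (Real.pi * x) ^ 2 := by
    have : 2 * Real.pi * x = 2 * (Real.pi * x) := by ring
    rw [this, Real.cos_two_mul, Real.cos_sq']; ring
  have h2 : 2 * |x| ≤ |Real.sin (Real.pi * x)| := by
    have h3 : |Real.sin (Real.pi * x)| = Real.sin (Real.pi * |x|) := by
      rcases abs_cases x with ⟨h, hx0⟩ | ⟨h, hx0⟩
      · rw [h, abs_of_nonneg]
        exact Real.sin_nonneg_of_nonneg_of_le_pi (by positivity) (by nlinarith [Real.pi_pos])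
      · rw [h, mul_neg, Real.sin_neg, abs_of_nonpos]
        have : 0 ≤ Real.sin (Real.pi * -x) :=
          Real.sin_nonneg_of_nonneg_of_le_pi (by nlinarith [Real.pi_pos]) (by nlinarith [Real.pi_pos])
        rw [mul_neg, Real.sin_neg] at this; linarith
    rw [h3]
    have := Real.mul_le_sin (x := Real.pi * |x|) (by positivity) (by nlinarith [Real.pi_pos])
    refine le_trans (le_of_eq ?_) this
    field_simp
  rw [h1]
  have h4 : (2 * |x|) ^ 2 ≤ |Real.sin (Real.pi * x)| ^ 2 := by gcongr
  rw [sq_abs] at h4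
  nlinarith

/-- The kernel is nonnegative of mass one, so the error is at most the kernel average of `L ∑ ‖y
i‖`. Bounding `‖y i‖` by `δ + ‖y i‖² / δ`, and the square by a multiple of `1 - cos`, leaves only
modes whose average is known exactly. -/
lemma abs_integral_poisson_mul_sub_le {s δ L : ℝ} (hs : 0 < s) (hδ : 0 < δ) (hL : 0 ≤ L)
    {φ : UnitAddTorus (Fin k) → ℝ} (hφ : Continuous φ) (hφL : ∀ y, |φ y - φ 0| ≤ L * ∑ i, ‖y i‖) :
    |(∫ y, poisson s y * φ y) - φ 0|
      ≤ L * (k * (δ + (1 - Real.exp (-(s * (2 * Real.pi)))) / (8 * δ))) := by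
  have hp := continuous_poisson (k := k) hs
  have hpi := integrable_torus hp
  have h1 : (∫ y, poisson s y * φ y) - φ 0 = ∫ y, poisson s y * (φ y - φ 0) := by
    simp_rw [mul_sub]
    have hi : Integrable fun y => poisson s y * φ y := integrable_torus (hp.mul hφ)
    rw [integral_sub hi (hpi.mul_const _), integral_mul_const,
      integral_poisson hs, one_mul]
  rw [h1]
  have hterm : ∀ i : Fin k, Integrable fun y => poisson s y * (δ + (1 - cosm (Pi.single i 1 : Fin k → ℤ) y) / (8 * δ)) :=
    fun i => integrable_torus (hp.mul (by have := continuous_cosm (Pi.single i 1 : Fin k → ℤ); fun_prop))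
  have h2 : |∫ y, poisson s y * (φ y - φ 0)|
      ≤ ∫ y, L * ∑ i : Fin k, poisson s y * (δ + (1 - cosm (Pi.single i 1 : Fin k → ℤ) y) / (8 * δ)) := by
    refine (abs_integral_le_integral_abs).trans (integral_mono_of_nonneg
      (Eventually.of_forall fun _ => abs_nonneg _)
      ((integrable_finsetSum _ fun i _ => hterm i).const_mul L) (Eventually.of_forall fun y => ?_))
    simp only
    rw [abs_mul, abs_of_nonneg (poisson_nonneg hs y), ← Finset.mul_sum]
    have e1 : ∀ i : Fin k, ‖y i‖ ≤ δ + (1 - cosm (Pi.single i 1 : Fin k → ℤ) y) / (8 * δ) := by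
      intro i
      have e2 := norm_sq_le_one_sub_cosm i y
      rw [← sub_le_iff_le_add', le_div_iff₀ (by positivity)]
      nlinarith [sq_nonneg (‖y i‖ - δ), norm_nonneg (y i)]
    have e3 := Finset.sum_le_sum fun i (_ : i ∈ Finset.univ) => e1 i
    calc poisson s y * |φ y - φ 0| ≤ poisson s y * (L * ∑ i, ‖y i‖) :=
          mul_le_mul_of_nonneg_left (hφL y) (poisson_nonneg hs y)
      _ ≤ poisson s y * (L * ∑ i : Fin k, (δ + (1 - cosm (Pi.single i 1 : Fin k → ℤ) y) / (8 * δ))) :=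
          mul_le_mul_of_nonneg_left (mul_le_mul_of_nonneg_left e3 hL) (poisson_nonneg hs y)
      _ = _ := by ring
  refine h2.trans_eq ?_
  rw [integral_const_mul, integral_finsetSum _ fun i _ => hterm i]
  congr 1
  have e4 : ∀ i : Fin k, ∫ y, poisson s y * (δ + (1 - cosm (Pi.single i 1 : Fin k → ℤ) y) / (8 * δ))
      = δ + (1 - Real.exp (-(s * (2 * Real.pi)))) / (8 * δ) := by
    intro i
    have e5 : ∀ y : UnitAddTorus (Fin k), poisson s y * (δ + (1 - cosm (Pi.single i 1 : Fin k → ℤ) y) / (8 * δ))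
        = (δ + 1 / (8 * δ)) * poisson s y
          - (1 / (8 * δ)) * (poisson s y * cosm (Pi.single i 1 : Fin k → ℤ) y) := fun y => by ring
    simp_rw [e5]
    have hi : Integrable fun y => poisson s y * cosm (Pi.single i 1 : Fin k → ℤ) y :=
      integrable_torus (hp.mul (continuous_cosm _))
    rw [integral_sub (hpi.const_mul _) (hi.const_mul _),
      integral_const_mul, integral_const_mul, integral_poisson hs, integral_poisson_mul_cosm hs]
    ring
  rw [Finset.sum_congr rfl fun i _ => e4 i, Finset.sum_const, Finset.card_univ, Fintype.card_fin,
    nsmul_eq_mul]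

/-- The choice `δ = √s` makes both error terms of order `√s`. -/
lemma tendsto_integral_poisson_mul {L : ℝ} (hL : 0 ≤ L)
    {φ : UnitAddTorus (Fin k) → ℝ} (hφ : Continuous φ) (hφL : ∀ y, |φ y - φ 0| ≤ L * ∑ i, ‖y i‖) :
    Tendsto (fun s : ℝ => ∫ y, poisson s y * φ y) (𝓝[>] 0) (𝓝 (φ 0)) := by
  rw [tendsto_iff_norm_sub_tendsto_zero]
  have hlim : Tendsto (fun s : ℝ => L * (k * (√s + (1 - Real.exp (-(s * (2 * Real.pi)))) / (8 * √s))))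
      (𝓝[>] 0) (𝓝 0) := by
    have h2 : Tendsto (fun s : ℝ => L * (k * (√s + 2 * Real.pi * √s / 8))) (𝓝[>] 0) (𝓝 0) := by
      have : Continuous (fun s : ℝ => L * (k * (√s + 2 * Real.pi * √s / 8))) := by fun_prop
      have := (this.tendsto 0).mono_left (nhdsWithin_le_nhds (s := Ioi 0))
      simpa using this
    refine tendsto_of_tendsto_of_tendsto_of_le_of_le' tendsto_const_nhds h2 ?_ ?_
    · filter_upwards [self_mem_nhdsWithin] with s hs
      have hs' : (0 : ℝ) < s := hs
      have : Real.exp (-(s * (2 * Real.pi))) ≤ 1 := Real.exp_le_one_iff.2 (by have := Real.pi_pos; nlinarith)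
      have : 0 ≤ (1 - Real.exp (-(s * (2 * Real.pi)))) / (8 * √s) := div_nonneg (by linarith) (by positivity)
      positivity
    · filter_upwards [self_mem_nhdsWithin] with s hs
      have hs' : (0 : ℝ) < s := hs
      have hsq : 0 < √s := Real.sqrt_pos.2 hs'
      have h3 : 1 - Real.exp (-(s * (2 * Real.pi))) ≤ s * (2 * Real.pi) := by
        have := Real.add_one_le_exp (-(s * (2 * Real.pi))); linarith
      have h4 : (1 - Real.exp (-(s * (2 * Real.pi)))) / (8 * √s) ≤ 2 * Real.pi * √s / 8 := by
        rw [div_le_iff₀ (by positivity)]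
        have : √s * √s = s := Real.mul_self_sqrt hs'.le
        have e : 2 * Real.pi * √s / 8 * (8 * √s) = 2 * Real.pi * (√s * √s) := by ring
        rw [e, this]; linarith
      gcongr
  refine tendsto_of_tendsto_of_tendsto_of_le_of_le' tendsto_const_nhds hlim
    (Eventually.of_forall fun _ => norm_nonneg _) ?_
  filter_upwards [self_mem_nhdsWithin] with s hs
  exact abs_integral_poisson_mul_sub_le hs (Real.sqrt_pos.2 hs) hL hφ hφL

/-! ### The Green's function as a mode series -/

/-- The coefficient of the `n`-th mode of Green's function at distance `x ≥ 0`. -/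
def gcoef (n : Fin k → ℤ) (x : ℝ) : ℝ :=
  if n = 0 then -x / 2 else (2 * √(torusEigenvalue n))⁻¹ * Real.exp (-(x * √(torusEigenvalue n)))

/-- Minus twice the derivative of `gcoef`. -/
def pcoef (n : Fin k → ℤ) (x : ℝ) : ℝ := Real.exp (-(x * √(torusEigenvalue n)))

lemma torusEigenvalue_zero : torusEigenvalue (0 : Fin k → ℤ) = 0 := by simp [torusEigenvalue]

lemma hasDerivAt_pcoef (n : Fin k → ℤ) (x : ℝ) :
    HasDerivAt (pcoef n) (-(√(torusEigenvalue n) * pcoef n x)) x := by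
  have := (((hasDerivAt_id x).mul_const (√(torusEigenvalue n))).neg).exp
  refine this.congr_deriv ?_
  simp [pcoef, mul_comm]

lemma hasDerivAt_gcoef (n : Fin k → ℤ) (x : ℝ) :
    HasDerivAt (gcoef n) (-(pcoef n x) / 2) x := by
  by_cases hn : n = 0
  · subst hn
    have h1 : gcoef (0 : Fin k → ℤ) = fun x => -x / 2 := by funext x; simp [gcoef]
    rw [h1]
    refine ((hasDerivAt_id x).neg.div_const 2).congr_deriv ?_
    simp [pcoef, torusEigenvalue_zero]
  · have h1 : gcoef n = fun x => (2 * √(torusEigenvalue n))⁻¹ * pcoef n x := by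
      funext x; simp [gcoef, hn, pcoef]
    rw [h1]
    refine ((hasDerivAt_pcoef n x).const_mul _).congr_deriv ?_
    have := (sqrt_torusEigenvalue_pos hn).ne'
    field_simp

lemma torusEigenvalue_mul_gcoef (n : Fin k → ℤ) (x : ℝ) :
    torusEigenvalue n * gcoef n x = √(torusEigenvalue n) * pcoef n x / 2 := by
  by_cases hn : n = 0
  · subst hn; simp [torusEigenvalue_zero]
  · have h := (sqrt_torusEigenvalue_pos hn).ne'
    have h2 := Real.mul_self_sqrt (torusEigenvalue_nonneg n)
    simp only [gcoef, hn, if_false, pcoef]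
    field_simp
    rw [sq, h2]

lemma pcoef_pos (n : Fin k → ℤ) (x : ℝ) : 0 < pcoef n x := Real.exp_pos _

lemma pcoef_le_one (n : Fin k → ℤ) {x : ℝ} (hx : 0 ≤ x) : pcoef n x ≤ 1 :=
  Real.exp_le_one_iff.2 (by have := Real.sqrt_nonneg (torusEigenvalue n); nlinarith)

lemma abs_gcoef_le (n : Fin k → ℤ) {x : ℝ} (hx : 0 ≤ x) :
    |gcoef n x| ≤ (1 + x) * pcoef n x := by
  by_cases hn : n = 0
  · subst hn
    simp only [gcoef, if_true, pcoef, torusEigenvalue_zero, Real.sqrt_zero, mul_zero, neg_zero,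
      Real.exp_zero, mul_one]
    rw [abs_div, abs_neg, abs_of_nonneg hx, abs_two]; linarith
  · simp only [gcoef, hn, if_false]
    have h := two_pi_le_sqrt_torusEigenvalue hn
    have h0 := sqrt_torusEigenvalue_pos hn
    rw [abs_mul, abs_of_pos (Real.exp_pos _), abs_of_pos (by positivity)]
    change _ * pcoef n x ≤ _
    have hp := pcoef_pos n x
    have : (2 * √(torusEigenvalue n))⁻¹ ≤ 1 := by
      apply inv_le_one_of_one_le₀
      nlinarith [Real.pi_gt_three]
    have : (2 * √(torusEigenvalue n))⁻¹ ≤ 1 + x := by linarith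
    gcongr

lemma pcoef_anti (n : Fin k → ℤ) {x x' : ℝ} (h : x ≤ x') : pcoef n x' ≤ pcoef n x :=
  Real.exp_le_exp.2 (by have := Real.sqrt_nonneg (torusEigenvalue n); nlinarith)

lemma summable_pcoef {s : ℝ} (hs : 0 < s) : Summable fun n : Fin k → ℤ => pcoef n s :=
  summable_exp_neg_sqrt hs

/-- A summable bound, uniform for `x` in `[s, X]`. The factor `1 + X` is there for the zero mode,
which is linear in `x`. -/
lemma abs_gcoef_mul_cosm_le (n : Fin k → ℤ) {x s X : ℝ} (hs : 0 < s) (hx : s ≤ x) (hX : x ≤ X)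
    (y : UnitAddTorus (Fin k)) : |gcoef n x * cosm n y| ≤ (1 + X) * pcoef n s := by
  rw [abs_mul]
  have h1 := abs_gcoef_le n (hs.le.trans hx)
  have h2 : (1 + x) * pcoef n x ≤ (1 + X) * pcoef n s := by
    have := pcoef_anti n hx
    have := pcoef_pos n x
    gcongr
    linarith
  calc |gcoef n x| * |cosm n y| ≤ |gcoef n x| * 1 := by gcongr; exact abs_cosm_le n y
    _ ≤ _ := by linarith

lemma summable_gcoef {x : ℝ} (hx : 0 < x) (y : UnitAddTorus (Fin k)) :
    Summable fun n : Fin k → ℤ => gcoef n x * cosm n y :=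
  Summable.of_norm_bounded ((summable_pcoef hx).mul_left (1 + x)) fun n => by
    rw [Real.norm_eq_abs]; exact abs_gcoef_mul_cosm_le n hx le_rfl le_rfl y

lemma green_eq_tsum {z : Cyl k} (hz : z.1 ≠ 0) :
    green z = ∑' n : Fin k → ℤ, gcoef n |z.1| * cosm n z.2 := by
  have hx : 0 < |z.1| := abs_pos.2 hz
  rw [(summable_gcoef hx z.2).tsum_eq_add_tsum_ite 0, green]
  congr 1
  · simp [gcoef, cosm_zero_left]
  · refine (tsum_subtype {n : Fin k → ℤ | n ≠ 0} (fun n : Fin k → ℤ => (2 * √(torusEigenvalue n))⁻¹ *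
        Real.exp (-(|z.1| * √(torusEigenvalue n))) * (UnitAddTorus.mFourier n z.2).re)).trans ?_
    congr 1; funext n
    by_cases hn : n = 0
    · simp [hn]
    · simp [hn, gcoef, cosm]

lemma abs_green_le {z : Cyl k} {s X : ℝ} (hs : 0 < s) (hz : s ≤ |z.1|) (hX : |z.1| ≤ X) :
    |green z| ≤ (1 + X) * ∑' n : Fin k → ℤ, pcoef n s := by
  rw [green_eq_tsum (abs_pos.1 (hs.trans_le hz)), ← tsum_mul_left]
  exact tsum_of_norm_bounded ((summable_pcoef hs).mul_left _).hasSum fun n => by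
    rw [Real.norm_eq_abs]; exact abs_gcoef_mul_cosm_le n hs hz hX z.2

/-- Termwise differentiation on `(x/2, ∞)`, where the derivatives are dominated by the summable
values `pcoef n (x / 2)`. -/
lemma hasDerivAt_green {x : ℝ} (hx : 0 < x) (y : UnitAddTorus (Fin k)) :
    HasDerivAt (fun x => green (x, y)) (-(poisson x y) / 2) x := by
  have h := hasDerivAt_tsum_of_isPreconnected (u := fun n : Fin k → ℤ => pcoef n (x / 2))
    (t := Ioi (x / 2)) (g := fun n x => gcoef n x * cosm n y)
    (g' := fun n x => -(pcoef n x) / 2 * cosm n y) (y₀ := x) (y := x)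
    (summable_pcoef (half_pos hx)) isOpen_Ioi isPreconnected_Ioi
    (fun n w _ => (hasDerivAt_gcoef n w).mul_const _)
    (fun n w hw => by
      have h1 := pcoef_anti n (le_of_lt hw)
      have h2 := pcoef_pos n w
      rw [norm_mul, Real.norm_eq_abs, Real.norm_eq_abs, abs_div, abs_neg, abs_of_pos h2, abs_two]
      have := abs_cosm_le n y
      calc pcoef n w / 2 * |cosm n y| ≤ pcoef n w / 2 * 1 := by gcongr
        _ ≤ _ := by linarith)
    (half_lt_self hx) (summable_gcoef hx y) (half_lt_self hx)
  have e : ∑' n : Fin k → ℤ, -(pcoef n x) / 2 * cosm n y = -(poisson x y) / 2 := by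
    rw [poisson, ← tsum_neg, ← tsum_div_const]
    congr 1; funext n; simp only [pcoef, cosm]; ring
  rw [e] at h
  refine h.congr_of_eventuallyEq ?_
  filter_upwards [Ioi_mem_nhds hx] with w hw
  have hw' : (0 : ℝ) < w := hw
  rw [green_eq_tsum (z := (w, y)) hw'.ne']
  simp [abs_of_pos hw']

/-- The derivative is `-1/2` times the Poisson kernel, which is nonnegative. The monotone and
dominated limits of `greenS s` as `s ↓ 0` rest on this. -/
lemma green_anti (y : UnitAddTorus (Fin k)) : AntitoneOn (fun x => green (x, y)) (Ioi (0 : ℝ)) := by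
  apply antitoneOn_of_deriv_nonpos (convex_Ioi 0)
  · intro x hx; exact (hasDerivAt_green hx y).continuousAt.continuousWithinAt
  · intro x hx
    rw [interior_Ioi] at hx
    exact (hasDerivAt_green hx y).differentiableAt.differentiableWithinAt
  · intro x hx
    rw [interior_Ioi] at hx
    rw [(hasDerivAt_green hx y).deriv]
    have := poisson_nonneg hx y
    linarith

lemma green_abs (x : ℝ) (y : UnitAddTorus (Fin k)) : green (|x|, y) = green (x, y) := by
  simp [green]

lemma green_neg (z : Cyl k) : green (-z) = green z := by
  have : ∀ n : Fin k → ℤ, (UnitAddTorus.mFourier n (-z.2)).re = (UnitAddTorus.mFourier n z.2).re :=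
    fun n => cosm_neg n z.2
  simp [green, this]

/-! ### Regularized Green's function, slice averages and integrability -/

/-- Green's function with the distance in the `x`-direction enlarged by `s`. -/
def greenS (s : ℝ) (z : Cyl k) : ℝ := green (|z.1| + s, z.2)

lemma greenS_eq_tsum {s : ℝ} (hs : 0 < s) (z : Cyl k) :
    greenS s z = ∑' n : Fin k → ℤ, modeFun n (fun x => gcoef n (x + s)) z := by
  have : 0 < |z.1| + s := by positivity
  rw [greenS, green_eq_tsum (z := (|z.1| + s, z.2)) this.ne']
  simp only [abs_of_pos this, modeFun]

lemma continuous_gcoef (n : Fin k → ℤ) : Continuous (gcoef n) :=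
  continuous_iff_continuousAt.2 fun x => (hasDerivAt_gcoef n x).continuousAt

lemma continuous_greenS {s : ℝ} (hs : 0 < s) : Continuous (greenS s : Cyl k → ℝ) := by
  rw [continuous_iff_continuousAt]
  intro z₀
  have h : ContinuousOn (greenS s : Cyl k → ℝ) {z | |z.1| < |z₀.1| + 1} := by
    have : (greenS s : Cyl k → ℝ) = fun z => ∑' n : Fin k → ℤ, modeFun n (fun x => gcoef n (x + s)) z :=
      funext fun z => greenS_eq_tsum hs z
    rw [this]
    refine continuousOn_tsum (u := fun n : Fin k → ℤ => (1 + (|z₀.1| + 1 + s)) * pcoef n s) (fun n => ?_)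
      ((summable_pcoef hs).mul_left _) fun n z hz => ?_
    · have h1 := continuous_gcoef n
      have h2 := continuous_cosm n
      exact Continuous.continuousOn (by unfold modeFun; fun_prop)
    · rw [Real.norm_eq_abs]
      exact abs_gcoef_mul_cosm_le n hs (by linarith [abs_nonneg z.1])
        (by have : |z.1| < |z₀.1| + 1 := hz; linarith) z.2
  refine h.continuousAt (IsOpen.mem_nhds (isOpen_lt (by fun_prop) (by fun_prop)) ?_)
  simp

/-- Green's function with the value on `x = 0` replaced by `0`. -/
def greenM (z : Cyl k) : ℝ := if z.1 = 0 then 0 else green z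

lemma greenM_of_ne {z : Cyl k} (hz : z.1 ≠ 0) : greenM z = green z := if_neg hz

lemma greenM_neg (z : Cyl k) : greenM (-z) = greenM z := by
  simp [greenM, green_neg]

lemma tendsto_greenS {z : Cyl k} (hz : z.1 ≠ 0) :
    Tendsto (fun s => greenS s z) (𝓝[>] 0) (𝓝 (greenM z)) := by
  have hx : 0 < |z.1| := abs_pos.2 hz
  have h := (hasDerivAt_green hx z.2).continuousAt
  rw [greenM_of_ne hz, show green z = green (|z.1| + 0, z.2) by rw [add_zero, green_abs]]
  have h2 : ContinuousAt (fun s : ℝ => green (|z.1| + s, z.2)) 0 := by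
    refine ContinuousAt.comp (f := fun s : ℝ => |z.1| + s) (g := fun x => green (x, z.2)) ?_ (by fun_prop)
    simpa using h
  exact h2.tendsto.mono_left nhdsWithin_le_nhds

lemma greenS_le {s s' : ℝ} (hs : 0 < s) (h : s ≤ s') (z : Cyl k) : greenS s' z ≤ greenS s z :=
  green_anti z.2 (show 0 < |z.1| + s by positivity) (show 0 < |z.1| + s' by linarith [abs_nonneg z.1]) (by linarith)

lemma greenS_le_greenM {s : ℝ} (hs : 0 < s) {z : Cyl k} (hz : z.1 ≠ 0) : greenS s z ≤ greenM z := by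
  rw [greenM_of_ne hz, ← green_abs]
  exact green_anti z.2 (abs_pos.2 hz) (show 0 < |z.1| + s by positivity) (by linarith)

lemma measurable_greenM : Measurable (greenM : Cyl k → ℝ) := by
  have hm : MeasurableSet {z : Cyl k | z.1 = 0} := measurableSet_eq_fun measurable_fst measurable_const
  refine measurable_of_tendsto_metrizable (f := fun (m : ℕ) (z : Cyl k) =>
    if z.1 = 0 then 0 else greenS (1 / ((m : ℝ) + 1)) z) (fun m =>
      Measurable.ite hm measurable_const (continuous_greenS (by positivity)).measurable) ?_
  rw [tendsto_pi_nhds]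
  intro z
  by_cases hz : z.1 = 0
  · simp [hz, greenM]
  · simp only [hz, if_false]
    refine (tendsto_greenS hz).comp ?_
    rw [tendsto_nhdsWithin_iff]
    exact ⟨tendsto_one_div_add_atTop_nhds_zero_nat, Eventually.of_forall fun n => by
      simp only [mem_Ioi]; positivity⟩

/-- Every mode with `n ≠ 0` averages to zero over the slice; only `-|x|/2` survives. -/
lemma greenM_section {x : ℝ} (hx : x ≠ 0) :
    Integrable (fun y : UnitAddTorus (Fin k) => greenM (x, y)) ∧
    ∫ y : UnitAddTorus (Fin k), greenM (x, y) = -|x| / 2 := by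
  have hx' : 0 < |x| := abs_pos.2 hx
  have hbd : ∀ y : UnitAddTorus (Fin k), greenM (x, y) = ∑' n : Fin k → ℤ, gcoef n |x| * cosm n y := fun y => by
    rw [greenM_of_ne (z := (x, y)) hx, green_eq_tsum (z := (x, y)) hx]
  have hc : Continuous fun y : UnitAddTorus (Fin k) => greenM (x, y) := by
    simp_rw [hbd]
    refine continuous_tsum (fun n => continuous_const.mul (continuous_cosm n))
      ((summable_pcoef hx').mul_left (1 + |x|)) fun n y => ?_
    rw [Real.norm_eq_abs]; exact abs_gcoef_mul_cosm_le n hx' le_rfl le_rfl y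
  refine ⟨integrable_torus hc, ?_⟩
  have h := integral_tsum_of_summable_integral_norm (μ := (volume : Measure (UnitAddTorus (Fin k))))
    (F := fun (n : Fin k → ℤ) y => gcoef n |x| * cosm n y)
    (fun n => (integrable_torus (continuous_cosm n)).const_mul _) (by
      refine Summable.of_nonneg_of_le (fun n => integral_nonneg fun _ => norm_nonneg _) (fun n => ?_)
        ((summable_pcoef (k := k) hx').mul_left (1 + |x|))
      refine (integral_mono_of_nonneg (Eventually.of_forall fun _ => norm_nonneg _)
        (integrable_const ((1 + |x|) * pcoef n |x|))
        (Eventually.of_forall fun y => ?_)).trans_eq (by simp)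
      simp only
      rw [Real.norm_eq_abs]; exact abs_gcoef_mul_cosm_le n hx' le_rfl le_rfl y)
  simp_rw [hbd, ← h, integral_const_mul, integral_cosm, mul_ite, mul_one, mul_zero]
  rw [tsum_ite_eq]
  simp [gcoef]

lemma exists_bound_greenS (X : ℝ) {s : ℝ} (hs : 0 < s) :
    ∃ B, 0 ≤ B ∧ ∀ z : Cyl k, |z.1| ≤ X → |greenS s z| ≤ B := by
  refine ⟨|(1 + (X + s)) * ∑' n : Fin k → ℤ, pcoef n s|, abs_nonneg _, fun z hz => ?_⟩
  have h : 0 < |z.1| + s := by positivity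
  refine (abs_green_le (z := (|z.1| + s, z.2)) hs (X := X + s) ?_ ?_).trans (le_abs_self _)
  · rw [abs_of_pos h]; linarith [abs_nonneg z.1]
  · rw [abs_of_pos h]; linarith

/-- No pointwise bound at the singularity is needed. Off `x = 0` the difference to `greenS 1` is
nonnegative by monotonicity and has slice integral `1/2`, so Tonelli's theorem makes it integrable
over the slab. -/
lemma integrableOn_greenM (X : ℝ) : IntegrableOn (greenM : Cyl k → ℝ) (slab k (-X) X) := by
  obtain ⟨B, hB0, hB⟩ := exists_bound_greenS (k := k) X one_pos
  have hfin : volume (slab k (-X) X) < ⊤ := by rw [volume_slab]; exact ENNReal.ofReal_lt_top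
  have : IsFiniteMeasure (volume.restrict (slab k (-X) X)) := ⟨by rwa [Measure.restrict_apply_univ]⟩
  have hS : IntegrableOn (greenS 1 : Cyl k → ℝ) (slab k (-X) X) :=
    (continuous_greenS one_pos).continuousOn.integrableOn_compact (isCompact_slab _ _)
  have hd : IntegrableOn (fun z : Cyl k => greenM z - greenS 1 z) (slab k (-X) X) := by
    have hmeas : Measurable (fun z : Cyl k => greenM z - greenS 1 z) :=
      measurable_greenM.sub (continuous_greenS one_pos).measurable
    refine ⟨hmeas.aestronglyMeasurable, ?_⟩
    rw [hasFiniteIntegral_iff_ofReal]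
    · have hslab : slab k (-X) X = Icc (-X) X ×ˢ univ := by ext z; simp [slab]
      rw [hslab, Measure.volume_eq_prod, ← Measure.prod_restrict, Measure.restrict_univ,
        lintegral_prod _ hmeas.ennreal_ofReal.aemeasurable]
      have hin : ∀ᵐ x : ℝ ∂(volume.restrict (Icc (-X) X)),
          ∫⁻ y : UnitAddTorus (Fin k), ENNReal.ofReal (greenM (x, y) - greenS 1 (x, y)) = ENNReal.ofReal (1 / 2) := by
        have : ∀ᵐ x : ℝ, x ≠ 0 := by rw [ae_iff]; simp
        filter_upwards [ae_restrict_of_ae this] with x hx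
        have h1 := greenM_section (k := k) hx
        have hx1 : |x| + 1 ≠ 0 := by positivity
        have h2 := greenM_section (k := k) hx1
        have h3 : ∀ y : UnitAddTorus (Fin k), greenS 1 (x, y) = greenM (|x| + 1, y) := fun y => by
          rw [greenM_of_ne (z := (|x| + 1, y)) hx1]; rfl
        simp_rw [h3]
        refine (ofReal_integral_eq_lintegral_ofReal (h1.1.sub h2.1) ?_).symm.trans ?_
        rotate_left
        · simp only [Pi.sub_apply]
          rw [integral_sub h1.1 h2.1, h1.2, h2.2]
          congr 1
          rw [abs_of_pos (by positivity : 0 < |x| + 1)]; ring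
        · refine Eventually.of_forall fun y => ?_
          have := greenS_le_greenM (z := (x, y)) one_pos hx
          rw [h3] at this
          simpa using this
      rw [lintegral_congr_ae hin]
      simp only [lintegral_const, Measure.restrict_apply_univ]
      exact ENNReal.mul_lt_top ENNReal.ofReal_lt_top (by simp)
    · filter_upwards [ae_restrict_of_ae (ae_fst_ne (k := k) 0)] with z hz
      simpa using greenS_le_greenM one_pos hz
  refine (hd.add hS).congr (Eventually.of_forall fun z => ?_)
  simp

/-! ### Green's function inverts the Laplacian -/

/-- The mode of `greenS s` with frequency `n`. -/
def gmode (n : Fin k → ℤ) (s : ℝ) : Cyl k → ℝ := modeFun n fun x => gcoef n (x + s)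

/-- The gradient of `gmode n s`. -/
def gmodeGrad (n : Fin k → ℤ) (s : ℝ) : Cyl k → Vec k :=
  modeGrad n (fun x => gcoef n (x + s)) fun x => pcoef n (x + s)

lemma continuous_gmode (n : Fin k → ℤ) (s : ℝ) : Continuous (gmode n s) := by
  have h1 := continuous_gcoef n
  have h2 := continuous_cosm n
  unfold gmode modeFun
  fun_prop

lemma hasDerivAt_gcoef_shift (n : Fin k → ℤ) (s x : ℝ) :
    HasDerivAt (fun x => gcoef n (x + s)) (-(pcoef n (x + s)) / 2) x :=
  (hasDerivAt_gcoef n (x + s)).comp_add_const x s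

lemma hasDerivAt_pcoef_shift (n : Fin k → ℤ) (s x : ℝ) :
    HasDerivAt (fun x => pcoef n (x + s)) (-(√(torusEigenvalue n) * pcoef n (x + s))) x :=
  (hasDerivAt_pcoef n (x + s)).comp_add_const x s

lemma hasDerivAt_gmode (n : Fin k → ℤ) (s : ℝ) (z : Cyl k) (v : Vec k)
    (hz : z.1 ≠ 0 ∨ v 0 = 0) :
    HasDerivAt (fun τ : ℝ => gmode n s (z + toCyl (τ • v))) (inner ℝ v (gmodeGrad n s z)) 0 :=
  hasDerivAt_modeFun n z v hz (hasDerivAt_gcoef_shift n s)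

lemma lipschitz_of_deriv_Ici {α α' : ℝ → ℝ} {K : ℝ} (h : ∀ x, HasDerivAt α (α' x) x)
    (hK : ∀ x, 0 ≤ x → |α' x| ≤ K) (x x' : ℝ) (hx : 0 ≤ x) (hx' : 0 ≤ x') :
    |α x - α x'| ≤ K * |x - x'| :=
  (convex_Ici (0 : ℝ)).norm_image_sub_le_of_norm_hasDerivWithin_le
    (fun y _ => (h y).hasDerivWithinAt) (fun y hy => hK y hy) hx' hx

lemma abs_gmode_le (n : Fin k → ℤ) {s X : ℝ} (hs : 0 < s) {z : Cyl k} (hz : |z.1| ≤ X) :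
    |gmode n s z| ≤ (1 + (X + s)) * pcoef n s :=
  abs_gcoef_mul_cosm_le n hs (by linarith [abs_nonneg z.1]) (by linarith) z.2

lemma integral_inner_gmodeGrad {f : Cyl k → ℝ} {Df : Cyl k → Vec k} {C X : ℝ}
    (h : LipGrad f Df C X) (n : Fin k → ℤ) {s : ℝ} (hs : 0 < s) :
    Integrable (fun z => inner ℝ (Df z) (gmodeGrad n s z)) ∧
    ∫ z, inner ℝ (Df z) (gmodeGrad n s z) = pcoef n s * ∫ y, f (0, y) * cosm n y := by
  have hq := Real.sqrt_nonneg (torusEigenvalue n)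
  have key := integral_inner_modeGrad h n (a := fun x => gcoef n (x + s)) (b := fun x => pcoef n (x + s))
    (κ := √(torusEigenvalue n)) (K := 1 + √(torusEigenvalue n)) (hasDerivAt_pcoef_shift n s)
    (fun x => torusEigenvalue_mul_gcoef n (x + s)) (hasDerivAt_gcoef_shift n s)
    (lipschitz_of_deriv_Ici (hasDerivAt_gcoef_shift n s) fun x hx => by
      have h1 := pcoef_pos n (x + s)
      have h2 := pcoef_le_one n (x := x + s) (by linarith)
      rw [abs_div, abs_neg, abs_of_pos h1, abs_two]; linarith)
    (lipschitz_of_deriv_Ici (hasDerivAt_pcoef_shift n s) fun x hx => by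
      have h1 := pcoef_pos n (x + s)
      have h2 := pcoef_le_one n (x := x + s) (by linarith)
      rw [abs_neg, abs_mul, abs_of_nonneg hq, abs_of_pos h1]; nlinarith)
  simpa [gmodeGrad] using key

/-- Stated for a measure together with a density, so that it covers both a singular charge and a
continuous density. The shift by `s` makes the modes summable uniformly on slabs, which justifies
the exchange. -/
lemma hasSum_integral_gmode {μ : Measure (Cyl k)} {ρ : Cyl k → ℝ} {X s : ℝ}
    (hρ : Integrable ρ μ) (hρs : ∀ᵐ z ∂μ, X < |z.1| → ρ z = 0) (z₀ : Cyl k) (hs : 0 < s) :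
    HasSum (fun n : Fin k → ℤ => ∫ z, gmode n s (z₀ - z) * ρ z ∂μ)
      (∫ z, greenS s (z₀ - z) * ρ z ∂μ) := by
  have hb : ∀ n : Fin k → ℤ, ∀ᵐ z ∂μ,
      ‖gmode n s (z₀ - z) * ρ z‖ ≤ (1 + (|z₀.1| + X + s)) * pcoef n s * ‖ρ z‖ := by
    intro n
    filter_upwards [hρs] with z hz
    by_cases hX : |z.1| ≤ X
    · rw [norm_mul, Real.norm_eq_abs]
      gcongr
      refine abs_gmode_le n hs ?_
      rw [Prod.fst_sub]
      exact (abs_sub _ _).trans (by linarith)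
    · simp [hz (not_le.1 hX)]
  have hint : ∀ n : Fin k → ℤ, Integrable (fun z => gmode n s (z₀ - z) * ρ z) μ := fun n =>
    Integrable.mono' (hρ.norm.const_mul _)
      (((continuous_gmode n s).comp (by fun_prop)).aestronglyMeasurable.mul hρ.1) (hb n)
  have key := hasSum_integral_of_summable_integral_norm hint (by
    refine Summable.of_nonneg_of_le (fun n => integral_nonneg fun _ => norm_nonneg _) (fun n => ?_)
      (((summable_pcoef (k := k) hs).mul_left (1 + (|z₀.1| + X + s))).mul_right (∫ z, ‖ρ z‖ ∂μ))
    rw [← integral_const_mul]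
    exact integral_mono_ae (hint n).norm (hρ.norm.const_mul _) (hb n))
  have e : (fun z => greenS s (z₀ - z) * ρ z) = fun z => ∑' n : Fin k → ℤ, gmode n s (z₀ - z) * ρ z := by
    funext z
    rw [greenS_eq_tsum hs, ← tsum_mul_right]
    rfl
  rw [e]; exact key

/-- If `-Δ f = μ + ρ` holds in the weak sense against all Green modes, then `f` is represented by
Green's function, up to a regularization. -/
lemma integral_greenS_of_weak {f : Cyl k → ℝ} {Df : Cyl k → Vec k} {C X : ℝ}
    (h : LipGrad f Df C X) {μ : Measure (Cyl k)} [IsFiniteMeasure μ] {X' : ℝ}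
    (hμ : ∀ᵐ z ∂μ, |z.1| ≤ X') {ρ : Cyl k → ℝ} (hρ : Continuous ρ) (hρs : ∀ z, X' < |z.1| → ρ z = 0)
    {z₀ : Cyl k} {s : ℝ} (hs : 0 < s)
    (H : ∀ n : Fin k → ℤ, ∫ z, gmode n s (z₀ - z) ∂μ + ∫ z, gmode n s (z₀ - z) * ρ z
      = ∫ ζ, inner ℝ (-Df (z₀ - ζ)) (gmodeGrad n s ζ)) :
    ∫ z, greenS s (z₀ - z) ∂μ + ∫ z, greenS s (z₀ - z) * ρ z
      = ∫ y, poisson s y * f (z₀.1, z₀.2 - y) := by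
  have h1 := hasSum_integral_gmode (μ := μ) (ρ := fun _ => 1) (X := X') (integrable_const 1)
    (by filter_upwards [hμ] with z hz hz'; exact absurd hz (not_le.2 hz')) z₀ hs
  have h2 := hasSum_integral_gmode (μ := volume) (ρ := ρ) (X := X') (integrable_of_fst hρ hρs)
    (Eventually.of_forall hρs) z₀ hs
  have h3 := h1.add h2
  simp only [mul_one] at h3
  rw [← h3.tsum_eq]
  have hφ : Continuous fun y : UnitAddTorus (Fin k) => f (z₀.1, z₀.2 - y) := h.cont.comp (by fun_prop)
  rw [integral_poisson_mul hs hφ]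
  congr 1; funext n
  rw [H n, (integral_inner_gmodeGrad (h.comp_const_sub z₀) n hs).2]
  simp only [pcoef]
  congr 1
  refine integral_congr_ae (Eventually.of_forall fun y => ?_)
  simp only
  rw [mul_comm, show z₀ - ((0 : ℝ), y) = (z₀.1, z₀.2 - y) by ext <;> simp]

lemma integrable_greenM_mul {ρ : Cyl k → ℝ} {X : ℝ} (hρ : Continuous ρ)
    (hρs : ∀ z, X < |z.1| → ρ z = 0) : Integrable fun ζ : Cyl k => greenM ζ * ρ ζ := by
  obtain ⟨B, hB⟩ := (hasCompactSupport_of_fst hρs).exists_bound_of_continuous hρ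
  have h1 : Integrable ((slab k (-X) X).indicator (greenM : Cyl k → ℝ)) :=
    (integrable_indicator_iff (measurableSet_slab _ _)).2 (integrableOn_greenM X)
  have h2 : (fun ζ : Cyl k => greenM ζ * ρ ζ) = fun ζ => ρ ζ * (slab k (-X) X).indicator greenM ζ := by
    funext ζ
    by_cases hζ : ζ ∈ slab k (-X) X
    · rw [indicator_of_mem hζ, mul_comm]
    · rw [hρs ζ (by by_contra hc; exact hζ (abs_le.1 (not_lt.1 hc)))]; simp
  rw [h2]
  exact h1.bdd_mul hρ.aestronglyMeasurable (Eventually.of_forall hB)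

lemma integral_greenM_sub_mul (g ρ : Cyl k → ℝ) (z₀ : Cyl k) :
    ∫ z, g (z₀ - z) * ρ z = ∫ ζ, g ζ * ρ (z₀ - ζ) := by
  rw [← integral_sub_left_eq_self (fun ζ => g ζ * ρ (z₀ - ζ)) volume z₀]
  simp

/-- For `0 < s ≤ 1` monotonicity squeezes `greenS s` between `greenS 1` and `greenM`, so the sum of
their absolute values dominates. -/
lemma tendsto_integral_greenS_mul {ρ : Cyl k → ℝ} {X : ℝ} (hρ : Continuous ρ)
    (hρs : ∀ z, X < |z.1| → ρ z = 0) :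
    Tendsto (fun s => ∫ ζ : Cyl k, greenS s ζ * ρ ζ) (𝓝[>] 0) (𝓝 (∫ ζ : Cyl k, greenM ζ * ρ ζ)) := by
  have hi1 := (integrable_greenM_mul hρ hρs).norm
  have hi2 : Integrable fun ζ : Cyl k => ‖greenS 1 ζ * ρ ζ‖ :=
    (integrable_of_fst (X := X) ((continuous_greenS one_pos).mul hρ)
      fun z hz => by simp [hρs z hz]).norm
  refine tendsto_integral_filter_of_dominated_convergence _ ?_ ?_ (hi1.add hi2) ?_
  · filter_upwards [self_mem_nhdsWithin] with s hs
    exact ((continuous_greenS hs).mul hρ).aestronglyMeasurable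
  · filter_upwards [Ioc_mem_nhdsGT one_pos] with s hs
    filter_upwards [ae_fst_ne (k := k) 0] with z hz
    have h1 := greenS_le hs.1 hs.2 z
    have h2 := greenS_le_greenM hs.1 hz
    simp only [Pi.add_apply, norm_mul, Real.norm_eq_abs]
    rw [← add_mul]
    gcongr
    rw [abs_le]
    constructor
    · linarith [neg_abs_le (greenS 1 z), abs_nonneg (greenM z)]
    · linarith [le_abs_self (greenM z), abs_nonneg (greenS 1 z)]
  · filter_upwards [ae_fst_ne (k := k) 0] with z hz
    exact (tendsto_greenS hz).mul_const _

/-- Each torus coordinate is lifted to its shortest representative, so the Lipschitz bound on the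
cylinder becomes the one required for the approximate identity. -/
lemma LipGrad.tendsto_poisson {f : Cyl k → ℝ} {Df : Cyl k → Vec k} {C X : ℝ}
    (h : LipGrad f Df C X) (z₀ : Cyl k) :
    Tendsto (fun s => ∫ y, poisson s y * f (z₀.1, z₀.2 - y)) (𝓝[>] 0) (𝓝 (f z₀)) := by
  have hφ : Continuous fun y : UnitAddTorus (Fin k) => f (z₀.1, z₀.2 - y) := h.cont.comp (by fun_prop)
  have key := tendsto_integral_poisson_mul (L := C) h.C_nonneg hφ fun y => by
    have hv : ∃ v : Vec k, toCyl v = ((0 : ℝ), -y) ∧ ‖v‖ ≤ ∑ i, ‖y i‖ := by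
      have hy : ∀ i, ∃ r : ℝ, ((r : ℝ) : UnitAddCircle) = -y i ∧ |r| = ‖y i‖ := fun i => by
        obtain ⟨r, hr⟩ := QuotientAddGroup.mk_surjective (-y i)
        refine ⟨r - round r, ?_, ?_⟩
        · rw [AddCircle.coe_sub]
          have : ((round r : ℝ) : UnitAddCircle) = 0 := by
            rw [AddCircle.coe_eq_zero_iff]; exact ⟨round r, by simp⟩
          rw [this, sub_zero]; exact hr
        · rw [← norm_neg, ← hr]
          exact (UnitAddCircle.norm_eq (x := r)).symm
      choose r hr hr' using hy
      refine ⟨WithLp.toLp 2 (Fin.cons 0 r), ?_, ?_⟩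
      · ext i
        · simp [toCyl]
        · simpa [toCyl] using hr i
      · calc ‖(WithLp.toLp 2 (Fin.cons 0 r) : Vec k)‖
            = ‖∑ j, (Fin.cons 0 r : Fin (k + 1) → ℝ) j • (bvec j : Vec k)‖ := by
              congr 1
              ext l
              simp [bvec, Finset.sum_apply, Pi.single_apply]
          _ ≤ ∑ j, ‖(Fin.cons 0 r : Fin (k + 1) → ℝ) j • (bvec j : Vec k)‖ := norm_sum_le _ _
          _ = ∑ i, ‖y i‖ := by
              rw [Fin.sum_univ_succ]
              simp only [norm_smul, norm_bvec, mul_one, Fin.cons_zero, Fin.cons_succ, norm_zero, zero_add,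
                Real.norm_eq_abs, hr']
    obtain ⟨v, hv1, hv2⟩ := hv
    have := h.lip (z₀.1, z₀.2) v
    rw [hv1] at this
    have e : ((z₀.1, z₀.2) : Cyl k) + (0, -y) = (z₀.1, z₀.2 - y) := by ext <;> simp [sub_eq_add_neg]
    rw [e] at this
    simp only [sub_zero]
    exact this.trans (mul_le_mul_of_nonneg_left hv2 h.C_nonneg)
  simpa using key

/-- The term with the continuous density converges by domination. The integral against `μ` is left
as a limit, because `μ` may be singular and moving the limit inside needs a separate argument. -/
lemma tendsto_integral_greenS_of_weak {f : Cyl k → ℝ} {Df : Cyl k → Vec k} {C X : ℝ}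
    (h : LipGrad f Df C X) {μ : Measure (Cyl k)} [IsFiniteMeasure μ] {X' : ℝ}
    (hμ : ∀ᵐ z ∂μ, |z.1| ≤ X') {ρ : Cyl k → ℝ} (hρ : Continuous ρ) (hρs : ∀ z, X' < |z.1| → ρ z = 0)
    {z₀ : Cyl k}
    (H : ∀ s > 0, ∀ n : Fin k → ℤ, ∫ z, gmode n s (z₀ - z) ∂μ + ∫ z, gmode n s (z₀ - z) * ρ z
      = ∫ ζ, inner ℝ (-Df (z₀ - ζ)) (gmodeGrad n s ζ)) :
    Tendsto (fun s => ∫ z, greenS s (z₀ - z) ∂μ) (𝓝[>] 0) (𝓝 (f z₀ - ∫ z, greenM (z₀ - z) * ρ z)) := by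
  have h1 := h.tendsto_poisson z₀
  have h2 := tendsto_integral_greenS_mul (ρ := fun ζ => ρ (z₀ - ζ)) (X := X' + |z₀.1|)
    (hρ.comp (by fun_prop)) fun ζ hζ => hρs _ (by
      rw [Prod.fst_sub, abs_sub_comm]
      have := abs_sub_abs_le_abs_sub ζ.1 z₀.1
      linarith)
  simp_rw [← integral_greenM_sub_mul] at h2
  refine (h1.sub h2).congr' ?_
  filter_upwards [self_mem_nhdsWithin] with s hs
  rw [← integral_greenS_of_weak h hμ hρ hρs hs (H s hs)]
  ring

/-! ### The chart around the origin -/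

/-- The fundamental domain of the covering `toCyl` around the origin. -/
def box (k : ℕ) : Set (Vec k) := {v | ∀ i : Fin k, v i.succ ∈ Ioc (-(1 / 2) : ℝ) (-(1 / 2) + 1)}

lemma measurableSet_box : MeasurableSet (box k) := by
  have : box k = ⋂ i : Fin k, (fun v : Vec k => v i.succ) ⁻¹' Ioc (-(1 / 2) : ℝ) (-(1 / 2) + 1) := by
    ext v; simp [box]
  rw [this]
  exact MeasurableSet.iInter fun i => measurableSet_Ioc.preimage (by fun_prop)

/-- Only the transversal coordinates are wrapped, and an interval of length one covers the circle
once. -/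
lemma measurePreserving_toCyl :
    MeasurePreserving (toCyl : Vec k → Cyl k) (volume.restrict (box k)) volume := by
  have h1 : MeasurePreserving (fun v : Vec k => ((v 0, fun i => v i.succ) : ℝ × (Fin k → ℝ))) volume
      (volume.prod volume) := by
    have := (volume_preserving_piFinSuccAbove (fun _ : Fin (k + 1) => ℝ) 0).comp
      (PiLp.volume_preserving_ofLp (Fin (k + 1)))
    have e : (fun v : Vec k => ((v 0, fun i => v i.succ) : ℝ × (Fin k → ℝ)))
        = (MeasurableEquiv.piFinSuccAbove (fun _ => ℝ) 0) ∘ WithLp.ofLp := by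
      funext v
      simp [MeasurableEquiv.piFinSuccAbove, Fin.insertNthEquiv, Fin.tail_def]
    rw [e]; exact this
  have h2 : MeasurePreserving (fun (w : Fin k → ℝ) (i : Fin k) => ((w i : ℝ) : UnitAddCircle))
      (volume.restrict (univ.pi fun _ => Ioc (-(1 / 2) : ℝ) (-(1 / 2) + 1))) volume := by
    have := measurePreserving_pi (fun _ : Fin k => volume.restrict (Ioc (-(1 / 2) : ℝ) (-(1 / 2) + 1)))
      (fun _ => (volume : Measure UnitAddCircle)) fun _ => UnitAddCircle.measurePreserving_mk (-(1 / 2))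
    rwa [← Measure.restrict_pi_pi, ← volume_pi, ← volume_pi] at this
  have h3 := h1.restrict_preimage (s := univ ×ˢ univ.pi fun _ => Ioc (-(1 / 2) : ℝ) (-(1 / 2) + 1))
    (MeasurableSet.univ.prod (MeasurableSet.univ_pi fun _ => measurableSet_Ioc))
  have h4 := (MeasurePreserving.id (volume : Measure ℝ)).prod h2
  have e1 : (fun v : Vec k => ((v 0, fun i => v i.succ) : ℝ × (Fin k → ℝ))) ⁻¹'
      (univ ×ˢ univ.pi fun _ => Ioc (-(1 / 2) : ℝ) (-(1 / 2) + 1)) = box k := by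
    ext v; simp [box]
  rw [e1, ← Measure.prod_restrict, Measure.restrict_univ] at h3
  exact h4.comp h3

/-- The representative in `box k` of a point of the cylinder. -/
def rep (z : Cyl k) : Vec k :=
  WithLp.toLp 2 (Fin.cons z.1 fun i => (AddCircle.equivIoc 1 (-(1 / 2) : ℝ) (z.2 i) : ℝ))

@[simp] lemma toCyl_rep (z : Cyl k) : toCyl (rep z) = z := by
  refine Prod.ext ?_ (funext fun i => ?_)
  · simp [rep]
  · simp only [rep, toCyl, Fin.cons_succ]
    exact AddCircle.coe_equivIoc

lemma rep_toCyl {v : Vec k} (hv : v ∈ box k) : rep (toCyl v) = v := by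
  ext i
  refine Fin.cases ?_ (fun i => ?_) i
  · simp [rep]
  · simp only [rep, toCyl, Fin.cons_succ]
    rw [AddCircle.equivIoc_coe_of_mem (hv i)]

lemma rep_mem_box (z : Cyl k) : rep z ∈ box k := fun i => by
  simp only [rep, Fin.cons_succ]
  exact (AddCircle.equivIoc 1 (-(1 / 2) : ℝ) (z.2 i)).2

@[simp] lemma rep_apply_zero (z : Cyl k) : rep z 0 = z.1 := by simp [rep]

lemma measurable_rep : Measurable (rep : Cyl k → Vec k) := by
  refine (WithLp.measurable_toLp 2 _).comp (measurable_pi_iff.2 fun i => ?_)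
  refine Fin.cases ?_ (fun i => ?_) i
  · simpa using measurable_fst
  · simp only [Fin.cons_succ]
    exact measurable_subtype_coe.comp ((AddCircle.measurableEquivIoc 1 (-(1 / 2) : ℝ)).measurable.comp
      ((measurable_pi_apply i).comp measurable_snd))

lemma mem_box_of_norm_lt {v : Vec k} (hv : ‖v‖ < 1 / 2) : v ∈ box k := fun i => by
  have := abs_lt.1 ((abs_coord_le_norm v i.succ).trans_lt hv)
  constructor <;> linarith [this.1, this.2]

/-- The distance of a point of the cylinder to the origin. -/
def cnorm (z : Cyl k) : ℝ := ‖rep z‖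

lemma abs_fst_le_cnorm (z : Cyl k) : |z.1| ≤ cnorm z := by
  have := abs_coord_le_norm (rep z) 0
  rwa [rep_apply_zero] at this

/-- The representative in `box k` has the smallest absolute value of its class in every transversal
coordinate. -/
lemma cnorm_toCyl_le (v : Vec k) : cnorm (toCyl v) ≤ ‖v‖ := by
  rw [cnorm, EuclideanSpace.norm_eq, EuclideanSpace.norm_eq]
  refine Real.sqrt_le_sqrt (Finset.sum_le_sum fun i _ => ?_)
  refine Fin.cases ?_ (fun i => ?_) i
  · simp
  · have h := rep_mem_box (toCyl v) i
    set w := rep (toCyl v) i.succ with hw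
    have hcoe : ((w : ℝ) : UnitAddCircle) = ((v i.succ : ℝ) : UnitAddCircle) := by
      have : (toCyl (rep (toCyl v))).2 i = (toCyl v).2 i := by rw [toCyl_rep]
      exact this
    have h1 : |w| ≤ |v i.succ| := by
      have hwn : ‖((w : ℝ) : UnitAddCircle)‖ = |w| := by
        rw [AddCircle.norm_coe_eq_abs_iff 1 one_ne_zero, abs_one, abs_le]
        constructor <;> linarith [h.1, h.2]
      have hvn : ‖((v i.succ : ℝ) : UnitAddCircle)‖ ≤ |v i.succ| := by
        rw [UnitAddCircle.norm_eq]
        simpa using round_le (v i.succ) 0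
      rw [← hwn, hcoe]; exact hvn
    rw [Real.norm_eq_abs, Real.norm_eq_abs]
    gcongr

lemma cnorm_add_toCyl_le (z : Cyl k) (v : Vec k) : cnorm (z + toCyl v) ≤ cnorm z + ‖v‖ := by
  conv_lhs => rw [← toCyl_rep z, ← toCyl_add]
  exact (cnorm_toCyl_le _).trans (norm_add_le _ _)

lemma abs_cnorm_sub_le (z : Cyl k) (v : Vec k) : |cnorm (z + toCyl v) - cnorm z| ≤ ‖v‖ := by
  have h1 := cnorm_add_toCyl_le z v
  have h2 := cnorm_add_toCyl_le (z + toCyl v) (-v)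
  rw [toCyl_neg, add_neg_cancel_right, norm_neg] at h2
  rw [abs_le]; constructor <;> linarith

/-- With this, continuity on the cylinder can be checked in the covering space. -/
lemma isOpenQuotientMap_toCyl : IsOpenQuotientMap (toCyl : Vec k → Cyl k) := by
  refine ⟨toCyl_surjective, continuous_toCyl, ?_⟩
  have h1 : IsOpenMap (fun v : Vec k => ((v 0, fun i => v i.succ) : ℝ × (Fin k → ℝ))) := by
    have hl : Function.LeftInverse (fun p : ℝ × (Fin k → ℝ) => (WithLp.toLp 2 (Fin.cons p.1 p.2) : Vec k))
        (fun v : Vec k => ((v 0, fun i => v i.succ) : ℝ × (Fin k → ℝ))) := fun v => by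
      ext i; refine Fin.cases ?_ (fun i => ?_) i <;> simp
    have hr : Function.RightInverse (fun p : ℝ × (Fin k → ℝ) => (WithLp.toLp 2 (Fin.cons p.1 p.2) : Vec k))
        (fun v : Vec k => ((v 0, fun i => v i.succ) : ℝ × (Fin k → ℝ))) := fun p => by
      ext i <;> simp
    refine IsOpenMap.of_inverse ?_ hr hl
    refine (PiLp.continuous_toLp 2 _).comp (continuous_pi fun i => ?_)
    refine Fin.cases ?_ (fun i => ?_) i
    · simpa using continuous_fst
    · simp only [Fin.cons_succ]; fun_prop
  have h2 : IsOpenMap (fun p : ℝ × (Fin k → ℝ) => ((p.1, fun i => ((p.2 i : ℝ) : UnitAddCircle)) : Cyl k)) := by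
    exact IsOpenMap.prodMap IsOpenMap.id (IsOpenMap.piMap (f := fun _ : Fin k => ((↑) : ℝ → UnitAddCircle)) (fun _ => QuotientAddGroup.isOpenMap_coe)
      (Eventually.of_forall fun _ => QuotientAddGroup.mk_surjective))
  exact h2.comp h1

lemma continuous_iff_comp_toCyl {E : Type*} [TopologicalSpace E] {f : Cyl k → E} :
    Continuous f ↔ Continuous fun v => f (toCyl v) :=
  isOpenQuotientMap_toCyl.isQuotientMap.continuous_iff

lemma continuous_of_lip {f : Cyl k → ℝ} {C : ℝ} (h : ∀ z v, |f (z + toCyl v) - f z| ≤ C * ‖v‖) :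
    Continuous f := by
  rw [continuous_iff_comp_toCyl]
  have : LipschitzWith C.toNNReal fun v : Vec k => f (toCyl v) := by
    refine LipschitzWith.of_dist_le_mul fun v w => ?_
    rw [dist_eq_norm, dist_eq_norm, Real.norm_eq_abs]
    have := h (toCyl w) (v - w)
    rw [← toCyl_add, add_sub_cancel] at this
    refine this.trans ?_
    gcongr; exact Real.le_coe_toNNReal C
  exact this.continuous

lemma continuous_cnorm : Continuous (cnorm : Cyl k → ℝ) :=
  continuous_of_lip (C := 1) fun z v => by rw [one_mul]; exact abs_cnorm_sub_le z v

/-- A function supported in the ball of radius `3/8` descends to the cylinder compatibly with small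
shifts. -/
lemma eventually_rep_add {E : Type*} [Zero E] {F : Vec k → E} (hF : ∀ v, 3 / 8 < ‖v‖ → F v = 0)
    (z : Cyl k) : ∀ᶠ v in 𝓝 (0 : Vec k), F (rep (z + toCyl v)) = F (rep z + v) := by
  have hc : Tendsto (fun v : Vec k => ‖rep z + v‖) (𝓝 0) (𝓝 ‖rep z‖) := by
    have : Continuous fun v : Vec k => ‖rep z + v‖ := by fun_prop
    simpa using this.tendsto 0
  -- Below `1/2` a small lift is unique, so the two lifts coincide. Otherwise both arguments stay
  -- outside the support of `F`.
  by_cases h : cnorm z < 1 / 2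
  · filter_upwards [hc.eventually (gt_mem_nhds h)] with v hv
    conv_lhs => rw [← toCyl_rep z, ← toCyl_add, rep_toCyl (mem_box_of_norm_lt hv)]
  · have h2 : 3 / 8 < ‖rep z‖ := by
      have := not_lt.1 h
      rw [cnorm] at this; linarith
    have hc2 : Tendsto (fun v : Vec k => cnorm (z + toCyl v)) (𝓝 0) (𝓝 (cnorm z)) := by
      have : Continuous fun v : Vec k => cnorm (z + toCyl v) :=
        continuous_cnorm.comp (continuous_const.add continuous_toCyl)
      simpa using this.tendsto 0
    filter_upwards [hc.eventually (lt_mem_nhds h2), hc2.eventually (lt_mem_nhds h2)] with v hv hv2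
    rw [hF _ hv, hF _ hv2]

lemma continuous_comp_rep {E : Type*} [Zero E] [TopologicalSpace E] {F : Vec k → E}
    (hF : ∀ v, 3 / 8 < ‖v‖ → F v = 0) (hc : Continuous F) : Continuous fun z : Cyl k => F (rep z) := by
  rw [continuous_iff_comp_toCyl, continuous_iff_continuousAt]
  intro v₀
  have h := eventually_rep_add hF (toCyl v₀)
  have h1 : ContinuousAt (fun v => F (rep (toCyl v₀) + (v - v₀))) v₀ := by fun_prop
  refine h1.congr ?_
  have h2 : Tendsto (fun v : Vec k => v - v₀) (𝓝 v₀) (𝓝 0) := by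
    have : Continuous fun v : Vec k => v - v₀ := by fun_prop
    simpa using this.tendsto v₀
  filter_upwards [h2.eventually h] with v hv
  rw [← hv, ← toCyl_add, add_sub_cancel]

lemma hasFDerivAt_comp_rep {F : Vec k → ℝ} (hF : ∀ v, 3 / 8 < ‖v‖ → F v = 0) (z : Cyl k)
    {F' : Vec k →L[ℝ] ℝ} (hd : HasFDerivAt F F' (rep z)) :
    HasFDerivAt (fun v => F (rep (z + toCyl v))) F' 0 := by
  have h1 : HasFDerivAt (fun v => F (rep z + v)) F' 0 := by
    have h0 : HasFDerivAt F F' (rep z + 0) := by simpa using hd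
    have h2 : HasFDerivAt (fun v : Vec k => rep z + v) (ContinuousLinearMap.id ℝ (Vec k)) 0 :=
      (hasFDerivAt_id _).const_add _
    have h3 := h0.comp 0 h2
    rwa [ContinuousLinearMap.comp_id] at h3
  exact h1.congr_of_eventuallyEq (eventually_rep_add hF z)

/-- The ball of radius `1/2` lies in the fundamental domain, so functions supported within radius
`3/8` are integrated in the flat chart. -/
lemma integral_cyl_eq {φ : Cyl k → ℝ} (hφ : AEStronglyMeasurable φ)
    (hs : ∀ v : Vec k, v ∈ box k → 3 / 8 < ‖v‖ → φ (toCyl v) = 0) :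
    ∫ z, φ z = ∫ v in Metric.ball (0 : Vec k) (1 / 2), φ (toCyl v) := by
  have hm := measurePreserving_toCyl (k := k)
  have h1 : ∫ z, φ z = ∫ v in box k, φ (toCyl v) := by
    rw [← hm.map_eq] at hφ ⊢
    exact integral_map hm.measurable.aemeasurable hφ
  rw [h1]
  refine setIntegral_eq_of_subset_of_forall_sdiff_eq_zero ?_ ?_ ?_
  · exact measurableSet_box
  · intro v hv
    exact mem_box_of_norm_lt (by simpa using hv)
  · intro v hv
    refine hs v hv.1 ?_
    have := hv.2
    simp only [Metric.mem_ball, dist_zero_right, not_lt] at this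
    linarith

/-! ### Polar coordinates and the radial charge profile -/

/-- The area of the unit sphere. -/
def sArea (k : ℕ) : ℝ := (volume : Measure (Vec k)).toSphere.real univ

lemma sArea_pos (k : ℕ) : 0 < sArea k := by
  have h : (volume : Measure (Vec k)).toSphere ≠ 0 := Measure.toSphere_ne_zero _
  exact ENNReal.toReal_pos (by rwa [ne_eq, Measure.measure_univ_eq_zero]) (measure_ne_top _ _)

instance isProbabilityMeasure_unifSphere (k : ℕ) : IsProbabilityMeasure (unifSphere k) := by
  refine ⟨?_⟩
  have h : (volume : Measure (Vec k)).toSphere ≠ 0 := Measure.toSphere_ne_zero _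
  rw [unifSphere, Measure.smul_apply, smul_eq_mul, ENNReal.inv_mul_cancel]
  · rwa [ne_eq, Measure.measure_univ_eq_zero]
  · exact measure_ne_top _ _

lemma integral_unifSphere (f : Metric.sphere (0 : Vec k) 1 → ℝ) :
    ∫ u, f u ∂(unifSphere k) = (sArea k)⁻¹ * ∫ u, f u ∂(volume : Measure (Vec k)).toSphere := by
  rw [unifSphere, integral_smul_measure, smul_eq_mul, ENNReal.toReal_inv]; rfl

lemma measurable_smear_map (η : ℝ) (z : Cyl k) :
    Measurable fun u : Metric.sphere (0 : Vec k) 1 => z + toCyl (η • (u : Vec k)) :=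
  (continuous_const.add (continuous_toCyl.comp (by fun_prop))).measurable

instance isProbabilityMeasure_smear (η : ℝ) (z : Cyl k) : IsProbabilityMeasure (smear η z) :=
  Measure.isProbabilityMeasure_map (measurable_smear_map η z).aemeasurable

lemma integral_smear (η : ℝ) (z : Cyl k) {f : Cyl k → ℝ} (hf : Measurable f) :
    ∫ z', f z' ∂(smear η z) = ∫ u, f (z + toCyl (η • (u : Vec k))) ∂(unifSphere k) :=
  integral_map (measurable_smear_map η z).aemeasurable hf.aestronglyMeasurable

lemma integral_polar {G : Vec k → ℝ} (hG : Integrable G) :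
    Integrable (fun u : Metric.sphere (0 : Vec k) 1 => ∫ r in Ioi (0 : ℝ), r ^ k * G (r • (u : Vec k)))
      (volume : Measure (Vec k)).toSphere ∧
    ∫ v, G v = ∫ u : Metric.sphere (0 : Vec k) 1, (∫ r in Ioi (0 : ℝ), r ^ k * G (r • (u : Vec k)))
      ∂(volume : Measure (Vec k)).toSphere := by
  have hmp := (volume : Measure (Vec k)).measurePreserving_homeomorphUnitSphereProd
  have hdim : Module.finrank ℝ (Vec k) - 1 = k := by simp
  rw [hdim] at hmp
  have hemb := (homeomorphUnitSphereProd (Vec k)).measurableEmbedding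
  set g : Metric.sphere (0 : Vec k) 1 × Ioi (0 : ℝ) → ℝ := fun p => G ((p.2 : ℝ) • (p.1 : Vec k)) with hg
  have hgG : ∀ v : ({0}ᶜ : Set (Vec k)), g (homeomorphUnitSphereProd (Vec k) v) = G v := fun v => by
    have h : ((homeomorphUnitSphereProd (Vec k)).symm (homeomorphUnitSphereProd (Vec k) v) : Vec k) = v := by
      simp
    rw [homeomorphUnitSphereProd_symm_apply_coe] at h
    rw [hg]; simp only; rw [h]
  have hGi : Integrable (fun v : ({0}ᶜ : Set (Vec k)) => G v) ((volume : Measure (Vec k)).comap (↑)) := by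
    have := (integrableOn_iff_comap_subtypeVal (μ := (volume : Measure (Vec k))) (f := G)
      (s := ({0}ᶜ : Set (Vec k))) (by measurability)).1 hG.integrableOn
    exact this
  have hgi : Integrable g ((volume : Measure (Vec k)).toSphere.prod (Measure.volumeIoiPow k)) := by
    rw [← hmp.integrable_comp_emb hemb]
    exact hGi.congr (Eventually.of_forall fun v => (hgG v).symm)
  have hin : ∀ u : Metric.sphere (0 : Vec k) 1, ∫ r, g (u, r) ∂(Measure.volumeIoiPow k)
      = ∫ r in Ioi (0 : ℝ), r ^ k * G (r • (u : Vec k)) := by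
    intro u
    rw [Measure.volumeIoiPow, integral_withDensity_eq_integral_toReal_smul (by fun_prop)
      (Eventually.of_forall fun _ => ENNReal.ofReal_lt_top)]
    rw [← integral_subtype_comap measurableSet_Ioi (fun r : ℝ => r ^ k * G (r • (u : Vec k)))]
    refine integral_congr_ae (Eventually.of_forall fun r => ?_)
    have : (0 : ℝ) < r := r.2
    simp only [smul_eq_mul, hg]
    rw [ENNReal.toReal_ofReal (by positivity)]
  refine ⟨?_, ?_⟩
  · exact hgi.integral_prod_left.congr (Eventually.of_forall fun u => hin u)
  · calc ∫ v, G v = ∫ v in ({0}ᶜ : Set (Vec k)), G v := by rw [restrict_compl_singleton]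
      _ = ∫ v : ({0}ᶜ : Set (Vec k)), G v ∂((volume : Measure (Vec k)).comap (↑)) :=
          (integral_subtype_comap (by measurability) G).symm
      _ = ∫ v : ({0}ᶜ : Set (Vec k)), g (homeomorphUnitSphereProd (Vec k) v)
            ∂((volume : Measure (Vec k)).comap (↑)) := by simp_rw [hgG]
      _ = ∫ p, g p ∂((volume : Measure (Vec k)).toSphere.prod (Measure.volumeIoiPow k)) :=
          hmp.integral_comp hemb g
      _ = _ := by rw [integral_prod _ hgi]; simp_rw [hin]

/-- A smooth transition from `0` on `r ≤ η` to `1` on `r ≥ 3/8`. -/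
def ramp (η r : ℝ) : ℝ := Real.smoothTransition ((r - η) / (3 / 8 - η))

lemma contDiff_ramp (η : ℝ) : ContDiff ℝ ((⊤ : ℕ∞) : WithTop ℕ∞) (ramp η) :=
  Real.smoothTransition.contDiff.comp ((contDiff_id.sub contDiff_const).div_const _)

lemma ramp_of_le {η r : ℝ} (hη : η < 1 / 4) (h : r ≤ η) : ramp η r = 0 :=
  Real.smoothTransition.zero_of_nonpos (div_nonpos_of_nonpos_of_nonneg (by linarith) (by linarith))

lemma ramp_of_ge {η r : ℝ} (hη : η < 1 / 4) (h : 3 / 8 ≤ r) : ramp η r = 1 :=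
  Real.smoothTransition.one_of_one_le (by rw [le_div_iff₀ (by linarith)]; linarith)

lemma ramp_nonneg (η r : ℝ) : 0 ≤ ramp η r := Real.smoothTransition.nonneg _

lemma ramp_le_one (η r : ℝ) : ramp η r ≤ 1 := Real.smoothTransition.le_one _

lemma hasDerivAt_ramp (η r : ℝ) : HasDerivAt (ramp η) (deriv (ramp η) r) r :=
  ((contDiff_ramp η).differentiable (by simp) r).hasDerivAt

lemma contDiff_deriv_ramp (η : ℝ) : ContDiff ℝ ((⊤ : ℕ∞) : WithTop ℕ∞) (deriv (ramp η)) :=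
  ((contDiff_infty_iff_deriv (𝕜 := ℝ)).1 (contDiff_ramp η)).2

lemma deriv_ramp_of_lt {η r : ℝ} (hη : η < 1 / 4) (h : r < η) : deriv (ramp η) r = 0 := by
  have : ramp η =ᶠ[𝓝 r] fun _ => 0 := by
    filter_upwards [gt_mem_nhds h] with x hx using ramp_of_le hη hx.le
  rw [this.deriv_eq, deriv_const]

lemma deriv_ramp_of_gt {η r : ℝ} (hη : η < 1 / 4) (h : 3 / 8 < r) : deriv (ramp η) r = 0 := by
  have : ramp η =ᶠ[𝓝 r] fun _ => 1 := by
    filter_upwards [lt_mem_nhds h] with x hx using ramp_of_ge hη hx.le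
  rw [this.deriv_eq, deriv_const]

/-- The radial field of a smeared unit charge that is screened by a smooth shell. -/
def shellField (η : ℝ) (v : Vec k) : Vec k :=
  (if η < ‖v‖ then -((1 - ramp η ‖v‖) / (sArea k * ‖v‖ ^ (k + 1))) else 0) • v

/-- The charge density of the smooth screening shell. -/
def shellDensity (η : ℝ) (v : Vec k) : ℝ := deriv (ramp η) ‖v‖ / (sArea k * ‖v‖ ^ k)

lemma measurable_shellField (η : ℝ) : Measurable (shellField η : Vec k → Vec k) := by
  have h := (contDiff_ramp η).continuous
  have h1 := h.measurable
  have h2 : Measurable fun v : Vec k =>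
      if η < ‖v‖ then -((1 - ramp η ‖v‖) / (sArea k * ‖v‖ ^ (k + 1))) else 0 :=
    Measurable.ite (measurableSet_lt measurable_const (measurable_norm : Measurable fun v : Vec k => ‖v‖))
      (by fun_prop) measurable_const
  exact h2.smul measurable_id

lemma shellField_of_gt {η : ℝ} (hη : η < 1 / 4) {v : Vec k} (hv : 3 / 8 ≤ ‖v‖) :
    shellField η v = 0 := by
  simp [shellField, ramp_of_ge hη hv]

lemma shellDensity_of_gt {η : ℝ} (hη : η < 1 / 4) (v : Vec k) (hv : 3 / 8 < ‖v‖) :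
    shellDensity η v = 0 := by
  simp [shellDensity, deriv_ramp_of_gt hη hv]

lemma norm_shellField_le {η : ℝ} (hη0 : 0 < η) (v : Vec k) :
    ‖shellField η v‖ ≤ (sArea k * η ^ k)⁻¹ := by
  have hA := sArea_pos k
  by_cases h : η < ‖v‖
  · have hv : 0 < ‖v‖ := hη0.trans h
    have h1 := ramp_nonneg η ‖v‖
    have h2 := ramp_le_one η ‖v‖
    rw [shellField, if_pos h, norm_smul, norm_neg, Real.norm_eq_abs, abs_div, abs_of_nonneg (by linarith),
      abs_of_pos (by positivity)]
    calc (1 - ramp η ‖v‖) / (sArea k * ‖v‖ ^ (k + 1)) * ‖v‖ = (1 - ramp η ‖v‖) * (sArea k * ‖v‖ ^ k)⁻¹ := by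
          field_simp
          try ring
      _ ≤ 1 * (sArea k * η ^ k)⁻¹ := by gcongr; linarith
      _ = _ := one_mul _
  · rw [shellField, if_neg h, zero_smul, norm_zero]; positivity

/-- The norm is not smooth at the origin, but the density vanishes for `‖v‖ < η`. -/
lemma contDiff_shellDensity {η : ℝ} (hη0 : 0 < η) (hη : η < 1 / 4) :
    ContDiff ℝ 1 (shellDensity η : Vec k → ℝ) := by
  rw [contDiff_iff_contDiffAt]
  intro v
  by_cases h : ‖v‖ < η
  · have : (shellDensity η : Vec k → ℝ) =ᶠ[𝓝 v] fun _ => 0 := by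
      filter_upwards [continuous_norm.continuousAt.eventually (gt_mem_nhds h)] with w hw
      simp [shellDensity, deriv_ramp_of_lt hη hw]
    exact contDiffAt_const.congr_of_eventuallyEq this
  · have hv : v ≠ 0 := fun h0 => by rw [h0, norm_zero] at h; exact h hη0
    have hn : ContDiffAt ℝ 1 (fun v : Vec k => ‖v‖) v := contDiffAt_norm ℝ hv
    have h1 : ContDiffAt ℝ 1 (fun v : Vec k => deriv (ramp η) ‖v‖) v :=
      ((contDiff_deriv_ramp η).of_le (by exact_mod_cast le_top)).contDiffAt.comp v hn
    refine h1.div (contDiffAt_const.mul (hn.pow k)) ?_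
    have := sArea_pos k
    have := norm_pos_iff.2 hv
    positivity

/-- The fundamental identity of the shell field along rays: `-∇·shellField = σ_η - shellDensity`. -/
lemma integral_inner_shellField {η : ℝ} (hη0 : 0 < η) (hη : η < 1 / 4) {f : Cyl k → ℝ}
    {g : Cyl k → Vec k} (hf : Continuous f) (hg : Measurable g)
    (hgb : ∃ B, ∀ v : Vec k, ‖v‖ ≤ 3 / 8 → ‖g (toCyl v)‖ ≤ B)
    (hder : ∀ u : Metric.sphere (0 : Vec k) 1, ∃ S : Set ℝ, S.Countable ∧ ∀ r ∉ S,
      HasDerivAt (fun r : ℝ => f (toCyl (r • (u : Vec k)))) (inner ℝ (u : Vec k) (g (toCyl (r • (u : Vec k))))) r) :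
    ∫ z, inner ℝ (shellField η (rep z)) (g z)
      = ∫ z, f z ∂(smear η 0) - ∫ z, f z * shellDensity η (rep z) := by
  obtain ⟨B, hB⟩ := hgb
  have hB0 : 0 ≤ B := (norm_nonneg _).trans (hB 0 (by simp; norm_num))
  have hA := sArea_pos k
  have hgm : Measurable fun v : Vec k => g (toCyl v) := hg.comp continuous_toCyl.measurable
  have hsfm := measurable_shellField (k := k) η
  have hsdc := (contDiff_shellDensity (k := k) hη0 hη).continuous
  have m1 : Measurable fun z : Cyl k => inner ℝ (shellField η (rep z)) (g z) :=
    (hsfm.comp measurable_rep).inner hg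
  have m2 : Measurable fun z : Cyl k => f z * shellDensity η (rep z) :=
    hf.measurable.mul (hsdc.measurable.comp measurable_rep)
  have t1 : ∫ z, inner ℝ (shellField η (rep z)) (g z) = ∫ v : Vec k, inner ℝ (shellField η v) (g (toCyl v)) := by
    rw [integral_cyl_eq m1.aestronglyMeasurable
      fun v hv hv' => by rw [rep_toCyl hv, shellField_of_gt hη hv'.le, inner_zero_left]]
    rw [setIntegral_congr_fun (g := fun v : Vec k => inner ℝ (shellField η v) (g (toCyl v))) measurableSet_ball
      fun v hv => by simp only; rw [rep_toCyl (mem_box_of_norm_lt (by simpa using hv))]]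
    refine setIntegral_eq_integral_of_forall_compl_eq_zero fun v hv => ?_
    have : 1 / 2 ≤ ‖v‖ := by simpa using hv
    rw [shellField_of_gt hη (by linarith), inner_zero_left]
  have t2 : ∫ z, f z * shellDensity η (rep z) = ∫ v : Vec k, f (toCyl v) * shellDensity η v := by
    rw [integral_cyl_eq m2.aestronglyMeasurable
      fun v hv hv' => by rw [rep_toCyl hv, shellDensity_of_gt hη v hv', mul_zero]]
    rw [setIntegral_congr_fun (g := fun v : Vec k => f (toCyl v) * shellDensity η v) measurableSet_ball
      fun v hv => by simp only; rw [rep_toCyl (mem_box_of_norm_lt (by simpa using hv))]]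
    refine setIntegral_eq_integral_of_forall_compl_eq_zero fun v hv => ?_
    have : 1 / 2 ≤ ‖v‖ := by simpa using hv
    rw [shellDensity_of_gt hη v (by linarith), mul_zero]
  have hball : volume (Metric.closedBall (0 : Vec k) (3 / 8)) < ⊤ := measure_closedBall_lt_top
  have i1 : Integrable fun v : Vec k => inner ℝ (shellField η v) (g (toCyl v)) := by
    have hsupp : (fun v : Vec k => inner ℝ (shellField η v) (g (toCyl v)))
        = (Metric.closedBall (0 : Vec k) (3 / 8)).indicator fun v => inner ℝ (shellField η v) (g (toCyl v)) := by
      symm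
      refine indicator_eq_self.2 fun v hv => ?_
      by_contra hc
      have : 3 / 8 < ‖v‖ := by simpa using hc
      exact hv (by simp only; rw [shellField_of_gt hη this.le, inner_zero_left])
    rw [hsupp, integrable_indicator_iff Metric.isClosed_closedBall.measurableSet]
    refine Measure.integrableOn_of_bounded (M := (sArea k * η ^ k)⁻¹ * B) hball.ne
      (hsfm.inner hgm).aestronglyMeasurable ?_
    filter_upwards [ae_restrict_mem Metric.isClosed_closedBall.measurableSet] with v hv
    refine (norm_inner_le_norm _ _).trans ?_
    gcongr
    · exact norm_shellField_le hη0 v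
    · exact hB v (by simpa using hv)
  have i2 : Integrable fun v : Vec k => f (toCyl v) * shellDensity η v := by
    refine Continuous.integrable_of_hasCompactSupport ((hf.comp continuous_toCyl).mul hsdc) ?_
    refine HasCompactSupport.intro (isCompact_closedBall (0 : Vec k) (3 / 8)) fun v hv => ?_
    have : 3 / 8 < ‖v‖ := by simpa using hv
    rw [shellDensity_of_gt hη v this, mul_zero]
  obtain ⟨p1, q1⟩ := integral_polar i1
  obtain ⟨p2, q2⟩ := integral_polar i2
  have hfu : Continuous fun u : Metric.sphere (0 : Vec k) 1 => f (toCyl (η • (u : Vec k))) :=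
    hf.comp (continuous_toCyl.comp (by fun_prop))
  -- Along a ray the weight `r ^ k` cancels the denominators of field and density, and the identity
  -- becomes an integration by parts in `r`.
  have key : ∀ u : Metric.sphere (0 : Vec k) 1,
      ∫ r in Ioi (0 : ℝ), r ^ k * inner ℝ (shellField η (r • (u : Vec k))) (g (toCyl (r • (u : Vec k))))
        = (sArea k)⁻¹ * f (toCyl (η • (u : Vec k)))
          - ∫ r in Ioi (0 : ℝ), r ^ k * (f (toCyl (r • (u : Vec k))) * shellDensity η (r • (u : Vec k))) := by
    intro u
    have hu : ‖(u : Vec k)‖ = 1 := by simp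
    have hru : ∀ r : ℝ, 0 < r → ‖r • (u : Vec k)‖ = r := fun r hr => by
      rw [norm_smul, hu, mul_one, Real.norm_eq_abs, abs_of_pos hr]
    set gr : ℝ → ℝ := fun r => inner ℝ (u : Vec k) (g (toCyl (r • (u : Vec k)))) with hgr
    set fr : ℝ → ℝ := fun r => f (toCyl (r • (u : Vec k))) with hfr
    have hfrc : Continuous fr := hf.comp (continuous_toCyl.comp (by fun_prop))
    have hgrm : Measurable gr :=
      measurable_const.inner (hgm.comp (by fun_prop : Measurable fun r : ℝ => r • (u : Vec k)))
    have hle : η ≤ 3 / 8 := by linarith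
    have e1 : ∫ r in Ioi (0 : ℝ), r ^ k * inner ℝ (shellField η (r • (u : Vec k))) (g (toCyl (r • (u : Vec k))))
        = ∫ r in η..(3 / 8), -(sArea k)⁻¹ * ((1 - ramp η r) * gr r) := by
      rw [intervalIntegral.integral_of_le hle]
      rw [setIntegral_eq_of_subset_of_forall_sdiff_eq_zero (s := Ioc η (3 / 8)) (t := Ioi (0 : ℝ))
        (f := fun r => r ^ k * inner ℝ (shellField η (r • (u : Vec k))) (g (toCyl (r • (u : Vec k)))))
        measurableSet_Ioi (fun r hr => hη0.trans hr.1) ?_]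
      · refine setIntegral_congr_fun measurableSet_Ioc fun r hr => ?_
        have hr0 : 0 < r := hη0.trans hr.1
        simp only [shellField, hru r hr0, if_pos hr.1, inner_smul_left, hgr]
        simp only [conj_trivial]
        field_simp
        ring
      · intro r hr
        have hr0 : (0 : ℝ) < r := hr.1
        by_cases h1 : η < r
        · have h2 : 3 / 8 < r := by
            by_contra hc; exact hr.2 ⟨h1, not_lt.1 hc⟩
          rw [shellField_of_gt hη (by rw [hru r hr0]; exact h2.le), inner_zero_left, mul_zero]
        · simp [shellField, hru r hr0, if_neg h1]
    have e2 : ∫ r in Ioi (0 : ℝ), r ^ k * (f (toCyl (r • (u : Vec k))) * shellDensity η (r • (u : Vec k)))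
        = ∫ r in η..(3 / 8), (sArea k)⁻¹ * (deriv (ramp η) r * fr r) := by
      rw [intervalIntegral.integral_of_le hle, ← integral_Icc_eq_integral_Ioc]
      rw [setIntegral_eq_of_subset_of_forall_sdiff_eq_zero (s := Icc η (3 / 8)) (t := Ioi (0 : ℝ))
        (f := fun r => r ^ k * (f (toCyl (r • (u : Vec k))) * shellDensity η (r • (u : Vec k))))
        measurableSet_Ioi (fun r hr => hη0.trans_le hr.1) ?_]
      · refine setIntegral_congr_fun measurableSet_Icc fun r hr => ?_
        have hr0 : 0 < r := hη0.trans_le hr.1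
        simp only [shellDensity, hru r hr0, hfr]
        field_simp
      · intro r hr
        have hr0 : (0 : ℝ) < r := hr.1
        have : deriv (ramp η) r = 0 := by
          by_cases h1 : r < η
          · exact deriv_ramp_of_lt hη h1
          · refine deriv_ramp_of_gt hη ?_
            by_contra hc; exact hr.2 ⟨not_lt.1 h1, not_lt.1 hc⟩
        simp [shellDensity, hru r hr0, this]
    have hrc := (contDiff_ramp η).continuous
    have hrc' := (contDiff_deriv_ramp η).continuous
    have int1 : IntervalIntegrable (fun r => (1 - ramp η r) * gr r) volume η (3 / 8) := by
      rw [intervalIntegrable_iff_integrableOn_Ioc_of_le hle]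
      refine Measure.integrableOn_of_bounded (M := B) measure_Ioc_lt_top.ne
        ((measurable_const.sub hrc.measurable).mul hgrm).aestronglyMeasurable ?_
      filter_upwards [ae_restrict_mem measurableSet_Ioc] with r hr
      have hr0 : 0 < r := hη0.trans hr.1
      have h1 := ramp_nonneg η r
      have h2 := ramp_le_one η r
      have h3 : |gr r| ≤ B := by
        refine (abs_real_inner_le_norm _ _).trans ?_
        rw [hu, one_mul]; exact hB _ (by rw [hru r hr0]; exact hr.2)
      rw [norm_mul, Real.norm_eq_abs, Real.norm_eq_abs, abs_of_nonneg (by linarith)]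
      calc (1 - ramp η r) * |gr r| ≤ 1 * B := by gcongr; linarith
        _ = B := one_mul B
    have int2 : IntervalIntegrable (fun r => deriv (ramp η) r * fr r) volume η (3 / 8) :=
      (hrc'.mul hfrc).intervalIntegrable _ _
    obtain ⟨S, hS, hS'⟩ := hder u
    -- The factor `1 - ramp` is `1` on the charged sphere and `0` at radius `3/8`, so the only
    -- boundary term is the value of `f` on the sphere. The countable exceptional set accommodates
    -- the kink of a Green mode where the ray crosses a section.
    have ftc := integral_eq_of_hasDerivAt_off_countable (fun r => (1 - ramp η r) * fr r)
      (fun r => (1 - ramp η r) * gr r - deriv (ramp η) r * fr r) (a := η) (b := 3 / 8) hS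
      ((continuous_const.sub hrc).mul hfrc).continuousOn
      (fun r hr => by
        have := ((hasDerivAt_const r (1 : ℝ)).sub (hasDerivAt_ramp η r)).mul (hS' r hr.2)
        refine this.congr_deriv ?_
        simp only [hfr, hgr, Pi.sub_apply]; ring) (int1.sub int2)
    rw [intervalIntegral.integral_sub int1 int2, ramp_of_ge hη le_rfl, ramp_of_le hη le_rfl] at ftc
    rw [e1, e2, intervalIntegral.integral_const_mul, intervalIntegral.integral_const_mul]
    have e3 : fr η = f (toCyl (η • (u : Vec k))) := rfl
    rw [← e3]
    have e4 : (∫ r in η..(3 / 8), (1 - ramp η r) * gr r) = (∫ r in η..(3 / 8), deriv (ramp η) r * fr r) - fr η := by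
      linarith
    rw [e4]; ring
  rw [t1, t2, q1, q2, integral_smear η 0 hf.measurable, integral_unifSphere]
  simp_rw [key, zero_add]
  rw [integral_sub _ p2, integral_const_mul]
  exact (hfu.integrable_of_hasCompactSupport (HasCompactSupport.of_compactSpace _)).const_mul _

/-! ### The potential of a smeared charge -/

/-- Fatou's lemma for the nonnegative differences `f n - f 0` bounds the limit through the
convergent integrals. Integrability of the limit is therefore a conclusion, not a hypothesis. -/
lemma integrable_of_monotone_tendsto {α : Type*} {mα : MeasurableSpace α} {μ : Measure α} {f : ℕ → α → ℝ}
    {F : α → ℝ} {L : ℝ} (hf : ∀ n, Integrable (f n) μ) (hm : ∀ᵐ x ∂μ, Monotone fun n => f n x)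
    (ht : ∀ᵐ x ∂μ, Tendsto (fun n => f n x) atTop (𝓝 (F x)))
    (hL : Tendsto (fun n => ∫ x, f n x ∂μ) atTop (𝓝 L)) : Integrable F μ ∧ ∫ x, F x ∂μ = L := by
  have hF : Integrable F μ := by
    have h0 : Integrable (fun x => F x - f 0 x) μ := by
      refine ⟨aestronglyMeasurable_of_tendsto_ae (u := atTop) (f := fun n x => f n x - f 0 x)
        (fun n => ((hf n).sub (hf 0)).1) (by filter_upwards [ht] with x hx using hx.sub_const _), ?_⟩
      have h1 : ∫⁻ x, ‖F x - f 0 x‖ₑ ∂μ ≤ liminf (fun n => ∫⁻ x, ‖f n x - f 0 x‖ₑ ∂μ) atTop := by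
        refine le_trans (le_of_eq (lintegral_congr_ae ?_))
          (lintegral_liminf_le' fun n => ((hf n).sub (hf 0)).1.enorm)
        filter_upwards [ht] with x hx
        exact (hx.sub_const (f 0 x)).enorm.liminf_eq.symm
      have h2 : ∀ n, ∫⁻ x, ‖f n x - f 0 x‖ₑ ∂μ = ENNReal.ofReal ((∫ x, f n x ∂μ) - ∫ x, f 0 x ∂μ) := by
        intro n
        rw [← integral_sub (hf n) (hf 0), ofReal_integral_eq_lintegral_ofReal (f := fun x => f n x - f 0 x) ((hf n).sub (hf 0))]
        · refine lintegral_congr_ae ?_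
          filter_upwards [hm] with x hx
          exact Real.enorm_of_nonneg (sub_nonneg.2 (hx (Nat.zero_le n)))
        · filter_upwards [hm] with x hx
          exact sub_nonneg.2 (hx (Nat.zero_le n))
      simp_rw [h2] at h1
      have h3 : Tendsto (fun n => ENNReal.ofReal ((∫ x, f n x ∂μ) - ∫ x, f 0 x ∂μ)) atTop
          (𝓝 (ENNReal.ofReal (L - ∫ x, f 0 x ∂μ))) := ENNReal.tendsto_ofReal (hL.sub_const _)
      rw [h3.liminf_eq] at h1
      exact h1.trans_lt ENNReal.ofReal_lt_top
    refine (h0.add (hf 0)).congr (Eventually.of_forall fun x => ?_)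
    simp
  exact ⟨hF, tendsto_nhds_unique (integral_tendsto_of_tendsto_of_monotone hf hF hm ht) hL⟩

open scoped Pointwise in
/-- A hyperplane section of the unit sphere is a null set, unless the sphere consists of two points. -/
lemma unifSphere_section (hk : 1 ≤ k) (c : ℝ) :
    unifSphere k {u | (u : Vec k) 0 = c} = 0 := by
  have hms : MeasurableSet {u : Metric.sphere (0 : Vec k) 1 | (u : Vec k) 0 = c} :=
    measurableSet_eq_fun (by fun_prop) measurable_const
  have key : ∀ σ : ℝ, |σ| = 1 → 0 ≤ σ * c → volume {v : Vec k | σ * v 0 = (σ * c) * ‖v‖} = 0 := by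
    intro σ hσ hc
    have hσ2 : σ * σ = 1 := by rw [← abs_mul_abs_self, hσ, one_mul]
    rcases lt_or_ge (σ * c) 1 with h1 | h1
    -- The equality set lies in the frontier of this convex cone: since `σ * c < 1`, a small step
    -- against the axis leaves the cone. Frontiers of convex sets are null.
    · have hconv : Convex ℝ {v : Vec k | (σ * c) * ‖v‖ ≤ σ * v 0} := by
        intro v hv w hw a b ha hb hab
        have hn : ‖a • v + b • w‖ ≤ a * ‖v‖ + b * ‖w‖ := by
          refine (norm_add_le _ _).trans ?_
          rw [norm_smul, norm_smul, Real.norm_eq_abs, Real.norm_eq_abs, abs_of_nonneg ha, abs_of_nonneg hb]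
        have e1 : (σ * c) * ‖v‖ ≤ σ * v 0 := hv
        have e2 : (σ * c) * ‖w‖ ≤ σ * w 0 := hw
        change (σ * c) * ‖a • v + b • w‖ ≤ σ * (a • v + b • w : Vec k) 0
        have e3 : (a • v + b • w : Vec k) 0 = a * v 0 + b * w 0 := by simp
        rw [e3]
        calc (σ * c) * ‖a • v + b • w‖ ≤ (σ * c) * (a * ‖v‖ + b * ‖w‖) := by gcongr
          _ = a * ((σ * c) * ‖v‖) + b * ((σ * c) * ‖w‖) := by ring
          _ ≤ a * (σ * v 0) + b * (σ * w 0) := by gcongr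
          _ = _ := by ring
      refine measure_mono_null ?_ (hconv.addHaar_frontier (volume : Measure (Vec k)))
      intro v hv
      have hv' : σ * v 0 = (σ * c) * ‖v‖ := hv
      refine ⟨subset_closure hv'.ge, fun hint => ?_⟩
      have hcont : Tendsto (fun τ : ℝ => v - (τ * σ) • (bvec 0 : Vec k)) (𝓝 0) (𝓝 v) := by
        have : Continuous fun τ : ℝ => v - (τ * σ) • (bvec 0 : Vec k) := by fun_prop
        simpa using this.tendsto 0
      have hev := hcont.eventually (mem_interior_iff_mem_nhds.1 hint)
      obtain ⟨τ, hτ, hτ0⟩ := ((hev.filter_mono nhdsWithin_le_nhds).and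
        (self_mem_nhdsWithin : Ioi (0 : ℝ) ∈ 𝓝[>] 0)).exists
      have hτ0' : (0 : ℝ) < τ := hτ0
      have hτ' : (σ * c) * ‖v - (τ * σ) • (bvec 0 : Vec k)‖ ≤ σ * (v - (τ * σ) • (bvec 0 : Vec k)) 0 := hτ
      have e1 : σ * (v - (τ * σ) • (bvec 0 : Vec k)) 0 = σ * v 0 - τ := by
        simp [bvec]; linear_combination (-τ) * hσ2
      have e2 : ‖v‖ - τ ≤ ‖v - (τ * σ) • (bvec 0 : Vec k)‖ := by
        have := norm_sub_norm_le v ((τ * σ) • (bvec 0 : Vec k))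
        rw [norm_smul, norm_bvec, Real.norm_eq_abs, abs_mul, hσ, abs_of_pos hτ0'] at this
        linarith
      rw [e1, hv'] at hτ'
      nlinarith
    -- If `σ * c ≥ 1`, equality forces `v` onto the axis, hence into the kernel of another
    -- coordinate, which exists because `1 ≤ k`.
    · set p : Vec k →L[ℝ] ℝ := EuclideanSpace.proj (⟨1, by omega⟩ : Fin (k + 1)) with hp
      refine measure_mono_null (t := (LinearMap.ker p.toLinearMap : Set (Vec k))) ?_
        (Measure.addHaar_submodule _ _ ?_)
      · intro v hv
        have hv' : σ * v 0 = (σ * c) * ‖v‖ := hv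
        have h2 : ‖v‖ ≤ |v 0| := by
          have : σ * v 0 ≤ |v 0| := by
            refine (le_abs_self _).trans ?_
            rw [abs_mul, hσ, one_mul]
          nlinarith [norm_nonneg v]
        have h3 : ‖v‖ ^ 2 = v 0 ^ 2 + ∑ i : Fin k, v i.succ ^ 2 := by
          rw [EuclideanSpace.real_norm_sq_eq, Fin.sum_univ_succ]
        have h4 : ∑ i : Fin k, v i.succ ^ 2 ≤ 0 := by
          have : ‖v‖ ^ 2 ≤ |v 0| ^ 2 := by gcongr
          rw [sq_abs] at this; linarith
        have h5 := Finset.single_le_sum (f := fun i : Fin k => v i.succ ^ 2) (fun i _ => sq_nonneg _)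
          (Finset.mem_univ (⟨0, by omega⟩ : Fin k))
        have h6 : v (Fin.succ (⟨0, by omega⟩ : Fin k)) = 0 := by
          have h7 := h5.trans h4
          simp only at h7
          nlinarith
        simpa [hp] using h6
      · intro htop
        have h8 : (bvec (⟨1, by omega⟩ : Fin (k + 1)) : Vec k) ∈ LinearMap.ker p.toLinearMap := by
          rw [htop]; trivial
        simp [hp, bvec] at h8
  have hcone : (volume : Measure (Vec k)) (Ioo (0 : ℝ) 1 •
      (((↑) : Metric.sphere (0 : Vec k) 1 → Vec k) '' {u | (u : Vec k) 0 = c})) = 0 := by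
    obtain ⟨σ, hσ, hc⟩ : ∃ σ : ℝ, |σ| = 1 ∧ 0 ≤ σ * c := by
      rcases le_total 0 c with h | h
      · exact ⟨1, by simp, by simpa using h⟩
      · exact ⟨-1, by simp, by linarith⟩
    refine measure_mono_null ?_ (key σ hσ hc)
    rintro _ ⟨r, hr, _, ⟨u, hu, rfl⟩, rfl⟩
    have hu' : (u : Vec k) 0 = c := hu
    have hn : ‖(u : Vec k)‖ = 1 := by simp
    simp only [mem_ofPred_eq, norm_smul, hn, Real.norm_eq_abs, abs_of_pos hr.1]
    simp [hu']; ring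
  rw [unifSphere, Measure.smul_apply, Measure.toSphere_apply' _ hms, hcone]
  simp

/-- For `k ≥ 1` the values of `green` on `x = 0` do not matter, because the sphere meets a section
in a null set. For `k = 0` the sphere consists of two points and may charge a section, but then the
mode series is empty and `green` is continuous. -/
lemma ae_smear_tendsto_greenS {η : ℝ} (hη : 0 < η) (z₀ : Cyl k) :
    ∀ᵐ z ∂(smear η (0 : Cyl k)), Tendsto (fun s => greenS s (z₀ - z)) (𝓝[>] 0) (𝓝 (green (z₀ - z))) := by
  rcases Nat.eq_zero_or_pos k with rfl | hk
  · refine Eventually.of_forall fun z => ?_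
    have h : ∀ z : Cyl 0, green z = -|z.1| / 2 := fun z => by
      have : IsEmpty {n : Fin 0 → ℤ // n ≠ 0} := ⟨fun n => n.2 (Subsingleton.elim _ _)⟩
      simp [green]
    simp only [greenS, h]
    have hc : Continuous fun s : ℝ => -|(|(z₀ - z).1| + s)| / 2 := by fun_prop
    have := hc.tendsto 0
    simp only [add_zero, abs_abs] at this
    exact this.mono_left nhdsWithin_le_nhds
  · have hms : MeasurableSet {z : Cyl k | (z₀ - z).1 = 0} :=
      measurableSet_eq_fun (by fun_prop) measurable_const
    have hnull : ∀ᵐ z ∂(smear η (0 : Cyl k)), (z₀ - z).1 ≠ 0 := by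
      rw [ae_iff]
      simp only [ne_eq, not_not]
      rw [smear, Measure.map_apply (measurable_smear_map η 0) hms]
      refine measure_mono_null ?_ (unifSphere_section hk (z₀.1 / η))
      intro u hu
      have : z₀.1 - η * (u : Vec k) 0 = 0 := by simpa using hu
      simp only [mem_ofPred_eq]
      rw [eq_div_iff hη.ne']; linarith
    filter_upwards [hnull] with z hz
    rw [← greenM_of_ne hz]
    exact tendsto_greenS hz

lemma ae_smear_cnorm {η : ℝ} (hη : 0 < η) : ∀ᵐ z ∂(smear η (0 : Cyl k)), |z.1| ≤ η := by
  have hms : MeasurableSet {z : Cyl k | |z.1| ≤ η} := measurableSet_le (by fun_prop) measurable_const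
  rw [smear, ae_map_iff (measurable_smear_map η 0).aemeasurable hms]
  refine Eventually.of_forall fun u => ?_
  have h := abs_coord_le_norm (u : Vec k) 0
  have hu : ‖(u : Vec k)‖ = 1 := by simp
  simp only [zero_add, toCyl_fst, PiLp.smul_apply, smul_eq_mul, abs_mul, abs_of_pos hη]
  rw [hu] at h
  nlinarith [abs_nonneg ((u : Vec k) 0)]

/-! ### The screening shell and its potential -/

/-- The charge density of the screening shell on the cylinder. -/
def shell (η : ℝ) (z : Cyl k) : ℝ := shellDensity η (rep z)

lemma continuous_shell {η : ℝ} (hη0 : 0 < η) (hη : η < 1 / 4) : Continuous (shell η : Cyl k → ℝ) :=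
  continuous_comp_rep (shellDensity_of_gt hη) (contDiff_shellDensity hη0 hη).continuous

lemma shell_of_fst {η : ℝ} (hη : η < 1 / 4) (z : Cyl k) (hz : 3 / 8 < |z.1|) : shell η z = 0 :=
  shellDensity_of_gt hη _ (hz.trans_le (abs_fst_le_cnorm z))

/-- The radial profile of the potential of a smeared charge screened by the shell. -/
def shellPot (k : ℕ) (η r : ℝ) : ℝ :=
  ∫ t in (max r η)..(3 / 8), (1 - ramp η t) / (sArea k * t ^ k)

lemma abs_shellPot_integrand_le (k : ℕ) {η t : ℝ} (hη0 : 0 < η) (ht : η ≤ t) :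
    |(1 - ramp η t) / (sArea k * t ^ k)| ≤ (sArea k * η ^ k)⁻¹ := by
  have hA := sArea_pos k
  have h1 := ramp_nonneg η t
  have h2 := ramp_le_one η t
  have ht0 := hη0.trans_le ht
  rw [abs_div, abs_of_nonneg (by linarith : 0 ≤ 1 - ramp η t), abs_of_pos (by positivity), div_eq_mul_inv]
  calc (1 - ramp η t) * (sArea k * t ^ k)⁻¹ ≤ 1 * (sArea k * η ^ k)⁻¹ := by gcongr; linarith
    _ = _ := one_mul _

lemma continuousOn_shellPot_integrand (k : ℕ) {η : ℝ} :
    ContinuousOn (fun t : ℝ => (1 - ramp η t) / (sArea k * t ^ k)) (Ioi 0) := by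
  have hA := sArea_pos k
  have hc := (contDiff_ramp η).continuous
  refine ContinuousOn.div (by fun_prop) (by fun_prop) fun t ht => ?_
  have : (0 : ℝ) < t := ht
  positivity

lemma intervalIntegrable_shellPot_integrand (k : ℕ) {η a b : ℝ} (ha : 0 < a) (hb : 0 < b) :
    IntervalIntegrable (fun t : ℝ => (1 - ramp η t) / (sArea k * t ^ k)) volume a b :=
  ((continuousOn_shellPot_integrand k).mono fun t ht => by
    rcases le_total a b with h | h
    · rw [uIcc_of_le h] at ht; exact ha.trans_le ht.1
    · rw [uIcc_of_ge h] at ht; exact hb.trans_le ht.1).intervalIntegrable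

lemma abs_shellPot_sub_le (k : ℕ) {η : ℝ} (hη0 : 0 < η) (r r' : ℝ) :
    |shellPot k η r - shellPot k η r'| ≤ (sArea k * η ^ k)⁻¹ * |r - r'| := by
  have hr : 0 < max r η := lt_max_of_lt_right hη0
  have hr' : 0 < max r' η := lt_max_of_lt_right hη0
  have e : shellPot k η r - shellPot k η r'
      = ∫ t in (max r η)..(max r' η), (1 - ramp η t) / (sArea k * t ^ k) := by
    have := intervalIntegral.integral_add_adjacent_intervals
      (intervalIntegrable_shellPot_integrand k (η := η) hr hr')
      (intervalIntegrable_shellPot_integrand k (η := η) hr' (show (0 : ℝ) < 3 / 8 by norm_num))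
    rw [shellPot, shellPot, ← this]; ring
  rw [e, ← Real.norm_eq_abs]
  refine (intervalIntegral.norm_integral_le_of_norm_le_const (C := (sArea k * η ^ k)⁻¹) fun t ht => ?_).trans ?_
  · refine abs_shellPot_integrand_le k hη0 ?_
    rcases le_total (max r η) (max r' η) with h | h
    · rw [uIoc_of_le h] at ht; exact (le_max_right _ _).trans ht.1.le
    · rw [uIoc_of_ge h] at ht; exact (le_max_right _ _).trans ht.1.le
  · have : 0 < sArea k := sArea_pos k
    rw [abs_sub_comm]
    exact mul_le_mul_of_nonneg_left (abs_max_sub_max_le_abs r r' η) (by positivity)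

lemma shellPot_of_ge (k : ℕ) {η r : ℝ} (hη : η < 1 / 4) (hr : 3 / 8 ≤ r) : shellPot k η r = 0 := by
  rw [shellPot, max_eq_left (by linarith), intervalIntegral.integral_congr (g := fun _ => 0)]
  · simp
  · intro t ht
    rw [uIcc_of_ge hr] at ht
    simp [ramp_of_ge hη ht.1]

lemma hasDerivAt_shellPot (k : ℕ) {η r : ℝ} (hη0 : 0 < η) (hr : η < r) :
    HasDerivAt (shellPot k η) (-((1 - ramp η r) / (sArea k * r ^ k))) r := by
  have h0 : 0 < r := hη0.trans hr
  have h1 := intervalIntegral.integral_hasDerivAt_left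
    (intervalIntegrable_shellPot_integrand k (η := η) h0 (show (0 : ℝ) < 3 / 8 by norm_num))
    ((continuousOn_shellPot_integrand k).stronglyMeasurableAtFilter isOpen_Ioi r h0)
    ((continuousOn_shellPot_integrand k).continuousAt (Ioi_mem_nhds h0))
  refine h1.congr_of_eventuallyEq ?_
  filter_upwards [lt_mem_nhds hr] with t ht
  rw [shellPot, max_eq_left ht.le]

/-- Inside the charged sphere the profile is constant; outside, the chain rule through the norm
gives the radial field. On the sphere the gradient jumps, which is why it is excluded. -/
lemma hasFDerivAt_shellPot {η : ℝ} (hη0 : 0 < η) (hη : η < 1 / 4) {z : Cyl k} (hz : cnorm z ≠ η) :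
    HasFDerivAt (fun v : Vec k => shellPot k η (cnorm (z + toCyl v)))
      (innerSL ℝ (shellField η (rep z))) 0 := by
  refine hasFDerivAt_comp_rep (F := fun v : Vec k => shellPot k η ‖v‖)
    (fun v hv => shellPot_of_ge k hη hv.le) z ?_
  rcases lt_or_gt_of_ne hz with h | h
  · have h' : ‖rep z‖ < η := h
    have e : innerSL ℝ (shellField η (rep z)) = (0 : Vec k →L[ℝ] ℝ) := by
      simp [shellField, not_lt.2 h'.le]
    rw [e]
    refine (hasFDerivAt_const (shellPot k η η) _).congr_of_eventuallyEq ?_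
    filter_upwards [continuous_norm.continuousAt.eventually (gt_mem_nhds h')] with v hv
    rw [shellPot, shellPot, max_eq_right hv.le, max_self]
  · have h' : η < ‖rep z‖ := h
    have hpos : 0 < ‖rep z‖ := hη0.trans h'
    have h1 : HasFDerivAt (fun v : Vec k => ‖v‖) (‖rep z‖⁻¹ • innerSL ℝ (rep z)) (rep z) := by
      have h2 := (hasStrictFDerivAt_norm_sq (rep z)).hasFDerivAt.sqrt (by positivity)
      refine (h2.congr_fderiv ?_).congr_of_eventuallyEq (Eventually.of_forall fun v => ?_)
      · ext w
        simp only [Real.sqrt_sq (norm_nonneg _)]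
        simp
        ring
      · simp
    refine ((hasDerivAt_shellPot k hη0 h').comp_hasFDerivAt (rep z) h1).congr_fderiv ?_
    ext w
    have hA := (sArea_pos k).ne'
    simp only [shellField, if_pos h']
    simp
    field_simp
    ring

lemma ae_cnorm_ne (η : ℝ) : ∀ᵐ z : Cyl k, cnorm z ≠ η := by
  have h := measurePreserving_toCyl (k := k)
  have hms : MeasurableSet {z : Cyl k | cnorm z ≠ η} :=
    (measurableSet_eq_fun continuous_cnorm.measurable measurable_const).compl
  rw [← h.map_eq, ae_map_iff h.measurable.aemeasurable hms]
  have h2 : ∀ᵐ v : Vec k, ‖v‖ ≠ η := by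
    rw [ae_iff]
    refine measure_mono_null (fun v hv => ?_) (Measure.addHaar_sphere (volume : Measure (Vec k)) 0 η)
    simpa using hv
  filter_upwards [ae_restrict_mem measurableSet_box, ae_restrict_of_ae h2] with v hv hv2
  rwa [cnorm, rep_toCyl hv]

lemma lipGrad_shellPot {η : ℝ} (hη0 : 0 < η) (hη : η < 1 / 4) :
    LipGrad (fun z : Cyl k => shellPot k η (cnorm z)) (fun z => shellField η (rep z))
      (sArea k * η ^ k)⁻¹ (3 / 8) := by
  have hA := sArea_pos k
  have hlip : ∀ (z : Cyl k) v, |shellPot k η (cnorm (z + toCyl v)) - shellPot k η (cnorm z)|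
      ≤ (sArea k * η ^ k)⁻¹ * ‖v‖ := fun z v =>
    (abs_shellPot_sub_le k hη0 _ _).trans (by gcongr; exact abs_cnorm_sub_le z v)
  refine ⟨hlip, fun z hz => shellPot_of_ge k hη (hz.le.trans (abs_fst_le_cnorm z)), continuous_of_lip hlip, ?_⟩
  filter_upwards [ae_cnorm_ne η] with z hz j
  have h1 := hasFDerivAt_shellPot hη0 hη hz
  have h2 : HasDerivAt (fun τ : ℝ => τ • (bvec j : Vec k)) (bvec j) 0 := by
    simpa using (hasDerivAt_id (0 : ℝ)).smul_const (bvec j : Vec k)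
  have h1' : HasFDerivAt (fun v : Vec k => shellPot k η (cnorm (z + toCyl v)))
      (innerSL ℝ (shellField η (rep z))) ((fun τ : ℝ => τ • (bvec j : Vec k)) 0) := by simpa using h1
  refine (h1'.comp_hasDerivAt (0 : ℝ) h2).congr_deriv ?_
  simp [bvec, EuclideanSpace.inner_single_right]

/-! ### The field of a smeared charge -/

lemma norm_le_sum_abs (v : Vec k) : ‖v‖ ≤ ∑ j, |v j| := by
  calc ‖v‖ = ‖∑ j, v j • (bvec j : Vec k)‖ := by
        congr 1
        ext l
        simp [bvec, Finset.sum_apply, Pi.single_apply]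
    _ ≤ ∑ j, ‖v j • (bvec j : Vec k)‖ := norm_sum_le _ _
    _ = ∑ j, |v j| := by simp only [norm_smul, norm_bvec, mul_one, Real.norm_eq_abs]

lemma measurable_real_sign : Measurable Real.sign := by
  unfold Real.sign
  exact Measurable.ite measurableSet_Iio measurable_const
    (Measurable.ite measurableSet_Ioi measurable_const measurable_const)

lemma abs_sign_le (x : ℝ) : |Real.sign x| ≤ 1 := by
  rcases Real.sign_apply_eq x with h | h | h <;> rw [h] <;> simp

lemma continuous_pcoef (n : Fin k → ℤ) : Continuous (pcoef n) :=
  continuous_iff_continuousAt.2 fun x => (hasDerivAt_pcoef n x).continuousAt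

lemma measurable_gmodeGrad (n : Fin k → ℤ) (s : ℝ) : Measurable (gmodeGrad n s) := by
  have h1 := (continuous_gcoef n).measurable
  have h2 := (continuous_pcoef n).measurable
  have h3 := (continuous_cosm n).measurable
  have h4 := (continuous_sinm n).measurable
  have h5 := measurable_real_sign
  refine (WithLp.measurable_toLp 2 _).comp (measurable_pi_iff.2 fun i => ?_)
  refine Fin.cases ?_ (fun i => ?_) i
  · simp only [Fin.cons_zero]; fun_prop
  · simp only [Fin.cons_succ]; fun_prop

lemma exists_bound_gmodeGrad (n : Fin k → ℤ) {s : ℝ} (hs : 0 < s) (X : ℝ) :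
    ∃ B, ∀ z : Cyl k, |z.1| ≤ X → ‖gmodeGrad n s z‖ ≤ B := by
  refine ⟨1 + ∑ i : Fin k, (1 + (X + s)) * |2 * Real.pi * n i|, fun z hz => (norm_le_sum_abs _).trans ?_⟩
  have hz0 := abs_nonneg z.1
  rw [Fin.sum_univ_succ]
  simp only [gmodeGrad, modeGrad, Fin.cons_zero, Fin.cons_succ]
  have hp := pcoef_pos n (|z.1| + s)
  have hp1 := pcoef_le_one n (x := |z.1| + s) (by linarith)
  refine add_le_add ?_ (Finset.sum_le_sum fun i _ => ?_)
  · rw [abs_div, abs_neg, abs_mul, abs_mul, abs_two, abs_of_pos hp]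
    have h1 := abs_sign_le z.1
    have h2 := abs_cosm_le n z.2
    have : |Real.sign z.1| * pcoef n (|z.1| + s) * |cosm n z.2| ≤ 1 * 1 * 1 := by gcongr
    linarith
  · rw [abs_neg, abs_mul, abs_mul]
    have h2 := abs_sinm_le n z.2
    have h3 := abs_gcoef_le n (x := |z.1| + s) (by linarith)
    have h5 : |(gcoef n (|z.1| + s))| ≤ 1 + (X + s) := by
      refine h3.trans ?_
      calc (1 + (|z.1| + s)) * pcoef n (|z.1| + s) ≤ (1 + (|z.1| + s)) * 1 := by gcongr
        _ ≤ 1 + (X + s) := by linarith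
    have h6 := abs_nonneg (2 * Real.pi * n i)
    have h7 := abs_nonneg (gcoef n (|z.1| + s))
    calc |(gcoef n (|z.1| + s))| * |2 * Real.pi * n i| * |sinm n z.2|
        ≤ (1 + (X + s)) * |2 * Real.pi * n i| * 1 :=
          mul_le_mul (mul_le_mul_of_nonneg_right h5 h6) h2 (abs_nonneg _)
            (mul_nonneg (h7.trans h5) h6)
      _ = _ := mul_one _

/-- The potential of a smeared charge is the explicit screened potential plus the potential of the
smooth shell, at every point. -/
lemma integral_green_smear {η : ℝ} (hη0 : 0 < η) (hη : η < 1 / 4) (z₀ : Cyl k) :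
    ∫ z, green (z₀ - z) ∂(smear η 0) = shellPot k η (cnorm z₀) + ∫ z, greenM (z₀ - z) * shell η z := by
  have hsc := continuous_shell (k := k) hη0 hη
  -- The weak equation of the screened potential against each Green mode. The reflection `z ↦ z₀ -
  -- z` accounts for the minus sign in `g`.
  have H : ∀ s > 0, ∀ n : Fin k → ℤ, ∫ z, gmode n s (z₀ - z) ∂(smear η 0)
      + ∫ z, gmode n s (z₀ - z) * -shell η z
      = ∫ ζ, inner ℝ (-shellField η (rep (z₀ - ζ))) (gmodeGrad n s ζ) := by
    intro s hs n
    have h1 := integral_inner_shellField hη0 hη (f := fun z => gmode n s (z₀ - z))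
      (g := fun z => -gmodeGrad n s (z₀ - z)) ((continuous_gmode n s).comp (by fun_prop))
      ((measurable_gmodeGrad n s).comp (by fun_prop)).neg (by
        obtain ⟨B, hB⟩ := exists_bound_gmodeGrad n hs (|z₀.1| + 3 / 8)
        refine ⟨B, fun v hv => ?_⟩
        rw [norm_neg]
        refine hB _ ?_
        rw [Prod.fst_sub, toCyl_fst]
        exact (abs_sub _ _).trans (by linarith [abs_coord_le_norm v 0])) (by
        intro u
        -- The only exceptional radius is the one at which the ray crosses the section through `z₀`;
        -- a ray inside a slice stays clear of the kink, as its `x`-component is zero.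
        refine ⟨{z₀.1 / (u : Vec k) 0}, countable_singleton _, fun r hr => ?_⟩
        have hc : (z₀ - toCyl (r • (u : Vec k))).1 ≠ 0 ∨ (-(u : Vec k)) 0 = 0 := by
          by_cases hu : (u : Vec k) 0 = 0
          · right; simp [hu]
          · left
            intro h0
            apply hr
            have : z₀.1 - r * (u : Vec k) 0 = 0 := by simpa using h0
            rw [mem_singleton_iff, eq_div_iff hu]; linarith
        have h2 := hasDerivAt_gmode n s (z₀ - toCyl (r • (u : Vec k))) (-(u : Vec k)) hc
        have h2' : HasDerivAt (fun τ : ℝ => gmode n s (z₀ - toCyl (r • (u : Vec k)) + toCyl (τ • (-(u : Vec k)))))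
          (inner ℝ (-(u : Vec k)) (gmodeGrad n s (z₀ - toCyl (r • (u : Vec k))))) (r - r) := by simpa using h2
        have h3 := h2'.comp_sub_const r r
        rw [inner_neg_left, ← inner_neg_right] at h3
        refine h3.congr_of_eventuallyEq (Eventually.of_forall fun τ => ?_)
        simp only
        congr 1
        rw [smul_neg, toCyl_neg, sub_smul, sub_eq_add_neg (τ • _) , toCyl_add, toCyl_neg]
        abel)
    have h4 : ∫ ζ, inner ℝ (-shellField η (rep (z₀ - ζ))) (gmodeGrad n s ζ)
        = ∫ z, inner ℝ (shellField η (rep z)) (-gmodeGrad n s (z₀ - z)) := by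
      rw [← integral_sub_left_eq_self (fun z : Cyl k => inner ℝ (shellField η (rep z)) (-gmodeGrad n s (z₀ - z)))
        volume z₀]
      simp only [sub_sub_cancel, inner_neg_left, inner_neg_right]
    rw [h4, h1]
    simp only [mul_neg, integral_neg, shell]
    ring
  have ht := tendsto_integral_greenS_of_weak (lipGrad_shellPot (k := k) hη0 hη) (μ := smear η 0) (X' := 3 / 8)
    (by filter_upwards [ae_smear_cnorm hη0] with z hz; linarith) (ρ := fun z => -shell η z) hsc.neg
    (fun z hz => by simp [shell_of_fst hη z hz]) (z₀ := z₀) H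
  simp only [mul_neg, integral_neg, sub_neg_eq_add] at ht
  -- Along `s = 1/(m + 1)` the integrands increase, so monotone convergence moves the limit inside
  -- the integral over the sphere for every position of `z₀`.
  have hseq : Tendsto (fun m : ℕ => 1 / ((m : ℝ) + 1)) atTop (𝓝[>] 0) := by
    rw [tendsto_nhdsWithin_iff]
    exact ⟨tendsto_one_div_add_atTop_nhds_zero_nat, Eventually.of_forall fun n => by
      simp only [mem_Ioi]; positivity⟩
  refine (integrable_of_monotone_tendsto (f := fun (m : ℕ) z => greenS (1 / ((m : ℝ) + 1)) (z₀ - z))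
    (fun m => ?_) (Eventually.of_forall fun z m m' hm => ?_) ?_ (ht.comp hseq)).2
  · obtain ⟨B, -, hB⟩ := exists_bound_greenS (k := k) (|z₀.1| + η) (s := 1 / ((m : ℝ) + 1)) (by positivity)
    refine Integrable.of_bound (C := B)
      ((continuous_greenS (by positivity)).comp (by fun_prop : Continuous fun z : Cyl k => z₀ - z)).aestronglyMeasurable ?_
    filter_upwards [ae_smear_cnorm hη0] with z hz
    refine hB _ ?_
    rw [Prod.fst_sub]
    exact (abs_sub _ _).trans (by linarith)
  · refine greenS_le (by positivity) ?_ _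
    gcongr
  · filter_upwards [ae_smear_tendsto_greenS hη0 z₀] with z hz
    exact hz.comp hseq

lemma integral_smear_shift (η : ℝ) (p : Cyl k) (f : Cyl k → ℝ) :
    ∫ z, f z ∂(smear η p) = ∫ z, f (p + z) ∂(smear η 0) := by
  have h : smear η p = (smear η 0).map (fun z => p + z) := by
    rw [smear, smear, Measure.map_map (by fun_prop) (measurable_smear_map η 0)]
    congr 1
    funext u
    simp
  rw [h]
  exact (MeasurableEquiv.addLeft p).measurableEmbedding.integral_map f

/-- The gradient of the shell density. -/
def shellGrad (η : ℝ) (z : Cyl k) : Vec k := gradient (shellDensity η) (rep z)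

lemma continuous_shellGrad {η : ℝ} (hη0 : 0 < η) (hη : η < 1 / 4) :
    Continuous (shellGrad η : Cyl k → Vec k) := by
  refine continuous_comp_rep (F := fun v => gradient (shellDensity η) v) (fun v hv => ?_) ?_
  · have : (shellDensity η : Vec k → ℝ) =ᶠ[𝓝 v] fun _ => 0 := by
      filter_upwards [continuous_norm.continuousAt.eventually (lt_mem_nhds hv)] with w hw
      exact shellDensity_of_gt hη w hw
    simp only [gradient]
    rw [this.fderiv_eq]; simp
  · exact (LinearIsometryEquiv.continuous _).comp
      ((contDiff_shellDensity hη0 hη).continuous_fderiv (by simp))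

lemma shellGrad_of_fst {η : ℝ} (hη : η < 1 / 4) (z : Cyl k) (hz : 3 / 8 < |z.1|) :
    shellGrad η z = 0 := by
  have hv : 3 / 8 < ‖rep z‖ := hz.trans_le (abs_fst_le_cnorm z)
  have : (shellDensity η : Vec k → ℝ) =ᶠ[𝓝 (rep z)] fun _ => 0 := by
    filter_upwards [continuous_norm.continuousAt.eventually (lt_mem_nhds hv)] with w hw
    exact shellDensity_of_gt hη w hw
  rw [shellGrad, gradient, this.fderiv_eq]; simp

lemma hasFDerivAt_shell {η : ℝ} (hη0 : 0 < η) (hη : η < 1 / 4) (z : Cyl k) (v₀ : Vec k) :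
    HasFDerivAt (fun v : Vec k => shell η (z + toCyl v)) (innerSL ℝ (shellGrad η (z + toCyl v₀))) v₀ := by
  have h1 := hasFDerivAt_comp_rep (F := shellDensity η) (shellDensity_of_gt hη) (z + toCyl v₀)
    (F' := fderiv ℝ (shellDensity η) (rep (z + toCyl v₀)))
    (((contDiff_shellDensity hη0 hη).differentiable (by simp)) _).hasFDerivAt
  have h2 : fderiv ℝ (shellDensity η) (rep (z + toCyl v₀)) = innerSL ℝ (shellGrad η (z + toCyl v₀)) := by
    ext w
    simp [shellGrad, gradient]
  rw [h2] at h1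
  have h3 : HasFDerivAt (fun v : Vec k => v - v₀) (ContinuousLinearMap.id ℝ (Vec k)) v₀ :=
    (hasFDerivAt_id _).sub_const _
  have h1' : HasFDerivAt (fun v => shellDensity η (rep (z + toCyl v₀ + toCyl v)))
    (innerSL ℝ (shellGrad η (z + toCyl v₀))) (v₀ - v₀) := by simpa using h1
  have h4 := HasFDerivAt.comp (f := fun v : Vec k => v - v₀) v₀ h1' h3
  rw [ContinuousLinearMap.comp_id] at h4
  refine h4.congr_of_eventuallyEq (Eventually.of_forall fun v => ?_)
  simp only [shell, Function.comp_apply]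
  congr 2
  rw [add_assoc, ← toCyl_add, add_sub_cancel]

lemma exists_bound_of_fst {E : Type*} [NormedAddCommGroup E] {f : Cyl k → E} {X : ℝ}
    (hc : Continuous f) (hs : ∀ z, X < |z.1| → f z = 0) : ∃ B, 0 ≤ B ∧ ∀ z, ‖f z‖ ≤ B := by
  obtain ⟨B, hB⟩ := (hasCompactSupport_of_fst hs).exists_bound_of_continuous hc
  exact ⟨B, (norm_nonneg _).trans (hB 0), hB⟩

/-- The bound is uniform for `z` in a slab and is the dominating function for continuity and
differentiability of convolutions. -/
lemma norm_greenM_smul_le {E : Type*} [NormedAddCommGroup E] [NormedSpace ℝ E] {G : Cyl k → E}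
    {X Z B : ℝ} (hB : ∀ z, ‖G z‖ ≤ B) (hs : ∀ z, X < |z.1| → G z = 0) {z : Cyl k} (hz : |z.1| ≤ Z)
    (ζ : Cyl k) :
    ‖greenM ζ • G (z - ζ)‖ ≤ ‖(slab k (-(X + Z)) (X + Z)).indicator (greenM : Cyl k → ℝ) ζ‖ * B := by
  have hB0 : 0 ≤ B := (norm_nonneg _).trans (hB 0)
  by_cases hζ : ζ ∈ slab k (-(X + Z)) (X + Z)
  · rw [indicator_of_mem hζ, norm_smul]
    gcongr
    exact hB _
  · rw [hs, smul_zero, norm_zero]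
    · positivity
    · by_contra hc
      apply hζ
      rw [Prod.fst_sub, not_lt] at hc
      refine abs_le.1 (?_ : |ζ.1| ≤ X + Z)
      have := abs_sub_abs_le_abs_sub ζ.1 z.1
      rw [abs_sub_comm] at this
      linarith

lemma integrable_indicator_greenM (X : ℝ) :
    Integrable ((slab k (-X) X).indicator (greenM : Cyl k → ℝ)) :=
  (integrable_indicator_iff (measurableSet_slab _ _)).2 (integrableOn_greenM X)

lemma integrable_greenM_smul {E : Type*} [NormedAddCommGroup E] [NormedSpace ℝ E]
    {G : Cyl k → E} {X : ℝ} (hG : Continuous G) (hs : ∀ z, X < |z.1| → G z = 0) (z : Cyl k) :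
    Integrable fun ζ : Cyl k => greenM ζ • G (z - ζ) := by
  obtain ⟨B, -, hB⟩ := exists_bound_of_fst hG hs
  refine Integrable.mono' ((integrable_indicator_greenM (X + |z.1|)).norm.mul_const B) ?_
    (Eventually.of_forall fun ζ => norm_greenM_smul_le hB hs le_rfl ζ)
  exact measurable_greenM.aestronglyMeasurable.smul
    (hG.comp (by fun_prop : Continuous fun ζ : Cyl k => z - ζ)).aestronglyMeasurable

lemma continuous_integral_greenM_smul {E : Type*} [NormedAddCommGroup E] [NormedSpace ℝ E]
    {G : Cyl k → E} {X : ℝ} (hG : Continuous G) (hs : ∀ z, X < |z.1| → G z = 0) :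
    Continuous fun z : Cyl k => ∫ ζ : Cyl k, greenM ζ • G (z - ζ) := by
  obtain ⟨B, -, hB⟩ := exists_bound_of_fst hG hs
  rw [continuous_iff_continuousAt]
  intro z₀
  have hnhds : ∀ᶠ z : Cyl k in 𝓝 z₀, |z.1| ≤ |z₀.1| + 1 := by
    have : ContinuousAt (fun z : Cyl k => |z.1|) z₀ := by fun_prop
    filter_upwards [this.eventually (gt_mem_nhds (lt_add_one _))] with z hz using hz.le
  refine continuousAt_of_dominated (bound := fun ζ =>
    ‖(slab k (-(X + (|z₀.1| + 1))) (X + (|z₀.1| + 1))).indicator (greenM : Cyl k → ℝ) ζ‖ * B) ?_ ?_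
    ((integrable_indicator_greenM _).norm.mul_const B) ?_
  · exact Eventually.of_forall fun z => (integrable_greenM_smul hG hs z).1
  · filter_upwards [hnhds] with z hz
    exact Eventually.of_forall fun ζ => norm_greenM_smul_le hB hs hz ζ
  · refine Eventually.of_forall fun ζ => ?_
    exact (continuous_const.smul (hG.comp (by fun_prop : Continuous fun z : Cyl k => z - ζ))).continuousAt

/-- The gradient of the potential of the shell. -/
def potGrad (η : ℝ) (z : Cyl k) : Vec k := ∫ ζ : Cyl k, greenM ζ • shellGrad η (z - ζ)

lemma continuous_potGrad {η : ℝ} (hη0 : 0 < η) (hη : η < 1 / 4) :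
    Continuous (potGrad η : Cyl k → Vec k) :=
  continuous_integral_greenM_smul (continuous_shellGrad hη0 hη) (shellGrad_of_fst hη)

/-- The derivative falls on the smooth density, so only integrability of Green's function is used
and nothing about its gradient. -/
lemma hasFDerivAt_integral_greenM_shell {η : ℝ} (hη0 : 0 < η) (hη : η < 1 / 4) (z : Cyl k) :
    HasFDerivAt (fun v : Vec k => ∫ z', greenM (z + toCyl v - z') * shell η z')
      (innerSL ℝ (potGrad η z)) 0 := by
  have hgc := continuous_shellGrad (k := k) hη0 hη
  have hgs := shellGrad_of_fst (k := k) hη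
  have hsc := continuous_shell (k := k) hη0 hη
  obtain ⟨B, hB0, hB⟩ := exists_bound_of_fst hgc hgs
  simp_rw [integral_greenM_sub_mul]
  have hcl : Continuous fun v : Vec k => innerSL ℝ v := (innerSL ℝ).continuous
  have e1 : innerSL ℝ (potGrad η z) = ∫ ζ : Cyl k, greenM ζ • innerSL ℝ (shellGrad η (z + toCyl 0 - ζ)) := by
    rw [potGrad, ← ContinuousLinearMap.integral_comp_comm _ (integrable_greenM_smul hgc hgs z)]
    simp
  rw [e1]
  refine hasFDerivAt_integral_of_dominated_of_fderiv_le (F := fun v ζ => greenM ζ * shell η (z + toCyl v - ζ))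
    (F' := fun v ζ => greenM ζ • innerSL ℝ (shellGrad η (z + toCyl v - ζ)))
    (bound := fun ζ =>
    ‖(slab k (-(3 / 8 + (|z.1| + 1))) (3 / 8 + (|z.1| + 1))).indicator (greenM : Cyl k → ℝ) ζ‖ * B)
    (Metric.ball_mem_nhds 0 one_pos) ?_ ?_ ?_ ?_ ((integrable_indicator_greenM _).norm.mul_const B) ?_
  · exact Eventually.of_forall fun v =>
      (integrable_greenM_smul hsc (shell_of_fst hη) (z + toCyl v)).1
  · exact integrable_greenM_smul hsc (shell_of_fst hη) (z + toCyl 0)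
  · exact (measurable_greenM.aestronglyMeasurable.smul
      (hcl.comp (hgc.comp (by fun_prop : Continuous fun ζ : Cyl k => z + toCyl 0 - ζ))).aestronglyMeasurable)
  · refine Eventually.of_forall fun ζ v hv => ?_
    refine norm_greenM_smul_le (G := fun w => innerSL ℝ (shellGrad η w)) (fun w => ?_) (fun w hw => ?_) ?_ ζ
    · rw [innerSL_apply_norm]; exact hB w
    · rw [hgs w hw, map_zero]
    · have h1 : ‖v‖ < 1 := by simpa using hv
      have h2 := abs_coord_le_norm v 0
      rw [Prod.fst_add, toCyl_fst]
      exact (abs_add_le _ _).trans (by linarith)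
  · refine Eventually.of_forall fun ζ v _ => ?_
    have h := (hasFDerivAt_shell hη0 hη (z - ζ) v).const_smul (greenM ζ)
    have e2 : ∀ v : Vec k, z - ζ + toCyl v = z + toCyl v - ζ := fun v => by abel
    simp_rw [e2] at h
    exact h

/-- The field of a smeared unit charge at the origin, off the sphere that carries the charge. -/
lemma hasFDerivAt_integral_green_smear {η : ℝ} (hη0 : 0 < η) (hη : η < 1 / 4) (p z : Cyl k)
    (hz : cnorm (z - p) ≠ η) :
    HasFDerivAt (fun v : Vec k => ∫ z', green (z + toCyl v - z') ∂(smear η p))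
      (innerSL ℝ (shellField η (rep (z - p)) + potGrad η (z - p))) 0 := by
  have h := (hasFDerivAt_shellPot hη0 hη hz).add (hasFDerivAt_integral_greenM_shell hη0 hη (z - p))
  rw [← map_add] at h
  refine h.congr_of_eventuallyEq (Eventually.of_forall fun v => ?_)
  simp only [Pi.add_apply]
  rw [integral_smear_shift, ← integral_green_smear hη0 hη (z - p + toCyl v)]
  congr 1
  funext z'
  congr 1
  abel

/-! ### Test functions and integration by parts -/

lemma lipGrad_of_hasFDerivAt {f : Cyl k → ℝ} {g : Cyl k → Vec k} {B X : ℝ}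
    (hd : ∀ z, HasFDerivAt (fun v : Vec k => f (z + toCyl v)) (innerSL ℝ (g z)) 0) (hb : ∀ z, ‖g z‖ ≤ B)
    (hs : ∀ z, X < |z.1| → f z = 0) : LipGrad f g B X := by
  have hd' : ∀ z (v₀ : Vec k), HasFDerivAt (fun v : Vec k => f (z + toCyl v)) (innerSL ℝ (g (z + toCyl v₀))) v₀ := by
    intro z v₀
    have h3 : HasFDerivAt (fun v : Vec k => v - v₀) (ContinuousLinearMap.id ℝ (Vec k)) v₀ :=
      (hasFDerivAt_id _).sub_const _
    have h1 : HasFDerivAt (fun v => f (z + toCyl v₀ + toCyl v)) (innerSL ℝ (g (z + toCyl v₀))) (v₀ - v₀) := by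
      simpa using hd (z + toCyl v₀)
    have h4 := HasFDerivAt.comp (f := fun v : Vec k => v - v₀) v₀ h1 h3
    rw [ContinuousLinearMap.comp_id] at h4
    refine h4.congr_of_eventuallyEq (Eventually.of_forall fun v => ?_)
    simp only [Function.comp_apply]
    rw [add_assoc, ← toCyl_add, add_sub_cancel]
  have hlip : ∀ z v, |f (z + toCyl v) - f z| ≤ B * ‖v‖ := fun z v => by
    have := convex_univ.norm_image_sub_le_of_norm_hasFDerivWithin_le (𝕜 := ℝ)
      (f := fun v : Vec k => f (z + toCyl v)) (C := B) (x := 0) (y := v)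
      (fun w _ => (hd' z w).hasFDerivWithinAt) (fun w _ => by rw [innerSL_apply_norm]; exact hb _)
      (mem_univ _) (mem_univ _)
    simpa using this
  refine ⟨hlip, hs, continuous_of_lip hlip, Eventually.of_forall fun z j => ?_⟩
  have h2 : HasDerivAt (fun τ : ℝ => τ • (bvec j : Vec k)) (bvec j) 0 := by
    simpa using (hasDerivAt_id (0 : ℝ)).smul_const (bvec j : Vec k)
  have h1' : HasFDerivAt (fun v : Vec k => f (z + toCyl v)) (innerSL ℝ (g z))
      ((fun τ : ℝ => τ • (bvec j : Vec k)) 0) := by simpa using hd z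
  refine (h1'.comp_hasDerivAt (0 : ℝ) h2).congr_deriv ?_
  simp [bvec, EuclideanSpace.inner_single_right]

lemma IsTestFunction.hasFDerivAt {U : Set (Cyl k)} {f : Cyl k → ℝ} (h : IsTestFunction U f)
    (z : Cyl k) : HasFDerivAt (fun v : Vec k => f (z + toCyl v)) (innerSL ℝ (grad f z)) 0 := by
  have h1 : DifferentiableAt ℝ (fun v : Vec k => f (z + toCyl v)) 0 := by
    have h2 : (fun v : Vec k => f (z + toCyl v)) = (fun v : Vec k => f (toCyl v)) ∘ fun v => rep z + v := by
      funext v; simp [toCyl_add]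
    rw [h2]
    exact DifferentiableAt.comp _ (h.smooth.differentiable (by simp) _) (by fun_prop)
  have h3 := h1.hasGradientAt.hasFDerivAt
  refine h3.congr_fderiv ?_
  ext w; simp [grad]

lemma grad_toCyl (f : Cyl k → ℝ) (v : Vec k) :
    grad f (toCyl v) = gradient (fun v => f (toCyl v)) v := by
  have h : (fun w : Vec k => f (toCyl v + toCyl w)) = fun w => (fun v => f (toCyl v)) (w + v) := by
    funext w; simp [toCyl_add, add_comm]
  have h2 := fderiv_comp_add_right (𝕜 := ℝ) (f := fun v : Vec k => f (toCyl v)) (x := 0) v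
  rw [zero_add] at h2
  rw [grad, h, gradient, gradient, h2]

lemma IsTestFunction.continuous_grad {U : Set (Cyl k)} {f : Cyl k → ℝ} (h : IsTestFunction U f) :
    Continuous (grad f) := by
  rw [continuous_iff_comp_toCyl]
  simp_rw [grad_toCyl]
  exact (LinearIsometryEquiv.continuous _).comp (h.smooth.continuous_fderiv (by simp))

lemma grad_eq_zero_of_notMem {f : Cyl k → ℝ} {z : Cyl k} (hz : z ∉ tsupport f) : grad f z = 0 := by
  have h : (fun v : Vec k => f (z + toCyl v)) =ᶠ[𝓝 0] fun _ => 0 := by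
    have hc : Tendsto (fun v : Vec k => z + toCyl v) (𝓝 0) (𝓝 z) := by
      have : Continuous fun v : Vec k => z + toCyl v := continuous_const.add continuous_toCyl
      simpa using this.tendsto 0
    filter_upwards [hc.eventually ((isClosed_tsupport f).isOpen_compl.mem_nhds hz)] with v hv
    exact image_eq_zero_of_notMem_tsupport hv
  rw [grad, gradient, h.fderiv_eq]; simp

lemma IsTestFunction.exists_support {U : Set (Cyl k)} {f : Cyl k → ℝ} (h : IsTestFunction U f) :
    ∃ X : ℝ, 0 ≤ X ∧ (∀ z, X < |z.1| → f z = 0) ∧ ∀ z, X < |z.1| → grad f z = 0 := by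
  obtain ⟨X, hX⟩ := (h.compact.isCompact.image continuous_fst).isBounded.exists_norm_le
  have hn : ∀ z : Cyl k, |X| < |z.1| → z ∉ tsupport f := fun z hz hzs => by
    have := hX z.1 (mem_image_of_mem _ hzs)
    rw [Real.norm_eq_abs] at this
    linarith [le_abs_self X]
  exact ⟨|X|, abs_nonneg _, fun z hz => image_eq_zero_of_notMem_tsupport (hn z hz),
    fun z hz => grad_eq_zero_of_notMem (hn z hz)⟩

lemma IsTestFunction.lipGrad {U : Set (Cyl k)} {f : Cyl k → ℝ} (h : IsTestFunction U f) :
    ∃ C X : ℝ, LipGrad f (grad f) C X ∧ ∀ z, X < |z.1| → grad f z = 0 := by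
  obtain ⟨X, -, h1, h2⟩ := h.exists_support
  obtain ⟨B, -, hB⟩ := exists_bound_of_fst h.continuous_grad h2
  exact ⟨B, X, lipGrad_of_hasFDerivAt h.hasFDerivAt hB h1, h2⟩

lemma IsTestFunction.continuous {U : Set (Cyl k)} {f : Cyl k → ℝ} (h : IsTestFunction U f) :
    Continuous f := by
  rw [continuous_iff_comp_toCyl]; exact h.smooth.continuous

lemma IsTestFunction.mono {U V : Set (Cyl k)} {f : Cyl k → ℝ} (h : IsTestFunction U f) (hUV : U ⊆ V) :
    IsTestFunction V f := ⟨h.smooth, h.compact, h.support.trans hUV⟩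

/-- Since test functions are stable under partial derivatives, the Laplacian is handled by applying
first-order identities twice. -/
lemma IsTestFunction.partialDeriv {U : Set (Cyl k)} {f : Cyl k → ℝ} (h : IsTestFunction U f)
    (j : Fin (k + 1)) : IsTestFunction U fun z => grad f z j := by
  have hsupp : tsupport (fun z => grad f z j) ⊆ tsupport f := by
    refine closure_minimal (fun z hz => ?_) (isClosed_tsupport f)
    by_contra hc
    exact hz (by simp [grad_eq_zero_of_notMem hc])
  refine ⟨?_, ?_, hsupp.trans h.support⟩
  · simp_rw [grad_toCyl]
    have h1 : ContDiff ℝ ((⊤ : ℕ∞) : WithTop ℕ∞) (fun v : Vec k => gradient (fun v => f (toCyl v)) v) :=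
      (LinearIsometryEquiv.contDiff _).comp (h.smooth.fderiv_right (by simp))
    exact (EuclideanSpace.proj (𝕜 := ℝ) j : Vec k →L[ℝ] ℝ).contDiff.comp h1
  · exact HasCompactSupport.of_support_subset_isCompact h.compact.isCompact (subset_closure.trans hsupp)

/-- The Laplacian on the cylinder. -/
def lap (f : Cyl k → ℝ) (z : Cyl k) : ℝ := ∑ j, grad (fun z => grad f z j) z j

lemma IsTestFunction.continuous_lap {U : Set (Cyl k)} {f : Cyl k → ℝ} (h : IsTestFunction U f) :
    Continuous (lap f) := by
  refine continuous_finsetSum _ fun j _ => ?_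
  have := (h.partialDeriv j).continuous_grad
  fun_prop

lemma IsTestFunction.exists_support_lap {U : Set (Cyl k)} {f : Cyl k → ℝ} (h : IsTestFunction U f) :
    ∃ X : ℝ, 0 ≤ X ∧ ∀ z, X < |z.1| → lap f z = 0 := by
  choose X hX0 _ hX using fun j => (h.partialDeriv j).exists_support
  refine ⟨∑ j, X j, Finset.sum_nonneg fun j _ => hX0 j, fun z hz => Finset.sum_eq_zero fun j _ => ?_⟩
  rw [hX j z ((Finset.single_le_sum (fun i _ => hX0 i) (Finset.mem_univ j)).trans_lt hz)]
  rfl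

/-- Integration by parts in the direction of a coordinate vector. -/
lemma LipGrad.integral_mul_deriv {f : Cyl k → ℝ} {Df : Cyl k → Vec k} {C X B L : ℝ}
    (h : LipGrad f Df C X) {j : Fin (k + 1)} {G G' : Cyl k → ℝ} (hG : Continuous G)
    (hGb : ∀ z : Cyl k, |z.1| ≤ X + 1 → |G z| ≤ B)
    (hGl : ∀ z τ, |τ| ≤ 1 → |z.1| ≤ X → |G (z + toCyl (τ • bvec j)) - G z| ≤ L * |τ|)
    (hd : ∀ᵐ z, HasDerivAt (fun τ : ℝ => G (z + toCyl (τ • (bvec j : Vec k)))) (G' z) 0) :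
    Integrable (fun z => Df z j * G z + f z * G' z) ∧ ∫ z, (Df z j * G z + f z * G' z) = 0 := by
  have hw : ‖(bvec j : Vec k)‖ ≤ 1 := (norm_bvec j).le
  obtain ⟨C', hC'⟩ := lip_mul hw (fun z τ _ => h.lip_dir hw z τ) h.supp h.exists_bound hGb hGl
  refine integral_deriv_eq_zero (F := fun z => f z * G z) hw (h.cont.mul hG) hC'
    (fun z hz => by rw [h.supp z hz, zero_mul]) ?_
  filter_upwards [h.der, hd] with z h1 h2
  refine ((h1 j).mul h2).congr_deriv ?_
  simp

lemma LipGrad.integral_mul_lipGrad {f g : Cyl k → ℝ} {Df Dg : Cyl k → Vec k} {C X C' X' : ℝ}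
    (h : LipGrad f Df C X) (h' : LipGrad g Dg C' X') (hDf : Continuous Df) (hDfs : ∀ z, X < |z.1| → Df z = 0)
    (j : Fin (k + 1)) :
    ∫ z, Df z j * g z = -∫ z, f z * Dg z j := by
  obtain ⟨B, -, hB⟩ := h'.exists_bound
  obtain ⟨h1, h2⟩ := h.integral_mul_deriv (j := j) (G := g) (G' := fun z => Dg z j) (B := B) (L := C') h'.cont
    (fun z _ => hB z) (fun z τ _ _ => h'.lip_dir (norm_bvec j).le z τ)
    (by filter_upwards [h'.der] with z hz using hz j)
  have i1 : Integrable fun z => Df z j * g z :=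
    integrable_of_fst (X := X) (Continuous.mul (by fun_prop) h'.cont) fun z hz => by simp [hDfs z hz]
  have i2 : Integrable fun z => f z * Dg z j := by
    refine (h1.sub i1).congr (Eventually.of_forall fun z => ?_)
    simp
  rw [integral_add i1 i2] at h2
  linarith

lemma lip_gmode (n : Fin k → ℤ) {s : ℝ} (hs : 0 < s) (j : Fin (k + 1)) (X : ℝ) :
    ∃ L, ∀ (z : Cyl k) (τ : ℝ), |τ| ≤ 1 → |z.1| ≤ X →
      |gmode n s (z + toCyl (τ • bvec j)) - gmode n s z| ≤ L * |τ| := by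
  have h := (lip_abs_fst_mul (α := fun x => gcoef n (x + s)) (K := 1) (c := cosm n)
    (P := |phase n (bvec j : Vec k)|) (norm_bvec j).le
    (lipschitz_of_deriv_Ici (hasDerivAt_gcoef_shift n s) fun x hx => by
      have h1 := pcoef_pos n (x + s)
      have h2 := pcoef_le_one n (x := x + s) (by linarith)
      rw [abs_div, abs_neg, abs_of_pos h1, abs_two]; linarith)
    (abs_cosm_le n) (fun z τ => by
      have := abs_cosm_shift_sub_le n z (τ • (bvec j : Vec k))
      rw [phase_smul, abs_mul, mul_comm] at this
      exact this) X).2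
  exact ⟨_, h⟩

lemma LipGrad.integral_mul_gmodeGrad {f : Cyl k → ℝ} {Df : Cyl k → Vec k} {C X : ℝ}
    (h : LipGrad f Df C X) (hDf : Continuous Df) (hDfs : ∀ z, X < |z.1| → Df z = 0) (n : Fin k → ℤ)
    {s : ℝ} (hs : 0 < s) (j : Fin (k + 1)) :
    Integrable (fun z => f z * gmodeGrad n s z j) ∧
    ∫ z, f z * gmodeGrad n s z j = -∫ z, Df z j * gmode n s z := by
  obtain ⟨L, hL⟩ := lip_gmode n hs j X
  obtain ⟨h1, h2⟩ := h.integral_mul_deriv (j := j) (G := gmode n s) (G' := fun z => gmodeGrad n s z j)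
    (continuous_gmode n s) (fun z hz => abs_gmode_le n hs hz) hL (by
      filter_upwards [ae_fst_ne (k := k) 0] with z hz
      have := hasDerivAt_gmode n s z (bvec j) (Or.inl hz)
      simpa [bvec, EuclideanSpace.inner_single_left] using this)
  have i1 : Integrable fun z => Df z j * gmode n s z :=
    integrable_of_fst (X := X) (Continuous.mul (by fun_prop) (continuous_gmode n s)) fun z hz => by
      simp [hDfs z hz]
  have i2 : Integrable fun z => f z * gmodeGrad n s z j := by
    refine (h1.sub i1).congr (Eventually.of_forall fun z => ?_)
    simp
  rw [integral_add i1 i2] at h2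
  exact ⟨i2, by linarith⟩

/-- Green's function inverts `-Δ` on test functions. -/
lemma IsTestFunction.integral_greenM_lap {U : Set (Cyl k)} {f : Cyl k → ℝ} (h : IsTestFunction U f)
    (z₀ : Cyl k) : ∫ z, greenM (z₀ - z) * -lap f z = f z₀ := by
  obtain ⟨C, X, hl, hls⟩ := h.lipGrad
  obtain ⟨X', hX'0, hX'⟩ := h.exists_support_lap
  have hlc := h.continuous_lap
  -- The general representation is used without singular charge and with density `-Δ f`.
  have ht := tendsto_integral_greenS_of_weak hl (μ := 0) (X' := X') (by simp)
    (ρ := fun z => -lap f z) hlc.neg (fun z hz => by simp [hX' z hz]) (z₀ := z₀) (by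
      intro s hs n
      rw [integral_zero_measure, zero_add, integral_greenM_sub_mul]
      have hj : ∀ j : Fin (k + 1), Integrable (fun ζ => -grad f (z₀ - ζ) j * gmodeGrad n s ζ j) ∧
          ∫ ζ, -grad f (z₀ - ζ) j * gmodeGrad n s ζ j
            = -∫ ζ, grad (fun z => grad f z j) (z₀ - ζ) j * gmode n s ζ := by
        intro j
        obtain ⟨C₂, X₂, hl₂, hls₂⟩ := (h.partialDeriv j).lipGrad
        have hc₂ := (h.partialDeriv j).continuous_grad
        have h3 := (hl₂.comp_const_sub z₀).integral_mul_gmodeGrad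
          (hc₂.comp (by fun_prop : Continuous fun ζ : Cyl k => z₀ - ζ)).neg
          (fun z hz => by
            simp only [neg_eq_zero]
            refine hls₂ _ ?_
            rw [Prod.fst_sub]
            have := abs_sub_abs_le_abs_sub z.1 z₀.1
            rw [abs_sub_comm]; linarith) n hs j
        refine ⟨?_, ?_⟩
        · simpa using h3.1.neg
        · have h4 := h3.2
          simp only [PiLp.neg_apply, neg_mul, integral_neg, neg_neg] at h4 ⊢
          rw [h4]
      have e1 : ∀ ζ, inner ℝ (-grad f (z₀ - ζ)) (gmodeGrad n s ζ)
          = ∑ j, -grad f (z₀ - ζ) j * gmodeGrad n s ζ j := fun ζ => by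
        rw [PiLp.inner_apply]
        refine Finset.sum_congr rfl fun j _ => ?_
        simp [mul_comm]
      simp_rw [e1]
      rw [integral_finsetSum _ fun j _ => (hj j).1]
      simp_rw [(hj _).2]
      have e2 : ∀ ζ, gmode n s ζ * -lap f (z₀ - ζ)
          = ∑ j, -(grad (fun z => grad f z j) (z₀ - ζ) j * gmode n s ζ) := fun ζ => by
        rw [lap, Finset.sum_neg_distrib, ← Finset.sum_mul]; ring
      simp_rw [e2]
      rw [integral_finsetSum]
      · simp_rw [integral_neg]
      · intro j _
        obtain ⟨C₂, X₂, hl₂, hls₂⟩ := (h.partialDeriv j).lipGrad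
        have hc₂ := (h.partialDeriv j).continuous_grad
        refine (integrable_of_fst (X := X₂ + |z₀.1|) (Continuous.mul (by fun_prop) (continuous_gmode n s))
          fun z hz => ?_).neg
        have h0 : grad (fun z => grad f z j) (z₀ - z) = 0 := by
          refine hls₂ (z₀ - z) ?_
          rw [Prod.fst_sub]
          have := abs_sub_abs_le_abs_sub z.1 z₀.1
          rw [abs_sub_comm]; linarith
        simp [h0])
  simp only [integral_zero_measure] at ht
  have := tendsto_nhds_unique ht tendsto_const_nhds
  linarith

/-- Fubini's theorem for the convolution with Green's function. -/
lemma integral_integral_greenM {a b : Cyl k → ℝ} {X : ℝ} (ha : Continuous a) (hb : Continuous b)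
    (has : ∀ z, X < |z.1| → a z = 0) (hbs : ∀ z, X < |z.1| → b z = 0) :
    ∫ z, (∫ ζ, greenM ζ * a (z - ζ)) * b z = ∫ ζ, greenM ζ * ∫ z, a (z - ζ) * b z := by
  obtain ⟨A, hA0, hA⟩ := exists_bound_of_fst ha has
  have hbi := integrable_of_fst hb hbs
  have hint : Integrable (Function.uncurry fun z ζ : Cyl k => greenM ζ * a (z - ζ) * b z)
      (volume.prod volume) := by
    have h1 := hbi.norm.mul_prod ((integrable_indicator_greenM (k := k) (X + X)).norm.mul_const A)
    refine h1.mono' ?_ (Eventually.of_forall fun p => ?_)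
    · have := measurable_greenM (k := k)
      have := ha.measurable
      have := hb.measurable
      exact Measurable.aestronglyMeasurable (by unfold Function.uncurry; fun_prop)
    · simp only [Function.uncurry]
      rw [norm_mul, mul_comm]
      by_cases hz : |p.1.1| ≤ X
      · gcongr
        exact norm_greenM_smul_le hA has hz p.2
      · rw [hbs _ (not_le.1 hz)]; simp
  calc ∫ z, (∫ ζ, greenM ζ * a (z - ζ)) * b z = ∫ z, ∫ ζ, greenM ζ * a (z - ζ) * b z := by
        simp_rw [integral_mul_const]
    _ = ∫ ζ, ∫ z, greenM ζ * a (z - ζ) * b z := integral_integral_swap hint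
    _ = _ := by simp_rw [mul_assoc, integral_const_mul]

lemma lipGrad_shell {η : ℝ} (hη0 : 0 < η) (hη : η < 1 / 4) :
    ∃ C, LipGrad (shell η : Cyl k → ℝ) (shellGrad η) C (3 / 8) := by
  obtain ⟨B, -, hB⟩ := exists_bound_of_fst (continuous_shellGrad (k := k) hη0 hη) (shellGrad_of_fst hη)
  exact ⟨B, lipGrad_of_hasFDerivAt (fun z => by simpa using hasFDerivAt_shell hη0 hη z 0) hB (shell_of_fst hη)⟩

lemma potGrad_apply {η : ℝ} (hη0 : 0 < η) (hη : η < 1 / 4) (z : Cyl k) (j : Fin (k + 1)) :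
    potGrad η z j = ∫ ζ, greenM ζ * shellGrad η (z - ζ) j := by
  have := (EuclideanSpace.proj (𝕜 := ℝ) j : Vec k →L[ℝ] ℝ).integral_comp_comm
    (integrable_greenM_smul (continuous_shellGrad (k := k) hη0 hη) (shellGrad_of_fst hη) z)
  rw [potGrad]
  simpa using this.symm

/-- The potential of the shell solves Poisson's equation in the weak sense. -/
lemma integral_inner_potGrad {η : ℝ} (hη0 : 0 < η) (hη : η < 1 / 4) {U : Set (Cyl k)}
    {f : Cyl k → ℝ} (h : IsTestFunction U f) :
    ∫ z, inner ℝ (potGrad η z) (grad f z) = ∫ z, shell η z * f z := by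
  obtain ⟨C, X, hl, hlX⟩ := h.lipGrad
  obtain ⟨X', hX'0, hX'⟩ := h.exists_support_lap
  have hgc := continuous_shellGrad (k := k) hη0 hη
  have hsc := continuous_shell (k := k) hη0 hη
  have hpc := continuous_potGrad (k := k) hη0 hη
  have hfg := h.continuous_grad
  have hlc := h.continuous_lap
  have hsX := shellGrad_of_fst (k := k) hη
  have hsX0 := shell_of_fst (k := k) hη
  obtain ⟨B, -, hB⟩ := exists_bound_of_fst hgc hsX
  have hUc : Continuous fun z : Cyl k => ∫ ζ, greenM ζ * shell η (z - ζ) :=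
    continuous_integral_greenM_smul hsc hsX0
  have hfst : ∀ {X : ℝ} {z ζ : Cyl k}, X + |ζ.1| < |z.1| → X < |(z - ζ).1| := fun {X z ζ} hz => by
    rw [Prod.fst_sub]
    have := abs_sub_abs_le_abs_sub z.1 ζ.1
    linarith
  -- After Fubini the derivative is moved from the translated shell to the other factor; Green's
  -- function itself is never differentiated.
  have step : ∀ j : Fin (k + 1), ∫ z, potGrad η z j * grad f z j
      = ∫ z, (∫ ζ, greenM ζ * shell η (z - ζ)) * -grad (fun z => grad f z j) z j := by
    intro j
    obtain ⟨C₂, X₂, hl₂, hls₂⟩ := (h.partialDeriv j).lipGrad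
    have hc₂ := (h.partialDeriv j).continuous_grad
    simp_rw [potGrad_apply hη0 hη]
    rw [integral_integral_greenM (X := max (3 / 8) X) (a := fun z => shellGrad η z j) (by fun_prop)
      (by fun_prop) (fun z hz => by simp [hsX z ((le_max_left _ _).trans_lt hz)])
      (fun z hz => by simp [hlX z ((le_max_right _ _).trans_lt hz)])]
    rw [integral_integral_greenM (X := max (3 / 8) X₂) (a := shell η) hsc
      (by fun_prop) (fun z hz => hsX0 z ((le_max_left _ _).trans_lt hz))
      (fun z hz => by simp [hls₂ z ((le_max_right _ _).trans_lt hz)])]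
    congr 1; funext ζ; congr 1
    have hsh : LipGrad (fun z : Cyl k => shell η (z - ζ)) (fun z => shellGrad η (z - ζ)) B (3 / 8 + |ζ.1|) := by
      refine lipGrad_of_hasFDerivAt (fun z => ?_) (fun z => hB _) fun z hz => hsX0 _ (hfst hz)
      have := hasFDerivAt_shell hη0 hη (z - ζ) 0
      simp only [toCyl_zero, add_zero] at this
      convert this using 4
      abel
    rw [hsh.integral_mul_lipGrad hl₂ (hgc.comp (by fun_prop)) (fun z hz => hsX _ (hfst hz)) j]
    simp_rw [mul_neg, integral_neg]
  have e1 : ∀ z, inner ℝ (potGrad η z) (grad f z) = ∑ j, potGrad η z j * grad f z j := fun z => by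
    rw [PiLp.inner_apply]
    refine Finset.sum_congr rfl fun j _ => ?_
    simp [mul_comm]
  simp_rw [e1]
  rw [integral_finsetSum _ fun j _ => integrable_of_fst (X := X) (by fun_prop)
    fun z hz => by simp [hlX z hz]]
  simp_rw [step]
  rw [← integral_finsetSum]
  · simp_rw [← Finset.mul_sum, Finset.sum_neg_distrib]
    change ∫ z, (∫ ζ, greenM ζ * shell η (z - ζ)) * -lap f z = _
    rw [integral_integral_greenM (X := max (3 / 8) X') (b := fun z => -lap f z) hsc hlc.neg
      (fun z hz => hsX0 z ((le_max_left _ _).trans_lt hz))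
      (fun z hz => by simp [hX' z ((le_max_right _ _).trans_lt hz)])]
    -- Evenness of Green's function transfers the convolution from the shell to `-Δ f`, where the
    -- inversion formula applies.
    rw [← integral_neg_eq_self]
    have e2 : ∀ ζ : Cyl k, greenM (-ζ) * ∫ z, shell η (z - -ζ) * -lap f z
        = greenM ζ * ∫ z, -lap f (z - ζ) * shell η z := fun ζ => by
      rw [greenM_neg, ← integral_sub_right_eq_self (fun z => shell η (z - -ζ) * -lap f z) ζ]
      congr 2; funext z
      rw [sub_neg_eq_add, sub_add_cancel, mul_comm]
    simp_rw [e2]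
    rw [← integral_integral_greenM (X := max (3 / 8) X') (a := fun z => -lap f z) hlc.neg hsc
      (fun z hz => by simp [hX' z ((le_max_right _ _).trans_lt hz)])
      (fun z hz => hsX0 z ((le_max_left _ _).trans_lt hz))]
    congr 1; funext z
    rw [← integral_greenM_sub_mul greenM (fun z => -lap f z) z, h.integral_greenM_lap, mul_comm]
  · intro j _
    obtain ⟨C₂, X₂, hl₂, hls₂⟩ := (h.partialDeriv j).lipGrad
    have hc₂ := (h.partialDeriv j).continuous_grad
    exact integrable_of_fst (X := X₂) (hUc.mul (by fun_prop)) fun z hz => by simp [hls₂ z hz]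

/-! ### Solving the divergence equation on slices -/

/-- The inclusion of the transversal directions. -/
def transv (s : Fin k → ℝ) : Vec k := WithLp.toLp 2 (Fin.cons 0 s)

@[simp] lemma transv_zero (s : Fin k → ℝ) : transv s 0 = 0 := by simp [transv]

@[simp] lemma transv_succ (s : Fin k → ℝ) (i : Fin k) : transv s i.succ = s i := by simp [transv]

lemma continuous_transv : Continuous (transv : (Fin k → ℝ) → Vec k) := by
  refine (PiLp.continuous_toLp 2 _).comp (continuous_pi fun i => ?_)
  refine Fin.cases ?_ (fun i => ?_) i
  · simpa using continuous_const
  · simpa using continuous_apply i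

lemma norm_transv_le {s : Fin k → ℝ} (hs : ∀ i, |s i| ≤ 1) : ‖transv s‖ ≤ √k := by
  rw [EuclideanSpace.norm_eq]
  refine Real.sqrt_le_sqrt ?_
  rw [Fin.sum_univ_succ]
  simp only [transv_zero, transv_succ, norm_zero, Real.norm_eq_abs, sq_abs]
  have h : ∑ i, s i ^ 2 ≤ ∑ _i : Fin k, (1 : ℝ) :=
    Finset.sum_le_sum fun i _ => (sq_le_one_iff_abs_le_one _).2 (hs i)
  simpa using h

/-- The uniform distribution on the unit cube. -/
def cubeMeasure (k : ℕ) : Measure ((Fin k → ℝ) × ℝ) := volume.restrict (Icc 0 1)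

lemma cubeMeasure_eq (k : ℕ) : cubeMeasure k
    = ((volume : Measure (Fin k → ℝ)).restrict (Icc 0 1)).prod ((volume : Measure ℝ).restrict (Icc 0 1)) := by
  rw [Measure.prod_restrict, Icc_prod_Icc]; rfl

instance (k : ℕ) : IsProbabilityMeasure ((volume : Measure (Fin k → ℝ)).restrict (Icc 0 1)) := by
  refine ⟨?_⟩
  rw [Measure.restrict_apply_univ, Real.volume_Icc_pi]; simp

instance : IsProbabilityMeasure ((volume : Measure ℝ).restrict (Icc 0 1)) := by
  refine ⟨?_⟩
  rw [Measure.restrict_apply_univ, Real.volume_Icc]; simp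

instance (k : ℕ) : IsProbabilityMeasure (cubeMeasure k) := by
  rw [cubeMeasure_eq]; infer_instance

lemma ae_cubeMeasure (k : ℕ) : ∀ᵐ p ∂(cubeMeasure k), ∀ i, |p.1 i| ≤ 1 := by
  refine (ae_restrict_mem measurableSet_Icc).mono fun p hp i => ?_
  have h1 := hp.1.1 i
  have h2 := hp.2.1 i
  simp only [Prod.fst_zero, Pi.zero_apply, Prod.fst_one, Pi.one_apply] at h1 h2
  rw [abs_of_nonneg h1]; exact h2

/-- The averaged solution of `∇ · F = φ - φ̄`, where `φ̄` denotes the slice average. -/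
def divSolve (φ : Cyl k → ℝ) (z : Cyl k) : Vec k :=
  ∫ p : (Fin k → ℝ) × ℝ, φ (z - toCyl (p.2 • transv p.1)) • transv p.1 ∂(cubeMeasure k)

/-- Stated with a parameter, so that it also yields joint continuity in time and space. -/
lemma continuous_divSolve {T : Type*} [TopologicalSpace T] [FirstCountableTopology T]
    [LocallyCompactSpace T] {φ : T → Cyl k → ℝ} (hφ : Continuous (Function.uncurry φ)) :
    Continuous fun p : T × Cyl k => divSolve (φ p.1) p.2 := by
  have ht := continuous_transv (k := k)
  have hc := continuous_toCyl (k := k)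
  refine continuous_parametric_integral_of_continuous (X := T × Cyl k) (f := fun q (p : (Fin k → ℝ) × ℝ) =>
    φ q.1 (q.2 - toCyl (p.2 • transv p.1)) • transv p.1) ?_ isCompact_Icc
  have h : Continuous fun r : (T × Cyl k) × ((Fin k → ℝ) × ℝ) =>
      (r.1.1, r.1.2 - toCyl (r.2.2 • transv r.2.1)) := by fun_prop
  exact (hφ.comp h).smul (by fun_prop : Continuous fun r : (T × Cyl k) × ((Fin k → ℝ) × ℝ) => transv r.2.1)

lemma continuous_divSolve_const {φ : Cyl k → ℝ} (hφ : Continuous φ) : Continuous (divSolve φ) := by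
  have := continuous_divSolve (T := Unit) (φ := fun _ => φ) (hφ.comp continuous_snd)
  exact this.comp (Continuous.prodMk continuous_const continuous_id : Continuous fun z : Cyl k => ((), z))

lemma integrable_divSolve {φ : Cyl k → ℝ} (hφ : Continuous φ) (z : Cyl k) :
    Integrable (fun p : (Fin k → ℝ) × ℝ => φ (z - toCyl (p.2 • transv p.1)) • transv p.1) (cubeMeasure k) := by
  have ht := continuous_transv (k := k)
  have hc := continuous_toCyl (k := k)
  have : Continuous fun p : (Fin k → ℝ) × ℝ => φ (z - toCyl (p.2 • transv p.1)) • transv p.1 := by fun_prop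
  exact this.continuousOn.integrableOn_compact isCompact_Icc

@[simp] lemma divSolve_apply_zero {φ : Cyl k → ℝ} (hφ : Continuous φ) (z : Cyl k) : divSolve φ z 0 = 0 := by
  have := (EuclideanSpace.proj (𝕜 := ℝ) (0 : Fin (k + 1)) : Vec k →L[ℝ] ℝ).integral_comp_comm
    (integrable_divSolve hφ z)
  rw [divSolve]
  simpa using this.symm

lemma divSolve_eq_zero {φ : Cyl k → ℝ} {z : Cyl k} (h : ∀ z' : Cyl k, z'.1 = z.1 → φ z' = 0) :
    divSolve φ z = 0 := by
  rw [divSolve]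
  refine integral_eq_zero_of_ae (Eventually.of_forall fun p => ?_)
  simp [h (z - toCyl (p.2 • transv p.1)) (by simp)]

lemma measurePreserving_cube (k : ℕ) :
    MeasurePreserving (fun (w : Fin k → ℝ) (i : Fin k) => ((w i : ℝ) : UnitAddCircle))
      ((volume : Measure (Fin k → ℝ)).restrict (Icc 0 1)) volume := by
  have h0 : MeasurePreserving (fun x : ℝ => (x : UnitAddCircle)) (volume.restrict (Icc (0 : ℝ) 1)) volume := by
    have := UnitAddCircle.measurePreserving_mk 0
    rwa [zero_add, Measure.restrict_congr_set Ioc_ae_eq_Icc] at this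
  have := measurePreserving_pi (fun _ : Fin k => volume.restrict (Icc (0 : ℝ) 1))
      (fun _ => (volume : Measure UnitAddCircle)) fun _ => h0
  rw [← Measure.restrict_pi_pi, ← volume_pi, ← volume_pi] at this
  rwa [← pi_univ_Icc]

/-- The unit cube covers the torus once, so averaging over transversal shifts in it gives the slice
mean. -/
lemma integral_slice_eq_cube {f : Cyl k → ℝ} (hf : Continuous f) (z : Cyl k) :
    ∫ s in Icc (0 : Fin k → ℝ) 1, f (z + toCyl (transv s)) = ∫ y, f (z.1, y) := by
  have h1 : ∀ s : Fin k → ℝ, f (z + toCyl (transv s))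
      = (fun y => f (z.1, z.2 + y)) fun i => ((s i : ℝ) : UnitAddCircle) := fun s => by
    simp only
    congr 1
    refine Prod.ext ?_ (funext fun i => ?_)
    · simp
    · simp
  simp_rw [h1]
  have hm := measurePreserving_cube k
  have := integral_map (μ := (volume : Measure (Fin k → ℝ)).restrict (Icc 0 1)) hm.measurable.aemeasurable
    (f := fun y => f (z.1, z.2 + y)) (by
      rw [hm.map_eq]; exact Continuous.aestronglyMeasurable (by fun_prop))
  rw [hm.map_eq] at this
  rw [← this]
  exact integral_add_left_eq_self (μ := (volume : Measure (UnitAddTorus (Fin k)))) (fun y => f (z.1, y)) z.2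

lemma IsTestFunction.hasDerivAt_line {U : Set (Cyl k)} {f : Cyl k → ℝ} (h : IsTestFunction U f)
    (z : Cyl k) (w : Vec k) (τ : ℝ) :
    HasDerivAt (fun τ : ℝ => f (z + toCyl (τ • w))) (inner ℝ w (grad f (z + toCyl (τ • w)))) τ := by
  have h1 := h.hasFDerivAt (z + toCyl (τ • w))
  have h2 : HasDerivAt (fun σ : ℝ => (σ - τ) • w) w τ := by
    have := ((hasDerivAt_id τ).sub_const τ).smul_const w
    simpa using this
  have h1' : HasFDerivAt (fun v : Vec k => f (z + toCyl (τ • w) + toCyl v))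
      (innerSL ℝ (grad f (z + toCyl (τ • w)))) ((fun σ : ℝ => (σ - τ) • w) τ) := by simpa using h1
  have h3 := h1'.comp_hasDerivAt τ h2
  rw [innerSL_apply_apply, real_inner_comm] at h3
  refine h3.congr_of_eventuallyEq (Eventually.of_forall fun σ => ?_)
  simp only [Function.comp_apply]
  rw [add_assoc, ← toCyl_add, ← add_smul, add_sub_cancel]

lemma IsTestFunction.integral_line {U : Set (Cyl k)} {f : Cyl k → ℝ} (h : IsTestFunction U f)
    (z : Cyl k) (w : Vec k) :
    ∫ τ in Icc (0 : ℝ) 1, inner ℝ w (grad f (z + toCyl (τ • w))) = f (z + toCyl w) - f z := by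
  have hg := h.continuous_grad
  have hc := continuous_toCyl (k := k)
  rw [integral_Icc_eq_integral_Ioc, ← intervalIntegral.integral_of_le zero_le_one,
    intervalIntegral.integral_eq_sub_of_hasDerivAt (fun τ _ => h.hasDerivAt_line z w τ)
      (Continuous.intervalIntegrable (by fun_prop) _ _)]
  simp

/-- The fundamental theorem along the segment from `z` to `z + s` gives an increment of `f`;
averaging over `s` in the cube replaces the endpoint value by the slice mean. -/
lemma IsTestFunction.integral_cube {U : Set (Cyl k)} {f : Cyl k → ℝ} (h : IsTestFunction U f)
    (z : Cyl k) :
    ∫ p, inner ℝ (transv p.1) (grad f (z + toCyl (p.2 • transv p.1))) ∂(cubeMeasure k)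
      = (∫ y, f (z.1, y)) - f z := by
  have hg := h.continuous_grad
  have hc := continuous_toCyl (k := k)
  have ht := continuous_transv (k := k)
  have hf := h.continuous
  rw [cubeMeasure_eq, integral_prod]
  · simp only
    simp_rw [h.integral_line]
    rw [integral_sub, integral_slice_eq_cube hf]
    · simp
    · exact (Continuous.continuousOn (by fun_prop)).integrableOn_compact isCompact_Icc
    · exact integrable_const _
  · rw [← cubeMeasure_eq]
    exact (Continuous.continuousOn (by fun_prop)).integrableOn_compact isCompact_Icc

/-- `divSolve φ` solves `∇ · F = φ - φ̄` in the weak sense. -/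
lemma integral_inner_divSolve {φ : Cyl k → ℝ} (hφ : Continuous φ) {X : ℝ}
    (hφs : ∀ z, X < |z.1| → φ z = 0) {U : Set (Cyl k)} {f : Cyl k → ℝ} (h : IsTestFunction U f) :
    ∫ z, inner ℝ (divSolve φ z) (grad f z) = ∫ z : Cyl k, φ z * ((∫ y, f (z.1, y)) - f z) := by
  have hg := h.continuous_grad
  have hc := continuous_toCyl (k := k)
  have ht := continuous_transv (k := k)
  obtain ⟨X', -, -, hgs⟩ := h.exists_support
  obtain ⟨B, hB0, hB⟩ := exists_bound_of_fst hg hgs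
  have hint : Integrable (Function.uncurry fun (z : Cyl k) (p : (Fin k → ℝ) × ℝ) =>
      φ (z - toCyl (p.2 • transv p.1)) * inner ℝ (transv p.1) (grad f z)) (volume.prod (cubeMeasure k)) := by
    obtain ⟨A, hA0, hA⟩ := exists_bound_of_fst hφ hφs
    have i1 : Integrable (fun z => ‖grad f z‖) := hg.norm.integrable_of_hasCompactSupport
      (hasCompactSupport_of_fst (X := X') fun z hz => by simp [hgs z hz])
    refine (i1.mul_prod (integrable_const (A * √k) : Integrable (fun _ => A * √k) (cubeMeasure k))).mono'
      (Continuous.aestronglyMeasurable (by unfold Function.uncurry; fun_prop)) ?_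
    have hae := ae_cubeMeasure k
    have : ∀ᵐ q ∂((volume : Measure (Cyl k)).prod (cubeMeasure k)), ∀ i, |q.2.1 i| ≤ 1 :=
      Measure.quasiMeasurePreserving_snd.ae hae
    filter_upwards [this] with q hq
    simp only [Function.uncurry]
    rw [norm_mul]
    calc ‖φ (q.1 - toCyl (q.2.2 • transv q.2.1))‖ * ‖inner ℝ (transv q.2.1) (grad f q.1)‖
        ≤ A * (√k * ‖grad f q.1‖) := by
          gcongr
          · exact hA _
          · exact (norm_inner_le_norm _ _).trans (by gcongr; exact norm_transv_le hq)
      _ = _ := by ring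
  calc ∫ z, inner ℝ (divSolve φ z) (grad f z)
      = ∫ z : Cyl k, ∫ p : (Fin k → ℝ) × ℝ, φ (z - toCyl (p.2 • transv p.1)) * inner ℝ (transv p.1) (grad f z) ∂(cubeMeasure k) := by
        congr 1; funext z
        have := (innerSL ℝ (grad f z)).integral_comp_comm (integrable_divSolve hφ z)
        simp only [innerSL_apply_apply] at this
        rw [real_inner_comm, divSolve, ← this]
        congr 1; funext p
        rw [real_inner_smul_right, real_inner_comm]
    _ = ∫ p : (Fin k → ℝ) × ℝ, (∫ z : Cyl k, φ (z - toCyl (p.2 • transv p.1)) * inner ℝ (transv p.1) (grad f z)) ∂(cubeMeasure k) :=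
        integral_integral_swap hint
    -- Translation invariance moves the shift from the density to the test function.
    _ = ∫ p : (Fin k → ℝ) × ℝ, (∫ z : Cyl k, φ z * inner ℝ (transv p.1) (grad f (z + toCyl (p.2 • transv p.1)))) ∂(cubeMeasure k) := by
        congr 1; funext p
        rw [← integral_add_right_eq_self _ (toCyl (p.2 • transv p.1))]
        simp
    _ = ∫ z : Cyl k, ∫ p : (Fin k → ℝ) × ℝ, φ z * inner ℝ (transv p.1) (grad f (z + toCyl (p.2 • transv p.1))) ∂(cubeMeasure k) := by
        symm
        apply integral_integral_swap
        have i2 : Integrable (fun z => ‖φ z‖) := (integrable_of_fst hφ hφs).norm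
        refine (i2.mul_prod (integrable_const (√k * B) : Integrable (fun _ => √k * B) (cubeMeasure k))).mono'
          (Continuous.aestronglyMeasurable (by unfold Function.uncurry; fun_prop)) ?_
        have : ∀ᵐ q ∂((volume : Measure (Cyl k)).prod (cubeMeasure k)), ∀ i, |q.2.1 i| ≤ 1 :=
          Measure.quasiMeasurePreserving_snd.ae (ae_cubeMeasure k)
        filter_upwards [this] with q hq
        simp only [Function.uncurry]
        rw [norm_mul]
        gcongr
        refine (norm_inner_le_norm _ _).trans ?_
        gcongr
        · exact norm_transv_le hq
        · exact hB _
    _ = _ := by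
        congr 1; funext z
        rw [integral_const_mul, h.integral_cube]

lemma sq_lintegral_le {α : Type*} {mα : MeasurableSpace α} {μ : Measure α} [IsProbabilityMeasure μ]
    {g : α → ℝ≥0∞} (hg : AEMeasurable g μ) : (∫⁻ a, g a ∂μ) ^ 2 ≤ ∫⁻ a, g a ^ 2 ∂μ := by
  have := ENNReal.lintegral_mul_le_Lp_mul_Lq μ Real.HolderConjugate.two_two hg (aemeasurable_const (b := 1))
  simp only [Pi.mul_apply, mul_one, ENNReal.one_rpow, lintegral_const, measure_univ] at this
  calc (∫⁻ a, g a ∂μ) ^ 2 ≤ ((∫⁻ a, g a ^ (2 : ℝ) ∂μ) ^ (1 / 2 : ℝ)) ^ 2 := by gcongr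
    _ = ∫⁻ a, g a ^ 2 ∂μ := by
      rw [← ENNReal.rpow_natCast, ← ENNReal.rpow_mul]
      norm_num

/-- The energy bound for `divSolve`. -/
lemma lintegral_divSolve_le {φ : Cyl k → ℝ} (hφ : Continuous φ) :
    ∫⁻ z, ‖divSolve φ z‖ₑ ^ 2 ≤ k * ∫⁻ z, ‖φ z‖ₑ ^ 2 := by
  have hc := continuous_toCyl (k := k)
  have ht := continuous_transv (k := k)
  -- Cauchy-Schwarz on the cube together with `‖transv‖ ≤ √k`; integration over `z` then removes the
  -- shift.
  have h1 : ∀ z, ‖divSolve φ z‖ₑ ^ 2 ≤ k * ∫⁻ p, ‖φ (z - toCyl (p.2 • transv p.1))‖ₑ ^ 2 ∂(cubeMeasure k) := by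
    intro z
    have e1 : ‖divSolve φ z‖ₑ ≤ ENNReal.ofReal (√k) * ∫⁻ p, ‖φ (z - toCyl (p.2 • transv p.1))‖ₑ ∂(cubeMeasure k) := by
      rw [divSolve]
      refine (enorm_integral_le_lintegral_enorm _).trans ?_
      rw [← lintegral_const_mul' _ _ ENNReal.ofReal_ne_top]
      refine lintegral_mono_ae ?_
      filter_upwards [ae_cubeMeasure k] with p hp
      rw [enorm_smul, mul_comm]
      gcongr
      rw [← ofReal_norm]
      exact ENNReal.ofReal_le_ofReal (norm_transv_le hp)
    have hm : AEMeasurable (fun p : (Fin k → ℝ) × ℝ => ‖φ (z - toCyl (p.2 • transv p.1))‖ₑ) (cubeMeasure k) :=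
      (Continuous.measurable (by fun_prop)).aemeasurable
    calc ‖divSolve φ z‖ₑ ^ 2 ≤ (ENNReal.ofReal (√k)) ^ 2 * (∫⁻ p, ‖φ (z - toCyl (p.2 • transv p.1))‖ₑ ∂(cubeMeasure k)) ^ 2 := by
          rw [← mul_pow]; gcongr
      _ = k * (∫⁻ p, ‖φ (z - toCyl (p.2 • transv p.1))‖ₑ ∂(cubeMeasure k)) ^ 2 := by
          rw [← ENNReal.ofReal_pow (Real.sqrt_nonneg _), Real.sq_sqrt (by positivity), ENNReal.ofReal_natCast]
      _ ≤ _ := by gcongr; exact sq_lintegral_le hm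
  calc ∫⁻ z, ‖divSolve φ z‖ₑ ^ 2
      ≤ ∫⁻ z, k * ∫⁻ p, ‖φ (z - toCyl (p.2 • transv p.1))‖ₑ ^ 2 ∂(cubeMeasure k) := lintegral_mono h1
    _ = k * ∫⁻ z, ∫⁻ p, ‖φ (z - toCyl (p.2 • transv p.1))‖ₑ ^ 2 ∂(cubeMeasure k) :=
        lintegral_const_mul' _ _ (by simp)
    _ = k * ∫⁻ p, (∫⁻ z, ‖φ (z - toCyl (p.2 • transv p.1))‖ₑ ^ 2) ∂(cubeMeasure k) := by
        rw [lintegral_lintegral_swap]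
        exact (Continuous.measurable (by unfold Function.uncurry; fun_prop)).aemeasurable
    _ = k * ∫⁻ z, ‖φ z‖ₑ ^ 2 := by
        congr 1
        have : ∀ p : (Fin k → ℝ) × ℝ, ∫⁻ z, ‖φ (z - toCyl (p.2 • transv p.1))‖ₑ ^ 2 = ∫⁻ z, ‖φ z‖ₑ ^ 2 :=
          fun p => lintegral_sub_right_eq_self (fun z => ‖φ z‖ₑ ^ 2) _
        simp_rw [this]
        simp

end

/-! ### The compactly supported part of the field of a charge -/

/-- The charge of the shell per unit length. -/
def shellSec (k : ℕ) (η x : ℝ) : ℝ := ∫ y : UnitAddTorus (Fin k), shell η (x, y)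

/-- The charge of the shell to the left of `x`. -/
def shellCum (k : ℕ) (η x : ℝ) : ℝ := ∫ t in Iic x, shellSec k η t

section
variable {k : ℕ} {η : ℝ}

lemma continuous_slice {E : Type*} [NormedAddCommGroup E] [NormedSpace ℝ E] {f : Cyl k → E}
    (hf : Continuous f) : Continuous fun x : ℝ => ∫ y, f (x, y) := by
  have := continuous_parametric_integral_of_continuous (μ := (volume : Measure (UnitAddTorus (Fin k))))
    (f := fun x y => f (x, y)) (by fun_prop) (s := univ) isCompact_univ
  simpa using this

lemma integral_fst {ψ : ℝ → ℝ} (hψ : Integrable fun z : Cyl k => ψ z.1) : ∫ z : Cyl k, ψ z.1 = ∫ x, ψ x := by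
  rw [integral_eq_iterated hψ]
  simp

lemma integrable_fst {ψ : ℝ → ℝ} (hψ : Integrable ψ) : Integrable fun z : Cyl k => ψ z.1 := by
  have := hψ.mul_prod (integrable_const (1 : ℝ) : Integrable (fun _ => (1 : ℝ)) (volume : Measure (UnitAddTorus (Fin k))))
  simp only [mul_one] at this
  exact this

lemma integrable_of_supp {ψ : ℝ → ℝ} {X : ℝ} (hψ : Continuous ψ) (hs : ∀ x, X < |x| → ψ x = 0) : Integrable ψ :=
  hψ.integrable_of_hasCompactSupport (HasCompactSupport.intro (isCompact_Icc (a := -X) (b := X)) fun x hx =>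
    hs x (by by_contra h; exact hx (abs_le.1 (not_lt.1 h))))

lemma continuous_shellSec (hη0 : 0 < η) (hη : η < 1 / 4) : Continuous (shellSec k η) :=
  continuous_slice (continuous_shell hη0 hη)

lemma shellSec_of_gt (hη : η < 1 / 4) {x : ℝ} (hx : 3 / 8 < |x|) : shellSec k η x = 0 := by
  rw [shellSec]; simp [shell_of_fst hη (x, _) hx]

lemma integrable_shell (hη0 : 0 < η) (hη : η < 1 / 4) : Integrable (shell η : Cyl k → ℝ) :=
  integrable_of_fst (continuous_shell hη0 hη) (shell_of_fst hη)

lemma integrable_shellSec (hη0 : 0 < η) (hη : η < 1 / 4) : Integrable (shellSec k η) :=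
  integrable_of_supp (continuous_shellSec hη0 hη) fun _ => shellSec_of_gt hη

/-- Testing the identity of the shell field with the constant function leaves only the two total
charges. -/
lemma integral_shell (hη0 : 0 < η) (hη : η < 1 / 4) : ∫ z : Cyl k, shell η z = 1 := by
  have := integral_inner_shellField (k := k) hη0 hη (f := fun _ => 1) (g := fun _ => 0) continuous_const
    measurable_const ⟨0, by simp⟩ (fun u => ⟨∅, countable_empty, fun r _ => by
      simpa using hasDerivAt_const r (1 : ℝ)⟩)
  simp only [inner_zero_right, integral_zero, integral_const, probReal_univ, smul_eq_mul, mul_one, one_mul] at this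
  change 0 = 1 - ∫ z : Cyl k, shell η z at this
  linarith

lemma integral_shell_mul_fst (hη0 : 0 < η) (hη : η < 1 / 4) {w : ℝ → ℝ} (hw : Measurable w) {B : ℝ}
    (hB : ∀ x, |w x| ≤ B) : ∫ z : Cyl k, shell η z * w z.1 = ∫ x, shellSec k η x * w x := by
  rw [integral_eq_iterated]
  · simp_rw [integral_mul_const]; rfl
  · exact (integrable_shell hη0 hη).mul_bdd (c := B) (hw.comp measurable_fst).aestronglyMeasurable
      (Eventually.of_forall fun z => hB z.1)

lemma integral_shellSec (hη0 : 0 < η) (hη : η < 1 / 4) : ∫ x, shellSec k η x = 1 := by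
  have := integral_eq_iterated (integrable_shell (k := k) hη0 hη)
  rw [integral_shell hη0 hη] at this
  exact this.symm

lemma hasDerivAt_shellCum (hη0 : 0 < η) (hη : η < 1 / 4) (x : ℝ) :
    HasDerivAt (shellCum k η) (shellSec k η x) x := by
  have hi := integrable_shellSec (k := k) hη0 hη
  have hc := continuous_shellSec (k := k) hη0 hη
  have h1 : HasDerivAt (fun u => shellCum k η 0 + ∫ t in (0 : ℝ)..u, shellSec k η t) (shellSec k η x) x :=
    (intervalIntegral.integral_hasDerivAt_right (hc.intervalIntegrable _ _)
      (hc.stronglyMeasurableAtFilter _ _) hc.continuousAt).const_add _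
  refine h1.congr_of_eventuallyEq (Eventually.of_forall fun u => ?_)
  have := intervalIntegral.integral_Iic_sub_Iic (f := shellSec k η) (μ := volume) (a := 0) (b := u) hi.integrableOn
    hi.integrableOn
  simp only [shellCum]
  linarith

lemma continuous_shellCum (hη0 : 0 < η) (hη : η < 1 / 4) : Continuous (shellCum k η) :=
  continuous_iff_continuousAt.2 fun x => (hasDerivAt_shellCum hη0 hη x).continuousAt

lemma shellCum_of_lt (hη : η < 1 / 4) {x : ℝ} (hx : x < -(3 / 8)) : shellCum k η x = 0 := by
  rw [shellCum]
  refine setIntegral_eq_zero_of_forall_eq_zero fun t ht => shellSec_of_gt hη ?_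
  have : t ≤ x := ht
  rw [abs_of_neg (by linarith)]; linarith

lemma shellCum_add (hη0 : 0 < η) (hη : η < 1 / 4) (x : ℝ) :
    shellCum k η x + ∫ t in Ioi x, shellSec k η t = 1 := by
  have hi := integrable_shellSec (k := k) hη0 hη
  rw [shellCum, intervalIntegral.integral_Iic_add_Ioi hi.integrableOn hi.integrableOn, integral_shellSec hη0 hη]

lemma shellCum_of_gt (hη0 : 0 < η) (hη : η < 1 / 4) {x : ℝ} (hx : 3 / 8 < x) : shellCum k η x = 1 := by
  have := shellCum_add (k := k) hη0 hη x
  rw [setIntegral_eq_zero_of_forall_eq_zero, add_zero] at this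
  · exact this
  · intro t ht
    have : x < t := ht
    exact shellSec_of_gt hη (by rw [abs_of_pos] <;> linarith)

lemma exists_bound_shellSec (hη0 : 0 < η) (hη : η < 1 / 4) : ∃ B, 0 ≤ B ∧ ∀ x, |shellSec k η x| ≤ B := by
  obtain ⟨B, hB⟩ := (HasCompactSupport.intro (isCompact_Icc (a := -(3 / 8 : ℝ)) (b := 3 / 8)) fun x hx =>
    shellSec_of_gt (k := k) hη (by
      by_contra h; exact hx (abs_le.1 (not_lt.1 h)))).exists_bound_of_continuous (continuous_shellSec (k := k) hη0 hη)
  exact ⟨B, (norm_nonneg _).trans (hB 0), fun x => by simpa using hB x⟩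

lemma exists_bound_shellCum (hη0 : 0 < η) (hη : η < 1 / 4) : ∃ B, 0 ≤ B ∧ ∀ x, |shellCum k η x| ≤ B := by
  refine ⟨∫ t, |shellSec k η t|, integral_nonneg fun _ => abs_nonneg _, fun x => ?_⟩
  refine (abs_integral_le_integral_abs).trans ?_
  exact setIntegral_le_integral (integrable_shellSec hη0 hη).abs (Eventually.of_forall fun _ => abs_nonneg _)

/-- The flux of the field of the shell through a slice. -/
lemma integral_potGrad_slice (hη0 : 0 < η) (hη : η < 1 / 4) (x : ℝ) :
    ∫ y : UnitAddTorus (Fin k), potGrad η (x, y) 0 = 1 / 2 - shellCum k η x := by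
  have hgc := continuous_shellGrad (k := k) hη0 hη
  have hgs := shellGrad_of_fst (k := k) hη
  have hg0s : ∀ z : Cyl k, 3 / 8 < |z.1| → shellGrad η z 0 = 0 := fun z hz => by simp [hgs z hz]
  have hg0c : Continuous fun z : Cyl k => shellGrad η z 0 := by fun_prop
  obtain ⟨B, hB0, hB⟩ := exists_bound_of_fst hg0c hg0s
  set κ : ℝ → ℝ := fun u => ∫ y : UnitAddTorus (Fin k), shellGrad η (u, y) 0 with hκ
  have hm := measurable_greenM (k := k)
  have hint : Integrable (Function.uncurry fun (y : UnitAddTorus (Fin k)) (ζ : Cyl k) =>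
      greenM ζ * shellGrad η ((x, y) - ζ) 0) (volume.prod volume) := by
    have h1 := (integrable_const (1 : ℝ) : Integrable (fun _ => (1 : ℝ)) (volume : Measure (UnitAddTorus (Fin k)))).mul_prod
      ((integrable_indicator_greenM (k := k) (3 / 8 + |x|)).norm.mul_const B)
    refine h1.mono' (Measurable.aestronglyMeasurable (by unfold Function.uncurry; fun_prop))
      (Eventually.of_forall fun p => ?_)
    rw [one_mul]
    exact norm_greenM_smul_le hB hg0s (z := (x, p.1)) le_rfl p.2
  have hslice : ∀ t : ℝ, ∫ y : UnitAddTorus (Fin k), shellGrad η ((x, (0 : UnitAddTorus (Fin k))) - (t, y)) 0 = κ (x - t) := by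
    intro t
    have : ∀ y : UnitAddTorus (Fin k), shellGrad η ((x, (0 : UnitAddTorus (Fin k))) - (t, y)) 0
        = (fun y => shellGrad η (x - t, y) 0) (-y) := fun y => by simp
    simp_rw [this]
    exact integral_neg_eq_self (fun y : UnitAddTorus (Fin k) => shellGrad η (x - t, y) 0) volume
  have e1 : ∫ y : UnitAddTorus (Fin k), potGrad η (x, y) 0 = ∫ ζ : Cyl k, greenM ζ * κ (x - ζ.1) := by
    simp_rw [potGrad_apply hη0 hη]
    rw [integral_integral_swap hint]
    congr 1; funext ζ
    rw [integral_const_mul]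
    congr 1
    exact integral_sub_right_eq_self (μ := (volume : Measure (UnitAddTorus (Fin k))))
      (fun y => shellGrad η (x - ζ.1, y) 0) ζ.2
  have hκs : ∀ u, 3 / 8 < |u| → κ u = 0 := fun u hu => by
    simp only [hκ]; simp [hg0s (u, _) hu]
  have hκc : Continuous κ := continuous_slice hg0c
  -- The second factor depends on `x` only, so Green's function enters through its slice average
  -- `-|t|/2`.
  have e2 : ∫ ζ : Cyl k, greenM ζ * κ (x - ζ.1) = ∫ t, -|t| / 2 * κ (x - t) := by
    rw [integral_eq_iterated]
    · refine integral_congr_ae ?_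
      filter_upwards [Measure.ae_ne volume (0 : ℝ)] with t ht
      rw [integral_mul_const, (greenM_section ht).2]
    · have := integrable_greenM_smul (k := k) (G := fun z => κ z.1) (hκc.comp continuous_fst) (X := 3 / 8)
        (fun z hz => hκs _ hz) (x, 0)
      simpa using this
  have e3 : ∫ t, -|t| / 2 * κ (x - t)
      = ∫ ζ : Cyl k, -|ζ.1| / 2 * shellGrad η ((x, (0 : UnitAddTorus (Fin k))) - ζ) 0 := by
    rw [integral_eq_iterated]
    · congr 1; funext t
      simp only
      rw [integral_const_mul, hslice]
    · refine integrable_of_fst (X := 3 / 8 + |x|) (by fun_prop) fun z hz => ?_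
      rw [hg0s, mul_zero]
      rw [Prod.fst_sub]
      have := abs_sub_abs_le_abs_sub z.1 x
      rw [abs_sub_comm]; simp only; linarith
  obtain ⟨C, hC⟩ := lipGrad_shell (k := k) hη0 hη
  have hsh := hC.comp_const_sub (x, (0 : UnitAddTorus (Fin k)))
  -- The `x`-derivative moves from the shell to `-|x|/2`, whose derivative `-sign x / 2` weighs the
  -- charge left of the slice against the charge right of it.
  have e4 := hsh.integral_mul_deriv (j := 0) (G := fun z => -|z.1| / 2) (G' := fun z => -Real.sign z.1 / 2)
    (B := (3 / 8 + |x| + 1) / 2) (L := 1 / 2) (by fun_prop)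
    (fun z hz => by
      rw [abs_div, abs_neg, abs_abs, abs_two]; simp only at hz; linarith)
    (fun z τ _ _ => by
      have := abs_abs_sub_abs_le (z + toCyl (τ • bvec 0)).1 z.1
      have e : (z + toCyl (τ • (bvec 0 : Vec k))).1 - z.1 = τ := by simp
      rw [e] at this
      rw [← sub_div, abs_div, abs_two, ← abs_neg]
      rw [show -(-|(z + toCyl (τ • (bvec 0 : Vec k))).1| - -|(z.1)|) = |(z + toCyl (τ • (bvec 0 : Vec k))).1| - |z.1| by ring]
      linarith)
    (by
      filter_upwards [ae_fst_ne (k := k) 0] with z hz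
      have h1 : HasDerivAt (fun τ : ℝ => z.1 + τ) 1 0 := by simpa using (hasDerivAt_id (0 : ℝ)).const_add z.1
      have h2 : HasDerivAt (fun u : ℝ => |u|) (SignType.sign (z.1 + 0) : ℝ) (z.1 + 0) := hasDerivAt_abs (by simpa using hz)
      have h3 := ((h2.comp (0 : ℝ) h1).neg.div_const 2)
      have e : (fun τ : ℝ => -|(z + toCyl (τ • (bvec 0 : Vec k))).1| / 2) = fun τ => -|(z.1 + τ)| / 2 := by
        funext τ; simp
      rw [e]
      refine h3.congr_deriv ?_
      rcases lt_or_gt_of_ne hz with h | h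
      · simp [Real.sign_of_neg h, sign_neg h]
      · simp [Real.sign_of_pos h, sign_pos h])
  have i2 : Integrable fun z : Cyl k => shell η ((x, (0 : UnitAddTorus (Fin k))) - z) * (-Real.sign z.1 / 2) := by
    refine ((integrable_shell (k := k) hη0 hη).comp_sub_left (x, (0 : UnitAddTorus (Fin k)))).mul_bdd (c := 1)
      ((measurable_real_sign.comp measurable_fst).neg.div_const 2).aestronglyMeasurable
      (Eventually.of_forall fun z => ?_)
    rw [Real.norm_eq_abs, abs_div, abs_neg, abs_two]
    have := abs_sign_le z.1
    linarith
  have i1 : Integrable fun z : Cyl k => -shellGrad η ((x, (0 : UnitAddTorus (Fin k))) - z) 0 * (-|z.1| / 2) := by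
    refine (e4.1.sub i2).congr (Eventually.of_forall fun z => ?_)
    simp
  have e5 := e4.2
  simp only [PiLp.neg_apply] at e5
  rw [integral_add i1 i2] at e5
  have e6 : ∫ z : Cyl k, -shellGrad η ((x, (0 : UnitAddTorus (Fin k))) - z) 0 * (-|z.1| / 2)
      = -∫ ζ : Cyl k, -|ζ.1| / 2 * shellGrad η ((x, (0 : UnitAddTorus (Fin k))) - ζ) 0 := by
    rw [← integral_neg]; congr 1; funext z; ring
  have e7 : ∫ z : Cyl k, shell η ((x, (0 : UnitAddTorus (Fin k))) - z) * (-Real.sign z.1 / 2)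
      = ∫ t, shellSec k η t * (-Real.sign (x - t) / 2) := by
    rw [← integral_shell_mul_fst hη0 hη (w := fun t => -Real.sign (x - t) / 2) (B := 1)
      ((measurable_real_sign.comp (measurable_const.sub measurable_id)).neg.div_const 2) (fun t => by
        rw [abs_div, abs_neg, abs_two]
        have := abs_sign_le (x - t)
        linarith),
      ← integral_sub_left_eq_self (fun z : Cyl k => shell η z * (-Real.sign (x - z.1) / 2)) volume
        (x, (0 : UnitAddTorus (Fin k)))]
    simp
  have hi := integrable_shellSec (k := k) hη0 hη
  have i3 : Integrable fun t => shellSec k η t * (-Real.sign (x - t) / 2) := by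
    refine hi.mul_bdd (c := 1) ((measurable_real_sign.comp
      (measurable_const.sub measurable_id)).neg.div_const 2).aestronglyMeasurable (Eventually.of_forall fun t => ?_)
    rw [Real.norm_eq_abs, abs_div, abs_neg, abs_two]
    have := abs_sign_le (x - t)
    linarith
  have e8 : ∫ t, shellSec k η t * (-Real.sign (x - t) / 2)
      = (-1 / 2) * shellCum k η x + (1 / 2) * ∫ t in Ioi x, shellSec k η t := by
    rw [← intervalIntegral.integral_Iic_add_Ioi (b := x) i3.integrableOn i3.integrableOn, shellCum,
      ← integral_const_mul, ← integral_const_mul]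
    congr 1
    · rw [integral_Iic_eq_integral_Iio, integral_Iic_eq_integral_Iio]
      refine setIntegral_congr_fun measurableSet_Iio fun t ht => ?_
      rw [Real.sign_of_pos (sub_pos.2 ht)]; ring
    · refine setIntegral_congr_fun measurableSet_Ioi fun t ht => ?_
      rw [Real.sign_of_neg (sub_neg.2 ht)]; ring
  have := shellCum_add (k := k) hη0 hη x
  rw [e1, e2, e3]
  rw [e6, e7, e8] at e5
  linarith

/-- The field of a charge minus its long-range part: it is divergence-free off the charge, vanishes to
the left of the charge and equals `-e_x` to the right of it. -/
def chargeField (η : ℝ) (z : Cyl k) : Vec k :=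
  shellField η (rep z) - divSolve (shell η) z - shellCum k η z.1 • bvec 0

/-- The divergence-free and flux-free remainder of the field of a charge. -/
def remField (η : ℝ) (z : Cyl k) : Vec k :=
  potGrad η z + divSolve (shell η) z + (shellCum k η z.1 - 1 / 2) • bvec 0

lemma shellField_add_potGrad (z : Cyl k) :
    shellField η (rep z) + potGrad η z = chargeField η z + remField η z + (1 / 2 : ℝ) • bvec 0 := by
  rw [chargeField, remField, sub_smul]; abel

lemma chargeField_of_lt (hη : η < 1 / 4) {z : Cyl k} (hz : z.1 < -(3 / 8)) : chargeField η z = 0 := by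
  have habs : 3 / 8 < |z.1| := by rw [abs_of_neg (by linarith)]; linarith
  rw [chargeField, shellCum_of_lt hη hz, shellField_of_gt hη (habs.le.trans (abs_fst_le_cnorm z)),
    divSolve_eq_zero fun z' hz' => shell_of_fst hη z' (by rwa [hz'])]
  simp

lemma chargeField_of_gt (hη0 : 0 < η) (hη : η < 1 / 4) {z : Cyl k} (hz : 3 / 8 < z.1) :
    chargeField η z = -bvec 0 := by
  have habs : 3 / 8 < |z.1| := by rw [abs_of_pos (by linarith)]; linarith
  rw [chargeField, shellCum_of_gt hη0 hη hz, shellField_of_gt hη (habs.le.trans (abs_fst_le_cnorm z)),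
    divSolve_eq_zero fun z' hz' => shell_of_fst hη z' (by rwa [hz'])]
  simp

lemma continuous_divSolve_shell (hη0 : 0 < η) (hη : η < 1 / 4) :
    Continuous (divSolve (shell η) : Cyl k → Vec k) := continuous_divSolve_const (continuous_shell hη0 hη)

lemma divSolve_shell_of_fst (hη : η < 1 / 4) (z : Cyl k) (hz : 3 / 8 < |z.1|) : divSolve (shell η) z = 0 :=
  divSolve_eq_zero fun z' hz' => shell_of_fst hη z' (by rwa [hz'])

lemma measurable_chargeField (hη0 : 0 < η) (hη : η < 1 / 4) : Measurable (chargeField η : Cyl k → Vec k) := by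
  have h1 := (measurable_shellField (k := k) η).comp measurable_rep
  have h2 := (continuous_divSolve_shell (k := k) hη0 hη).measurable
  have h3 := (continuous_shellCum (k := k) hη0 hη).measurable.comp
    (measurable_fst : Measurable fun z : Cyl k => z.1)
  exact (h1.sub h2).sub (h3.smul_const _)

lemma exists_bound_chargeField (hη0 : 0 < η) (hη : η < 1 / 4) :
    ∃ B, 0 ≤ B ∧ ∀ z : Cyl k, ‖chargeField η z‖ ≤ B := by
  obtain ⟨B₁, h1, hB₁⟩ := exists_bound_of_fst (continuous_divSolve_shell (k := k) hη0 hη) (divSolve_shell_of_fst hη)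
  obtain ⟨B₂, h2, hB₂⟩ := exists_bound_shellCum (k := k) hη0 hη
  refine ⟨(sArea k * η ^ k)⁻¹ + B₁ + B₂, by have := sArea_pos k; positivity, fun z => ?_⟩
  rw [chargeField]
  refine (norm_sub_le _ _).trans (add_le_add ((norm_sub_le _ _).trans
    (add_le_add (norm_shellField_le hη0 _) (hB₁ z))) ?_)
  rw [norm_smul, norm_bvec, mul_one]
  exact hB₂ _

lemma continuous_remField (hη0 : 0 < η) (hη : η < 1 / 4) : Continuous (remField η : Cyl k → Vec k) := by
  have h1 := continuous_potGrad (k := k) hη0 hη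
  have h2 := continuous_divSolve_shell (k := k) hη0 hη
  have h3 := continuous_shellCum (k := k) hη0 hη
  unfold remField
  fun_prop

/-- The flux of `potGrad` is compensated by the longitudinal term, and `divSolve` has no
`x`-component. -/
lemma integral_remField_slice (hη0 : 0 < η) (hη : η < 1 / 4) (x : ℝ) :
    ∫ y : UnitAddTorus (Fin k), remField η (x, y) 0 = 0 := by
  have h1 := continuous_potGrad (k := k) hη0 hη
  have e : ∀ y : UnitAddTorus (Fin k), remField η (x, y) 0 = potGrad η (x, y) 0 + (shellCum k η x - 1 / 2) := by
    intro y
    simp [remField, divSolve_apply_zero (continuous_shell (k := k) hη0 hη)]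
  simp_rw [e]
  rw [integral_add (integrable_torus (by fun_prop)) (integrable_const _), integral_potGrad_slice hη0 hη]
  simp

/-- Integration by parts against the cumulative charge of the shell. -/
lemma integral_shellCum_mul_grad (hη0 : 0 < η) (hη : η < 1 / 4) {U : Set (Cyl k)} {f : Cyl k → ℝ}
    (h : IsTestFunction U f) :
    ∫ z : Cyl k, shellCum k η z.1 * grad f z 0 = -∫ z : Cyl k, shellSec k η z.1 * f z := by
  obtain ⟨C, X, hl, hlX⟩ := h.lipGrad
  have hg := h.continuous_grad
  have hfc := h.continuous
  have hs := continuous_shellSec (k := k) hη0 hη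
  have hC := continuous_shellCum (k := k) hη0 hη
  obtain ⟨B₁, h1, hB₁⟩ := exists_bound_shellSec (k := k) hη0 hη
  obtain ⟨B₂, h2, hB₂⟩ := exists_bound_shellCum (k := k) hη0 hη
  have := (hl.integral_mul_deriv (j := 0) (G := fun z => shellCum k η z.1) (G' := fun z => shellSec k η z.1)
    (B := B₂) (L := B₁) (by fun_prop) (fun z _ => hB₂ _) (fun z τ _ _ => by
      have := convex_univ.norm_image_sub_le_of_norm_hasDerivWithin_le (𝕜 := ℝ) (f := shellCum k η) (C := B₁)
        (x := z.1) (y := z.1 + τ) (fun x _ => (hasDerivAt_shellCum hη0 hη x).hasDerivWithinAt)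
        (fun x _ => hB₁ x) (mem_univ _) (mem_univ _)
      simpa using this)
    (Eventually.of_forall fun z => by
      have h1 : HasDerivAt (fun τ : ℝ => z.1 + τ) 1 0 := by simpa using (hasDerivAt_id (0 : ℝ)).const_add z.1
      have h2 : HasDerivAt (shellCum k η) (shellSec k η z.1) (z.1 + 0) := by
        simpa using hasDerivAt_shellCum (k := k) hη0 hη z.1
      have h3 := h2.comp (0 : ℝ) h1
      rw [mul_one] at h3
      refine h3.congr_of_eventuallyEq (Eventually.of_forall fun τ => ?_)
      simp)).2
  rw [integral_add] at this
  · have e1 : ∫ z : Cyl k, grad f z 0 * shellCum k η z.1 = ∫ z : Cyl k, shellCum k η z.1 * grad f z 0 := by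
      congr 1; funext z; ring
    have e2 : ∫ z : Cyl k, f z * shellSec k η z.1 = ∫ z : Cyl k, shellSec k η z.1 * f z := by
      congr 1; funext z; ring
    linarith
  · exact integrable_of_fst (X := X) (by fun_prop) fun z hz => by simp [hlX z hz]
  · exact integrable_of_fst (X := X) (by fun_prop) fun z hz => by simp [hl.supp z hz]

lemma integral_shell_mul_slice (hη0 : 0 < η) (hη : η < 1 / 4) {f : Cyl k → ℝ} (hf : Continuous f) {X : ℝ}
    (hfs : ∀ z, X < |z.1| → f z = 0) :
    ∫ z : Cyl k, shell η z * (∫ y, f (z.1, y)) = ∫ z : Cyl k, shellSec k η z.1 * f z := by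
  have hfc := continuous_slice hf
  have hs := continuous_shellSec (k := k) hη0 hη
  have hsh := continuous_shell (k := k) hη0 hη
  rw [integral_eq_iterated, integral_eq_iterated]
  · simp_rw [integral_mul_const, integral_const_mul]; rfl
  · exact integrable_of_fst (X := X) (by fun_prop) fun z hz => by simp [hfs z hz]
  · exact integrable_of_fst (X := 3 / 8) (hsh.mul (hfc.comp continuous_fst)) fun z hz => by simp [shell_of_fst hη z hz]

lemma integral_shell_mul_slice_sub (hη0 : 0 < η) (hη : η < 1 / 4) {f : Cyl k → ℝ} (hf : Continuous f) {X : ℝ}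
    (hfs : ∀ z, X < |z.1| → f z = 0) :
    ∫ z : Cyl k, shell η z * ((∫ y, f (z.1, y)) - f z)
      = (∫ z : Cyl k, shellSec k η z.1 * f z) - ∫ z : Cyl k, shell η z * f z := by
  have hfc := continuous_slice hf
  have hsh := continuous_shell (k := k) hη0 hη
  simp_rw [mul_sub]
  rw [integral_sub, integral_shell_mul_slice hη0 hη hf hfs]
  · exact integrable_of_fst (X := 3 / 8) (hsh.mul (hfc.comp continuous_fst)) fun z hz => by simp [shell_of_fst hη z hz]
  · exact integrable_of_fst (X := 3 / 8) (by fun_prop) fun z hz => by simp [shell_of_fst hη z hz]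

/-- `-∇ · chargeField` is the smeared charge. -/
lemma integral_inner_chargeField_zero (hη0 : 0 < η) (hη : η < 1 / 4) {U : Set (Cyl k)} {f : Cyl k → ℝ}
    (h : IsTestFunction U f) :
    ∫ z, inner ℝ (chargeField η z) (grad f z) = ∫ z, f z ∂(smear η 0) := by
  obtain ⟨X, hX0, hfX, hgX⟩ := h.exists_support
  have hg := h.continuous_grad
  have hfc := h.continuous
  have hsh := continuous_shell (k := k) hη0 hη
  have hC := continuous_shellCum (k := k) hη0 hη
  have hD := continuous_divSolve_shell (k := k) hη0 hη
  obtain ⟨B, hB0, hB⟩ := exists_bound_of_fst hg hgX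
  have e1 := integral_inner_shellField hη0 hη hfc hg.measurable ⟨B, fun v _ => hB _⟩
    (fun u => ⟨∅, countable_empty, fun r _ => by
      simpa using h.hasDerivAt_line 0 (u : Vec k) r⟩)
  have e2 := integral_inner_divSolve hsh (shell_of_fst hη) h
  rw [integral_shell_mul_slice_sub hη0 hη hfc hfX] at e2
  have e3 := integral_shellCum_mul_grad hη0 hη h
  have e4 : ∀ z, inner ℝ (chargeField η z) (grad f z) = inner ℝ (shellField η (rep z)) (grad f z)
      - inner ℝ (divSolve (shell η) z) (grad f z) - shellCum k η z.1 * grad f z 0 := by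
    intro z
    rw [chargeField, inner_sub_left, inner_sub_left, real_inner_smul_left]
    simp [bvec, EuclideanSpace.inner_single_left]
  simp_rw [e4]
  have i2 : Integrable fun z => inner ℝ (divSolve (shell η) z) (grad f z) :=
    integrable_of_fst (X := X) (by fun_prop) fun z hz => by simp [hgX z hz]
  have i3 : Integrable fun z : Cyl k => shellCum k η z.1 * grad f z 0 :=
    integrable_of_fst (X := X) (by fun_prop) fun z hz => by simp [hgX z hz]
  have i1 : Integrable fun z => inner ℝ (shellField η (rep z)) (grad f z) := by
    have hgi : Integrable (fun z => ‖grad f z‖) := hg.norm.integrable_of_hasCompactSupport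
      (hasCompactSupport_of_fst (X := X) fun z hz => by simp [hgX z hz])
    refine (hgi.const_mul (sArea k * η ^ k)⁻¹).mono'
      (((measurable_shellField η).comp measurable_rep).inner hg.measurable).aestronglyMeasurable
      (Eventually.of_forall fun z => ?_)
    refine (norm_inner_le_norm _ _).trans ?_
    gcongr
    exact norm_shellField_le hη0 _
  have s1 := integral_sub (i1.sub i2) i3
  simp only [Pi.sub_apply] at s1
  rw [s1, integral_sub i1 i2, e1, e2, e3]
  have e5 : ∫ z, f z * shellDensity η (rep z) = ∫ z : Cyl k, shell η z * f z := by
    congr 1; funext z; rw [mul_comm]; rfl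
  rw [e5]; ring

/-- The remainder of the field of a charge is divergence-free. -/
lemma integral_inner_remField_zero (hη0 : 0 < η) (hη : η < 1 / 4) {U : Set (Cyl k)} {f : Cyl k → ℝ}
    (h : IsTestFunction U f) :
    ∫ z, inner ℝ (remField η z) (grad f z) = 0 := by
  obtain ⟨C, X, hl, hgX⟩ := h.lipGrad
  have hfX := hl.supp
  have hg := h.continuous_grad
  have hfc := h.continuous
  have hsh := continuous_shell (k := k) hη0 hη
  have hC := continuous_shellCum (k := k) hη0 hη
  have hD := continuous_divSolve_shell (k := k) hη0 hη
  have hP := continuous_potGrad (k := k) hη0 hη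
  have e1 := integral_inner_potGrad hη0 hη h
  have e2 := integral_inner_divSolve hsh (shell_of_fst hη) h
  rw [integral_shell_mul_slice_sub hη0 hη hfc hfX] at e2
  have e3 := integral_shellCum_mul_grad hη0 hη h
  have e4 : ∀ z, inner ℝ (remField η z) (grad f z) = inner ℝ (potGrad η z) (grad f z)
      + inner ℝ (divSolve (shell η) z) (grad f z) + shellCum k η z.1 * grad f z 0 - 1 / 2 * grad f z 0 := by
    intro z
    rw [remField, inner_add_left, inner_add_left, real_inner_smul_left]
    simp [bvec, EuclideanSpace.inner_single_left]
    ring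
  have e5 : ∫ z, grad f z 0 = 0 := by
    have := (integral_deriv_eq_zero (F' := fun z => grad f z 0) (norm_bvec 0).le hfc
      (fun z τ _ => hl.lip_dir (norm_bvec 0).le z τ) hfX (by filter_upwards [hl.der] with z hz using hz 0)).2
    exact this
  have i0 : Integrable fun z : Cyl k => grad f z 0 :=
    integrable_of_fst (X := X) (by fun_prop) fun z hz => by simp [hgX z hz]
  have i1 : Integrable fun z => inner ℝ (potGrad η z) (grad f z) :=
    integrable_of_fst (X := X) (by fun_prop) fun z hz => by simp [hgX z hz]
  have i2 : Integrable fun z => inner ℝ (divSolve (shell η) z) (grad f z) :=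
    integrable_of_fst (X := X) (by fun_prop) fun z hz => by simp [hgX z hz]
  have i3 : Integrable fun z : Cyl k => shellCum k η z.1 * grad f z 0 :=
    integrable_of_fst (X := X) (by fun_prop) fun z hz => by simp [hgX z hz]
  simp_rw [e4]
  have s1 := integral_sub ((i1.add i2).add i3) (i0.const_mul (1 / 2))
  have s2 := integral_add (i1.add i2) i3
  simp only [Pi.add_apply] at s1 s2
  rw [s1, s2, integral_add i1 i2, integral_const_mul, e1, e2, e3, e5]
  ring

/-- The flux of the field of a charge through a weighted family of slices. -/
lemma integral_chargeField_flux_zero (hη0 : 0 < η) (hη : η < 1 / 4) {ψ Ψ : ℝ → ℝ} {X : ℝ} (hψ : Continuous ψ)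
    (hψs : ∀ x, X < |x| → ψ x = 0) (hΨ : ∀ x, HasDerivAt Ψ (-ψ x) x) (hΨs : ∀ x, X < x → Ψ x = 0) :
    ∫ z : Cyl k, chargeField η z 0 * ψ z.1 = -∫ z, Ψ z.1 ∂(smear η (0 : Cyl k)) := by
  have hΨc : Continuous Ψ := continuous_iff_continuousAt.2 fun x => (hΨ x).continuousAt
  have hsh := continuous_shell (k := k) hη0 hη
  have hC := continuous_shellCum (k := k) hη0 hη
  have hS := continuous_shellSec (k := k) hη0 hη
  have hψi := integrable_of_supp hψ hψs
  obtain ⟨B, hB⟩ : ∃ B, ∀ x, |ψ x| ≤ B := by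
    obtain ⟨B, -, hB⟩ := exists_bound_of_fst (k := 0) (f := fun z => ψ z.1) (by fun_prop) fun z hz => hψs _ hz
    exact ⟨B, fun x => hB (x, 0)⟩
  have e1 := integral_inner_shellField (k := k) hη0 hη (f := fun z => -Ψ z.1) (g := fun z => ψ z.1 • bvec 0)
    (by fun_prop) (by fun_prop) ⟨B, fun v _ => by
      rw [norm_smul, norm_bvec, mul_one]; exact hB _⟩
    (fun u => ⟨∅, countable_empty, fun r _ => by
      have h1 : HasDerivAt (fun r : ℝ => r * (u : Vec k) 0) ((u : Vec k) 0) r := by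
        simpa using (hasDerivAt_id r).mul_const ((u : Vec k) 0)
      have h2 := ((hΨ (r * (u : Vec k) 0)).comp r h1).neg
      have e : (fun r : ℝ => -Ψ (toCyl (r • (u : Vec k))).1) = fun r => -Ψ (r * (u : Vec k) 0) := by
        funext r; simp
      rw [e]
      refine h2.congr_deriv ?_
      simp [bvec, EuclideanSpace.inner_single_right, real_inner_smul_right]⟩)
  have e2 : ∫ z : Cyl k, shell η z * Ψ z.1 = ∫ x, shellSec k η x * Ψ x := by
    rw [integral_eq_iterated]
    · simp_rw [integral_mul_const]; rfl
    · exact integrable_of_fst (X := 3 / 8) (by fun_prop) fun z hz => by simp [shell_of_fst hη z hz]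
  have i4 : Integrable fun x => shellCum k η x * ψ x := integrable_of_supp (by fun_prop) fun x hx => by
    rw [hψs x hx, mul_zero]
  have i5 : Integrable fun x => shellSec k η x * Ψ x :=
    integrable_of_supp (X := 3 / 8) (by fun_prop) fun x hx => by
      rw [shellSec_of_gt hη hx, zero_mul]
  -- Integration by parts for `shellCum * Ψ` on the line: there are no boundary terms, as `shellCum`
  -- vanishes far to the left and `Ψ` far to the right.
  have e3 : ∫ x, (shellSec k η x * Ψ x + shellCum k η x * (-ψ x)) = 0 - 0 := by
    refine integral_of_hasDerivAt_of_tendsto (f := fun x => shellCum k η x * Ψ x)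
      (fun x => (hasDerivAt_shellCum hη0 hη x).mul (hΨ x)) ?_ ?_ ?_
    · exact i5.add (by simpa using i4.neg)
    · refine tendsto_const_nhds.congr' ?_
      filter_upwards [eventually_lt_atBot (-(3 / 8 : ℝ))] with x hx
      rw [shellCum_of_lt hη hx, zero_mul]
    · refine tendsto_const_nhds.congr' ?_
      filter_upwards [eventually_gt_atTop X] with x hx
      rw [hΨs x hx, mul_zero]
  rw [integral_add i5 (by simpa using i4.neg)] at e3
  simp_rw [mul_neg] at e3
  rw [integral_neg] at e3
  have e4 : ∀ z : Cyl k, chargeField η z 0 * ψ z.1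
      = inner ℝ (shellField η (rep z)) (ψ z.1 • (bvec 0 : Vec k)) - shellCum k η z.1 * ψ z.1 := by
    intro z
    simp [chargeField, divSolve_apply_zero hsh, real_inner_smul_right, bvec, EuclideanSpace.inner_single_right]
    ring
  simp_rw [e4]
  have i1 : Integrable fun z : Cyl k => inner ℝ (shellField η (rep z)) (ψ z.1 • (bvec 0 : Vec k)) := by
    refine ((integrable_fst (k := k) hψi).norm.const_mul (sArea k * η ^ k)⁻¹).mono'
      (((measurable_shellField η).comp measurable_rep).inner (by fun_prop)).aestronglyMeasurable
      (Eventually.of_forall fun z => ?_)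
    refine (norm_inner_le_norm _ _).trans ?_
    rw [norm_smul, norm_bvec, mul_one]
    gcongr
    exact norm_shellField_le hη0 _
  rw [integral_sub i1 (integrable_fst i4), e1, integral_fst (ψ := fun x => shellCum k η x * ψ x) (integrable_fst i4)]
  have e5 : ∫ z : Cyl k, -Ψ z.1 * shellDensity η (rep z) = -∫ z : Cyl k, shell η z * Ψ z.1 := by
    rw [← integral_neg]; congr 1; funext z; simp only [shell]; ring
  rw [e5, e2, integral_neg]
  linarith

end

section
variable {k : ℕ} {η β : ℝ}

/-! ### The electric field of a neutral configuration -/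


lemma integral_abs_sub {a b x : ℝ} (hx : x ∈ Icc a b) :
    ∫ t in a..b, -|x - t| / 2 = -((x - a) ^ 2 + (b - x) ^ 2) / 4 := by
  have hc : Continuous fun t : ℝ => -|x - t| / 2 := by fun_prop
  rw [← intervalIntegral.integral_add_adjacent_intervals (b := x) (hc.intervalIntegrable _ _)
    (hc.intervalIntegrable _ _)]
  have h1 : ∫ t in a..x, -|x - t| / 2 = ∫ t in a..x, (t - x) / 2 := by
    refine intervalIntegral.integral_congr fun t ht => ?_
    rw [uIcc_of_le hx.1] at ht
    rw [abs_of_nonneg (by linarith [ht.2])]; ring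
  have h2 : ∫ t in x..b, -|x - t| / 2 = ∫ t in x..b, (x - t) / 2 := by
    refine intervalIntegral.integral_congr fun t ht => ?_
    rw [uIcc_of_le hx.2] at ht
    rw [abs_of_nonpos (by linarith [ht.1])]; ring
  rw [h1, h2]
  simp only [intervalIntegral.integral_div]
  rw [intervalIntegral.integral_comp_sub_right (fun t => t), intervalIntegral.integral_comp_sub_left (fun t => t)]
  simp
  ring

/-- The potential of the background charge. -/
lemma setIntegral_green_slab {a b : ℝ} (hab : a ≤ b) (z : Cyl k) :
    ∫ z' in slab k a b, green (z - z') = ∫ t in a..b, -|z.1 - t| / 2 := by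
  have e0 : ∫ z' in slab k a b, green (z - z') = ∫ z' in slab k a b, greenM (z - z') := by
    refine integral_congr_ae (ae_restrict_of_ae ?_)
    filter_upwards [ae_fst_ne (k := k) z.1] with z' hz'
    refine (greenM_of_ne ?_).symm
    rw [Prod.fst_sub, sub_ne_zero]; exact hz'.symm
  have hs : slab k a b = Icc a b ×ˢ univ := by ext z; simp [slab]
  have hi : IntegrableOn (fun z' : Cyl k => greenM (z - z')) (slab k a b) := by
    set X := |z.1| + |a| + |b| with hX
    have h1 := (integrable_indicator_greenM (k := k) X).comp_sub_left z
    refine (h1.integrableOn (s := slab k a b)).congr_fun (fun z' hz' => ?_) (measurableSet_slab _ _)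
    simp only
    rw [indicator_of_mem]
    refine abs_le.1 (?_ : |(z - z').1| ≤ X)
    rw [Prod.fst_sub]
    refine (abs_sub _ _).trans ?_
    have h2 : |z'.1| ≤ |a| + |b| := by
      have h3 : a ≤ z'.1 := hz'.1
      have h4 : z'.1 ≤ b := hz'.2
      rw [abs_le]
      constructor
      · linarith [neg_abs_le a, abs_nonneg b]
      · linarith [le_abs_self b, abs_nonneg a]
    linarith
  rw [e0, hs, Measure.volume_eq_prod, setIntegral_prod _ (by rwa [hs] at hi),
    intervalIntegral.integral_of_le hab, integral_Icc_eq_integral_Ioc]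
  refine integral_congr_ae (ae_restrict_of_ae ?_)
  filter_upwards [Measure.ae_ne volume z.1] with t ht
  simp only [Measure.restrict_univ]
  rw [← (greenM_section (k := k) (sub_ne_zero.2 ht.symm)).2]
  exact integral_sub_left_eq_self (μ := (volume : Measure (UnitAddTorus (Fin k)))) (fun y => greenM (z.1 - t, y)) z.2

/-- The sum of the short-range fields of the charges at time `t`. -/
def chargeSum (η : ℝ) (W : Finset (Bridge k β)) (t : ℝ) (z : Cyl k) : Vec k :=
  ∑ b ∈ W, chargeField η (z - b (t : AddCircle β))

/-- The sum of the remainders of the fields of the charges at time `t`. -/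
def remSum (η : ℝ) (W : Finset (Bridge k β)) (t : ℝ) (z : Cyl k) : Vec k :=
  ∑ b ∈ W, remField η (z - b (t : AddCircle β))

lemma ae_cnorm_sub_ne (η : ℝ) (W : Finset (Bridge k β)) (t : ℝ) :
    ∀ᵐ z : Cyl k, ∀ b ∈ W, cnorm (z - b (t : AddCircle β)) ≠ η := by
  rw [Finset.eventually_all]
  intro b _
  exact (measurePreserving_sub_right volume (b (t : AddCircle β))).quasiMeasurePreserving.ae (ae_cnorm_ne η)

/-- Each charge contributes a constant `e_x / 2` and the background contributes `(x - (L₁ + L₂)/2)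
e_x`. By neutrality the `L₂ - L₁` halves shift the zero of the latter to `L₁`. The charged spheres
are excluded because the gradient jumps there. -/
lemma elField_eq (hη0 : 0 < η) (hη : η < 1 / 4) {L₁ L₂ : ℝ} {W : Finset (Bridge k β)}
    (hW : ∀ b ∈ W, b 0 ∈ slab k L₁ L₂) (hcard : (W.card : ℝ) = L₂ - L₁) (t : ℝ) {z : Cyl k}
    (hz : z.1 ∈ Ioo L₁ L₂) (hzW : ∀ b ∈ W, cnorm (z - b (t : AddCircle β)) ≠ η) :
    elField η (W : Set (Bridge k β)) (slab k L₁ L₂) t z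
      = (z.1 - L₁) • bvec 0 + chargeSum η W t z + remSum η W t z := by
  have hL : L₁ ≤ L₂ := (hz.1.trans hz.2).le
  have hproj : proj (W : Set (Bridge k β)) (slab k L₁ L₂) = W := by
    ext b; simp only [proj, Set.mem_ofPred_eq, Finset.mem_coe, and_iff_left_iff_imp]; exact hW b
  have hpot : ∀ v : Vec k, potential η (W : Set (Bridge k β)) (slab k L₁ L₂) t (z + toCyl v)
      = (∑ b ∈ W, ∫ z', green (z + toCyl v - z') ∂(smear η (b (t : AddCircle β))))
        - ∫ t in L₁..L₂, -|(z + toCyl v).1 - t| / 2 := fun v => by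
    rw [potential, hproj, finsum_mem_coe_finset, setIntegral_green_slab hL]
  have hbg : HasFDerivAt (fun v : Vec k => ∫ t in L₁..L₂, -|(z + toCyl v).1 - t| / 2)
      (innerSL ℝ ((-(z.1 - (L₁ + L₂) / 2)) • bvec 0 : Vec k)) 0 := by
    have h1 : HasFDerivAt (fun v : Vec k => v 0) (EuclideanSpace.proj (𝕜 := ℝ) 0 : Vec k →L[ℝ] ℝ) 0 :=
      (EuclideanSpace.proj (𝕜 := ℝ) 0 : Vec k →L[ℝ] ℝ).hasFDerivAt
    have h2 : HasDerivAt (fun u : ℝ => -((z.1 + u - L₁) ^ 2 + (L₂ - (z.1 + u)) ^ 2) / 4)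
        (-(z.1 - (L₁ + L₂) / 2)) ((0 : Vec k) 0) := by
      have a1 : HasDerivAt (fun u : ℝ => z.1 + u - L₁) 1 ((0 : Vec k) 0) := by
        simpa using ((hasDerivAt_id ((0 : Vec k) 0)).const_add z.1).sub_const L₁
      have a2 : HasDerivAt (fun u : ℝ => L₂ - (z.1 + u)) (-1) ((0 : Vec k) 0) := by
        simpa using ((hasDerivAt_id ((0 : Vec k) 0)).const_add z.1).const_sub L₂
      refine (((a1.pow 2).add (a2.pow 2)).neg.div_const 4).congr_deriv ?_
      simp; ring
    have h3 := h2.comp_hasFDerivAt (0 : Vec k) h1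
    have h4 : innerSL ℝ ((-(z.1 - (L₁ + L₂) / 2)) • bvec 0 : Vec k)
        = (-(z.1 - (L₁ + L₂) / 2)) • (EuclideanSpace.proj (𝕜 := ℝ) 0 : Vec k →L[ℝ] ℝ) := by
      ext w; simp [bvec, EuclideanSpace.inner_single_left]
    rw [h4]
    refine h3.congr_of_eventuallyEq ?_
    have hc : ContinuousAt (fun v : Vec k => (z + toCyl v).1) 0 := by
      have : Continuous fun v : Vec k => (z + toCyl v).1 :=
        continuous_fst.comp (continuous_const.add continuous_toCyl)
      exact this.continuousAt
    filter_upwards [hc.eventually (isOpen_Ioo.mem_nhds (by simpa using hz : (z + toCyl 0).1 ∈ Ioo L₁ L₂))] with v hv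
    rw [integral_abs_sub (Ioo_subset_Icc_self hv)]
    simp
  have hsum : HasFDerivAt (fun v : Vec k => ∑ b ∈ W, ∫ z', green (z + toCyl v - z') ∂(smear η (b (t : AddCircle β))))
      (∑ b ∈ W, innerSL ℝ (shellField η (rep (z - b (t : AddCircle β))) + potGrad η (z - b (t : AddCircle β)))) 0 :=
    HasFDerivAt.fun_sum fun b hb => hasFDerivAt_integral_green_smear hη0 hη _ z (hzW b hb)
  have htot := hsum.sub hbg
  rw [← map_sum, ← map_sub] at htot
  rw [elField, grad]
  have hg : HasGradientAt (fun v : Vec k => potential η (W : Set (Bridge k β)) (slab k L₁ L₂) t (z + toCyl v))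
      (∑ b ∈ W, (shellField η (rep (z - b (t : AddCircle β))) + potGrad η (z - b (t : AddCircle β)))
        - (-(z.1 - (L₁ + L₂) / 2)) • bvec 0) 0 := by
    rw [hasGradientAt_iff_hasFDerivAt]
    refine (htot.congr_of_eventuallyEq (Eventually.of_forall hpot)).congr_fderiv ?_
    ext w; simp
  rw [hg.gradient]
  simp_rw [shellField_add_potGrad, Finset.sum_add_distrib, Finset.sum_const, ← Nat.cast_smul_eq_nsmul ℝ]
  rw [smul_smul, hcard, chargeSum, remSum]
  rw [show (z.1 - L₁) = (L₂ - L₁) * (1 / 2) + (z.1 - (L₁ + L₂) / 2) by ring, add_smul, neg_smul]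
  abel

/-! ### Translates of the elementary fields -/

lemma IsTestFunction.translate {U : Set (Cyl k)} {f : Cyl k → ℝ} (h : IsTestFunction U f) (p : Cyl k) :
    IsTestFunction univ fun z => f (z + p) := by
  obtain ⟨X, hX0, hfX, -⟩ := h.exists_support
  refine ⟨?_, hasCompactSupport_of_fst (X := X + |p.1|) fun z hz => hfX _ ?_, subset_univ _⟩
  · have : (fun v : Vec k => f (toCyl v + p)) = (fun v : Vec k => f (toCyl v)) ∘ fun v => v + rep p := by
      funext v; simp [toCyl_add]
    rw [this]
    exact h.smooth.comp (by fun_prop)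
  · have := abs_sub_abs_le_abs_sub z.1 (-p.1)
    rw [abs_neg, sub_neg_eq_add] at this
    rw [Prod.fst_add]; linarith

lemma grad_translate (f : Cyl k → ℝ) (p z : Cyl k) : grad (fun z => f (z + p)) z = grad f (z + p) := by
  unfold grad
  congr 1; funext v
  rw [add_right_comm]

lemma integral_inner_chargeField (hη0 : 0 < η) (hη : η < 1 / 4) {U : Set (Cyl k)} {f : Cyl k → ℝ}
    (h : IsTestFunction U f) (p : Cyl k) :
    ∫ z, inner ℝ (chargeField η (z - p)) (grad f z) = ∫ z, f z ∂(smear η p) := by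
  have := integral_inner_chargeField_zero hη0 hη (h.translate p)
  simp_rw [grad_translate] at this
  rw [integral_smear_shift]
  simp_rw [add_comm p]
  rw [← this, ← integral_sub_right_eq_self (fun z => inner ℝ (chargeField η z) (grad f (z + p))) p]
  simp only [sub_add_cancel]

lemma integral_inner_remField (hη0 : 0 < η) (hη : η < 1 / 4) {U : Set (Cyl k)} {f : Cyl k → ℝ}
    (h : IsTestFunction U f) (p : Cyl k) :
    ∫ z, inner ℝ (remField η (z - p)) (grad f z) = 0 := by
  have := integral_inner_remField_zero hη0 hη (h.translate p)
  simp_rw [grad_translate] at this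
  rw [← this, ← integral_sub_right_eq_self (fun z => inner ℝ (remField η z) (grad f (z + p))) p]
  simp only [sub_add_cancel]

lemma integral_remField_slice_sub (hη0 : 0 < η) (hη : η < 1 / 4) (x : ℝ) (p : Cyl k) :
    ∫ y : UnitAddTorus (Fin k), remField η ((x, y) - p) 0 = 0 := by
  rw [← integral_remField_slice (k := k) hη0 hη (x - p.1)]
  exact integral_sub_right_eq_self (μ := (volume : Measure (UnitAddTorus (Fin k))))
    (fun y => remField η (x - p.1, y) 0) p.2

lemma integral_chargeField_flux (hη0 : 0 < η) (hη : η < 1 / 4) {ψ Ψ : ℝ → ℝ} {X : ℝ} (hψ : Continuous ψ)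
    (hψs : ∀ x, X < |x| → ψ x = 0) (hΨ : ∀ x, HasDerivAt Ψ (-ψ x) x) (hΨs : ∀ x, X < x → Ψ x = 0) (p : Cyl k) :
    ∫ z : Cyl k, chargeField η (z - p) 0 * ψ z.1 = -∫ z, Ψ (z.1 + p.1) ∂(smear η (0 : Cyl k)) := by
  have := integral_chargeField_flux_zero (k := k) hη0 hη (ψ := fun x => ψ (x + p.1)) (Ψ := fun x => Ψ (x + p.1))
    (X := X + |p.1|) (by fun_prop) (fun x hx => hψs _ (by
      have := abs_sub_abs_le_abs_sub x (-p.1)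
      rw [abs_neg, sub_neg_eq_add] at this; linarith))
    (fun x => by simpa using (hΨ (x + p.1)).comp_add_const x p.1)
    (fun x hx => hΨs _ (by linarith [neg_abs_le p.1]))
  rw [← this, ← integral_sub_right_eq_self (fun z : Cyl k => chargeField η z 0 * ψ (z.1 + p.1)) p]
  simp

lemma IsTestFunction.integral_fst_mul_grad {U : Set (Cyl k)} {f : Cyl k → ℝ} (h : IsTestFunction U f) :
    ∫ z : Cyl k, z.1 * grad f z 0 = -∫ z, f z := by
  obtain ⟨C, X, hl, hlX⟩ := h.lipGrad
  have hg := h.continuous_grad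
  have hfc := h.continuous
  have := (hl.integral_mul_deriv (j := 0) (G := fun z => z.1) (G' := fun _ => 1) (B := X + 1) (L := 1)
    (by fun_prop) (fun z hz => hz) (fun z τ _ _ => by simp)
    (Eventually.of_forall fun z => by
      have h1 : HasDerivAt (fun τ : ℝ => z.1 + τ) 1 0 := by simpa using (hasDerivAt_id (0 : ℝ)).const_add z.1
      refine h1.congr_of_eventuallyEq (Eventually.of_forall fun τ => ?_)
      simp)).2
  rw [integral_add] at this
  · have e1 : ∫ z : Cyl k, grad f z 0 * z.1 = ∫ z : Cyl k, z.1 * grad f z 0 := by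
      congr 1; funext z; ring
    simp only [mul_one] at this
    linarith
  · exact integrable_of_fst (X := X) (by fun_prop) fun z hz => by simp [hlX z hz]
  · exact integrable_of_fst (X := X) (by fun_prop) fun z hz => by simp [hl.supp z hz]

/-! ### Compatible fields -/


lemma continuous_bridge (b : Bridge k β) : Continuous fun t : ℝ => b (t : AddCircle β) :=
  b.continuous.comp (AddCircle.continuous_mk' β)

lemma continuous_sub_bridge (b : Bridge k β) : Continuous fun q : ℝ × Cyl k => q.2 - b (q.1 : AddCircle β) :=
  continuous_snd.sub ((continuous_bridge b).comp continuous_fst)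

lemma measurable_chargeSum (hη0 : 0 < η) (hη : η < 1 / 4) (W : Finset (Bridge k β)) :
    Measurable (Function.uncurry (chargeSum η W)) :=
  Finset.measurable_fun_sum W fun b _ =>
    (measurable_chargeField hη0 hη).comp (continuous_sub_bridge b).measurable

lemma continuous_remSum (hη0 : 0 < η) (hη : η < 1 / 4) (W : Finset (Bridge k β)) :
    Continuous (Function.uncurry (remSum η W)) :=
  continuous_finsetSum W fun b _ => (continuous_remField hη0 hη).comp (continuous_sub_bridge b)

lemma norm_chargeSum_le {B : ℝ} (hB : ∀ z : Cyl k, ‖chargeField η z‖ ≤ B) (W : Finset (Bridge k β)) (t : ℝ)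
    (z : Cyl k) : ‖chargeSum η W t z‖ ≤ W.card * B := by
  refine (norm_sum_le _ _).trans ((Finset.sum_le_card_nsmul _ _ B fun b _ => hB _).trans ?_)
  rw [nsmul_eq_mul]

/-- The field of the charges of `W` screened to the left, together with the background. -/
def bgField (η : ℝ) (W : Finset (Bridge k β)) (t : ℝ) (z : Cyl k) : Vec k :=
  z.1 • bvec 0 + chargeSum η W t z

lemma measurable_bgField (hη0 : 0 < η) (hη : η < 1 / 4) (W : Finset (Bridge k β)) :
    Measurable (Function.uncurry (bgField η W)) := by
  have h1 : Measurable fun q : ℝ × Cyl k => q.2.1 • (bvec 0 : Vec k) :=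
    (measurable_fst.comp measurable_snd).smul_const _
  exact h1.add (measurable_chargeSum hη0 hη W)

lemma measurable_bgField_time (hη0 : 0 < η) (hη : η < 1 / 4) (W : Finset (Bridge k β)) (t : ℝ) :
    Measurable (bgField η W t) := (measurable_bgField hη0 hη W).comp measurable_prodMk_left

lemma norm_bgField_le {B : ℝ} (hB : ∀ z : Cyl k, ‖chargeField η z‖ ≤ B) (W : Finset (Bridge k β)) (t : ℝ)
    (z : Cyl k) : ‖bgField η W t z‖ ≤ |z.1| + W.card * B := by
  refine (norm_add_le _ _).trans (add_le_add ?_ (norm_chargeSum_le hB W t z))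
  rw [norm_smul, norm_bvec, mul_one, Real.norm_eq_abs]

lemma abs_le_of_mem_slab {R : ℝ} {z : Cyl k} (hz : z ∈ slab k 0 R) : |z.1| ≤ R := by
  rw [abs_of_nonneg hz.1]; exact hz.2

lemma integrableOn_slab_of_bound {E : Type*} [NormedAddCommGroup E] {F : Cyl k → E} {a b C : ℝ}
    (hF : AEStronglyMeasurable F volume)
    (hC : ∀ z ∈ slab k a b, ‖F z‖ ≤ C) : IntegrableOn F (slab k a b) := by
  refine Measure.integrableOn_of_bounded (M := C) (by rw [volume_slab]; exact ENNReal.ofReal_ne_top) hF ?_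
  exact (ae_restrict_mem (measurableSet_slab a b)).mono fun z hz => hC z hz

lemma integrable_mul_test {F : Cyl k → Vec k} {U : Set (Cyl k)} {f : Cyl k → ℝ} (h : IsTestFunction U f)
    (hF : Measurable F) (hb : ∀ X : ℝ, ∃ C, ∀ z : Cyl k, |z.1| ≤ X → ‖F z‖ ≤ C) :
    Integrable fun z => inner ℝ (F z) (grad f z) := by
  obtain ⟨X, hX0, -, hgX⟩ := h.exists_support
  obtain ⟨C, hC⟩ := hb X
  have hg := h.continuous_grad
  have hgi : Integrable (fun z => ‖grad f z‖) := hg.norm.integrable_of_hasCompactSupport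
    (hasCompactSupport_of_fst (X := X) fun z hz => by simp [hgX z hz])
  refine (hgi.const_mul C).mono' (hF.inner hg.measurable).aestronglyMeasurable (Eventually.of_forall fun z => ?_)
  by_cases hz : X < |z.1|
  · simp [hgX z hz]
  · refine (norm_inner_le_norm _ _).trans ?_
    gcongr
    exact hC z (not_lt.1 hz)

lemma setIntegral_slab_eq {R : ℝ} {g : Cyl k → ℝ} {f : Cyl k → ℝ}
    (h : IsTestFunction {z | z.1 ∈ Ioo (0 : ℝ) R} f) (hg : ∀ z, z ∉ tsupport f → g z = 0) :
    ∫ z in slab k 0 R, g z = ∫ z, g z :=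
  setIntegral_eq_integral_of_forall_compl_eq_zero fun z hz => hg z fun hc =>
    hz (Ioo_subset_Icc_self (h.support hc))

/-- The term `x e_x` has divergence one, and each short-range field carries its whole smeared
charge. -/
lemma integral_inner_bgField (hη0 : 0 < η) (hη : η < 1 / 4) (W : Finset (Bridge k β)) (t : ℝ)
    {U : Set (Cyl k)} {f : Cyl k → ℝ} (h : IsTestFunction U f) :
    Integrable (fun z => inner ℝ (bgField η W t z) (grad f z)) ∧
    ∫ z, inner ℝ (bgField η W t z) (grad f z)
      = (∑ b ∈ W, ∫ z, f z ∂(smear η (b (t : AddCircle β)))) - ∫ z, f z := by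
  obtain ⟨B, hB0, hB⟩ := exists_bound_chargeField (k := k) hη0 hη
  have i1 : ∀ b ∈ W, Integrable fun z => inner ℝ (chargeField η (z - b (t : AddCircle β))) (grad f z) := fun b _ =>
    integrable_mul_test h ((measurable_chargeField hη0 hη).comp (measurable_id.sub_const _))
      fun X => ⟨B, fun z _ => hB _⟩
  have i2 : Integrable fun z : Cyl k => inner ℝ (z.1 • (bvec 0 : Vec k)) (grad f z) :=
    integrable_mul_test h (by fun_prop) fun X => ⟨X, fun z hz => by
      rw [norm_smul, norm_bvec, mul_one]; exact hz⟩
  have e : ∀ z, inner ℝ (bgField η W t z) (grad f z) = inner ℝ (z.1 • (bvec 0 : Vec k)) (grad f z)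
      + ∑ b ∈ W, inner ℝ (chargeField η (z - b (t : AddCircle β))) (grad f z) := fun z => by
    rw [bgField, inner_add_left, chargeSum, sum_inner]
  simp_rw [e]
  refine ⟨i2.add (integrable_finsetSum _ i1), ?_⟩
  rw [integral_add i2 (integrable_finsetSum _ i1), integral_finsetSum _ i1]
  simp_rw [integral_inner_chargeField hη0 hη h]
  have e2 : ∀ z : Cyl k, inner ℝ (z.1 • (bvec 0 : Vec k)) (grad f z) = z.1 * grad f z 0 := fun z => by
    rw [real_inner_smul_left]; simp [bvec, EuclideanSpace.inner_single_left]
  simp_rw [e2, h.integral_fst_mul_grad]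
  ring

/-- Adding a continuous divergence-free field to `bgField` gives a compatible field. -/
lemma isCompatible_bgField_add (hη0 : 0 < η) (hη : η < 1 / 4) (R : ℕ) (W : Finset (Bridge k β))
    {G : ℝ → Cyl k → Vec k} (hG : ∀ t, Continuous (G t))
    (hGf : ∀ t (f : Cyl k → ℝ), IsTestFunction univ f → ∫ z, inner ℝ (G t z) (grad f z) = 0) :
    IsCompatible η R (W : Set (Bridge k β)) fun t z => bgField η W t z + G t z := by
  obtain ⟨B, hB0, hB⟩ := exists_bound_chargeField (k := k) hη0 hη
  intro t _
  refine ⟨?_, fun f h => ?_⟩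
  · refine IntegrableOn.add ?_ ((hG t).continuousOn.integrableOn_compact (isCompact_slab _ _))
    refine integrableOn_slab_of_bound (C := R + W.card * B) (measurable_bgField_time hη0 hη W t).aestronglyMeasurable
      fun z hz => (norm_bgField_le hB W t z).trans ?_
    gcongr
    exact abs_le_of_mem_slab hz
  · have hu := h.mono (subset_univ _)
    obtain ⟨i1, e1⟩ := integral_inner_bgField hη0 hη W t h
    rw [setIntegral_slab_eq h (fun z hz => by rw [grad_eq_zero_of_notMem hz, inner_zero_right]),
      setIntegral_slab_eq h (fun z hz => image_eq_zero_of_notMem_tsupport hz), finsum_mem_coe_finset]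
    have i2 : Integrable fun z => inner ℝ (G t z) (grad f z) :=
      integrable_mul_test h (hG t).measurable fun X => by
        obtain ⟨C, hC⟩ := (isCompact_slab (k := k) (-X) X).exists_bound_of_continuousOn (hG t).continuousOn
        exact ⟨C, fun z hz => hC z (abs_le.1 hz)⟩
    simp_rw [inner_add_left]
    rw [integral_add i1 i2, e1, hGf t f hu]
    ring

lemma chargeSum_of_lt (hη : η < 1 / 4) {W : Finset (Bridge k β)} {t : ℝ} {z : Cyl k}
    (h : ∀ b ∈ W, z.1 < (b (t : AddCircle β)).1 - 3 / 8) : chargeSum η W t z = 0 :=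
  Finset.sum_eq_zero fun b hb => chargeField_of_lt hη (by rw [Prod.fst_sub]; linarith [h b hb])

lemma chargeSum_of_gt (hη0 : 0 < η) (hη : η < 1 / 4) {W : Finset (Bridge k β)} {t : ℝ} {z : Cyl k}
    (h : ∀ b ∈ W, (b (t : AddCircle β)).1 + 3 / 8 < z.1) : chargeSum η W t z = (-(W.card : ℝ)) • bvec 0 := by
  rw [chargeSum, Finset.sum_congr rfl fun b hb => chargeField_of_gt hη0 hη (by rw [Prod.fst_sub]; linarith [h b hb])]
  rw [Finset.sum_const, ← Nat.cast_smul_eq_nsmul ℝ, smul_neg, neg_smul]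

/-- All bridges keep the distance `1/2` from the faces. So the field is `x e_x` near `x = 0`, and
near `x = R`, with all `R` charges to the left, it is `(x - R) e_x`. Neutrality is what makes the
second one vanish on its face. -/
lemma isScreened_bgField_add (hη0 : 0 < η) (hη : η < 1 / 4) (R : ℕ) (W : Finset (Bridge k β))
    {G : ℝ → Cyl k → Vec k} (hW : ∀ b ∈ W, ∀ t : AddCircle β, (b t).1 ∈ Icc (1 / 2 : ℝ) (R - 1 / 2))
    (hcard : W.card = R) (hGl : ∀ t (z : Cyl k), z.1 ≤ 1 / 16 → G t z = 0)
    (hGr : ∀ t (z : Cyl k), R - 1 / 16 ≤ z.1 → G t z = 0) :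
    IsScreened β R fun t z => bgField η W t z + G t z := by
  intro t _
  have hl : ∀ z : Cyl k, z.1 ≤ 1 / 16 → bgField η W t z + G t z = z.1 • bvec 0 := fun z hz => by
    rw [hGl t z hz, bgField, chargeSum_of_lt hη fun b hb => by linarith [(hW b hb t).1]]
    simp
  have hr : ∀ z : Cyl k, R - 1 / 16 ≤ z.1 → bgField η W t z + G t z = (z.1 - R) • bvec 0 := fun z hz => by
    rw [hGr t z hz, bgField, chargeSum_of_gt hη0 hη fun b hb => by linarith [(hW b hb t).2], hcard, sub_smul,
      neg_smul]
    abel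
  refine ⟨⟨1 / 16, by norm_num, ?_, ?_⟩, fun y => ⟨?_, ?_⟩⟩
  · refine ContinuousOn.congr (f := fun z : Cyl k => z.1 • (bvec 0 : Vec k)) (by fun_prop) fun z hz => hl z hz.2
  · refine ContinuousOn.congr (f := fun z : Cyl k => (z.1 - R) • (bvec 0 : Vec k)) (by fun_prop) fun z hz => hr z hz.1
  · simp only
    rw [hl _ (by norm_num)]; simp
  · simp only
    rw [hr _ (by norm_num)]; simp

/-! ### Cutting off a divergence-free field -/

/-- The cutoff of the divergence-free and flux-free field `D`. -/
def cutField (χ : ℝ → ℝ) (D : Cyl k → Vec k) (z : Cyl k) : Vec k :=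
  χ z.1 • D z - divSolve (fun z => deriv χ z.1 * D z 0) z

lemma continuous_cutField {χ : ℝ → ℝ} (hχ : ContDiff ℝ ((⊤ : ℕ∞) : WithTop ℕ∞) χ) {D : ℝ → Cyl k → Vec k}
    (hD : Continuous (Function.uncurry D)) : Continuous (Function.uncurry fun t => cutField χ (D t)) := by
  have h1 : Continuous χ := hχ.continuous
  have h2 : Continuous (deriv χ) := hχ.continuous_deriv (by simp)
  have h3 : Continuous fun q : ℝ × Cyl k => D q.1 q.2 := hD
  have h4 : Continuous (Function.uncurry fun (t : ℝ) (z : Cyl k) => deriv χ z.1 * D t z 0) := by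
    unfold Function.uncurry; fun_prop
  have h5 := continuous_divSolve h4
  exact Continuous.sub (by fun_prop) h5

lemma IsTestFunction.mul_fst {χ : ℝ → ℝ} (hχ : ContDiff ℝ ((⊤ : ℕ∞) : WithTop ℕ∞) χ) {U : Set (Cyl k)}
    {f : Cyl k → ℝ} (h : IsTestFunction U f) : IsTestFunction univ fun z => χ z.1 * f z := by
  refine ⟨?_, h.compact.mul_left, subset_univ _⟩
  have h1 : ContDiff ℝ ((⊤ : ℕ∞) : WithTop ℕ∞) fun v : Vec k => χ (v 0) :=
    hχ.comp (EuclideanSpace.proj (𝕜 := ℝ) 0 : Vec k →L[ℝ] ℝ).contDiff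
  exact h1.mul h.smooth

lemma IsTestFunction.grad_mul_fst {χ : ℝ → ℝ} (hχ : ContDiff ℝ ((⊤ : ℕ∞) : WithTop ℕ∞) χ) {U : Set (Cyl k)}
    {f : Cyl k → ℝ} (h : IsTestFunction U f) (z : Cyl k) :
    grad (fun z => χ z.1 * f z) z = χ z.1 • grad f z + (deriv χ z.1 * f z) • bvec 0 := by
  have h1 : HasFDerivAt (fun v : Vec k => z.1 + v 0) (EuclideanSpace.proj (𝕜 := ℝ) 0 : Vec k →L[ℝ] ℝ) 0 :=
    (EuclideanSpace.proj (𝕜 := ℝ) 0 : Vec k →L[ℝ] ℝ).hasFDerivAt.const_add z.1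
  have h2 : HasDerivAt χ (deriv χ z.1) (z.1 + (0 : Vec k) 0) := by
    simpa using (hχ.differentiable (by simp) z.1).hasDerivAt
  have h3 := h2.comp_hasFDerivAt (0 : Vec k) h1
  have h4 := h3.mul (h.hasFDerivAt z)
  have h5 : HasGradientAt (fun v : Vec k => χ (z + toCyl v).1 * f (z + toCyl v))
      (χ z.1 • grad f z + (deriv χ z.1 * f z) • bvec 0) 0 := by
    rw [hasGradientAt_iff_hasFDerivAt]
    refine (h4.congr_of_eventuallyEq (Eventually.of_forall fun v => ?_)).congr_fderiv ?_
    · simp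
    · ext w
      simp [bvec, EuclideanSpace.inner_single_left]
      ring
  exact h5.gradient

/-- Cutting off keeps divergence-free fields divergence-free. -/
lemma integral_inner_cutField {χ : ℝ → ℝ} (hχ : ContDiff ℝ ((⊤ : ℕ∞) : WithTop ℕ∞) χ) {X : ℝ}
    (hχs : ∀ x, X < |x| → χ x = 0) {D : Cyl k → Vec k} (hD : Continuous D)
    (hDf : ∀ f : Cyl k → ℝ, IsTestFunction univ f → ∫ z, inner ℝ (D z) (grad f z) = 0)
    (hDs : ∀ x : ℝ, ∫ y : UnitAddTorus (Fin k), D (x, y) 0 = 0) {f : Cyl k → ℝ} (h : IsTestFunction univ f) :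
    ∫ z, inner ℝ (cutField χ D z) (grad f z) = 0 := by
  have h1 : Continuous χ := hχ.continuous
  have h2 : Continuous (deriv χ) := hχ.continuous_deriv (by simp)
  have hg := h.continuous_grad
  have hfc := h.continuous
  obtain ⟨Y, hY0, hfY, hgY⟩ := h.exists_support
  have hφ : Continuous fun z : Cyl k => deriv χ z.1 * D z 0 := by fun_prop
  have hφs : ∀ z : Cyl k, X < |z.1| → deriv χ z.1 * D z 0 = 0 := fun z hz => by
    have : χ =ᶠ[𝓝 z.1] fun _ => 0 := by
      have ho : IsOpen {x : ℝ | X < |x|} := isOpen_lt continuous_const continuous_abs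
      filter_upwards [ho.mem_nhds hz] with x hx using hχs x hx
    rw [this.deriv_eq]; simp
  have hdc := continuous_divSolve_const hφ
  have e1 := integral_inner_divSolve hφ hφs h
  -- Testing the divergence-free field with `χ f` identifies the divergence of `χ D` as `χ' D_x`.
  have e2 := hDf _ (h.mul_fst hχ)
  simp_rw [h.grad_mul_fst hχ, inner_add_right, real_inner_smul_right] at e2
  have e3 : ∀ z, (deriv χ z.1 * f z) * inner ℝ (D z) (bvec 0 : Vec k) = deriv χ z.1 * D z 0 * f z := fun z => by
    simp [bvec, EuclideanSpace.inner_single_right]; ring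
  simp_rw [e3] at e2
  have i1 : Integrable fun z : Cyl k => χ z.1 * inner ℝ (D z) (grad f z) :=
    integrable_of_fst (X := Y) (by fun_prop) fun z hz => by simp [hgY z hz]
  have i2 : Integrable fun z : Cyl k => deriv χ z.1 * D z 0 * f z :=
    integrable_of_fst (X := Y) (by fun_prop) fun z hz => by simp [hfY z hz]
  have i3 : Integrable fun z : Cyl k => inner ℝ (divSolve (fun z => deriv χ z.1 * D z 0) z) (grad f z) :=
    integrable_of_fst (X := Y) (by fun_prop) fun z hz => by simp [hgY z hz]
  have hfs := continuous_slice hfc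
  have i4 : Integrable fun z : Cyl k => deriv χ z.1 * D z 0 * ∫ y, f (z.1, y) :=
    integrable_of_fst (X := Y) (hφ.mul (hfs.comp continuous_fst)) fun z hz => by
      have h0 : ∀ y, f (z.1, y) = 0 := fun y => hfY (z.1, y) hz
      simp [h0]
  rw [integral_add i1 i2] at e2
  simp_rw [mul_sub] at e1
  rw [integral_sub i4 i2] at e1
  -- As `D` has no flux, the density `χ' D_x` has zero slice averages, so `divSolve` removes it
  -- exactly.
  have e4 : ∫ z : Cyl k, deriv χ z.1 * D z 0 * ∫ y, f (z.1, y) = 0 := by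
    rw [integral_eq_iterated i4]
    simp_rw [integral_mul_const, integral_const_mul, hDs]
    simp
  simp_rw [cutField, inner_sub_left, real_inner_smul_left]
  rw [integral_sub i1 i3, e1, e4]
  linarith

lemma integral_inner_remSum (hη0 : 0 < η) (hη : η < 1 / 4) (W : Finset (Bridge k β)) (t : ℝ)
    {U : Set (Cyl k)} {f : Cyl k → ℝ} (h : IsTestFunction U f) :
    ∫ z, inner ℝ (remSum η W t z) (grad f z) = 0 := by
  simp_rw [remSum, sum_inner]
  rw [integral_finsetSum]
  · exact Finset.sum_eq_zero fun b _ => integral_inner_remField hη0 hη h _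
  · intro b _
    obtain ⟨Y, hY0, hfY, hgY⟩ := h.exists_support
    have hg := h.continuous_grad
    have hr : Continuous fun z => remField η (z - b (t : AddCircle β)) :=
      (continuous_remField (k := k) hη0 hη).comp (by fun_prop)
    exact integrable_of_fst (X := Y) (by fun_prop) fun z hz => by simp [hgY z hz]

lemma integral_remSum_slice (hη0 : 0 < η) (hη : η < 1 / 4) (W : Finset (Bridge k β)) (t x : ℝ) :
    ∫ y : UnitAddTorus (Fin k), remSum η W t (x, y) 0 = 0 := by
  have e : ∀ y : UnitAddTorus (Fin k), remSum η W t (x, y) 0 = ∑ b ∈ W, remField η ((x, y) - b (t : AddCircle β)) 0 :=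
    fun y => by simp [remSum]
  simp_rw [e]
  rw [integral_finsetSum]
  · exact Finset.sum_eq_zero fun b _ => integral_remField_slice_sub hη0 hη x _
  · intro b _
    have hr := (continuous_remField (k := k) hη0 hη)
    exact integrable_torus (by fun_prop)

/-- The smooth cutoff that equals `1` on `[a + 1, b - 1]` and vanishes outside of `[a, b]`. -/
def cutoff (a b x : ℝ) : ℝ := Real.smoothTransition (x - a) * Real.smoothTransition (b - x)

lemma contDiff_cutoff (a b : ℝ) : ContDiff ℝ ((⊤ : ℕ∞) : WithTop ℕ∞) (cutoff a b) :=
  (Real.smoothTransition.contDiff.comp (contDiff_id.sub contDiff_const)).mul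
    (Real.smoothTransition.contDiff.comp (contDiff_const.sub contDiff_id))

lemma cutoff_of_le {a b x : ℝ} (h : x ≤ a) : cutoff a b x = 0 := by
  rw [cutoff, Real.smoothTransition.zero_of_nonpos (by linarith), zero_mul]

lemma cutoff_of_ge {a b x : ℝ} (h : b ≤ x) : cutoff a b x = 0 := by
  rw [cutoff, Real.smoothTransition.zero_of_nonpos (x := b - x) (by linarith), mul_zero]

lemma cutoff_of_mem {a b x : ℝ} (h : x ∈ Icc (a + 1) (b - 1)) : cutoff a b x = 1 := by
  rw [cutoff, Real.smoothTransition.one_of_one_le (by linarith [h.1]),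
    Real.smoothTransition.one_of_one_le (by linarith [h.2]), mul_one]

lemma abs_cutoff_le (a b x : ℝ) : |cutoff a b x| ≤ 1 := by
  have h1 := Real.smoothTransition.nonneg (x - a)
  have h2 := Real.smoothTransition.nonneg (b - x)
  rw [cutoff, abs_of_nonneg (mul_nonneg h1 h2)]
  exact mul_le_one₀ (Real.smoothTransition.le_one _) h2 (Real.smoothTransition.le_one _)

lemma deriv_cutoff_eq_zero {a b x : ℝ} {U : Set ℝ} (hU : IsOpen U) (hx : x ∈ U) {c : ℝ}
    (h : ∀ y ∈ U, cutoff a b y = c) : deriv (cutoff a b) x = 0 := by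
  have : cutoff a b =ᶠ[𝓝 x] fun _ => c := by
    filter_upwards [hU.mem_nhds hx] with y hy using h y hy
  rw [this.deriv_eq]; simp

/-- Both factors are a translate and a reflected translate of one profile, so the constant does not
depend on the position of the cut. -/
lemma exists_bound_deriv_cutoff : ∃ C, 0 ≤ C ∧ ∀ a b x, |deriv (cutoff a b) x| ≤ C := by
  have hc : Continuous (deriv Real.smoothTransition) :=
    (Real.smoothTransition.contDiff (n := (⊤ : ℕ∞))).continuous_deriv (by simp)
  obtain ⟨C, hC⟩ := isCompact_Icc (a := (0 : ℝ)) (b := 1) |>.exists_bound_of_continuousOn hc.continuousOn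
  have hC0 : 0 ≤ C := (norm_nonneg _).trans (hC 0 (by simp))
  have hb : ∀ x, |deriv Real.smoothTransition x| ≤ C := fun x => by
    by_cases hx : x ∈ Icc (0 : ℝ) 1
    · exact hC x hx
    · have : ∃ c : ℝ, Real.smoothTransition =ᶠ[𝓝 x] fun _ => c := by
        rw [mem_Icc, not_and_or, not_le, not_le] at hx
        rcases hx with h | h
        · exact ⟨0, by filter_upwards [gt_mem_nhds h] with y hy using Real.smoothTransition.zero_of_nonpos hy.le⟩
        · exact ⟨1, by filter_upwards [lt_mem_nhds h] with y hy using Real.smoothTransition.one_of_one_le hy.le⟩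
      obtain ⟨c, hc⟩ := this
      rw [hc.deriv_eq]; simpa using hC0
  refine ⟨C + C, by positivity, fun a b x => ?_⟩
  have hd : ∀ y, HasDerivAt Real.smoothTransition (deriv Real.smoothTransition y) y := fun y =>
    ((Real.smoothTransition.contDiff (n := (⊤ : ℕ∞))).differentiable (by simp) y).hasDerivAt
  have d1 : HasDerivAt (fun x => Real.smoothTransition (x - a)) (deriv Real.smoothTransition (x - a)) x :=
    (hd (x - a)).comp_sub_const x a
  have d2 : HasDerivAt (fun x => Real.smoothTransition (b - x)) (-deriv Real.smoothTransition (b - x)) x :=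
    (hd (b - x)).comp_const_sub b x
  have d3 : HasDerivAt (cutoff a b) _ x := d1.mul d2
  rw [d3.deriv]
  refine (abs_add_le _ _).trans (add_le_add ?_ ?_)
  · rw [abs_mul, abs_of_nonneg (Real.smoothTransition.nonneg _)]
    exact (mul_le_of_le_one_right (abs_nonneg _) (Real.smoothTransition.le_one _)).trans (hb _)
  · rw [abs_mul, abs_of_nonneg (Real.smoothTransition.nonneg _), abs_neg]
    exact (mul_le_of_le_one_left (abs_nonneg _) (Real.smoothTransition.le_one _)).trans (hb _)

/-! ### The energy of the screened field -/


lemma enorm_sq_eq {E : Type*} [NormedAddCommGroup E] (a : E) : ‖a‖ₑ ^ 2 = ENNReal.ofReal (‖a‖ ^ 2) := by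
  rw [ENNReal.ofReal_pow (norm_nonneg _), ofReal_norm]

lemma enorm_add_sq_le {E : Type*} [NormedAddCommGroup E] (a b : E) :
    ‖a + b‖ₑ ^ 2 ≤ 2 * ‖a‖ₑ ^ 2 + 2 * ‖b‖ₑ ^ 2 := by
  simp_rw [enorm_sq_eq]
  have h2 : (2 : ℝ≥0∞) = ENNReal.ofReal 2 := by simp
  rw [h2, ← ENNReal.ofReal_mul zero_le_two, ← ENNReal.ofReal_mul zero_le_two,
    ← ENNReal.ofReal_add (by positivity) (by positivity)]
  refine ENNReal.ofReal_le_ofReal ?_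
  have := norm_add_le a b
  nlinarith [norm_nonneg (a + b), sq_nonneg (‖a‖ - ‖b‖)]

lemma enorm_sub_sq_le {E : Type*} [NormedAddCommGroup E] (a b : E) :
    ‖a - b‖ₑ ^ 2 ≤ 2 * ‖a‖ₑ ^ 2 + 2 * ‖b‖ₑ ^ 2 := by
  have := enorm_add_sq_le a (-b)
  rwa [← sub_eq_add_neg, enorm_neg] at this

lemma enorm_smul_sq_le {E : Type*} [NormedAddCommGroup E] [NormedSpace ℝ E] {c C : ℝ} (hC : |c| ≤ C) (a : E) :
    ‖c • a‖ₑ ^ 2 ≤ ENNReal.ofReal (C ^ 2) * ‖a‖ₑ ^ 2 := by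
  rw [enorm_sq_eq, enorm_sq_eq, ← ENNReal.ofReal_mul (by positivity), norm_smul, mul_pow]
  refine ENNReal.ofReal_le_ofReal ?_
  rw [Real.norm_eq_abs]
  gcongr

/-- The two slabs in which a field on `[0, R] × D` is cut off at the distance `s` from the faces. -/
def cutZone (k : ℕ) (s R : ℝ) : Set (Cyl k) := slab k s (s + 1) ∪ slab k (R - s - 1) (R - s)

/-- The part of `[0, R] × D` that is modified when a field is cut off at the distance `s` from the faces. -/
def outerZone (k : ℕ) (s R : ℝ) : Set (Cyl k) := slab k 0 (s + 1) ∪ slab k (R - s - 1) R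

lemma measurableSet_cutZone (s R : ℝ) : MeasurableSet (cutZone k s R) :=
  (measurableSet_slab _ _).union (measurableSet_slab _ _)

lemma measurableSet_outerZone (s R : ℝ) : MeasurableSet (outerZone k s R) :=
  (measurableSet_slab _ _).union (measurableSet_slab _ _)

lemma deriv_cutoff_of_notMem {s R : ℝ} {z : Cyl k} (hz : z ∉ cutZone k s R) : deriv (cutoff s (R - s)) z.1 = 0 := by
  rw [cutZone, mem_union, not_or] at hz
  obtain ⟨h1, h2⟩ := hz
  simp only [slab, mem_ofPred_eq, mem_Icc, not_and_or, not_le] at h1 h2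
  rcases h1 with h1 | h1
  · exact deriv_cutoff_eq_zero isOpen_Iio h1 fun y hy => cutoff_of_le (le_of_lt hy)
  rcases h2 with h2 | h2
  · exact deriv_cutoff_eq_zero isOpen_Ioo (mem_Ioo.2 ⟨h1, h2⟩) fun y hy =>
      cutoff_of_mem ⟨hy.1.le, by linarith [hy.2]⟩
  · exact deriv_cutoff_eq_zero isOpen_Ioi h2 fun y hy => cutoff_of_ge (le_of_lt hy)

/-- The divergence correction acts within slices and hence lives where the cutoff varies. -/
lemma cutField_of_notMem {s R : ℝ} {z : Cyl k} (hz : z ∉ cutZone k s R) (D : Cyl k → Vec k) :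
    cutField (cutoff s (R - s)) D z = cutoff s (R - s) z.1 • D z := by
  rw [cutField, divSolve_eq_zero, sub_zero]
  intro z' hz'
  have : deriv (cutoff s (R - s)) z'.1 = 0 := by rw [hz']; exact deriv_cutoff_of_notMem hz
  rw [this, zero_mul]

lemma cutField_of_lt {s R : ℝ} {z : Cyl k} (hz : z.1 < s) (hsR : s ≤ R - s - 1) (D : Cyl k → Vec k) :
    cutField (cutoff s (R - s)) D z = 0 := by
  rw [cutField_of_notMem, cutoff_of_le hz.le, zero_smul]
  rw [cutZone, mem_union, not_or]
  exact ⟨fun h => by linarith [h.1], fun h => by linarith [h.1]⟩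

lemma cutField_of_gt {s R : ℝ} {z : Cyl k} (hz : R - s < z.1) (hsR : s + 1 ≤ R - s) (D : Cyl k → Vec k) :
    cutField (cutoff s (R - s)) D z = 0 := by
  rw [cutField_of_notMem, cutoff_of_ge hz.le, zero_smul]
  rw [cutZone, mem_union, not_or]
  exact ⟨fun h => by linarith [h.2], fun h => by linarith [h.2]⟩

/-- If `F = A + D` on `[s, R - s] × D`, then replacing `D` by its cutoff costs only energy near the faces. -/
lemma exists_lintegral_cutField_le (k : ℕ) : ∃ C : ℝ≥0, ∀ (s R : ℝ) (F A D : Cyl k → Vec k), 0 ≤ s → s + 1 ≤ R - s - 1 →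
    Measurable F → Measurable A → Continuous D → (∀ z : Cyl k, z.1 ∈ Icc s (R - s) → F z = A z + D z) →
    ∫⁻ z in slab k 0 R, ‖A z + cutField (cutoff s (R - s)) D z‖ₑ ^ 2
      ≤ (∫⁻ z in slab k 0 R, ‖F z‖ₑ ^ 2) + C * (∫⁻ z in cutZone k s R, ‖F z‖ₑ ^ 2)
        + C * ∫⁻ z in outerZone k s R, ‖A z‖ₑ ^ 2 := by
  obtain ⟨K, hK0, hK⟩ := exists_bound_deriv_cutoff
  set C₁ : ℝ≥0∞ := k * (ENNReal.ofReal (K ^ 2) * 2) with hC₁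
  have hC₁t : 4 + 2 * C₁ ≠ ⊤ := by
    rw [hC₁]; finiteness
  refine ⟨(4 + 2 * C₁).toNNReal, fun s R F A D hs hsR hF hA hD hFAD => ?_⟩
  rw [ENNReal.coe_toNNReal hC₁t]
  set χ := cutoff s (R - s) with hχ
  have hχc : Continuous χ := (contDiff_cutoff _ _).continuous
  have hχ' : Continuous (deriv χ) := (contDiff_cutoff _ _).continuous_deriv (by simp)
  set φ : Cyl k → ℝ := fun z => deriv χ z.1 * D z 0 with hφ
  have hφc : Continuous φ := by fun_prop
  have hDS := (continuous_divSolve_const hφc).measurable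
  have hcut : cutZone k s R ⊆ outerZone k s R := by
    refine union_subset_union ?_ ?_
    · intro z hz; exact ⟨hs.trans hz.1, hz.2⟩
    · intro z hz; exact ⟨hz.1, hz.2.trans (by linarith)⟩
  have hzone : ∀ z ∈ cutZone k s R, z.1 ∈ Icc s (R - s) := by
    rintro z (hz | hz)
    · exact ⟨hz.1, hz.2.trans (by linarith)⟩
    · exact ⟨le_trans (by linarith) hz.1, hz.2⟩
  have hpt : ∀ z, (slab k 0 R).indicator (fun z => ‖A z + cutField χ D z‖ₑ ^ 2) z
      ≤ (slab k 0 R).indicator (fun z => ‖F z‖ₑ ^ 2) z + 4 * (cutZone k s R).indicator (fun z => ‖F z‖ₑ ^ 2) z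
        + 4 * (outerZone k s R).indicator (fun z => ‖A z‖ₑ ^ 2) z + 2 * ‖divSolve φ z‖ₑ ^ 2 := by
    intro z
    by_cases hz : z ∈ slab k 0 R
    swap
    · rw [indicator_of_notMem hz]; exact zero_le
    rw [indicator_of_mem hz]
    by_cases hzc : z ∈ cutZone k s R
    · rw [indicator_of_mem hzc, indicator_of_mem (hcut hzc)]
      -- On the cut zone the new field interpolates between `A` and `F`, up to the divergence
      -- correction.
      have e : A z + cutField χ D z = ((1 - χ z.1) • A z + χ z.1 • F z) - divSolve φ z := by
        rw [cutField, hFAD z (hzone z hzc), smul_add, sub_smul, one_smul]; abel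
      have h0 : 0 ≤ χ z.1 := mul_nonneg (Real.smoothTransition.nonneg _) (Real.smoothTransition.nonneg _)
      have h1 := abs_cutoff_le s (R - s) z.1
      have h1' : χ z.1 ≤ 1 := (le_abs_self _).trans h1
      have a1 := enorm_smul_sq_le h1 (F z)
      have a2 := enorm_smul_sq_le (C := 1) (c := 1 - χ z.1) (by rw [abs_of_nonneg] <;> linarith) (A z)
      rw [one_pow, ENNReal.ofReal_one, one_mul] at a1 a2
      rw [e]
      calc _ ≤ 2 * ‖(1 - χ z.1) • A z + χ z.1 • F z‖ₑ ^ 2 + 2 * ‖divSolve φ z‖ₑ ^ 2 := enorm_sub_sq_le _ _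
        _ ≤ 2 * (2 * ‖A z‖ₑ ^ 2 + 2 * ‖F z‖ₑ ^ 2) + 2 * ‖divSolve φ z‖ₑ ^ 2 := by
            gcongr
            refine (enorm_add_sq_le _ _).trans ?_
            gcongr
        _ = 4 * ‖F z‖ₑ ^ 2 + 4 * ‖A z‖ₑ ^ 2 + 2 * ‖divSolve φ z‖ₑ ^ 2 := by ring
        _ ≤ _ := by
            gcongr
            exact le_add_self
    · rw [hχ, cutField_of_notMem hzc]
      by_cases hzo : z ∈ outerZone k s R
      · have hc0 : cutoff s (R - s) z.1 = 0 := by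
          rw [cutZone, mem_union, not_or] at hzc
          rcases hzo with h | h
          · refine cutoff_of_le ?_
            by_contra hh
            exact hzc.1 ⟨(not_le.1 hh).le, h.2⟩
          · refine cutoff_of_ge ?_
            by_contra hh
            exact hzc.2 ⟨h.1, (not_le.1 hh).le⟩
        rw [hc0, zero_smul, add_zero, indicator_of_mem hzo]
        refine le_trans ?_ (le_add_right le_add_self)
        calc ‖A z‖ₑ ^ 2 = 1 * ‖A z‖ₑ ^ 2 := (one_mul _).symm
          _ ≤ 4 * ‖A z‖ₑ ^ 2 := by gcongr; norm_num
      · have hm : z.1 ∈ Icc (s + 1) (R - s - 1) := by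
          rw [outerZone, mem_union, not_or] at hzo
          constructor
          · by_contra hh
            exact hzo.1 ⟨hz.1, (not_le.1 hh).le⟩
          · by_contra hh
            exact hzo.2 ⟨(not_le.1 hh).le, hz.2⟩
        rw [cutoff_of_mem (by simpa using hm), one_smul,
          ← hFAD z ⟨by linarith [hm.1], by linarith [hm.2]⟩]
        rw [indicator_of_mem hz]
        exact le_add_right (le_add_right le_self_add)
  have hmF : Measurable fun z => ‖F z‖ₑ ^ 2 := by fun_prop
  have hmA : Measurable fun z => ‖A z‖ₑ ^ 2 := by fun_prop
  have hmS := (hmF.indicator (measurableSet_slab (k := k) 0 R))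
  have hmZ := (hmF.indicator (measurableSet_cutZone (k := k) s R))
  have hmO := (hmA.indicator (measurableSet_outerZone (k := k) s R))
  have hDSle : ∫⁻ z, ‖divSolve φ z‖ₑ ^ 2 ≤ C₁ * ((∫⁻ z in cutZone k s R, ‖F z‖ₑ ^ 2)
      + ∫⁻ z in outerZone k s R, ‖A z‖ₑ ^ 2) := by
    have hpt2 : ∀ z, ‖φ z‖ₑ ^ 2 ≤ (ENNReal.ofReal (K ^ 2) * 2) * ((cutZone k s R).indicator (fun z => ‖F z‖ₑ ^ 2) z
        + (outerZone k s R).indicator (fun z => ‖A z‖ₑ ^ 2) z) := by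
      intro z
      by_cases hzc : z ∈ cutZone k s R
      · rw [indicator_of_mem hzc, indicator_of_mem (hcut hzc)]
        -- The remainder has no a priori bound; on the cut zone it is controlled through `D = F -
        -- A`.
        have hD' : D z = F z - A z := by rw [hFAD z (hzone z hzc)]; abel
        calc ‖φ z‖ₑ ^ 2 ≤ ENNReal.ofReal (K ^ 2) * ‖D z 0‖ₑ ^ 2 := by
              have := enorm_smul_sq_le (hK s (R - s) z.1) (D z 0)
              rwa [smul_eq_mul] at this
          _ ≤ ENNReal.ofReal (K ^ 2) * ‖D z‖ₑ ^ 2 := by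
              gcongr
              rw [← ofReal_norm, ← ofReal_norm]
              exact ENNReal.ofReal_le_ofReal (abs_coord_le_norm _ _)
          _ ≤ ENNReal.ofReal (K ^ 2) * (2 * ‖F z‖ₑ ^ 2 + 2 * ‖A z‖ₑ ^ 2) := by
              gcongr; rw [hD']; exact enorm_sub_sq_le _ _
          _ = _ := by ring
      · have : φ z = 0 := by rw [hφ]; simp only; rw [hχ, deriv_cutoff_of_notMem hzc, zero_mul]
        rw [this]; simp
    refine (lintegral_divSolve_le hφc).trans ?_
    rw [hC₁, mul_assoc]
    gcongr
    rw [← lintegral_indicator (measurableSet_cutZone s R), ← lintegral_indicator (measurableSet_outerZone s R),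
      ← lintegral_add_left hmZ]
    exact (lintegral_mono hpt2).trans (lintegral_const_mul _ (hmZ.add hmO)).le
  calc _ = ∫⁻ z, (slab k 0 R).indicator (fun z => ‖A z + cutField χ D z‖ₑ ^ 2) z :=
        (lintegral_indicator (measurableSet_slab _ _) _).symm
    _ ≤ _ := lintegral_mono hpt
    _ = (∫⁻ z in slab k 0 R, ‖F z‖ₑ ^ 2) + 4 * (∫⁻ z in cutZone k s R, ‖F z‖ₑ ^ 2)
        + 4 * (∫⁻ z in outerZone k s R, ‖A z‖ₑ ^ 2) + 2 * ∫⁻ z, ‖divSolve φ z‖ₑ ^ 2 := by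
        rw [lintegral_add_left, lintegral_add_left, lintegral_add_left hmS, lintegral_const_mul _ hmZ,
          lintegral_const_mul _ hmO, lintegral_const_mul _ (by fun_prop), lintegral_indicator (measurableSet_slab _ _),
          lintegral_indicator (measurableSet_cutZone s R), lintegral_indicator (measurableSet_outerZone s R)]
        · exact hmS.add (hmZ.const_mul 4)
        · exact (hmS.add (hmZ.const_mul 4)).add (hmO.const_mul 4)
    _ ≤ (∫⁻ z in slab k 0 R, ‖F z‖ₑ ^ 2) + 4 * (∫⁻ z in cutZone k s R, ‖F z‖ₑ ^ 2)
        + 4 * (∫⁻ z in outerZone k s R, ‖A z‖ₑ ^ 2) + 2 * (C₁ * ((∫⁻ z in cutZone k s R, ‖F z‖ₑ ^ 2)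
      + ∫⁻ z in outerZone k s R, ‖A z‖ₑ ^ 2)) := by gcongr
    _ = _ := by ring

/-! ### Regularly placed charges -/

/-- Positions of charges: `J` of them are at `1/2, 3/2, …, J - 1/2`, the others between `J` and `J + 1`. -/
def sitePos (J j : ℕ) : ℝ := if j < J then j + 1 / 2 else J + 1 / ((j - J : ℕ) + 2)

lemma sitePos_of_lt {J j : ℕ} (h : j < J) : sitePos J j = j + 1 / 2 := if_pos h

lemma sitePos_of_ge {J j : ℕ} (h : J ≤ j) : (J : ℝ) < sitePos J j ∧ sitePos J j ≤ J + 1 / 2 := by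
  rw [sitePos, if_neg (not_lt.2 h)]
  have h0 : (0 : ℝ) ≤ (j - J : ℕ) := Nat.cast_nonneg _
  refine ⟨by linarith [show (0 : ℝ) < 1 / ((j - J : ℕ) + 2) by positivity], ?_⟩
  gcongr
  linarith

lemma sitePos_mem (J j : ℕ) : sitePos J j ∈ Ioc (0 : ℝ) (J + 1 / 2) := by
  rcases lt_or_ge j J with h | h
  · rw [sitePos_of_lt h]
    have : (j : ℝ) < J := by exact_mod_cast h
    constructor
    · positivity
    · linarith
  · have := sitePos_of_ge h
    exact ⟨(Nat.cast_nonneg J).trans_lt this.1, this.2⟩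

lemma half_le_sitePos {J : ℕ} (hJ : 0 < J) (j : ℕ) : 1 / 2 ≤ sitePos J j := by
  rcases lt_or_ge j J with h | h
  · rw [sitePos_of_lt h]
    have : (0 : ℝ) ≤ j := Nat.cast_nonneg _
    linarith
  · have h1 := (sitePos_of_ge h).1
    have : (1 : ℝ) ≤ J := by exact_mod_cast hJ
    linarith

/-- Configurations are sets, so charges need pairwise distinct positions; the points `J + 1/(i + 2)`
accommodate any number of surplus charges. -/
lemma sitePos_injective (J : ℕ) : Function.Injective (sitePos J) := by
  intro i j hij
  rcases lt_or_ge i J with hi | hi <;> rcases lt_or_ge j J with hj | hj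
  · rw [sitePos_of_lt hi, sitePos_of_lt hj] at hij
    exact_mod_cast add_right_cancel hij
  · have h1 := (sitePos_of_ge hj).1
    rw [← hij, sitePos_of_lt hi] at h1
    have : (i : ℝ) + 1 ≤ J := by exact_mod_cast hi
    linarith
  · have h1 := (sitePos_of_ge hi).1
    rw [hij, sitePos_of_lt hj] at h1
    have : (j : ℝ) + 1 ≤ J := by exact_mod_cast hj
    linarith
  · rw [sitePos, sitePos, if_neg (not_lt.2 hi), if_neg (not_lt.2 hj)] at hij
    have h1 := add_left_cancel hij
    rw [one_div, one_div, inv_inj] at h1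
    have h2 : ((i - J : ℕ) : ℝ) = (j - J : ℕ) := by linarith
    have h3 : i - J = j - J := by exact_mod_cast h2
    omega

/-- The field of the background screened by regularly placed charges is bounded. -/
lemma norm_regular_le {w : Vec k} (hw : ‖w‖ = 1) {B : ℝ} (hB : 0 ≤ B) {J : ℕ} {F : ℕ → Vec k} {u : ℝ} (hu : 0 ≤ u)
    (h0 : ∀ j < J, u < (j : ℝ) + 1 / 2 - 3 / 8 → F j = 0) (h1 : ∀ j < J, (j : ℝ) + 1 / 2 + 3 / 8 < u → F j = -w)
    (hb : ∀ j, ‖F j‖ ≤ B) :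
    ‖u • w + ∑ j ∈ Finset.range J, F j‖ ≤ B + 1 + max 0 (u - J) := by
  -- Charges in the cells before `⌊u⌋` compensate the background cell by cell and those in later
  -- cells are not felt. Only the charge in the cell of `u` is undecided.
  set m := ⌊u⌋₊ with hm
  have hm1 : (m : ℝ) ≤ u := Nat.floor_le hu
  have hm2 : u < m + 1 := Nat.lt_floor_add_one u
  have hlow : ∀ i, i ≤ m → i ≤ J → u • w + ∑ j ∈ Finset.range i, F j = (u - i) • w := by
    intro i hi hiJ
    rw [Finset.sum_congr rfl (g := fun _ => -w), Finset.sum_const, Finset.card_range, ← Nat.cast_smul_eq_nsmul ℝ,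
      smul_neg, sub_smul, sub_eq_add_neg]
    intro j hj
    have hj' : j < i := Finset.mem_range.1 hj
    refine h1 j (hj'.trans_le hiJ) ?_
    have : (j : ℝ) + 1 ≤ m := by exact_mod_cast (Nat.succ_le_of_lt hj').trans hi
    linarith
  rcases le_or_gt J m with hJ | hJ
  · rw [hlow J hJ le_rfl, norm_smul, hw, mul_one, Real.norm_eq_abs]
    have : (J : ℝ) ≤ u := le_trans (by exact_mod_cast hJ) hm1
    rw [abs_of_nonneg (by linarith)]
    linarith [le_max_right 0 (u - J)]
  · have hhigh : ∀ i, m + 1 ≤ i → i ≤ J → ∑ j ∈ Finset.range i, F j = ∑ j ∈ Finset.range (m + 1), F j := by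
      intro i hi
      induction i, hi using Nat.le_induction with
      | base => intro _; rfl
      | succ n hn ih =>
        intro hnJ
        rw [Finset.sum_range_succ, ih (by omega), h0 n (by omega), add_zero]
        have : (m : ℝ) + 1 ≤ n := by exact_mod_cast hn
        linarith
    rw [hhigh J hJ le_rfl, Finset.sum_range_succ, ← add_assoc, hlow m le_rfl hJ.le]
    refine (norm_add_le _ _).trans ?_
    rw [norm_smul, hw, mul_one, Real.norm_eq_abs, abs_of_nonneg (by linarith)]
    linarith [hb m, le_max_left 0 (u - J)]

/-- The first `J` charges neutralize the background up to `J`, and each surplus charge costs at most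
`B`. For `u < J - 3/8` all surplus charges are still ahead and contribute nothing. -/
lemma norm_sites_le {w : Vec k} (hw : ‖w‖ = 1) {B : ℝ} (hB : 0 ≤ B) {J n : ℕ} (hJ : J ≤ n) {F : ℕ → Vec k} {u : ℝ}
    (hu : 0 ≤ u) (h0 : ∀ j < n, u < sitePos J j - 3 / 8 → F j = 0)
    (h1 : ∀ j < n, sitePos J j + 3 / 8 < u → F j = -w) (hb : ∀ j, ‖F j‖ ≤ B) :
    ‖u • w + ∑ j ∈ Finset.range n, F j‖ ≤ B + 1 + max 0 (u - J) + (n - J) * B ∧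
      (u < J - 3 / 8 → ‖u • w + ∑ j ∈ Finset.range n, F j‖ ≤ B + 1) := by
  have hreg := norm_regular_le hw hB (J := J) (F := F) hu
    (fun j hj => by rw [← sitePos_of_lt hj]; exact h0 j (hj.trans_le hJ))
    (fun j hj => by rw [← sitePos_of_lt hj]; exact h1 j (hj.trans_le hJ)) hb
  rw [← Finset.sum_range_add_sum_Ico _ hJ, ← add_assoc]
  constructor
  · refine (norm_add_le _ _).trans (add_le_add hreg ?_)
    refine (norm_sum_le _ _).trans ((Finset.sum_le_card_nsmul _ _ B fun j _ => hb j).trans ?_)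
    rw [Nat.card_Ico, nsmul_eq_mul, Nat.cast_sub hJ]
  · intro huJ
    rw [Finset.sum_eq_zero (s := Finset.Ico J n), add_zero]
    · rwa [max_eq_left (by linarith), add_zero] at hreg
    · intro j hj
      rw [Finset.mem_Ico] at hj
      exact h0 j hj.2 (by linarith [(sitePos_of_ge hj.1).1])

/-- The constant bridge at the point `(x, 0)`. -/
def constBridge (k : ℕ) (β x : ℝ) : Bridge k β := ContinuousMap.const _ (x, 0)

@[simp] lemma constBridge_apply (x : ℝ) (t : AddCircle β) : constBridge k β x t = (x, 0) := rfl

lemma constBridge_injective : Function.Injective (constBridge k β) := fun x y h => by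
  have := congrArg (fun b : Bridge k β => (b 0).1) h
  simpa using this

end

/-! ### Counting charges by fluxes -/

/-- A continuous probability density on `[a, a + w]`. -/
def bump (a w x : ℝ) : ℝ := max 0 (6 * (x - a) * (a + w - x) / w ^ 3)

/-- The mass of `bump a w` to the right of `x`. -/
def bumpTail (a w x : ℝ) : ℝ := 1 - ∫ t in a..x, bump a w t

section bump
variable {a w x : ℝ}

lemma continuous_bump (a w : ℝ) : Continuous (bump a w) := by
  unfold bump; fun_prop

lemma bump_nonneg (a w x : ℝ) : 0 ≤ bump a w x := le_max_left _ _

lemma bump_of_notMem (hw : 0 < w) (hx : x ∉ Icc a (a + w)) : bump a w x = 0 := by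
  refine max_eq_left (div_nonpos_of_nonpos_of_nonneg ?_ (by positivity))
  rw [mem_Icc, not_and_or, not_le, not_le] at hx
  rcases hx with h | h
  · nlinarith [mul_pos (sub_pos.2 h) (by linarith : 0 < a + w - x)]
  · nlinarith [mul_pos (sub_pos.2 h) (by linarith : 0 < x - a)]

lemma bump_le (hw : 0 < w) (x : ℝ) : bump a w x ≤ 2 / w := by
  refine max_le (by positivity) ?_
  rw [div_le_div_iff₀ (by positivity) hw]
  nlinarith [mul_nonneg hw.le (sq_nonneg (2 * (x - a) - w)), mul_pos hw (mul_pos hw hw)]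

lemma bump_of_mem (hw : 0 < w) (hx : x ∈ Icc a (a + w)) : bump a w x = 6 * (x - a) * (a + w - x) / w ^ 3 :=
  max_eq_right (div_nonneg (mul_nonneg (by linarith [hx.1]) (by linarith [hx.2])) (by positivity))

lemma integral_bump (hw : 0 < w) : ∫ t in a..(a + w), bump a w t = 1 := by
  have h1 : ∫ t in a..(a + w), bump a w t = ∫ t in a..(a + w), 6 * (t - a) * (a + w - t) / w ^ 3 := by
    refine intervalIntegral.integral_congr fun t ht => bump_of_mem hw ?_
    rwa [uIcc_of_le (by linarith)] at ht
  rw [h1, intervalIntegral.integral_eq_sub_of_hasDerivAt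
    (f := fun t => (3 * w * (t - a) ^ 2 - 2 * (t - a) ^ 3) / w ^ 3)]
  · field_simp; ring
  · intro t _
    have h2 : HasDerivAt (fun t : ℝ => t - a) 1 t := (hasDerivAt_id t).sub_const a
    refine ((((h2.pow 2).const_mul (3 * w)).sub ((h2.pow 3).const_mul 2)).div_const (w ^ 3)).congr_deriv ?_
    simp; ring
  · exact Continuous.intervalIntegrable (by fun_prop) _ _

lemma hasDerivAt_bumpTail (a w x : ℝ) : HasDerivAt (bumpTail a w) (-bump a w x) x :=
  (intervalIntegral.integral_hasDerivAt_right ((continuous_bump a w).intervalIntegrable _ _)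
    ((continuous_bump a w).stronglyMeasurableAtFilter _ _) (continuous_bump a w).continuousAt).const_sub 1

lemma continuous_bumpTail (a w : ℝ) : Continuous (bumpTail a w) :=
  continuous_iff_continuousAt.2 fun x => (hasDerivAt_bumpTail a w x).continuousAt

lemma antitone_bumpTail (a w : ℝ) : Antitone (bumpTail a w) :=
  antitone_of_hasDerivAt_nonpos (hasDerivAt_bumpTail a w) fun x => neg_nonpos.2 (bump_nonneg a w x)

lemma bumpTail_of_le (hw : 0 < w) (hx : x ≤ a) : bumpTail a w x = 1 := by
  rw [bumpTail, intervalIntegral.integral_zero_ae, sub_zero]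
  filter_upwards [Measure.ae_ne volume a] with t hta ht
  rw [uIoc_of_ge hx] at ht
  exact bump_of_notMem hw fun h => hta (le_antisymm ht.2 h.1)

lemma bumpTail_of_ge (hw : 0 < w) (hx : a + w ≤ x) : bumpTail a w x = 0 := by
  rw [bumpTail, ← intervalIntegral.integral_add_adjacent_intervals (b := a + w)
    ((continuous_bump a w).intervalIntegrable _ _) ((continuous_bump a w).intervalIntegrable _ _), integral_bump hw,
    intervalIntegral.integral_zero_ae]
  · ring
  filter_upwards [Measure.ae_ne volume (a + w)] with t hta ht
  rw [uIoc_of_le hx] at ht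
  exact bump_of_notMem hw fun h => hta (le_antisymm h.2 ht.1.le)

lemma bumpTail_mem (hw : 0 < w) (x : ℝ) : bumpTail a w x ∈ Icc (0 : ℝ) 1 := by
  constructor
  · rw [← bumpTail_of_ge hw (le_max_right x (a + w))]
    exact antitone_bumpTail a w (le_max_left _ _)
  · rw [← bumpTail_of_le hw (min_le_right x a)]
    exact antitone_bumpTail a w (min_le_left _ _)

lemma bump_of_abs (hw : 0 < w) (hx : |a| + |w| < |x|) : bump a w x = 0 :=
  bump_of_notMem hw fun h => by
    have : |x| ≤ |a| + |w| := by
      rw [abs_le]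
      constructor
      · linarith [neg_abs_le a, abs_nonneg w, h.1]
      · linarith [le_abs_self a, le_abs_self w, h.2]
    linarith

lemma integral_bump_eq (hw : 0 < w) : ∫ x, bump a w x = 1 := by
  rw [← integral_bump (a := a) hw, intervalIntegral.integral_of_le (by linarith), ← integral_Icc_eq_integral_Ioc]
  exact (setIntegral_eq_integral_of_forall_compl_eq_zero fun x hx => bump_of_notMem hw hx).symm

lemma integral_sub_mul_bump (hw : 0 < w) (L : ℝ) : ∫ x, (x - L) * bump a w x ∈ Icc (a - L) (a + w - L) := by
  have hc := continuous_bump a w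
  have i1 : Integrable (bump a w) := integrable_of_supp hc fun x => bump_of_abs hw
  have i2 : Integrable fun x => (x - L) * bump a w x :=
    integrable_of_supp (X := |a| + |w|) (by fun_prop) fun x hx => by rw [bump_of_abs hw hx, mul_zero]
  constructor
  · calc a - L = ∫ x, (a - L) * bump a w x := by rw [integral_const_mul, integral_bump_eq hw, mul_one]
      _ ≤ _ := integral_mono (i1.const_mul _) i2 fun x => by
        by_cases hx : x ∈ Icc a (a + w)
        · exact mul_le_mul_of_nonneg_right (by linarith [hx.1]) (bump_nonneg _ _ _)
        · simp [bump_of_notMem hw hx]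
  · calc _ ≤ ∫ x, (a + w - L) * bump a w x := integral_mono i2 (i1.const_mul _) fun x => by
          by_cases hx : x ∈ Icc a (a + w)
          · exact mul_le_mul_of_nonneg_right (by linarith [hx.2]) (bump_nonneg _ _ _)
          · simp [bump_of_notMem hw hx]
      _ = a + w - L := by rw [integral_const_mul, integral_bump_eq hw, mul_one]

end bump

section
variable {k : ℕ} {η β : ℝ}

/-! ### Gauss's law and the flux-energy inequality -/

/-- The field of the charges `W` and of the background that starts at `x = L`. -/
def fullField (η L : ℝ) (W : Finset (Bridge k β)) (t : ℝ) (z : Cyl k) : Vec k :=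
  (z.1 - L) • bvec 0 + chargeSum η W t z + remSum η W t z

lemma measurable_fullField (hη0 : 0 < η) (hη : η < 1 / 4) (L : ℝ) (W : Finset (Bridge k β)) :
    Measurable (Function.uncurry (fullField η L W)) := by
  have h1 : Measurable fun q : ℝ × Cyl k => (q.2.1 - L) • (bvec 0 : Vec k) :=
    ((measurable_fst.comp measurable_snd).sub_const L).smul_const _
  exact (h1.add (measurable_chargeSum hη0 hη W)).add (continuous_remSum hη0 hη W).measurable

lemma measurable_fullField_time (hη0 : 0 < η) (hη : η < 1 / 4) (L : ℝ) (W : Finset (Bridge k β)) (t : ℝ) :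
    Measurable (fullField η L W t) := (measurable_fullField hη0 hη L W).of_uncurry_left

lemma continuous_remSum_time (hη0 : 0 < η) (hη : η < 1 / 4) (W : Finset (Bridge k β)) (t : ℝ) :
    Continuous (remSum η W t) := (continuous_remSum hη0 hη W).uncurry_left t

/-- The smoothed number of charges to the left of the interval `[a, a + w]`. -/
def leftCount (η a w : ℝ) (W : Finset (Bridge k β)) (t : ℝ) : ℝ :=
  ∑ b ∈ W, ∫ z, bumpTail a w (z.1 + (b (t : AddCircle β)).1) ∂(smear η (0 : Cyl k))

/-- Gauss's law. -/
lemma integral_fullField_mul_bump (hη0 : 0 < η) (hη : η < 1 / 4) (L : ℝ) (W : Finset (Bridge k β)) (t : ℝ)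
    {a w : ℝ} (hw : 0 < w) :
    ∫ z : Cyl k, fullField η L W t z 0 * bump a w z.1 = (∫ x, (x - L) * bump a w x) - leftCount η a w W t := by
  have hc := continuous_bump a w
  have hsupp : ∀ z : Cyl k, |a| + |w| < |z.1| → bump a w z.1 = 0 := fun z hz => bump_of_abs hw hz
  obtain ⟨B, hB0, hB⟩ := exists_bound_chargeField (k := k) hη0 hη
  have hbi : Integrable fun z : Cyl k => bump a w z.1 := integrable_of_fst (by fun_prop) hsupp
  have hr := continuous_remSum_time hη0 hη W t
  have i1 : Integrable fun z : Cyl k => (z.1 - L) * bump a w z.1 :=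
    integrable_of_fst (X := |a| + |w|) (by fun_prop) fun z hz => by rw [hsupp z hz, mul_zero]
  have i3 : Integrable fun z : Cyl k => remSum η W t z 0 * bump a w z.1 :=
    integrable_of_fst (X := |a| + |w|) (by fun_prop) fun z hz => by rw [hsupp z hz, mul_zero]
  have i2 : ∀ b ∈ W, Integrable fun z : Cyl k => chargeField η (z - b (t : AddCircle β)) 0 * bump a w z.1 := fun b _ => by
    have hm : Measurable fun z : Cyl k => chargeField η (z - b (t : AddCircle β)) :=
      (measurable_chargeField hη0 hη).comp (measurable_id.sub_const _)
    have hm0 : Measurable fun z : Cyl k => chargeField η (z - b (t : AddCircle β)) 0 := by fun_prop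
    exact hbi.bdd_mul (c := B) hm0.aestronglyMeasurable
      (Eventually.of_forall fun z => (abs_coord_le_norm _ 0).trans (hB _))
  have e : ∀ z : Cyl k, fullField η L W t z 0 * bump a w z.1 = (z.1 - L) * bump a w z.1
      + (∑ b ∈ W, chargeField η (z - b (t : AddCircle β)) 0 * bump a w z.1) + remSum η W t z 0 * bump a w z.1 := fun z => by
    simp [fullField, chargeSum, add_mul, Finset.sum_mul]
  simp_rw [e]
  have s1 := integral_add (i1.add (integrable_finsetSum _ i2)) i3
  simp only [Pi.add_apply] at s1
  rw [s1, integral_add i1 (integrable_finsetSum _ i2), integral_finsetSum _ i2,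
    integral_fst (ψ := fun x => (x - L) * bump a w x) i1]
  -- The remainder has no flux through any slice, so only background and charges are counted.
  have e3 : ∫ z : Cyl k, remSum η W t z 0 * bump a w z.1 = 0 := by
    rw [integral_eq_iterated i3]
    simp_rw [integral_mul_const, integral_remSum_slice hη0 hη W t]
    simp
  rw [e3, add_zero, leftCount, sub_eq_add_neg, ← Finset.sum_neg_distrib]
  congr 1
  refine Finset.sum_congr rfl fun b _ => ?_
  exact integral_chargeField_flux hη0 hη hc (fun x => bump_of_abs hw) (hasDerivAt_bumpTail a w)
    (X := |a| + |w|) (fun x hx => bumpTail_of_ge hw (by linarith [le_abs_self a, le_abs_self w])) _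

lemma integrable_bumpTail (a w p : ℝ) (hw : 0 < w) :
    Integrable (fun z : Cyl k => bumpTail a w (z.1 + p)) (smear η (0 : Cyl k)) := by
  have := continuous_bumpTail a w
  refine Integrable.of_bound (C := 1) (Continuous.aestronglyMeasurable (by fun_prop)) (Eventually.of_forall fun z => ?_)
  have := bumpTail_mem (a := a) hw (z.1 + p)
  rw [Real.norm_eq_abs, abs_of_nonneg this.1]; exact this.2

lemma integral_bumpTail_mem (a p : ℝ) {w : ℝ} (hw : 0 < w) :
    ∫ z, bumpTail a w (z.1 + p) ∂(smear η (0 : Cyl k)) ∈ Icc (0 : ℝ) 1 := by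
  constructor
  · exact integral_nonneg fun z => (bumpTail_mem hw _).1
  · have := integral_mono (integrable_bumpTail (k := k) (η := η) a w p hw) (integrable_const (1 : ℝ))
      fun z => (bumpTail_mem hw _).2
    simpa using this

lemma integral_bumpTail_of_le (hη0 : 0 < η) (hη : η < 1 / 4) {a p w : ℝ} (hw : 0 < w) (hp : p + 1 ≤ a) :
    ∫ z, bumpTail a w (z.1 + p) ∂(smear η (0 : Cyl k)) = 1 := by
  rw [integral_congr_ae (g := fun _ => 1)]
  · simp
  · filter_upwards [ae_smear_cnorm (k := k) hη0] with z hz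
    exact bumpTail_of_le hw (by linarith [le_abs_self z.1])

lemma integral_bumpTail_of_ge (hη0 : 0 < η) (hη : η < 1 / 4) {a p w : ℝ} (hw : 0 < w) (hp : a + w + 1 ≤ p) :
    ∫ z, bumpTail a w (z.1 + p) ∂(smear η (0 : Cyl k)) = 0 := by
  rw [integral_congr_ae (g := fun _ => 0)]
  · simp
  · filter_upwards [ae_smear_cnorm (k := k) hη0] with z hz
    exact bumpTail_of_ge hw (by linarith [neg_abs_le z.1])

/-- A flux is bounded by the energy. -/
lemma abs_flux_le {F : Cyl k → Vec k} {a w E δ : ℝ} (hw : 0 < w) (hδ : 0 < δ) (hE0 : 0 ≤ E)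
    (hE : ∫⁻ z in slab k a (a + w), ‖F z‖ₑ ^ 2 ≤ ENNReal.ofReal E) :
    |∫ z : Cyl k, F z 0 * bump a w z.1| ≤ (δ * E + 4 / (w * δ)) / 2 := by
  have hpt : ∀ z : Cyl k, ‖F z 0 * bump a w z.1‖ₑ ≤ (slab k a (a + w)).indicator
      (fun z => ENNReal.ofReal (δ / 2) * ‖F z‖ₑ ^ 2 + ENNReal.ofReal ((2 / w) ^ 2 / δ / 2)) z := by
    intro z
    by_cases hz : z ∈ slab k a (a + w)
    · rw [indicator_of_mem hz, enorm_sq_eq, ← ENNReal.ofReal_mul (by positivity),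
        ← ENNReal.ofReal_add (by positivity) (by positivity), ← ofReal_norm]
      refine ENNReal.ofReal_le_ofReal ?_
      rw [Real.norm_eq_abs, abs_mul, abs_of_nonneg (bump_nonneg _ _ _)]
      have h1 := bump_le (a := a) hw z.1
      have h2 := abs_coord_le_norm (F z) 0
      have h3 : |F z 0| * bump a w z.1 ≤ ‖F z‖ * (2 / w) := by
        gcongr
        exact bump_nonneg _ _ _
      refine h3.trans ?_
      -- Young's inequality with weight `δ`, written as a square.
      have h4 : 0 ≤ (δ * ‖F z‖ - 2 / w) ^ 2 / (2 * δ) := by positivity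
      have h5 : (δ * ‖F z‖ - 2 / w) ^ 2 / (2 * δ) = δ / 2 * ‖F z‖ ^ 2 + (2 / w) ^ 2 / δ / 2 - ‖F z‖ * (2 / w) := by
        field_simp; ring
      linarith
    · rw [bump_of_notMem hw hz]; simp
  have hmS := measurableSet_slab (k := k) a (a + w)
  have h1 : ‖∫ z : Cyl k, F z 0 * bump a w z.1‖ₑ ≤ ENNReal.ofReal ((δ * E + 4 / (w * δ)) / 2) := by
    refine (enorm_integral_le_lintegral_enorm _).trans ((lintegral_mono hpt).trans ?_)
    rw [lintegral_indicator hmS, lintegral_add_right _ measurable_const, lintegral_const_mul' _ _ ENNReal.ofReal_ne_top,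
      lintegral_const, Measure.restrict_apply_univ, volume_slab, ← ENNReal.ofReal_mul (by positivity)]
    refine (add_le_add_left (mul_le_mul_right hE _) _).trans ?_
    rw [← ENNReal.ofReal_mul (by positivity), ← ENNReal.ofReal_add (by positivity)
      (mul_nonneg (by positivity) (by linarith))]
    refine ENNReal.ofReal_le_ofReal (le_of_eq ?_)
    field_simp; ring
  rw [← ofReal_norm] at h1
  exact (ENNReal.ofReal_le_ofReal_iff (by positivity)).1 h1

/-- Some time slice has at most the average energy. -/
lemma exists_time_le {f : ℝ → ℝ≥0∞} {E : ℝ} (hβ : 0 < β) (hf : Measurable f)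
    (h : ∫⁻ t in Icc 0 β, f t ≤ ENNReal.ofReal (β * E)) : ∃ t ∈ Icc 0 β, f t ≤ ENNReal.ofReal E := by
  have hv : volume (Icc 0 β) = ENNReal.ofReal β := by rw [Real.volume_Icc, sub_zero]
  obtain ⟨t, ht, hft⟩ := exists_le_setLAverage (μ := volume) (s := Icc 0 β) (f := f)
    (by rw [hv]; simpa using hβ) (by rw [hv]; exact ENNReal.ofReal_ne_top) hf.aemeasurable
  refine ⟨t, ht, hft.trans ?_⟩
  rw [setLAverage_eq, hv]
  refine ENNReal.div_le_of_le_mul ?_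
  rwa [← ENNReal.ofReal_mul' hβ.le, mul_comm]

end

section
variable {k : ℕ} {η β : ℝ}

/-! ### Configurations that can be screened -/


lemma abs_sub_le_xRange (hβ : 0 < β) (b : Bridge k β) (t : AddCircle β) : |(b t).1 - (b 0).1| ≤ xRange b := by
  have : Fact (0 < β) := ⟨hβ⟩
  have hc : Continuous fun t : AddCircle β => |(b t).1 - (b 0).1| := by fun_prop
  exact le_ciSup (f := fun t : AddCircle β => |(b t).1 - (b 0).1|) (isCompact_range hc).bddAbove t

lemma xRange_nonneg (hβ : 0 < β) (b : Bridge k β) : 0 ≤ xRange b :=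
  (abs_nonneg _).trans (abs_sub_le_xRange hβ b 0)

lemma abs_sub_le_two_mul (hβ : 0 < β) (b : Bridge k β) (t t₀ : AddCircle β) :
    |(b t).1 - (b t₀).1| ≤ 2 * xRange b := by
  have h1 := abs_sub_le_xRange hβ b t
  have h2 := abs_sub_le_xRange hβ b t₀
  have h3 : (b t).1 - (b t₀).1 = ((b t).1 - (b 0).1) - ((b t₀).1 - (b 0).1) := by ring
  rw [h3]
  exact (abs_sub _ _).trans (by linarith)

/-- A bridge that never meets `[p, q] × D` stays on one side of it. -/
lemma bridge_side (b : Bridge k β) {p q : ℝ} (hpq : p ≤ q) (h : ∀ t, (b t).1 ∉ Icc p q) :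
    (∀ t, (b t).1 < p) ∨ ∀ t, q < (b t).1 := by
  have hc : Continuous fun t : AddCircle β => (b t).1 := by fun_prop
  have hpre := isPreconnected_range hc
  have hs : ∀ t, (b t).1 < p ∨ q < (b t).1 := fun t => by
    have := h t
    rw [mem_Icc, not_and_or, not_le, not_le] at this
    exact this
  rcases hs 0 with h0 | h0
  · left
    intro t
    refine (hs t).resolve_right fun ht => ?_
    obtain ⟨u, hu⟩ := hpre.ordConnected.out (mem_range_self 0) (mem_range_self t) ⟨h0.le, hpq.trans ht.le⟩
    have hu' : (b u).1 = p := hu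
    exact h u ⟨hu'.ge, hu'.le.trans hpq⟩
  · right
    intro t
    refine (hs t).resolve_left fun ht => ?_
    obtain ⟨u, hu⟩ := hpre.ordConnected.out (mem_range_self t) (mem_range_self 0) ⟨ht.le, hpq.trans h0.le⟩
    have hu' : (b u).1 = p := hu
    exact h u ⟨hu'.ge, hu'.le.trans hpq⟩

open scoped Classical in
/-- The properties of the competitors of regular configurations that are used for screening. -/
structure CutData (η ε : ℝ) (R : ℕ) (L₁ : ℤ) (W : Finset (Bridge k β)) : Prop where
  pos : 0 < ε
  le : ε ≤ 1 / 20
  large : (2 / ε) ^ 8 < (R : ℝ)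
  inner : ∀ b ∈ W, ∀ t, (b t).1 ∈ Icc (ε * R) (R - ε * R) → b 0 ∈ slab k 0 R
  range : ∑ b ∈ W with b 0 ∈ slab k 0 R, max (xRange b ^ (7 / 6 : ℝ) - ε ^ (-(7 / 3) : ℝ)) 0 ≤ ε * R / 2
  energy : ∫⁻ t in Icc 0 β, ∫⁻ z in slab k 0 R, ‖fullField η L₁ W t z‖ₑ ^ 2 ≤ ENNReal.ofReal (β * (R / ε))

/-- Makes `ε R` large compared with `ε^(-7)`, which absorbs the threshold `ε^(-7/3)` of the range
condition. -/
lemma large_iff_pow {ε : ℝ} {R : ℕ} (hε : 0 < ε) (h : (2 / ε) ^ 8 < (R : ℝ)) : 256 * (1 / ε) ^ 7 < ε * R := by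
  have h1 : (2 / ε) ^ 8 = 256 * (1 / ε) ^ 8 := by rw [div_pow, div_pow]; ring
  rw [h1] at h
  have h2 := mul_lt_mul_of_pos_left h hε
  have h3 : ε * (256 * (1 / ε) ^ 8) = 256 * (1 / ε) ^ 7 := by field_simp
  linarith

namespace CutData
variable {ε : ℝ} {R : ℕ} {L₁ : ℤ} {W : Finset (Bridge k β)}

lemma twenty_le (h : CutData η ε R L₁ W) : 20 ≤ 1 / ε := by
  rw [le_div_iff₀ h.pos]; linarith [h.le]

lemma eps_mul_gt (h : CutData η ε R L₁ W) : 256 * (1 / ε) ^ 7 < ε * R := large_iff_pow h.pos h.large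

lemma eps_mul_ge (h : CutData η ε R L₁ W) : (8 : ℝ) ^ 7 ≤ ε * R := by
  have h1 : (20 : ℝ) ^ 7 ≤ (1 / ε) ^ 7 := pow_le_pow_left₀ (by norm_num) h.twenty_le 7
  have h2 := h.eps_mul_gt
  have h3 : (8 : ℝ) ^ 7 ≤ 20 ^ 7 := by norm_num
  linarith [pow_nonneg (show (0 : ℝ) ≤ 1 / ε by linarith [h.twenty_le]) 7]

lemma twenty_mul_le (h : CutData η ε R L₁ W) : 20 * (ε * R) ≤ R := by
  have h0 : (0 : ℝ) ≤ R := Nat.cast_nonneg R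
  nlinarith [h.le]

lemma rpow_neg_le (h : CutData η ε R L₁ W) : ε ^ (-(7 / 3) : ℝ) ≤ (1 / ε) ^ 7 := by
  rw [Real.rpow_neg h.pos.le, ← Real.inv_rpow h.pos.le, ← one_div, ← Real.rpow_natCast]
  exact Real.rpow_le_rpow_of_exponent_le (by linarith [h.twenty_le]) (by norm_num)

open scoped Classical in
-- One summand of the range condition is at most `ε R / 2`, and the threshold `ε^(-7/3) ≤ ε^(-7)` is
-- below `ε R / 256`.
lemma rpow_xRange_le (h : CutData η ε R L₁ W) {b : Bridge k β} (hb : b ∈ W) (hb0 : b 0 ∈ slab k 0 R) :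
    xRange b ^ (7 / 6 : ℝ) ≤ ε * R := by
  have h1 : max (xRange b ^ (7 / 6 : ℝ) - ε ^ (-(7 / 3) : ℝ)) 0 ≤ ε * R / 2 :=
    (Finset.single_le_sum (f := fun b : Bridge k β => max (xRange b ^ (7 / 6 : ℝ) - ε ^ (-(7 / 3) : ℝ)) 0)
      (fun _ _ => le_max_right _ _) (Finset.mem_filter.2 ⟨hb, hb0⟩)).trans h.range
  have h2 := h.rpow_neg_le
  have h3 := h.eps_mul_gt
  have h4 := (le_max_left _ _).trans h1
  have h5 : 0 ≤ (1 / ε) ^ 7 := by have := h.pos; positivity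
  linarith

lemma xRange_le_rpow (hβ : 0 < β) (h : CutData η ε R L₁ W) {b : Bridge k β} (hb : b ∈ W)
    (hb0 : b 0 ∈ slab k 0 R) : xRange b ≤ (ε * R) ^ (6 / 7 : ℝ) := by
  have h1 := h.rpow_xRange_le hb hb0
  have h0 := xRange_nonneg hβ b
  calc xRange b = (xRange b ^ (7 / 6 : ℝ)) ^ (6 / 7 : ℝ) := by
        rw [← Real.rpow_mul h0]; norm_num
    _ ≤ _ := Real.rpow_le_rpow (by positivity) h1 (by norm_num)

/-- Compared with `ε R`, the exponent `6/7` gains the factor `(ε R)^(1/7)`, which is at least `8`.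
-/
lemma xRange_le (hβ : 0 < β) (h : CutData η ε R L₁ W) {b : Bridge k β} (hb : b ∈ W)
    (hb0 : b 0 ∈ slab k 0 R) : xRange b ≤ ε * R / 8 := by
  refine (h.xRange_le_rpow hβ hb hb0).trans ?_
  have h1 := h.eps_mul_ge
  set y := ε * R with hy
  have hy0 : 0 < y := lt_of_lt_of_le (by norm_num) h1
  have h2 : (8 : ℝ) ≤ y ^ (1 / 7 : ℝ) := by
    calc (8 : ℝ) = ((8 : ℝ) ^ 7) ^ (1 / 7 : ℝ) := by
          rw [← Real.rpow_natCast, ← Real.rpow_mul (by norm_num)]; norm_num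
      _ ≤ _ := Real.rpow_le_rpow (by norm_num) h1 (by norm_num)
  have h3 : y ^ (6 / 7 : ℝ) * y ^ (1 / 7 : ℝ) = y := by
    rw [← Real.rpow_add hy0]; norm_num
  have h4 : 0 < y ^ (6 / 7 : ℝ) := by positivity
  rw [le_div_iff₀ (by norm_num)]
  nlinarith

lemma abs_sub_le_quarter (hβ : 0 < β) (h : CutData η ε R L₁ W) {b : Bridge k β} (hb : b ∈ W)
    {t₀ : AddCircle β} (ht₀ : (b t₀).1 ∈ Icc (ε * R) (R - ε * R)) (t : AddCircle β) :
    |(b t).1 - (b t₀).1| ≤ ε * R / 4 := by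
  have h1 := abs_sub_le_two_mul hβ b t t₀
  have h2 := h.xRange_le hβ hb (h.inner b hb t₀ ht₀)
  linarith

lemma exists_time (hβ : 0 < β) (hη0 : 0 < η) (hη : η < 1 / 4) (h : CutData η ε R L₁ W) :
    ∃ t ∈ Icc 0 β, ∫⁻ z in slab k 0 R, ‖fullField η L₁ W t z‖ₑ ^ 2 ≤ ENNReal.ofReal (R / ε) := by
  refine exists_time_le hβ ?_ h.energy
  have hm : Measurable fun q : ℝ × Cyl k => ‖fullField η L₁ W q.1 q.2‖ₑ ^ 2 :=
    ((measurable_fullField hη0 hη L₁ W).enorm).pow_const 2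
  exact hm.lintegral_prod_right'

open scoped Classical in
/-- At most `R` charges stay in the interior. -/
lemma card_interior_le (hβ : 0 < β) (hη0 : 0 < η) (hη : η < 1 / 4) (h : CutData η ε R L₁ W) :
    (W.filter fun b => ∀ t, (b t).1 ∈ Icc (5 * (ε * R) + 1) (R - 5 * (ε * R) - 1)).card ≤ R := by
  obtain ⟨t, ht, hE⟩ := h.exists_time hβ hη0 hη
  set w := ε * R with hw
  have hw1 := h.eps_mul_ge
  have hw20 := h.twenty_mul_le
  rw [← hw] at hw1 hw20
  have hw1' : (2097152 : ℝ) ≤ w := by norm_num at hw1; exact hw1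
  have hw0 : 0 < w := by linarith
  have hRpos : (0 : ℝ) < R := by linarith
  have hε := h.pos
  have hflux : ∀ a : ℝ, 0 ≤ a → a + w ≤ R →
      |∫ z : Cyl k, fullField η L₁ W t z 0 * bump a w z.1| ≤ w / 2 + 1 := by
    intro a ha haw
    have hsub : slab k a (a + w) ⊆ slab k 0 R := fun z hz => ⟨ha.trans hz.1, hz.2.trans haw⟩
    -- The weight `δ = ε²` turns the energy `R / ε` into `ε R`, of which half enters the flux bound;
    -- the other Young term stays below a constant because `ε R > 256 ε^(-7)`.
    have := abs_flux_le (F := fullField η L₁ W t) (a := a) hw0 (δ := ε ^ 2) (by positivity)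
      (E := R / ε) (by positivity) ((lintegral_mono_set hsub).trans hE)
    refine this.trans ?_
    have e1 : ε ^ 2 * (R / ε) = w := by rw [hw]; field_simp
    have e2 : 4 / (w * ε ^ 2) ≤ 2 := by
      rw [div_le_iff₀ (by positivity)]
      have h1 := h.eps_mul_gt
      rw [← hw] at h1
      have h2 : (1 / ε) ^ 7 * ε ^ 2 = (1 / ε) ^ 5 := by field_simp
      have h3 : (20 : ℝ) ^ 5 ≤ (1 / ε) ^ 5 := pow_le_pow_left₀ (by norm_num) h.twenty_le 5
      have h4 : 256 * (1 / ε) ^ 7 * ε ^ 2 ≤ w * ε ^ 2 := by gcongr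
      have h5 : (20 : ℝ) ^ 5 = 3200000 := by norm_num
      rw [mul_assoc, h2] at h4
      linarith
    rw [e1]
    linarith
  have g1 := hflux (4 * w) (by linarith) (by linarith)
  have g2 := hflux (R - 5 * w) (by linarith) (by linarith)
  rw [integral_fullField_mul_bump hη0 hη _ _ _ hw0] at g1 g2
  have m1 := integral_sub_mul_bump (a := 4 * w) hw0 L₁
  have m2 := integral_sub_mul_bump (a := R - 5 * w) hw0 L₁
  -- An interior bridge is counted fully at the right window and not at all at the left one; every
  -- other bridge contributes a nonnegative difference.
  have hcount : ((W.filter fun b => ∀ t, (b t).1 ∈ Icc (5 * w + 1) (R - 5 * w - 1)).card : ℝ)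
      ≤ leftCount η (R - 5 * w) w W t - leftCount η (4 * w) w W t := by
    rw [leftCount, leftCount, ← Finset.sum_sub_distrib, Finset.card_filter, Nat.cast_sum]
    refine Finset.sum_le_sum fun b hb => ?_
    by_cases hV : ∀ t, (b t).1 ∈ Icc (5 * w + 1) (R - 5 * w - 1)
    · rw [if_pos hV, integral_bumpTail_of_le hη0 hη hw0 (by linarith [(hV t).2]),
        integral_bumpTail_of_ge hη0 hη hw0 (by linarith [(hV t).1])]
      simp
    · rw [if_neg hV, Nat.cast_zero, sub_nonneg]
      refine integral_mono (integrable_bumpTail _ _ _ hw0) (integrable_bumpTail _ _ _ hw0) fun z => ?_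
      simp only
      rcases le_or_gt (z.1 + (b (t : AddCircle β)).1) (R - 5 * w) with hx | hx
      · rw [bumpTail_of_le (a := R - 5 * w) hw0 hx]
        exact (bumpTail_mem hw0 _).2
      · rw [bumpTail_of_ge (a := 4 * w) hw0 (by linarith)]
        exact (bumpTail_mem hw0 _).1
  have a1 := abs_le.1 g1
  have a2 := abs_le.1 g2
  -- The background means at the two windows differ by at most `R - 8w`, and the two fluxes add at
  -- most `w + 2`.
  have : ((W.filter fun b => ∀ t, (b t).1 ∈ Icc (5 * w + 1) (R - 5 * w - 1)).card : ℝ) ≤ R := by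
    linarith [m1.1, m2.2, a1.2, a2.1]
  exact_mod_cast this

end CutData

/-! ### Choosing the cut -/

open scoped Classical in
/-- The bridges that meet a neighbourhood of the two cuts at distance `s` from the faces. -/
def visitors (s R : ℝ) (W : Finset (Bridge k β)) : Finset (Bridge k β) :=
  W.filter fun b => ∃ t, (b t).1 ∈ Icc (s - 3) (s + 3) ∪ Icc (R - s - 3) (R - s + 3)

lemma card_le_of_abs_sub_le {S : Finset ℕ} {d : ℝ} (hd : 0 ≤ d)
    (h : ∀ i ∈ S, ∀ j ∈ S, |(i : ℝ) - j| ≤ d) : (S.card : ℝ) ≤ d + 1 := by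
  rcases S.eq_empty_or_nonempty with rfl | hS
  · simp; linarith
  have hsub : S ⊆ Finset.Icc (S.min' hS) (S.min' hS + ⌊d⌋₊) := fun i hi => by
    rw [Finset.mem_Icc]
    refine ⟨S.min'_le i hi, ?_⟩
    have h1 := (le_abs_self _).trans (h i hi _ (S.min'_mem hS))
    have h2 : i - S.min' hS ≤ ⌊d⌋₊ := by
      rw [Nat.le_floor_iff hd, Nat.cast_sub (S.min'_le i hi)]
      exact h1
    omega
  have h1 := Finset.card_le_card hsub
  rw [Nat.card_Icc] at h1
  have h2 : S.card ≤ ⌊d⌋₊ + 1 := by omega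
  calc (S.card : ℝ) ≤ (⌊d⌋₊ : ℝ) + 1 := by exact_mod_cast h2
    _ ≤ d + 1 := by linarith [Nat.floor_le hd]

lemma disjoint_cutZone {R s s' : ℝ} (h : s + 1 < s') (hR : s' + 1 < R - s' - 1) :
    Disjoint (cutZone k s R) (cutZone k s' R) := by
  rw [Set.disjoint_left]
  rintro z (⟨h1, h2⟩ | ⟨h1, h2⟩) (⟨h3, h4⟩ | ⟨h3, h4⟩) <;> linarith

lemma cutZone_subset {R s : ℝ} (h : 0 ≤ s) (hR : s + 1 ≤ R) : cutZone k s R ⊆ slab k 0 R := by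
  rintro z (⟨h1, h2⟩ | ⟨h1, h2⟩)
  · exact ⟨by linarith, by linarith⟩
  · exact ⟨by linarith, by linarith⟩

lemma sum_lintegral_cutZone_le {R : ℝ} {N : ℕ} {s : ℕ → ℝ} (hs : ∀ i j, i < j → s i + 1 < s j)
    (h0 : ∀ j < N, 0 ≤ s j) (hR : ∀ j < N, s j + 1 < R - s j - 1) (f : Cyl k → ℝ≥0∞) :
    ∑ j ∈ Finset.range N, ∫⁻ z in cutZone k (s j) R, f z ≤ ∫⁻ z in slab k 0 R, f z := by
  rw [← lintegral_biUnion_finset]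
  · refine lintegral_mono_set (iUnion₂_subset fun j hj => cutZone_subset (h0 j (Finset.mem_range.1 hj)) ?_)
    linarith [hR j (Finset.mem_range.1 hj), h0 j (Finset.mem_range.1 hj)]
  · intro i hi j hj hij
    rcases lt_or_gt_of_ne hij with h | h
    · exact disjoint_cutZone (hs i j h) (hR j (by simpa using hj))
    · exact (disjoint_cutZone (hs j i h) (hR i (by simpa using hi))).symm
  · exact fun j _ => measurableSet_cutZone _ _

/-- The bound on charge and energy near a good cut. -/
def cutBound (ε : ℝ) : ℝ := 8 * (1 / ε) * (7 + (1 / ε) ^ 7 + 1 / ε)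

namespace CutData
variable {ε : ℝ} {R : ℕ} {L₁ : ℤ} {W : Finset (Bridge k β)}

lemma cutBound_nonneg (h : CutData η ε R L₁ W) : 0 ≤ cutBound ε := by
  have := h.pos
  rw [cutBound]; positivity

open scoped Classical in
-- Each bridge is near at most `xRange b + 5` of the candidate cuts, and at most `R` bridges are
-- involved. The power `7/6` in the range condition dominates the range itself, so the ranges sum to
-- the excess `ε R / 2` plus a threshold per bridge.
lemma sum_card_visitors_le (hβ : 0 < β) (hη0 : 0 < η) (hη : η < 1 / 4) (h : CutData η ε R L₁ W) {N : ℕ}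
    (hN : (N : ℝ) ≤ ε * R / 4) :
    (∑ j ∈ Finset.range N, ((visitors (6 * (ε * R) + 4 * j) R W).card : ℝ)) ≤ R * (7 + (1 / ε) ^ 7) := by
  set w := ε * R with hw
  have hw1 := h.eps_mul_ge
  have hw20 := h.twenty_mul_le
  rw [← hw] at hw1 hw20
  have hw1' : (2097152 : ℝ) ≤ w := by norm_num at hw1; exact hw1
  set s : ℕ → ℝ := fun j => 6 * w + 4 * j with hs
  have hsm : ∀ j ∈ Finset.range N, 6 * w ≤ s j ∧ s j ≤ 7 * w := by
    intro j hj
    have h1 : (j : ℝ) < N := by exact_mod_cast Finset.mem_range.1 hj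
    have h2 : (0 : ℝ) ≤ j := Nat.cast_nonneg j
    exact ⟨by simp only [hs]; linarith, by simp only [hs]; linarith⟩
  set I := W.filter fun b => ∀ t, (b t).1 ∈ Icc (5 * w + 1) (R - 5 * w - 1) with hI
  have hIR : (I.card : ℝ) ≤ R := by exact_mod_cast h.card_interior_le hβ hη0 hη
  -- A bridge that comes near a candidate cut moves by at most `ε R / 4` from there, so it belongs
  -- to the interior bridges counted before.
  have hvis : ∀ j ∈ Finset.range N, ∀ b ∈ visitors (s j) R W, b ∈ I ∧ b 0 ∈ slab k 0 R := by
    intro j hj b hb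
    obtain ⟨hbW, t₀, ht₀⟩ := Finset.mem_filter.1 hb
    obtain ⟨hj1, hj2⟩ := hsm j hj
    have h1 : 6 * w - 3 ≤ (b t₀).1 ∧ (b t₀).1 ≤ R - 6 * w + 3 := by
      rcases ht₀ with h1 | h1
      · exact ⟨by linarith [h1.1], by linarith [h1.2]⟩
      · exact ⟨by linarith [h1.1], by linarith [h1.2]⟩
    have h2 : (b t₀).1 ∈ Icc (ε * R) (R - ε * R) := ⟨by rw [← hw]; linarith, by rw [← hw]; linarith⟩
    refine ⟨Finset.mem_filter.2 ⟨hbW, fun t => ?_⟩, h.inner b hbW t₀ h2⟩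
    have h3 := abs_le.1 (h.abs_sub_le_quarter hβ hbW h2 t)
    rw [← hw] at h3
    exact ⟨by linarith [h3.1], by linarith [h3.2]⟩
  set I' := I.filter fun b => b 0 ∈ slab k 0 R with hI'
  have hcount : ∀ b : Bridge k β, (((Finset.range N).filter fun j => b ∈ visitors (s j) R W).card : ℝ)
      ≤ xRange b + 5 := by
    intro b
    have hψ := xRange_nonneg hβ b
    set P : Finset ℕ := (Finset.range N).filter fun j => ∃ t, (b t).1 ∈ Icc (s j - 3) (s j + 3) with hP
    set Q : Finset ℕ := (Finset.range N).filter fun j => ∃ t, (b t).1 ∈ Icc (R - s j - 3) (R - s j + 3) with hQ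
    have hsub : ((Finset.range N).filter fun j => b ∈ visitors (s j) R W) ⊆ P ∪ Q := by
      intro j hj
      obtain ⟨hjN, hj⟩ := Finset.mem_filter.1 hj
      obtain ⟨-, t, ht⟩ := Finset.mem_filter.1 hj
      rcases ht with ht | ht
      · exact Finset.mem_union_left _ (Finset.mem_filter.2 ⟨hjN, t, ht⟩)
      · exact Finset.mem_union_right _ (Finset.mem_filter.2 ⟨hjN, t, ht⟩)
    -- Cuts are `4` apart and are met within distance `3`, so two of them met by one bridge satisfy
    -- `4 |i - j| ≤ 2 xRange b + 6`.
    have hPc : (P.card : ℝ) ≤ (xRange b / 2 + 3 / 2) + 1 := by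
      refine card_le_of_abs_sub_le (by positivity) fun i hi j hj => ?_
      obtain ⟨-, t, ht⟩ := Finset.mem_filter.1 hi
      obtain ⟨-, t', ht'⟩ := Finset.mem_filter.1 hj
      have h1 := abs_le.1 (abs_sub_le_two_mul hβ b t t')
      simp only [hs, mem_Icc] at ht ht'
      rw [abs_le]
      constructor <;> linarith [ht.1, ht.2, ht'.1, ht'.2, h1.1, h1.2]
    have hQc : (Q.card : ℝ) ≤ (xRange b / 2 + 3 / 2) + 1 := by
      refine card_le_of_abs_sub_le (by positivity) fun i hi j hj => ?_
      obtain ⟨-, t, ht⟩ := Finset.mem_filter.1 hi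
      obtain ⟨-, t', ht'⟩ := Finset.mem_filter.1 hj
      have h1 := abs_le.1 (abs_sub_le_two_mul hβ b t t')
      simp only [hs, mem_Icc] at ht ht'
      rw [abs_le]
      constructor <;> linarith [ht.1, ht.2, ht'.1, ht'.2, h1.1, h1.2]
    have h1 : (((Finset.range N).filter fun j => b ∈ visitors (s j) R W).card : ℝ) ≤ P.card + Q.card := by
      exact_mod_cast (Finset.card_le_card hsub).trans (Finset.card_union_le _ _)
    linarith
  have hswap : (∑ j ∈ Finset.range N, ((visitors (s j) R W).card : ℝ))
      = ∑ b ∈ I', (((Finset.range N).filter fun j => b ∈ visitors (s j) R W).card : ℝ) := by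
    have h1 : ∀ j ∈ Finset.range N, ((visitors (s j) R W).card : ℝ)
        = ∑ b ∈ I', if b ∈ visitors (s j) R W then (1 : ℝ) else 0 := by
      intro j hj
      rw [Finset.sum_boole]
      congr 2
      ext b
      rw [Finset.mem_filter]
      exact ⟨fun hb => ⟨Finset.mem_filter.2 (hvis j hj b hb), hb⟩, fun hb => hb.2⟩
    rw [Finset.sum_congr rfl h1, Finset.sum_comm]
    exact Finset.sum_congr rfl fun b _ => Finset.sum_boole _ _
  have hI'c : (I'.card : ℝ) ≤ R := le_trans (by exact_mod_cast Finset.card_filter_le _ _) hIR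
  have hb : ∀ b ∈ I', (((Finset.range N).filter fun j => b ∈ visitors (s j) R W).card : ℝ)
      ≤ max (xRange b ^ (7 / 6 : ℝ) - ε ^ (-(7 / 3) : ℝ)) 0 + ((1 / ε) ^ 7 + 6) := by
    intro b _
    refine (hcount b).trans ?_
    have h0 := xRange_nonneg hβ b
    have h1 : xRange b ≤ xRange b ^ (7 / 6 : ℝ) + 1 := by
      rcases le_total (xRange b) 1 with hx | hx
      · have : 0 ≤ xRange b ^ (7 / 6 : ℝ) := by positivity
        linarith
      · have := Real.rpow_le_rpow_of_exponent_le hx (show (1 : ℝ) ≤ 7 / 6 by norm_num)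
        rw [Real.rpow_one] at this
        linarith
    have h2 := h.rpow_neg_le
    have h3 := le_max_left (xRange b ^ (7 / 6 : ℝ) - ε ^ (-(7 / 3) : ℝ)) 0
    linarith
  have hpos := h.pos
  have hψs : ∑ b ∈ I', max (xRange b ^ (7 / 6 : ℝ) - ε ^ (-(7 / 3) : ℝ)) 0 ≤ w / 2 := by
    refine le_trans (Finset.sum_le_sum_of_subset_of_nonneg ?_ fun _ _ _ => le_max_right _ _) h.range
    intro b hb
    obtain ⟨h1, h2⟩ := Finset.mem_filter.1 hb
    exact Finset.mem_filter.2 ⟨(Finset.mem_filter.1 h1).1, h2⟩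
  have h1 := Finset.sum_le_sum hb
  rw [Finset.sum_add_distrib, Finset.sum_const, nsmul_eq_mul] at h1
  have h2 : (I'.card : ℝ) * ((1 / ε) ^ 7 + 6) ≤ R * ((1 / ε) ^ 7 + 6) := by gcongr
  rw [hswap]
  linarith

/-- There is a cut near which there are few bridges and little energy. -/
lemma exists_cut (hβ : 0 < β) (hη0 : 0 < η) (hη : η < 1 / 4) (h : CutData η ε R L₁ W) :
    ∃ s ∈ Icc (6 * (ε * R)) (7 * (ε * R)), ((visitors s R W).card : ℝ) ≤ cutBound ε ∧
      ∫⁻ t in Icc 0 β, ∫⁻ z in cutZone k s R, ‖fullField η L₁ W t z‖ₑ ^ 2 ≤ ENNReal.ofReal (β * cutBound ε) := by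
  have hw1 := h.eps_mul_ge
  have hw20 := h.twenty_mul_le
  have hpos := h.pos
  have hw1' : (2097152 : ℝ) ≤ ε * R := by norm_num at hw1; exact hw1
  -- Spacing `4` keeps the cut zones disjoint, and `ε R / 4` candidates fit into `[6 ε R, 7 ε R]`.
  set N : ℕ := ⌊ε * R / 4⌋₊ with hNdef
  have hN : (N : ℝ) ≤ ε * R / 4 := Nat.floor_le (by linarith)
  have hN' : ε * R / 8 ≤ N := by
    have := Nat.lt_floor_add_one (ε * R / 4)
    rw [← hNdef] at this
    linarith
  have hsum := h.sum_card_visitors_le hβ hη0 hη hN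
  set s : ℕ → ℝ := fun j => 6 * (ε * R) + 4 * j with hs
  have hsm : ∀ j < N, 6 * (ε * R) ≤ s j ∧ s j ≤ 7 * (ε * R) := by
    intro j hj
    have h1 : (j : ℝ) < N := by exact_mod_cast hj
    have h2 : (0 : ℝ) ≤ j := Nat.cast_nonneg j
    exact ⟨by simp only [hs]; linarith, by simp only [hs]; linarith⟩
  set Z : ℕ → ℝ≥0∞ := fun j => ∫⁻ t in Icc 0 β, ∫⁻ z in cutZone k (s j) R, ‖fullField η L₁ W t z‖ₑ ^ 2 with hZ
  have hm : Measurable fun q : ℝ × Cyl k => ‖fullField η L₁ W q.1 q.2‖ₑ ^ 2 :=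
    ((measurable_fullField hη0 hη L₁ W).enorm).pow_const 2
  have hZs : ∑ j ∈ Finset.range N, Z j ≤ ENNReal.ofReal (β * (R / ε)) := by
    refine le_trans ?_ h.energy
    simp only [hZ]
    rw [← lintegral_finsetSum]
    · refine lintegral_mono fun t => ?_
      refine sum_lintegral_cutZone_le (s := s) ?_ ?_ ?_ _
      · intro i j hij
        have : (i : ℝ) + 1 ≤ j := by exact_mod_cast hij
        simp only [hs]; linarith
      · intro j hj; linarith [(hsm j hj).1]
      · intro j hj; linarith [(hsm j hj).2]
    · exact fun j _ => hm.lintegral_prod_right'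
  have hZfin : ∀ j ∈ Finset.range N, Z j ≠ ∞ := fun j hj =>
    ((Finset.single_le_sum (fun _ _ => zero_le) hj).trans hZs).trans_lt ENNReal.ofReal_lt_top |>.ne
  have hR0 : (0 : ℝ) ≤ R := Nat.cast_nonneg R
  have hZr : ∑ j ∈ Finset.range N, (Z j).toReal ≤ β * (R / ε) := by
    rw [← ENNReal.toReal_sum hZfin]
    exact ENNReal.toReal_le_of_le_ofReal (by positivity) hZs
  have hNpos : 0 < N := by
    have : (0 : ℝ) < N := by linarith
    exact_mod_cast this
  have hX := h.cutBound_nonneg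
  -- Pigeonhole for the sum of both quantities, so that one cut is good for both. The total `R (7 +
  -- ε^(-7)) + R / ε` is shared by at least `ε R / 8` candidates; `cutBound` is this quotient.
  obtain ⟨j, hj, hle⟩ := Finset.exists_le_of_sum_le (s := Finset.range N) (f := fun j =>
      ((visitors (s j) R W).card : ℝ) + (Z j).toReal / β) (g := fun _ => cutBound ε)
      ⟨0, Finset.mem_range.2 hNpos⟩ (by
    rw [Finset.sum_add_distrib, ← Finset.sum_div, Finset.sum_const, Finset.card_range, nsmul_eq_mul]
    have h1 : (∑ j ∈ Finset.range N, (Z j).toReal) / β ≤ R / ε := by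
      rw [div_le_iff₀ hβ]; linarith
    have h2 : ε * R / 8 * cutBound ε ≤ N * cutBound ε := by gcongr
    have h3 : ε * R / 8 * cutBound ε = R * (7 + (1 / ε) ^ 7) + R / ε := by
      rw [cutBound]; field_simp
    linarith)
  have hj' := Finset.mem_range.1 hj
  refine ⟨s j, hsm j hj', ?_, ?_⟩
  · have : 0 ≤ (Z j).toReal / β := by positivity
    linarith
  · have h1 : (Z j).toReal / β ≤ cutBound ε := by
      have : (0 : ℝ) ≤ (visitors (s j) R W).card := Nat.cast_nonneg _
      linarith
    rw [div_le_iff₀ hβ] at h1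
    refine (ENNReal.ofReal_toReal (hZfin j hj)).symm.trans_le ?_
    exact ENNReal.ofReal_le_ofReal (by linarith)

end CutData

/-! ### Placing charges near the faces -/

open scoped Classical in
/-- Constant bridges at the abscissae `x j`, `j < n`. -/
def siteBridges (k : ℕ) (β : ℝ) (x : ℕ → ℝ) (n : ℕ) : Finset (Bridge k β) :=
  (Finset.range n).image fun j => constBridge k β (x j)

lemma mem_siteBridges {x : ℕ → ℝ} {n : ℕ} {b : Bridge k β} :
    b ∈ siteBridges k β x n ↔ ∃ j < n, constBridge k β (x j) = b := by
  simp [siteBridges]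

open scoped Classical in
lemma card_siteBridges {x : ℕ → ℝ} (hx : Function.Injective x) (n : ℕ) : (siteBridges k β x n).card = n := by
  rw [siteBridges, Finset.card_image_of_injective _ fun i j h => hx (constBridge_injective h), Finset.card_range]

open scoped Classical in
lemma chargeSum_siteBridges {x : ℕ → ℝ} (hx : Function.Injective x) (n : ℕ) (t : ℝ) (z : Cyl k) :
    chargeSum η (siteBridges k β x n) t z = ∑ j ∈ Finset.range n, chargeField η (z - (x j, 0)) := by
  rw [chargeSum, siteBridges, Finset.sum_image fun i _ j _ h => hx (constBridge_injective h)]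
  rfl

/-- The number of regular sites between a face and the cut. -/
def siteNumber (s : ℝ) (n : ℕ) : ℕ := min n (⌊s⌋₊ - 5)

/-- Sites near the left face. -/
def leftSites (k : ℕ) (β s : ℝ) (n : ℕ) : Finset (Bridge k β) := siteBridges k β (sitePos (siteNumber s n)) n

/-- Sites near the right face. -/
def rightSites (k : ℕ) (β s R : ℝ) (n : ℕ) : Finset (Bridge k β) :=
  siteBridges k β (fun j => R - sitePos (siteNumber s n) j) n

lemma sub_sitePos_injective (R : ℝ) (J : ℕ) : Function.Injective fun j => R - sitePos J j := fun i j h =>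
  sitePos_injective J (by simpa using h)

open scoped Classical in
/-- The screened configuration. -/
def screenSet (s R : ℝ) (K : Finset (Bridge k β)) (m n : ℕ) : Finset (Bridge k β) :=
  K ∪ (leftSites k β s m ∪ rightSites k β s R n)

/-- The requirements on the bridges that are kept and on the number of sites. -/
structure ScreenData (s R X y : ℝ) (K : Finset (Bridge k β)) (m n : ℕ) : Prop where
  X_nonneg : 0 ≤ X
  y_nonneg : 0 ≤ y
  large : 2 * X + 20 ≤ s
  small : 2 * s + 20 ≤ R
  range_small : 2 * y + 3 ≤ s
  meet : ∀ b ∈ K, ∃ t, (b t).1 ∈ Icc (s - 2) (R - s + 2)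
  range : ∀ b ∈ K, ∀ t t', |(b t).1 - (b t').1| ≤ 2 * y
  visit : ((visitors s R K).card : ℝ) ≤ X
  left : |(m : ℝ) - s| ≤ 2 * X + 3
  right : |(n : ℝ) - s| ≤ 2 * X + 3
  total : m + n + K.card = R

lemma siteNumber_le_left (s : ℝ) (n : ℕ) : siteNumber s n ≤ n := min_le_left _ _

/-- Stopping five units before the cut separates the sites from the kept bridges. As `n` deviates
from `s` by at most `2 X + 3`, the number of regular sites falls short of `s` by at most `2 X + 9`.
-/
lemma siteNumber_bounds {s X : ℝ} {n : ℕ} (hX : 0 ≤ X) (h : 2 * X + 20 ≤ s) (hn : |(n : ℝ) - s| ≤ 2 * X + 3) :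
    s - (2 * X + 9) ≤ siteNumber s n ∧ (siteNumber s n : ℝ) ≤ s - 5 ∧ 0 < siteNumber s n := by
  have h0 : 0 ≤ s := by linarith
  have h1 : (⌊s⌋₊ : ℝ) ≤ s := Nat.floor_le h0
  have h2 : s < ⌊s⌋₊ + 1 := Nat.lt_floor_add_one s
  have h3 : 5 ≤ ⌊s⌋₊ := Nat.le_floor (by push_cast; linarith)
  have h4 : ((⌊s⌋₊ - 5 : ℕ) : ℝ) = ⌊s⌋₊ - 5 := by rw [Nat.cast_sub h3]; norm_num
  have h5 := abs_le.1 hn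
  have h6 : (siteNumber s n : ℝ) = min (n : ℝ) (⌊s⌋₊ - 5) := by rw [siteNumber, Nat.cast_min, h4]
  have h7 : s - (2 * X + 9) ≤ siteNumber s n := by
    rw [h6]; exact le_min (by linarith) (by linarith)
  refine ⟨h7, ?_, ?_⟩
  · rw [h6]; exact (min_le_right _ _).trans (by linarith)
  · have : (0 : ℝ) < siteNumber s n := by linarith
    exact_mod_cast this

/-- The uniform bound on the background field near the cuts. -/
def nearBound (X B : ℝ) : ℝ := (B + 1) + 1 + (2 * X + 10) + (5 * X + 12) * (B + 1)

namespace ScreenData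
variable {s R X y : ℝ} {K : Finset (Bridge k β)} {m n : ℕ}

lemma left_mem (h : ScreenData s R X y K m n) {b : Bridge k β} (hb : b ∈ leftSites k β s m) (t : AddCircle β) :
    (b t).1 ∈ Icc (1 / 2) (s - 4) := by
  obtain ⟨j, -, rfl⟩ := mem_siteBridges.1 hb
  obtain ⟨h1, h2, h3⟩ := siteNumber_bounds h.X_nonneg h.large h.left
  rw [constBridge_apply]
  exact ⟨half_le_sitePos h3 j, by linarith [(sitePos_mem (siteNumber s m) j).2]⟩

lemma right_mem (h : ScreenData s R X y K m n) {b : Bridge k β} (hb : b ∈ rightSites k β s R n) (t : AddCircle β) :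
    (b t).1 ∈ Icc (R - s + 4) (R - 1 / 2) := by
  obtain ⟨j, -, rfl⟩ := mem_siteBridges.1 hb
  obtain ⟨h1, h2, h3⟩ := siteNumber_bounds h.X_nonneg h.large h.right
  rw [constBridge_apply]
  exact ⟨by linarith [(sitePos_mem (siteNumber s n) j).2], by linarith [half_le_sitePos h3 j]⟩

lemma mid_mem (h : ScreenData s R X y K m n) {b : Bridge k β} (hb : b ∈ K) (t : AddCircle β) :
    (b t).1 ∈ Icc (s - 2 - 2 * y) (R - s + 2 + 2 * y) := by
  obtain ⟨t₀, ht₀⟩ := h.meet b hb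
  have := abs_le.1 (h.range b hb t t₀)
  exact ⟨by linarith [ht₀.1], by linarith [ht₀.2]⟩

open scoped Classical in
-- By connectedness, a bridge that meets the kept region but avoids the windows around both cuts
-- remains strictly between them.
lemma mid_of_not_visitor (h : ScreenData s R X y K m n) {b : Bridge k β} (hb : b ∈ K) (hv : b ∉ visitors s R K)
    (t : AddCircle β) : (b t).1 ∈ Ioo (s + 3) (R - s - 3) := by
  obtain ⟨t₀, ht₀⟩ := h.meet b hb
  have hs := h.small
  have hv' : ∀ t, (b t).1 ∉ Icc (s - 3) (s + 3) ∪ Icc (R - s - 3) (R - s + 3) := fun t ht =>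
    hv (Finset.mem_filter.2 ⟨hb, t, ht⟩)
  constructor
  · rcases bridge_side b (p := s - 3) (q := s + 3) (by linarith) fun t ht => hv' t (Or.inl ht) with h1 | h1
    · linarith [h1 t₀, ht₀.1]
    · exact h1 t
  · rcases bridge_side b (p := R - s - 3) (q := R - s + 3) (by linarith) fun t ht => hv' t (Or.inr ht) with h1 | h1
    · exact h1 t
    · linarith [h1 t₀, ht₀.2]

open scoped Classical in
lemma disjoint_sites (h : ScreenData s R X y K m n) : Disjoint (leftSites k β s m) (rightSites k β s R n) := by
  rw [Finset.disjoint_left]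
  intro b h1 h2
  linarith [(h.left_mem h1 0).2, (h.right_mem h2 0).1, h.small]

open scoped Classical in
lemma disjoint_mid (h : ScreenData s R X y K m n) : Disjoint K (leftSites k β s m ∪ rightSites k β s R n) := by
  rw [Finset.disjoint_left]
  intro b h1 h2
  obtain ⟨t, ht⟩ := h.meet b h1
  rcases Finset.mem_union.1 h2 with h2 | h2
  · linarith [(h.left_mem h2 t).2, ht.1]
  · linarith [(h.right_mem h2 t).1, ht.2]

open scoped Classical in
lemma card_screenSet (h : ScreenData s R X y K m n) : ((screenSet s R K m n).card : ℝ) = R := by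
  rw [screenSet, Finset.card_union_of_disjoint h.disjoint_mid, Finset.card_union_of_disjoint h.disjoint_sites,
    leftSites, rightSites, card_siteBridges (sitePos_injective _), card_siteBridges (sub_sitePos_injective _ _),
    ← h.total]
  push_cast
  ring

open scoped Classical in
lemma mem_screenSet (h : ScreenData s R X y K m n) {b : Bridge k β} (hb : b ∈ screenSet s R K m n) (t : AddCircle β) :
    (b t).1 ∈ Icc (1 / 2) (R - 1 / 2) := by
  have h1 := h.small
  have h2 := h.range_small
  have h3 := h.y_nonneg
  rcases Finset.mem_union.1 hb with hb | hb
  · have := h.mid_mem hb t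
    exact ⟨by linarith [this.1], by linarith [this.2]⟩
  · rcases Finset.mem_union.1 hb with hb | hb
    · have := h.left_mem hb t
      exact ⟨this.1, by linarith [this.2]⟩
    · have := h.right_mem hb t
      exact ⟨by linarith [this.1], this.2⟩

open scoped Classical in
-- The sites lie outside `[s - 2, R - s + 2]`, so there only the kept bridges are seen.
lemma mem_screenSet_iff (h : ScreenData s R X y K m n) {b : Bridge k β} {t : AddCircle β}
    (ht : (b t).1 ∈ Icc (s - 2) (R - s + 2)) : b ∈ screenSet s R K m n ↔ b ∈ K := by
  refine ⟨fun hb => ?_, fun hb => Finset.mem_union_left _ hb⟩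
  rcases Finset.mem_union.1 hb with hb | hb
  · exact hb
  · rcases Finset.mem_union.1 hb with hb | hb
    · linarith [(h.left_mem hb t).2, ht.1]
    · linarith [(h.right_mem hb t).1, ht.2]

open scoped Classical in
lemma chargeSum_screenSet (h : ScreenData s R X y K m n) (t : ℝ) (z : Cyl k) :
    chargeSum η (screenSet s R K m n) t z = chargeSum η K t z
      + (chargeSum η (leftSites k β s m) t z + chargeSum η (rightSites k β s R n) t z) := by
  rw [chargeSum, screenSet, Finset.sum_union h.disjoint_mid, Finset.sum_union h.disjoint_sites]
  rfl

lemma chargeSum_left (hη0 : 0 < η) (hη : η < 1 / 4) (h : ScreenData s R X y K m n) {t : ℝ} {z : Cyl k}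
    (hz : s - 3 ≤ z.1) : chargeSum η (leftSites k β s m) t z = (-(m : ℝ)) • bvec 0 := by
  rw [chargeSum_of_gt hη0 hη fun b hb => by linarith [(h.left_mem hb t).2], leftSites,
    card_siteBridges (sitePos_injective _)]

lemma chargeSum_right (hη : η < 1 / 4) (h : ScreenData s R X y K m n) {t : ℝ} {z : Cyl k}
    (hz : z.1 ≤ R - s + 3) : chargeSum η (rightSites k β s R n) t z = 0 :=
  chargeSum_of_lt hη fun b hb => by linarith [(h.right_mem hb t).1]

/-- Between the cuts the left sites act as the constant `-m e_x` and the right sites are not felt.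
-/
lemma bgField_mid (hη0 : 0 < η) (hη : η < 1 / 4) (h : ScreenData s R X y K m n) {t : ℝ} {z : Cyl k}
    (hz : z.1 ∈ Icc (s - 3) (R - s + 3)) :
    bgField η (screenSet s R K m n) t z = (z.1 - m) • bvec 0 + chargeSum η K t z := by
  rw [bgField, h.chargeSum_screenSet, h.chargeSum_left hη0 hη hz.1, h.chargeSum_right hη hz.2, sub_smul]
  module

open scoped Classical in
-- Near a cut only the visitors contribute, and there are at most `X` of them.
lemma norm_sum_mid_le {B : ℝ} (hB0 : 0 ≤ B) (h : ScreenData s R X y K m n) {F : Bridge k β → Vec k}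
    (hF : ∀ b, ‖F b‖ ≤ B) (h0 : ∀ b ∈ K, b ∉ visitors s R K → F b = 0) : ‖∑ b ∈ K, F b‖ ≤ X * B := by
  have hsub : visitors s R K ⊆ K := Finset.filter_subset _ _
  rw [← Finset.sum_subset hsub h0]
  refine (norm_sum_le _ _).trans ((Finset.sum_le_card_nsmul _ _ B fun b _ => hF b).trans ?_)
  rw [nsmul_eq_mul]
  exact mul_le_mul_of_nonneg_right h.visit hB0

/-- The regular sites compensate the background up to one cell. What remains is a stretch of at most
`2 X + 10` beyond them, at most `4 X + 12` surplus sites and at most `X` visitors. Farther than `2 X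
+ 10 + 2 y` from the cut, neither surplus sites nor kept bridges are felt and the bound no longer
involves `X`. -/
lemma norm_bgField_left {B : ℝ} (hη0 : 0 < η) (hη : η < 1 / 4) (hB0 : 0 ≤ B)
    (hB : ∀ z : Cyl k, ‖chargeField η z‖ ≤ B) (h : ScreenData s R X y K m n) {t : ℝ} {z : Cyl k}
    (hz0 : 0 ≤ z.1) (hz : z.1 ≤ s + 1) :
    ‖bgField η (screenSet s R K m n) t z‖ ≤ nearBound X B ∧
      (z.1 < s - (2 * X + 10) - 2 * y → ‖bgField η (screenSet s R K m n) t z‖ ≤ B + 2) := by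
  obtain ⟨j1, j2, j3⟩ := siteNumber_bounds h.X_nonneg h.large h.left
  have hX := h.X_nonneg
  have hy := h.y_nonneg
  have hm := abs_le.1 h.left
  set J := siteNumber s m with hJ
  have e : bgField η (screenSet s R K m n) t z
      = (z.1 • bvec 0 + ∑ j ∈ Finset.range m, chargeField η (z - (sitePos J j, 0))) + chargeSum η K t z := by
    rw [bgField, h.chargeSum_screenSet, h.chargeSum_right hη (by linarith [h.small]), leftSites,
      chargeSum_siteBridges (sitePos_injective _)]
    rw [add_zero, add_comm (chargeSum η K t z), add_assoc]
  have hs := norm_sites_le (norm_bvec (0 : Fin (k + 1))) hB0 (siteNumber_le_left s m)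
    (F := fun j => chargeField η (z - (sitePos J j, 0))) hz0
    (fun j _ hj => chargeField_of_lt hη (by rw [Prod.fst_sub]; simp only; linarith))
    (fun j _ hj => chargeField_of_gt hη0 hη (by rw [Prod.fst_sub]; simp only; linarith)) (fun j => hB _)
  rw [e]
  constructor
  · refine (norm_add_le _ _).trans ?_
    have h1 : ‖chargeSum η K t z‖ ≤ X * B := h.norm_sum_mid_le hB0 (fun b => hB _) fun b hb hv =>
      chargeField_of_lt hη (by rw [Prod.fst_sub]; linarith [(h.mid_of_not_visitor hb hv t).1])
    have h2 : max 0 (z.1 - J) ≤ 2 * X + 10 := max_le (by linarith) (by linarith)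
    have h3 : ((m : ℝ) - J) * B ≤ (4 * X + 12) * B := by gcongr; linarith
    have h4 := hs.1
    rw [nearBound]
    nlinarith
  · intro hz'
    have h1 : chargeSum η K t z = 0 := chargeSum_of_lt hη fun b hb => by linarith [(h.mid_mem hb t).1]
    rw [h1, add_zero]
    exact (hs.2 (by linarith)).trans (by linarith)

/-- The mirror image of the left estimate. Adding `e_x` to each charge field makes it vanish to the
right of the charge, and the total number `R` of charges rewrites the background as seen from the
right face. The shifted fields are bounded by `B + 1`, which explains this constant in `nearBound`.
-/
lemma norm_bgField_right {B : ℝ} (hη0 : 0 < η) (hη : η < 1 / 4) (hB0 : 0 ≤ B)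
    (hB : ∀ z : Cyl k, ‖chargeField η z‖ ≤ B) (h : ScreenData s R X y K m n) {t : ℝ} {z : Cyl k}
    (hz0 : z.1 ≤ R) (hz : R - s - 1 ≤ z.1) :
    ‖bgField η (screenSet s R K m n) t z‖ ≤ nearBound X B ∧
      (R - z.1 < s - (2 * X + 10) - 2 * y → ‖bgField η (screenSet s R K m n) t z‖ ≤ B + 2) := by
  obtain ⟨j1, j2, j3⟩ := siteNumber_bounds h.X_nonneg h.large h.right
  have hX := h.X_nonneg
  have hy := h.y_nonneg
  have hn := abs_le.1 h.right
  set J := siteNumber s n with hJ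
  have hB' : ∀ z : Cyl k, ‖chargeField η z + bvec 0‖ ≤ B + 1 := fun z =>
    (norm_add_le _ _).trans (by rw [norm_bvec]; linarith [hB z])
  have e : bgField η (screenSet s R K m n) t z
      = ((R - z.1) • -bvec 0 + ∑ j ∈ Finset.range n, (chargeField η (z - (R - sitePos J j, 0)) + bvec 0))
        + ∑ b ∈ K, (chargeField η (z - b (t : AddCircle β)) + bvec 0) := by
    rw [bgField, h.chargeSum_screenSet, h.chargeSum_left hη0 hη (by linarith [h.small]), rightSites,
      chargeSum_siteBridges (sub_sitePos_injective _ _), Finset.sum_add_distrib, Finset.sum_add_distrib,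
      Finset.sum_const, Finset.sum_const, Finset.card_range, ← Nat.cast_smul_eq_nsmul ℝ, ← Nat.cast_smul_eq_nsmul ℝ,
      chargeSum, ← hJ, show R - z.1 = (m + n + K.card) - z.1 by rw [h.total]]
    module
  have hs := norm_sites_le (w := -bvec 0) (by rw [norm_neg, norm_bvec]) (by linarith : 0 ≤ B + 1)
    (siteNumber_le_left s n) (F := fun j => chargeField η (z - (R - sitePos J j, 0)) + bvec 0) (u := R - z.1)
    (by linarith)
    (fun j _ hj => by
      rw [chargeField_of_gt hη0 hη (by rw [Prod.fst_sub]; simp only; linarith)]; simp)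
    (fun j _ hj => by
      rw [chargeField_of_lt hη (by rw [Prod.fst_sub]; simp only; linarith)]; simp) (fun j => hB' _)
  rw [e]
  constructor
  · refine (norm_add_le _ _).trans ?_
    have h1 : ‖∑ b ∈ K, (chargeField η (z - b (t : AddCircle β)) + bvec 0)‖ ≤ X * (B + 1) :=
      h.norm_sum_mid_le (by linarith) (fun b => hB' _) fun b hb hv => by
        rw [chargeField_of_gt hη0 hη (by rw [Prod.fst_sub]; linarith [(h.mid_of_not_visitor hb hv t).2])]; simp
    have h2 : max 0 (R - z.1 - J) ≤ 2 * X + 10 := max_le (by linarith) (by linarith)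
    have h3 : ((n : ℝ) - J) * (B + 1) ≤ (4 * X + 12) * (B + 1) := by gcongr; linarith
    have h4 := hs.1
    rw [nearBound]
    nlinarith
  · intro hz'
    have h1 : ∑ b ∈ K, (chargeField η (z - b (t : AddCircle β)) + bvec 0) = (0 : Vec k) :=
      Finset.sum_eq_zero fun b hb => by
        rw [chargeField_of_gt hη0 hη (by rw [Prod.fst_sub]; linarith [(h.mid_mem hb t).2])]; simp
    rw [h1, add_zero]
    exact (hs.2 (by linarith)).trans (by linarith)

end ScreenData

lemma lintegral_slab_le {A : Cyl k → Vec k} {a b c : ℝ} (h : ∀ z ∈ slab k a b, ‖A z‖ ≤ c) :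
    ∫⁻ z in slab k a b, ‖A z‖ₑ ^ 2 ≤ ENNReal.ofReal (c ^ 2 * (b - a)) := by
  calc ∫⁻ z in slab k a b, ‖A z‖ₑ ^ 2 ≤ ∫⁻ _ in slab k a b, ENNReal.ofReal (c ^ 2) := by
        refine setLIntegral_mono measurable_const fun z hz => ?_
        rw [enorm_sq_eq]
        exact ENNReal.ofReal_le_ofReal (pow_le_pow_left₀ (norm_nonneg _) (h z hz) 2)
    _ = _ := by rw [setLIntegral_const, volume_slab, ENNReal.ofReal_mul (sq_nonneg c)]

/-- Each outer slab is split at distance `d + 1` from the cut: `c` is used on the long part next to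
the face and `G` on a part of length at most `d + 2`. The maximum with `0` covers the case in which
there is no long part. -/
lemma lintegral_outerZone_le {A : Cyl k → Vec k} {s R c G d : ℝ} (hs : 0 ≤ s) (hd : 0 ≤ d)
    (hl : ∀ z : Cyl k, 0 ≤ z.1 → z.1 ≤ s + 1 → ‖A z‖ ≤ G ∧ (z.1 < s - d → ‖A z‖ ≤ c))
    (hr : ∀ z : Cyl k, z.1 ≤ R → R - s - 1 ≤ z.1 → ‖A z‖ ≤ G ∧ (R - z.1 < s - d → ‖A z‖ ≤ c)) :
    ∫⁻ z in outerZone k s R, ‖A z‖ₑ ^ 2 ≤ ENNReal.ofReal (2 * (c ^ 2 * s + G ^ 2 * (d + 2))) := by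
  set e := max 0 (s - d - 1) with he
  have he1 : s - d - 1 ≤ e := le_max_right _ _
  have he0 : 0 ≤ e := le_max_left _ _
  have hcov : outerZone k s R ⊆ (slab k 0 (s - d - 1) ∪ slab k e (s + 1))
      ∪ (slab k (R - (s - d - 1)) R ∪ slab k (R - s - 1) (R - e)) := by
    rintro z (⟨h1, h2⟩ | ⟨h1, h2⟩)
    · left
      rcases le_or_gt z.1 (s - d - 1) with h3 | h3
      · exact Or.inl ⟨h1, h3⟩
      · exact Or.inr ⟨max_le h1 h3.le, h2⟩
    · right
      rcases le_or_gt (R - z.1) (s - d - 1) with h3 | h3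
      · exact Or.inl ⟨by linarith, h2⟩
      · refine Or.inr ⟨h1, ?_⟩
        have : e ≤ R - z.1 := max_le (by linarith) h3.le
        linarith
  have b1 := lintegral_slab_le (A := A) (a := 0) (b := s - d - 1) (c := c) fun z hz =>
    (hl z hz.1 (by linarith [hz.2])).2 (by linarith [hz.2])
  have b2 := lintegral_slab_le (A := A) (a := e) (b := s + 1) (c := G) fun z hz =>
    (hl z (he0.trans hz.1) hz.2).1
  have b3 := lintegral_slab_le (A := A) (a := R - (s - d - 1)) (b := R) (c := c) fun z hz =>
    (hr z hz.2 (by linarith [hz.1])).2 (by linarith [hz.1])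
  have b4 := lintegral_slab_le (A := A) (a := R - s - 1) (b := R - e) (c := G) fun z hz =>
    (hr z (by linarith [hz.2]) hz.1).1
  have q1 : ENNReal.ofReal (c ^ 2 * (s - d - 1 - 0)) ≤ ENNReal.ofReal (c ^ 2 * s) := by gcongr; linarith
  have q2 : ENNReal.ofReal (G ^ 2 * (s + 1 - e)) ≤ ENNReal.ofReal (G ^ 2 * (d + 2)) := by gcongr; linarith
  have q3 : ENNReal.ofReal (c ^ 2 * (R - (R - (s - d - 1)))) ≤ ENNReal.ofReal (c ^ 2 * s) := by gcongr; linarith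
  have q4 : ENNReal.ofReal (G ^ 2 * (R - e - (R - s - 1))) ≤ ENNReal.ofReal (G ^ 2 * (d + 2)) := by gcongr; linarith
  refine (lintegral_mono_set hcov).trans ((lintegral_union_le _ _ _).trans ?_)
  refine (add_le_add (lintegral_union_le _ _ _) (lintegral_union_le _ _ _)).trans ?_
  refine (add_le_add (add_le_add (b1.trans q1) (b2.trans q2)) (add_le_add (b3.trans q3) (b4.trans q4))).trans_eq ?_
  rw [← ENNReal.ofReal_add (by positivity) (by positivity), ← ENNReal.ofReal_add (by positivity) (by positivity)]
  congr 1
  ring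

/-! ### Gauss's law at the cut -/

open scoped Classical in
-- At distance one from the window the smoothed count of a bridge is exactly `0` or `1`. Only
-- bridges in `V` can be miscounted, each by at most one.
lemma abs_leftCount_sub_le (hη0 : 0 < η) (hη : η < 1 / 4) {a w : ℝ} (hw : 0 < w) {W V : Finset (Bridge k β)}
    (hV : V ⊆ W) (P : Bridge k β → Prop) (t : ℝ)
    (h1 : ∀ b ∈ W, b ∉ V → P b → (b (t : AddCircle β)).1 + 1 ≤ a)
    (h0 : ∀ b ∈ W, b ∉ V → ¬P b → a + w + 1 ≤ (b (t : AddCircle β)).1) :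
    |leftCount η a w W t - (W.filter P).card| ≤ V.card := by
  have e : (V.card : ℝ) = ∑ b ∈ W, if b ∈ V then (1 : ℝ) else 0 := by
    rw [Finset.sum_boole]
    congr 2
    ext b
    rw [Finset.mem_filter]
    exact ⟨fun hb => ⟨hV hb, hb⟩, fun hb => hb.2⟩
  have e' : ((W.filter P).card : ℝ) = ∑ b ∈ W, if P b then (1 : ℝ) else 0 := by rw [Finset.sum_boole]
  rw [e, e', leftCount, ← Finset.sum_sub_distrib]
  refine (Finset.abs_sum_le_sum_abs _ _).trans (Finset.sum_le_sum fun b hb => ?_)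
  by_cases hbV : b ∈ V
  · rw [if_pos hbV]
    have := integral_bumpTail_mem (k := k) (η := η) a (b (t : AddCircle β)).1 hw
    rw [abs_le]
    split_ifs
    · exact ⟨by linarith [this.1], by linarith [this.2]⟩
    · exact ⟨by linarith [this.1], by linarith [this.2]⟩
  · rw [if_neg hbV]
    by_cases hP : P b
    · rw [if_pos hP, integral_bumpTail_of_le hη0 hη hw (h1 b hb hbV hP)]; simp
    · rw [if_neg hP, integral_bumpTail_of_ge hη0 hη hw (h0 b hb hbV hP)]; simp

lemma not_visitor_side {s R : ℝ} {W : Finset (Bridge k β)} {b : Bridge k β} (hb : b ∈ W) (hv : b ∉ visitors s R W) :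
    ((∀ t, (b t).1 < s - 3) ∨ ∀ t, s + 3 < (b t).1) ∧
      ((∀ t, (b t).1 < R - s - 3) ∨ ∀ t, R - s + 3 < (b t).1) := by
  have hv' : ∀ t, (b t).1 ∉ Icc (s - 3) (s + 3) ∪ Icc (R - s - 3) (R - s + 3) := fun t ht => by
    classical
    exact hv (Finset.mem_filter.2 ⟨hb, t, ht⟩)
  exact ⟨bridge_side b (by linarith) fun t ht => hv' t (Or.inl ht),
    bridge_side b (by linarith) fun t ht => hv' t (Or.inr ht)⟩

open scoped Classical in
/-- The bridges to the left of the cuts. -/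
def leftBridges (s : ℝ) (W : Finset (Bridge k β)) : Finset (Bridge k β) := W.filter fun b => ∀ t, (b t).1 < s - 2

open scoped Classical in
/-- The bridges that are kept. -/
def midBridges (s R : ℝ) (W : Finset (Bridge k β)) : Finset (Bridge k β) :=
  W.filter fun b => ∃ t, (b t).1 ∈ Icc (s - 2) (R - s + 2)

open scoped Classical in
/-- The bridges to the right of the cuts. -/
def rightBridges (s R : ℝ) (W : Finset (Bridge k β)) : Finset (Bridge k β) :=
  W.filter fun b => ∀ t, R - s + 2 < (b t).1

open scoped Classical in
-- A bridge that never meets the kept region stays on one side of it by connectedness, so the three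
-- classes partition `W`.
lemma sum_bridges {M : Type*} [AddCommMonoid M] {s R : ℝ} (hsR : s - 2 ≤ R - s + 2) (W : Finset (Bridge k β))
    (F : Bridge k β → M) :
    ∑ b ∈ W, F b = ∑ b ∈ leftBridges s W, F b + (∑ b ∈ midBridges s R W, F b + ∑ b ∈ rightBridges s R W, F b) := by
  have d1 : Disjoint (midBridges s R W) (rightBridges s R W) := by
    rw [Finset.disjoint_left]
    intro b h1 h2
    obtain ⟨-, t, ht⟩ := Finset.mem_filter.1 h1
    linarith [(Finset.mem_filter.1 h2).2 t, ht.2]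
  have d2 : Disjoint (leftBridges s W) (midBridges s R W ∪ rightBridges s R W) := by
    rw [Finset.disjoint_left]
    intro b h1 h2
    rcases Finset.mem_union.1 h2 with h2 | h2
    · obtain ⟨-, t, ht⟩ := Finset.mem_filter.1 h2
      linarith [(Finset.mem_filter.1 h1).2 t, ht.1]
    · linarith [(Finset.mem_filter.1 h2).2 0, (Finset.mem_filter.1 h1).2 0]
  rw [← Finset.sum_union d1, ← Finset.sum_union d2]
  congr 1
  ext b
  refine ⟨fun hb => ?_, fun hb => ?_⟩
  · by_cases hm : ∃ t, (b t).1 ∈ Icc (s - 2) (R - s + 2)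
    · exact Finset.mem_union_right _ (Finset.mem_union_left _ (Finset.mem_filter.2 ⟨hb, hm⟩))
    · push Not at hm
      rcases bridge_side b hsR hm with h | h
      · exact Finset.mem_union_left _ (Finset.mem_filter.2 ⟨hb, h⟩)
      · exact Finset.mem_union_right _ (Finset.mem_union_right _ (Finset.mem_filter.2 ⟨hb, h⟩))
  · rcases Finset.mem_union.1 hb with hb | hb
    · exact (Finset.mem_filter.1 hb).1
    · rcases Finset.mem_union.1 hb with hb | hb <;> exact (Finset.mem_filter.1 hb).1

/-- The field near the bridges that are kept. -/
lemma fullField_mid (hη0 : 0 < η) (hη : η < 1 / 4) {s R L : ℝ} (hsR : s - 2 ≤ R - s + 2) (W : Finset (Bridge k β))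
    {t : ℝ} {z : Cyl k} (hz : z.1 ∈ Icc s (R - s)) :
    fullField η L W t z = (z.1 - (((leftBridges s W).card : ℝ) + L)) • bvec 0 + chargeSum η (midBridges s R W) t z
      + remSum η W t z := by
  classical
  have h1 : chargeSum η (leftBridges s W) t z = (-((leftBridges s W).card : ℝ)) • bvec 0 :=
    chargeSum_of_gt hη0 hη fun b hb => by linarith [(Finset.mem_filter.1 hb).2 t, hz.1]
  have h2 : chargeSum η (rightBridges s R W) t z = 0 :=
    chargeSum_of_lt hη fun b hb => by linarith [(Finset.mem_filter.1 hb).2 t, hz.2]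
  have h3 : chargeSum η W t z = chargeSum η (leftBridges s W) t z
      + (chargeSum η (midBridges s R W) t z + chargeSum η (rightBridges s R W) t z) := sum_bridges hsR W _
  rw [fullField, h3, h1, h2, add_zero]
  module

lemma card_filter_le_right {s R : ℝ} (hsR : s - 2 ≤ R - s + 2) (W : Finset (Bridge k β)) :
    open scoped Classical in
    (W.filter fun b => ∃ t, (b t).1 ≤ R - s + 2).card = (leftBridges s W).card + (midBridges s R W).card := by
  classical
  rw [Finset.card_filter, sum_bridges hsR, Finset.sum_congr rfl (g := fun _ => 1), Finset.sum_congr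
    (s₁ := midBridges s R W) rfl (g := fun _ => 1), Finset.sum_eq_zero (s := rightBridges s R W)]
  · simp
  · intro b hb
    rw [if_neg]
    push Not
    exact fun t => (Finset.mem_filter.1 hb).2 t
  · intro b hb
    obtain ⟨-, t, ht⟩ := Finset.mem_filter.1 hb
    exact if_pos ⟨t, ht.2⟩
  · intro b hb
    exact if_pos ⟨0, by linarith [(Finset.mem_filter.1 hb).2 0]⟩

namespace CutData
variable {ε : ℝ} {R : ℕ} {L₁ : ℤ} {W : Finset (Bridge k β)}

/-- Gauss's law at a good cut determines the number of sites up to a bounded error. -/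
lemma exists_screenData (hβ : 0 < β) (hη0 : 0 < η) (hη : η < 1 / 4) (h : CutData η ε R L₁ W)
    (hR : 2 * cutBound ε + 20 ≤ ε * R) {s : ℝ} (hs : s ∈ Icc (6 * (ε * R)) (7 * (ε * R)))
    (hvis : ((visitors s R W).card : ℝ) ≤ cutBound ε)
    (hE : ∫⁻ t in Icc 0 β, ∫⁻ z in cutZone k s R, ‖fullField η L₁ W t z‖ₑ ^ 2 ≤ ENNReal.ofReal (β * cutBound ε)) :
    ∃ m n : ℕ, ((leftBridges s W).card : ℝ) + L₁ = m ∧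
      ScreenData s R (cutBound ε) ((ε * R) ^ (6 / 7 : ℝ)) (midBridges s R W) m n := by
  classical
  have hw1 := h.eps_mul_ge
  have hw20 := h.twenty_mul_le
  have hpos := h.pos
  have hw1' : (2097152 : ℝ) ≤ ε * R := by norm_num at hw1; exact hw1
  have hX := h.cutBound_nonneg
  set w := ε * R with hw
  set X := cutBound ε with hXdef
  have hs1 := hs.1
  have hs2 := hs.2
  have hsR : s - 2 ≤ R - s + 2 := by linarith
  obtain ⟨t, -, hEt⟩ := exists_time_le (f := fun t => ∫⁻ z in cutZone k s R, ‖fullField η L₁ W t z‖ₑ ^ 2) hβ (by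
    have hm : Measurable fun q : ℝ × Cyl k => ‖fullField η L₁ W q.1 q.2‖ₑ ^ 2 :=
      ((measurable_fullField hη0 hη L₁ W).enorm).pow_const 2
    exact hm.lintegral_prod_right') hE
  -- On a unit window with `δ = 1` the flux is at most `X / 2 + 2`. With at most `X` miscounted
  -- bridges and the window width one, the total deviation stays within `2 X + 3`.
  have f1 := abs_flux_le (F := fullField η L₁ W t) (a := s) (w := 1) one_pos one_pos hX
    ((lintegral_mono_set fun z hz => Or.inl hz).trans hEt)
  have f2 := abs_flux_le (F := fullField η L₁ W t) (a := R - s - 1) (w := 1) one_pos one_pos hX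
    ((lintegral_mono_set fun z hz => Or.inr (by rwa [sub_add_cancel] at hz)).trans hEt)
  rw [integral_fullField_mul_bump hη0 hη _ _ _ one_pos] at f1 f2
  have m1 := integral_sub_mul_bump (a := s) one_pos L₁
  have m2 := integral_sub_mul_bump (a := R - s - 1) one_pos L₁
  have hVW : visitors s R W ⊆ W := Finset.filter_subset _ _
  have c1 := abs_leftCount_sub_le hη0 hη (a := s) one_pos hVW (fun b => ∀ t, (b t).1 < s - 2) t
    (fun b hb hv hP => by
      rcases (not_visitor_side hb hv).1 with h1 | h1
      · linarith [h1 t]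
      · linarith [h1 t, hP t])
    (fun b hb hv hP => by
      rcases (not_visitor_side hb hv).1 with h1 | h1
      · exact absurd (fun t => by linarith [h1 t]) hP
      · linarith [h1 t])
  have c2 := abs_leftCount_sub_le hη0 hη (a := R - s - 1) one_pos hVW (fun b => ∃ t, (b t).1 ≤ R - s + 2) t
    (fun b hb hv hP => by
      rcases (not_visitor_side hb hv).2 with h1 | h1
      · linarith [h1 t]
      · obtain ⟨u, hu⟩ := hP
        linarith [h1 u])
    (fun b hb hv hP => by
      rcases (not_visitor_side hb hv).2 with h1 | h1
      · exact absurd ⟨t, by linarith [h1 t]⟩ hP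
      · linarith [h1 t])
  rw [card_filter_le_right hsR] at c2
  change |_ - ((leftBridges s W).card : ℝ)| ≤ _ at c1
  push_cast at c2
  have f1 := abs_le.1 f1
  have f2 := abs_le.1 f2
  have c1 := abs_le.1 c1
  have c2 := abs_le.1 c2
  have l1 : |((leftBridges s W).card : ℝ) + L₁ - s| ≤ 2 * X + 3 := by
    rw [abs_le]
    constructor <;> linarith [f1.1, f1.2, c1.1, c1.2, m1.1, m1.2]
  have l2 : |((R : ℝ) - (midBridges s R W).card - ((leftBridges s W).card + L₁)) - s| ≤ 2 * X + 3 := by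
    rw [abs_le]
    constructor <;> linarith [f2.1, f2.2, c2.1, c2.2, m2.1, m2.2]
  -- The numbers of sites are integers because `L₁` is, and nonnegative because `s` exceeds `2 X +
  -- 3`.
  have hm : (0 : ℤ) ≤ (leftBridges s W).card + L₁ := by
    have : (0 : ℝ) ≤ ((leftBridges s W).card : ℝ) + L₁ := by linarith [(abs_le.1 l1).1]
    exact_mod_cast this
  have hn : (0 : ℤ) ≤ R - (midBridges s R W).card - ((leftBridges s W).card + L₁) := by
    have : (0 : ℝ) ≤ (R : ℝ) - (midBridges s R W).card - ((leftBridges s W).card + L₁) := by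
      linarith [(abs_le.1 l2).1]
    exact_mod_cast this
  obtain ⟨m, hm⟩ := Int.eq_ofNat_of_zero_le hm
  obtain ⟨n, hn⟩ := Int.eq_ofNat_of_zero_le hn
  have hm' : ((leftBridges s W).card : ℝ) + L₁ = m := by exact_mod_cast hm
  have hn' : (R : ℝ) - (midBridges s R W).card - ((leftBridges s W).card + L₁) = n := by exact_mod_cast hn
  have hinner : ∀ b ∈ midBridges s R W, b ∈ W ∧ ∃ t, (b t).1 ∈ Icc (s - 2) (R - s + 2) ∧
      (b t).1 ∈ Icc (ε * R) (R - ε * R) := by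
    intro b hb
    obtain ⟨h1, t, ht⟩ := Finset.mem_filter.1 hb
    exact ⟨h1, t, ht, by rw [← hw]; linarith [ht.1], by rw [← hw]; linarith [ht.2]⟩
  have hy : w ^ (6 / 7 : ℝ) ≤ w := by
    have := Real.rpow_le_rpow_of_exponent_le (show 1 ≤ w by linarith) (show (6 / 7 : ℝ) ≤ 1 by norm_num)
    rwa [Real.rpow_one] at this
  have hw0 : 0 ≤ w := by linarith
  refine ⟨m, n, hm', ?_⟩
  exact {
    X_nonneg := hX
    y_nonneg := by positivity
    large := by linarith
    small := by linarith
    range_small := by linarith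
    meet := fun b hb => (Finset.mem_filter.1 hb).2
    range := fun b hb t t' => by
      obtain ⟨h1, u, -, hu⟩ := hinner b hb
      exact (abs_sub_le_two_mul hβ b t t').trans
        (by linarith [h.xRange_le_rpow hβ h1 (h.inner b h1 u hu)])
    visit := by
      refine le_trans ?_ hvis
      exact_mod_cast Finset.card_le_card (Finset.filter_subset_filter _ (Finset.filter_subset _ _))
    left := by rw [← hm']; exact l1
    right := by rw [← hn']; exact l2
    total := by rw [← hm', ← hn']; ring }

end CutData

/-! ### Screening -/

/-- `(ωscr, E)` is a screening of `ω` that keeps the bridges starting in `[c, R - c] × D`. -/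
structure IsScreening (η c : ℝ) (R : ℕ) (ω ωscr : Set (Bridge k β)) (E : ℝ → Cyl k → Vec k) : Prop where
  neutral : IsNeutral (slab k 0 R) ωscr
  measurable : AEStronglyMeasurable (Function.uncurry E)
    ((volume.restrict (Icc 0 β)).prod (volume.restrict (slab k 0 R)))
  agree : proj ω (slab k c (R - c)) = proj ωscr (slab k c (R - c))
  compatible : IsCompatible η R ωscr E
  screened : IsScreened β R E

lemma isNeutral_coe {R : ℕ} {W : Finset (Bridge k β)} (hW : ∀ b ∈ W, b 0 ∈ slab k 0 R) (hcard : W.card = R) :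
    IsNeutral (slab k 0 R) (W : Set (Bridge k β)) := by
  refine ⟨⟨⟨W.countable_toSet, fun K _ => W.finite_toSet.subset fun b hb => hb.1⟩, fun b hb => hW b hb⟩, ?_⟩
  rw [volume_slab, Set.encard_coe_eq_coe_finsetCard, hcard]
  simp

/-- Common frame of the fine and the crude construction: `R` bridges that keep away from the faces,
and a continuous divergence-free correction `G` that vanishes near them. -/
lemma isScreening_of_finset (hη0 : 0 < η) (hη : η < 1 / 4) {c : ℝ} {R : ℕ} {ω : Set (Bridge k β)}
    {W : Finset (Bridge k β)} (hW : ∀ b ∈ W, ∀ t : AddCircle β, (b t).1 ∈ Icc (1 / 2 : ℝ) (R - 1 / 2))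
    (hcard : W.card = R) (hag : ∀ b : Bridge k β, b 0 ∈ slab k c (R - c) → (b ∈ ω ↔ b ∈ W))
    {G : ℝ → Cyl k → Vec k} (hG : Continuous (Function.uncurry G))
    (hGf : ∀ t (f : Cyl k → ℝ), IsTestFunction univ f → ∫ z, inner ℝ (G t z) (grad f z) = 0)
    (hGl : ∀ t (z : Cyl k), z.1 ≤ 1 / 16 → G t z = 0) (hGr : ∀ t (z : Cyl k), R - 1 / 16 ≤ z.1 → G t z = 0) :
    IsScreening η c R ω (W : Set (Bridge k β)) fun t z => bgField η W t z + G t z where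
  neutral := isNeutral_coe (fun b hb => ⟨by linarith [(hW b hb 0).1], by linarith [(hW b hb 0).2]⟩) hcard
  measurable := ((measurable_bgField hη0 hη W).add hG.measurable).aestronglyMeasurable
  agree := by
    ext b
    exact ⟨fun hb => ⟨(hag b hb.2).1 hb.1, hb.2⟩, fun hb => ⟨(hag b hb.2).2 hb.1, hb.2⟩⟩
  compatible := isCompatible_bgField_add hη0 hη R W (fun t => hG.uncurry_left t) hGf
  screened := isScreened_bgField_add hη0 hη R W hW hcard hGl hGr

/-- Screening without any control of the energy. -/
lemma exists_crude_screening (hη0 : 0 < η) (hη : η < 1 / 4) {B : ℝ} (hB : ∀ z : Cyl k, ‖chargeField η z‖ ≤ B)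
    {c : ℝ} {R : ℕ} (hc : 1 < c) (hR : 2 ≤ R) {ω : Set (Bridge k β)} {I : Finset (Bridge k β)}
    (hI : ∀ b, b ∈ I ↔ b ∈ ω ∧ b 0 ∈ slab k c (R - c))
    (hIt : ∀ b ∈ I, ∀ t : AddCircle β, (b t).1 ∈ Icc (1 / 2 : ℝ) (R - 1 / 2)) (hIR : I.card ≤ R) :
    ∃ (ωscr : Set (Bridge k β)) (E : ℝ → Cyl k → Vec k), IsScreening η c R ω ωscr E ∧
      ∀ t, ∫⁻ z in slab k 0 R, ‖E t z‖ₑ ^ 2 ≤ ENNReal.ofReal ((R + R * B) ^ 2 * (R - 0)) := by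
  classical
  have hR' : (2 : ℝ) ≤ R := by exact_mod_cast hR
  -- With `J = 0` there are no regular sites: all missing charges go to distinct points of `(1/2,
  -- 1]`, left of the region to be preserved since `1 < c`.
  have hinj : Function.Injective fun j => 1 / 2 + sitePos 0 j := fun i j h => sitePos_injective 0 (by simpa using h)
  set S := siteBridges k β (fun j => 1 / 2 + sitePos 0 j) (R - I.card) with hS
  have hSt : ∀ b ∈ S, ∀ t : AddCircle β, (b t).1 ∈ Icc (1 / 2 : ℝ) 1 := by
    intro b hb t
    obtain ⟨j, -, rfl⟩ := mem_siteBridges.1 hb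
    have := sitePos_mem 0 j
    rw [constBridge_apply]
    refine ⟨by linarith [this.1], ?_⟩
    have := this.2
    norm_num at this ⊢
    linarith
  have hdisj : Disjoint I S := by
    rw [Finset.disjoint_left]
    intro b h1 h2
    linarith [((hI b).1 h1).2.1, (hSt b h2 0).2]
  have hcard : (I ∪ S).card = R := by
    rw [Finset.card_union_of_disjoint hdisj, hS, card_siteBridges hinj]
    omega
  have hW : ∀ b ∈ I ∪ S, ∀ t : AddCircle β, (b t).1 ∈ Icc (1 / 2 : ℝ) (R - 1 / 2) := by
    intro b hb t
    rcases Finset.mem_union.1 hb with hb | hb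
    · exact hIt b hb t
    · exact ⟨(hSt b hb t).1, by linarith [(hSt b hb t).2]⟩
  refine ⟨_, _, isScreening_of_finset hη0 hη (W := I ∪ S) (G := fun _ _ => 0) hW hcard ?_ continuous_const (by simp)
    (by simp) (by simp), fun t => ?_⟩
  · intro b hb
    rw [Finset.mem_union, hI]
    refine ⟨fun h => Or.inl ⟨h, hb⟩, fun h => ?_⟩
    rcases h with h | h
    · exact h.1
    · linarith [hb.1, (hSt b h 0).2]
  · refine lintegral_slab_le fun z hz => ?_
    simp only [add_zero]
    refine (norm_bgField_le hB _ t z).trans ?_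
    rw [hcard]
    linarith [abs_le_of_mem_slab hz]

/-- The energy of the background field near the faces. -/
def outerBound (B ε R : ℝ) : ℝ :=
  2 * ((B + 2) ^ 2 * (7 * (ε * R)) + nearBound (cutBound ε) B ^ 2 * (2 * cutBound ε + 12 + 2 * (ε * R) ^ (6 / 7 : ℝ)))

/-- Screening with control of the energy. -/
lemma exists_screening (k : ℕ) : ∃ C : ℝ≥0, ∀ {η β : ℝ}, 0 < β → 0 < η → η < 1 / 4 →
    ∀ {B : ℝ}, 0 ≤ B → (∀ z : Cyl k, ‖chargeField η z‖ ≤ B) →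
    ∀ {ε : ℝ} {R : ℕ} {L₁ : ℤ} {W : Finset (Bridge k β)}, CutData η ε R L₁ W → 2 * cutBound ε + 20 ≤ ε * R →
    ∃ s ∈ Icc (6 * (ε * R)) (7 * (ε * R)),
    ∃ (ωscr : Set (Bridge k β)) (E : ℝ → Cyl k → Vec k), IsScreening η (10 * ε * R) R (W : Set (Bridge k β)) ωscr E ∧
      (∀ t, ∫⁻ z in slab k 0 R, ‖E t z‖ₑ ^ 2 ≤ (∫⁻ z in slab k 0 R, ‖fullField η L₁ W t z‖ₑ ^ 2)
        + C * (∫⁻ z in cutZone k s R, ‖fullField η L₁ W t z‖ₑ ^ 2) + C * ENNReal.ofReal (outerBound B ε R)) ∧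
      ∫⁻ t in Icc 0 β, ∫⁻ z in cutZone k s R, ‖fullField η L₁ W t z‖ₑ ^ 2 ≤ ENNReal.ofReal (β * cutBound ε) := by
  classical
  obtain ⟨C, hC⟩ := exists_lintegral_cutField_le k
  refine ⟨C, fun {η β} hβ hη0 hη {B} hB0 hB {ε R L₁ W} h hR => ?_⟩
  obtain ⟨s, hs, hvis, hE⟩ := h.exists_cut hβ hη0 hη
  obtain ⟨m, n, hm, hS⟩ := h.exists_screenData hβ hη0 hη hR hs hvis hE
  have hw1 := h.eps_mul_ge
  have hw20 := h.twenty_mul_le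
  have hpos := h.pos
  have hw1' : (2097152 : ℝ) ≤ ε * R := by norm_num at hw1; exact hw1
  have hs1 := hs.1
  have hs2 := hs.2
  have hsR : s - 2 ≤ R - s + 2 := by linarith
  have hs0 : 0 ≤ s := by linarith
  have hcut := continuous_cutField (contDiff_cutoff s (R - s)) (continuous_remSum hη0 hη W)
  refine ⟨s, hs, _, _, isScreening_of_finset hη0 hη (W := screenSet s R (midBridges s R W) m n)
    (G := fun t => cutField (cutoff s (R - s)) (remSum η W t)) (fun b hb t => hS.mem_screenSet hb t)
    (by exact_mod_cast hS.card_screenSet) ?_ hcut ?_ ?_ ?_, ?_, hE⟩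
  · intro b hb
    -- As `s ≤ 7 ε R`, bridges starting in the region to be preserved start between the cuts.
    have hb' : (b 0).1 ∈ Icc (s - 2) (R - s + 2) := by
      have h1 : 10 * ε * R ≤ (b 0).1 := hb.1
      have h2 : (b 0).1 ≤ R - 10 * ε * R := hb.2
      rw [mul_assoc] at h1 h2
      exact ⟨by linarith, by linarith⟩
    rw [hS.mem_screenSet_iff hb', midBridges, Finset.mem_filter]
    exact ⟨fun h => ⟨h, 0, hb'⟩, fun h => h.1⟩
  · intro t f hf
    refine integral_inner_cutField (contDiff_cutoff s (R - s)) (X := R) ?_ (continuous_remSum_time hη0 hη W t)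
      (fun f hf => integral_inner_remSum hη0 hη W t hf) (integral_remSum_slice hη0 hη W t) hf
    intro x hx
    rcases lt_abs.1 hx with hx | hx
    · exact cutoff_of_ge (by linarith)
    · exact cutoff_of_le (by linarith)
  · exact fun t z hz => cutField_of_lt (by linarith) (by linarith) _
  · exact fun t z hz => cutField_of_gt (by linarith) (by linarith) _
  · intro t
    refine (hC s R (fullField η L₁ W t) _ (remSum η W t) hs0 (by linarith) (measurable_fullField_time hη0 hη L₁ W t)
      (measurable_bgField_time hη0 hη _ t) (continuous_remSum_time hη0 hη W t) fun z hz => ?_).trans ?_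
    -- The choice of `m` makes the explicit parts of old and new field equal between the cuts, so
    -- that they differ by the remainder only.
    · rw [fullField_mid hη0 hη hsR W hz, hm, hS.bgField_mid hη0 hη ⟨by linarith [hz.1], by linarith [hz.2]⟩]
    · gcongr
      refine (lintegral_outerZone_le (c := B + 2) (G := nearBound (cutBound ε) B)
        (d := 2 * cutBound ε + 10 + 2 * (ε * R) ^ (6 / 7 : ℝ)) hs0 ?_ ?_ ?_).trans ?_
      · have := hS.X_nonneg
        have := hS.y_nonneg
        positivity
      · intro z h1 h2
        have := hS.norm_bgField_left hη0 hη hB0 hB (t := t) h1 h2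
        exact ⟨this.1, fun h3 => this.2 (by linarith)⟩
      · intro z h1 h2
        have := hS.norm_bgField_right hη0 hη hB0 hB (t := t) h1 h2
        exact ⟨this.1, fun h3 => this.2 (by linarith)⟩
      · refine ENNReal.ofReal_le_ofReal ?_
        rw [outerBound]
        gcongr 2 * (_ * ?_ + _ * ?_)
        linarith

/-! ### The competitors of regular configurations -/

/-- A neutral competitor is a finite configuration. -/
lemma IsNeutral.exists_finset {a b : ℝ} (hab : a ≤ b) {ω : Set (Bridge k β)} (h : IsNeutral (slab k a b) ω) :
    ∃ W : Finset (Bridge k β), (W : Set (Bridge k β)) = ω ∧ (W.card : ℝ) = b - a := by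
  have h1 := h.2
  rw [volume_slab] at h1
  have hfin : ω.Finite := by
    rw [← Set.encard_ne_top_iff]
    intro htop
    rw [htop] at h1
    exact ENNReal.ofReal_ne_top h1.symm
  refine ⟨hfin.toFinset, hfin.coe_toFinset, ?_⟩
  rw [hfin.encard_eq_coe_toFinset_card] at h1
  have h2 := congrArg ENNReal.toReal h1
  rw [ENNReal.toReal_ofReal (by linarith)] at h2
  simpa using h2

/-- The faces are removed along with the charged spheres, since `[L₁, L₂]` may coincide with `[0,
R]` and the explicit formula holds in its interior. -/
lemma ae_elField_eq (hη0 : 0 < η) (hη : η < 1 / 4) {L₁ L₂ R : ℝ} {W : Finset (Bridge k β)} (h1 : L₁ ≤ 0) (h2 : R ≤ L₂)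
    (hW : ∀ b ∈ W, b 0 ∈ slab k L₁ L₂) (hcard : (W.card : ℝ) = L₂ - L₁) (t : ℝ) :
    ∀ᵐ z ∂(volume.restrict (slab k 0 R)),
      elField η (W : Set (Bridge k β)) (slab k L₁ L₂) t z = fullField η L₁ W t z := by
  filter_upwards [ae_restrict_of_ae (ae_cnorm_sub_ne η W t), ae_restrict_of_ae (ae_fst_ne (k := k) 0),
    ae_restrict_of_ae (ae_fst_ne (k := k) R), ae_restrict_mem (measurableSet_slab 0 R)] with z hz hz0 hzR hzs
  refine elField_eq hη0 hη hW hcard t ⟨?_, ?_⟩ hz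
  · exact h1.trans_lt (lt_of_le_of_ne hzs.1 (Ne.symm hz0))
  · exact (lt_of_le_of_ne hzs.2 hzR).trans_le h2

lemma lintegral_elField_eq (hη0 : 0 < η) (hη : η < 1 / 4) {L₁ L₂ R : ℝ} {W : Finset (Bridge k β)} (h1 : L₁ ≤ 0)
    (h2 : R ≤ L₂) (hW : ∀ b ∈ W, b 0 ∈ slab k L₁ L₂) (hcard : (W.card : ℝ) = L₂ - L₁) (t : ℝ) {K : Set (Cyl k)}
    (hK : K ⊆ slab k 0 R) :
    ∫⁻ z in K, ‖elField η (W : Set (Bridge k β)) (slab k L₁ L₂) t z‖ₑ ^ 2 = ∫⁻ z in K, ‖fullField η L₁ W t z‖ₑ ^ 2 := by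
  refine lintegral_congr_ae ?_
  filter_upwards [ae_restrict_of_ae_restrict_of_subset hK (ae_elField_eq hη0 hη h1 h2 hW hcard t)] with z hz
  rw [hz]

/-- Needed because the energy bound takes values in `ℝ≥0` through `toNNReal`, which would send `∞`
to `0`. -/
lemma lintegral_fullField_ne_top (hη0 : 0 < η) (hη : η < 1 / 4) (L R : ℝ) (W : Finset (Bridge k β)) (t : ℝ) :
    ∫⁻ z in slab k 0 R, ‖fullField η L W t z‖ₑ ^ 2 ≠ ∞ := by
  obtain ⟨B, hB0, hB⟩ := exists_bound_chargeField (k := k) hη0 hη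
  obtain ⟨D, hD⟩ := (isCompact_slab (k := k) 0 R).exists_bound_of_continuousOn (continuous_remSum_time hη0 hη W t).continuousOn
  refine ne_top_of_le_ne_top ENNReal.ofReal_ne_top (lintegral_slab_le (c := R + |L| + W.card * B + D) fun z hz => ?_)
  rw [fullField]
  refine (norm_add_le _ _).trans (add_le_add ((norm_add_le _ _).trans (add_le_add ?_ (norm_chargeSum_le hB W t z))) (hD z hz))
  rw [norm_smul, norm_bvec, mul_one, Real.norm_eq_abs]
  exact (abs_sub _ _).trans (add_le_add_left (abs_le_of_mem_slab hz) _)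

/-- The hypothesis gives `R^(1/8) ≥ 2/ε`, hence `R^(7/8) ≤ ε R / 2`; rounding up costs at most one,
and `2 ≤ ε R`. It places `[ε R, R - ε R] × D` inside the eroded slab. -/
lemma ceil_rpow_le {ε R : ℝ} (hε : 0 < ε) (h : (2 / ε) ^ 8 < R) (h2 : 2 ≤ ε * R) :
    ((⌈(R - 0) ^ (7 / 8 : ℝ)⌉ : ℤ) : ℝ) ≤ ε * R := by
  have hR : 0 < R := lt_of_le_of_lt (by positivity) h
  have h1 : 2 / ε ≤ R ^ (1 / 8 : ℝ) := by
    calc 2 / ε = ((2 / ε) ^ 8) ^ (1 / 8 : ℝ) := by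
          rw [← Real.rpow_natCast, ← Real.rpow_mul (by positivity)]; norm_num
      _ ≤ _ := Real.rpow_le_rpow (by positivity) h.le (by norm_num)
  have h3 : R ^ (7 / 8 : ℝ) * R ^ (1 / 8 : ℝ) = R := by rw [← Real.rpow_add hR]; norm_num
  have h4 : 0 < R ^ (7 / 8 : ℝ) := by positivity
  have h5 : R ^ (7 / 8 : ℝ) * (2 / ε) ≤ R := by
    have := mul_le_mul_of_nonneg_left h1 h4.le
    linarith
  have h6 : R ^ (7 / 8 : ℝ) ≤ ε * R / 2 := by
    rw [mul_div_assoc', div_le_iff₀ hε] at h5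
    linarith
  rw [sub_zero]
  linarith [Int.ceil_lt_add_one (R ^ (7 / 8 : ℝ))]

/-- Since `M > 2`, `2 M ε < 2 / M < 1`; this trades the dependence of the energy bound on `M` for
one on `ε`. -/
lemma two_mul_lt_inv {M ε : ℝ} (hM : 2 < M) (hε : 0 < ε) (h : ε < 1 / M ^ 2) : 2 * M < 1 / ε := by
  rw [lt_div_iff₀ hε]
  rw [lt_div_iff₀ (by positivity)] at h
  nlinarith

lemma quarter_of_lt {M ε : ℝ} (hM : 2 < M) (h : ε < 1 / M ^ 2) : ε < 1 / 4 := by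
  refine h.trans ?_
  rw [div_lt_div_iff₀ (by positivity) (by norm_num)]
  nlinarith

/-- Near-optimality transfers the energy bound from the infimum to the chosen competitor. The
condition `Θ` controls where bridges in the bulk start, and agreement on `[0, R] × D` transfers the
range condition. -/
lemma cutData_of_isNearOptimal (hβ : 0 < β) (hη0 : 0 < η) (hη : η < 1 / 4) {M ε : ℝ} {R : ℕ} (hM : 2 < M) (hε : 0 < ε)
    (hεM : ε < 1 / M ^ 2) (hε20 : ε ≤ 1 / 20) (hR : (2 / ε) ^ 8 < (R : ℝ)) {ω : Set (Bridge k β)}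
    (hω : IsBridgeRegular η M ε R ω) {L₁ L₂ : ℤ} {W : Finset (Bridge k β)}
    (h : IsNearOptimal η ε R ω L₁ L₂ (W : Set (Bridge k β))) (hcard : (W.card : ℝ) = L₂ - L₁) :
    CutData η ε R L₁ W := by
  have hstart : ∀ b ∈ W, b 0 ∈ slab k L₁ L₂ := fun b hb => h.competitor.neutral.1.2 b hb
  have hbig := large_iff_pow hε hR
  have h20 : 20 ≤ 1 / ε := by rw [le_div_iff₀ hε]; linarith
  have h1 : (1 : ℝ) ≤ (1 / ε) ^ 7 := one_le_pow₀ (by linarith)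
  have hproj : proj (W : Set (Bridge k β)) (slab k 0 R) = ω := by
    rw [h.competitor.agree]
    exact Set.ext fun b => ⟨fun hb => hb.1, fun hb => ⟨hb, hω.conf.2 b hb⟩⟩
  exact {
    pos := hε
    le := hε20
    large := hR
    inner := fun b hb t ht => by
      by_contra hb0
      refine h.competitor.theta b hb hb0 t ?_
      have := ceil_rpow_le hε hR (by linarith)
      exact ⟨by linarith [ht.1], by linarith [ht.2]⟩
    range := by
      classical
      have h2 := hω.range
      have h3 : ω = ((W.filter fun b => b 0 ∈ slab k 0 R : Finset (Bridge k β)) : Set (Bridge k β)) := by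
        rw [← hproj, Finset.coe_filter]; rfl
      rw [h3, finsum_mem_coe_finset] at h2
      convert h2.le
    energy := by
      have h2 := h.energy_le.trans hω.energy.le
      rw [fieldEnergy] at h2
      have h3 : ∀ t, ∫⁻ z in slab k 0 R, ‖elField η (W : Set (Bridge k β)) (slab k L₁ L₂) t z‖ₑ ^ 2
          = ∫⁻ z in slab k 0 R, ‖fullField η L₁ W t z‖ₑ ^ 2 := fun t =>
        lintegral_elField_eq hη0 hη h.competitor.left_le h.competitor.le_right hstart hcard t Subset.rfl
      simp_rw [h3] at h2
      set Q := ∫⁻ t in Icc 0 β, ∫⁻ z in slab k 0 R, ‖fullField η L₁ W t z‖ₑ ^ 2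
      have h4 : Q = ENNReal.ofReal (2 * β) * (ENNReal.ofReal (1 / (2 * β)) * Q) := by
        rw [← mul_assoc, ← ENNReal.ofReal_mul (by positivity), mul_one_div_cancel (by positivity), ENNReal.ofReal_one,
          one_mul]
      rw [h4]
      refine (mul_le_mul_right h2 _).trans ?_
      rw [← ENNReal.ofReal_mul (by positivity)]
      refine ENNReal.ofReal_le_ofReal ?_
      have h5 := (two_mul_lt_inv hM hε hεM).le
      have hR0 : (0 : ℝ) ≤ R := Nat.cast_nonneg R
      calc 2 * β * (M * R) = β * R * (2 * M) := by ring
        _ ≤ β * R * (1 / ε) := by gcongr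
        _ = _ := by ring }

/-! ### The error functions and their limits -/

/-- The bound on the screening error relative to the volume. -/
def errorBound (C B ε R : ℝ) : ℝ := C * (cutBound ε + outerBound B ε R) / (2 * R)

/-- For fixed `ε` only the first term of `outerBound` is of order `R`; the energy near the cuts
grows like `R^(6/7)`. -/
lemma tendsto_errorBound (C B : ℝ) {ε : ℝ} (hε : 0 < ε) :
    Tendsto (fun R : ℕ => errorBound C B ε R) atTop (𝓝 (C * ((B + 2) ^ 2 * (7 * ε)))) := by
  have h1 : Tendsto (fun R : ℕ => (R : ℝ)⁻¹) atTop (𝓝 0) := tendsto_inv_atTop_zero.comp tendsto_natCast_atTop_atTop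
  have h2 : Tendsto (fun R : ℕ => (R : ℝ) ^ (-(1 / 7) : ℝ)) atTop (𝓝 0) :=
    (tendsto_rpow_neg_atTop (by norm_num : (0 : ℝ) < 1 / 7)).comp tendsto_natCast_atTop_atTop
  set G := nearBound (cutBound ε) B with hG
  have h3 : Tendsto (fun R : ℕ => C * (cutBound ε / 2 * (R : ℝ)⁻¹ + (B + 2) ^ 2 * (7 * ε)
      + G ^ 2 * (2 * cutBound ε + 12) * (R : ℝ)⁻¹ + G ^ 2 * 2 * ε ^ (6 / 7 : ℝ) * (R : ℝ) ^ (-(1 / 7) : ℝ))) atTop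
      (𝓝 (C * (cutBound ε / 2 * 0 + (B + 2) ^ 2 * (7 * ε)
      + G ^ 2 * (2 * cutBound ε + 12) * 0 + G ^ 2 * 2 * ε ^ (6 / 7 : ℝ) * 0))) :=
    Tendsto.const_mul _ ((((h1.const_mul _).add_const _).add (h1.const_mul _)).add (h2.const_mul _))
  simp only [mul_zero, zero_add, add_zero] at h3
  refine h3.congr' ?_
  filter_upwards [eventually_gt_atTop 0] with R hR
  have hR' : (0 : ℝ) < R := by exact_mod_cast hR
  have e : (R : ℝ) ^ (-(1 / 7) : ℝ) = (R : ℝ) ^ (6 / 7 : ℝ) / R := by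
    rw [eq_div_iff hR'.ne', ← Real.rpow_add_one hR'.ne']; norm_num
  rw [errorBound, outerBound, ← hG, Real.mul_rpow hε.le hR'.le, e]
  field_simp
  ring

open scoped Classical in
/-- The error of screening: crude where the cut is not available. -/
def screeningError (C B ε : ℝ) (R : ℕ) : ℝ≥0 :=
  if ε ≤ 1 / 20 ∧ 2 * cutBound ε + 20 ≤ ε * R then (errorBound C B ε R).toNNReal
  else ((R + R * B) ^ 2 * (R - 0) / (2 * R)).toNNReal

/-- For fixed small `ε` the fine error applies as soon as `R` is large, and its limit is linear in
`ε`. The crude values never enter. -/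
lemma limsup_screeningError (C B : ℝ) :
    limsup (fun ε : ℝ => limsup (fun R : ℕ => (screeningError C B ε R : ℝ≥0∞)) atTop) (𝓝[>] 0) = 0 := by
  have h1 : ∀ᶠ ε : ℝ in 𝓝[>] 0, limsup (fun R : ℕ => (screeningError C B ε R : ℝ≥0∞)) atTop
      = ENNReal.ofReal (C * ((B + 2) ^ 2 * (7 * ε))) := by
    filter_upwards [self_mem_nhdsWithin, Ioc_mem_nhdsGT (show (0 : ℝ) < 1 / 20 by norm_num)] with ε hε hε'
    have hε0 : 0 < ε := hε
    refine Tendsto.limsup_eq ((ENNReal.tendsto_ofReal (tendsto_errorBound C B hε0)).congr' ?_)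
    have h2 : Tendsto (fun R : ℕ => ε * (R : ℝ)) atTop atTop := tendsto_natCast_atTop_atTop.const_mul_atTop hε0
    filter_upwards [h2.eventually_ge_atTop (2 * cutBound ε + 20)] with R hR
    rw [screeningError, if_pos ⟨hε'.2, hR⟩]
    rfl
  rw [limsup_congr h1]
  refine Tendsto.limsup_eq ?_
  have h2 : Continuous fun ε : ℝ => ENNReal.ofReal (C * ((B + 2) ^ 2 * (7 * ε))) :=
    ENNReal.continuous_ofReal.comp (by fun_prop)
  have h3 := (h2.tendsto 0).mono_left (nhdsWithin_le_nhds (s := Ioi 0))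
  simpa using h3

open scoped Classical in
/-- The bound on the energy of the screened field. -/
def screeningEnergy (C : ℝ≥0) (B : ℝ) (F : Cyl k → Vec k) (ε : ℝ) (R : ℕ) (x : ℝ) : ℝ≥0 :=
  if ε ≤ 1 / 20 ∧ 2 * cutBound ε + 20 ≤ ε * R then
    ((∫⁻ z in slab k 0 R, ‖F z‖ₑ ^ 2) + C * (∫⁻ z in cutZone k x R, ‖F z‖ₑ ^ 2)
      + C * ENNReal.ofReal (outerBound B ε R)).toNNReal
  else ((R + R * B) ^ 2 * (R - 0)).toNNReal

/-! ### The screened field -/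

/-- The error obtained is independent of `M`; the factor `M` may be inserted because it exceeds one.
-/
lemma ofReal_div_mul_le {R β x : ℝ} {y : ℝ≥0∞} (hR : 0 < R) (hβ : 0 < β) (hy : y ≤ ENNReal.ofReal (β * x)) {M : ℝ}
    (hM : 2 < M) :
    ENNReal.ofReal (1 / (2 * R * β)) * y ≤ ENNReal.ofReal (x / (2 * R)) * ENNReal.ofReal M := by
  refine (mul_le_mul_right hy _).trans ?_
  rw [← ENNReal.ofReal_mul (by positivity), show 1 / (2 * R * β) * (β * x) = x / (2 * R) by field_simp]
  refine le_mul_of_one_le_right zero_le ?_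
  rw [ENNReal.one_le_ofReal]
  linarith

lemma lintegral_const_Icc (β : ℝ) (c : ℝ≥0∞) : ∫⁻ _ in Icc 0 β, c = c * ENNReal.ofReal β := by
  rw [setLIntegral_const, Real.volume_Icc, sub_zero]

/-- Everything the proposition claims about a screening, with the crude or the fine energy bound. -/
lemma exists_screening_of_isNearOptimal (k : ℕ) (β η : ℝ) (hβ : 0 < β) (hη : 0 < η) (hη' : η < 1 / 4) :
    ∃ (C : ℝ≥0) (B : ℝ), ∀ (M ε : ℝ) (R : ℕ), 2 < M → 0 < ε → ε < 1 / M ^ 2 → (2 / ε) ^ 8 < (R : ℝ) →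
      ∀ ω : Set (Bridge k β), IsBridgeRegular η M ε R ω →
      ∀ (L₁ L₂ : ℤ) (ω' : Set (Bridge k β)), IsNearOptimal η ε R ω L₁ L₂ ω' →
      ∃ x₀ ∈ Icc (6 * ε * R) (10 * ε * R),
      ∃ (ωscr : Set (Bridge k β)) (Escr : ℝ → Cyl k → Vec k),
        IsScreening η (10 * ε * R) R ω' ωscr Escr ∧
        (∀ t ∈ Icc 0 β, ∫⁻ z in slab k 0 R, ‖Escr t z‖ₑ ^ 2
          ≤ screeningEnergy C B (elField η ω' (slab k L₁ L₂) t) ε R x₀) ∧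
        Measurable (fun t : ℝ => screeningEnergy C B (elField η ω' (slab k L₁ L₂) t) ε R x₀) ∧
        ENNReal.ofReal (1 / (2 * R * β))
            * ∫⁻ t in Icc 0 β, (screeningEnergy C B (elField η ω' (slab k L₁ L₂) t) ε R x₀ : ℝ≥0∞)
          ≤ ENNReal.ofReal (1 / (2 * R * β))
              * (∫⁻ t in Icc 0 β, ∫⁻ z in slab k 0 R,
                  ‖elField η ω' (slab k L₁ L₂) t z‖ₑ ^ 2)
            + screeningError C B ε R * ENNReal.ofReal M := by
  classical
  obtain ⟨B, hB0, hB⟩ := exists_bound_chargeField (k := k) hη hη'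
  obtain ⟨C, hC⟩ := exists_screening k
  refine ⟨C, B, fun M ε R hM hε hεM hR ω hω L₁ L₂ ω' h => ?_⟩
  have hL₁ := h.competitor.left_le
  have hL₂ := h.competitor.le_right
  have hR0 : (0 : ℝ) < R := lt_of_le_of_lt (by positivity) hR
  obtain ⟨W, rfl, hcard⟩ := h.competitor.neutral.exists_finset (by linarith)
  have hstart : ∀ b ∈ W, b 0 ∈ slab k L₁ L₂ := fun b hb => h.competitor.neutral.1.2 b hb
  have hint : ∀ t {K : Set (Cyl k)}, K ⊆ slab k 0 R →
      ∫⁻ z in K, ‖elField η (W : Set (Bridge k β)) (slab k L₁ L₂) t z‖ₑ ^ 2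
        = ∫⁻ z in K, ‖fullField η L₁ W t z‖ₑ ^ 2 := fun t K hK =>
    lintegral_elField_eq hη hη' hL₁ hL₂ hstart hcard t hK
  by_cases hcase : ε ≤ 1 / 20 ∧ 2 * cutBound ε + 20 ≤ ε * R
  · have hcut : CutData η ε R L₁ W := cutData_of_isNearOptimal hβ hη hη' hM hε hεM hcase.1 hR hω h hcard
    obtain ⟨s, hs, ωscr, E, hscr, hE, hZ⟩ := hC hβ hη hη' hB0 hB hcut hcase.2
    have hw20 := hcut.twenty_mul_le
    have hw1 := hcut.eps_mul_ge
    have hw1' : (2097152 : ℝ) ≤ ε * R := by norm_num at hw1; exact hw1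
    have hX := hcut.cutBound_nonneg
    have hO : 0 ≤ outerBound B ε R := by rw [outerBound]; positivity
    have hzone : cutZone k s R ⊆ slab k 0 R := cutZone_subset (by linarith [hs.1]) (by linarith [hs.2])
    set f : ℝ → ℝ≥0∞ := fun t => (∫⁻ z in slab k 0 R, ‖fullField η L₁ W t z‖ₑ ^ 2)
      + C * (∫⁻ z in cutZone k s R, ‖fullField η L₁ W t z‖ₑ ^ 2) + C * ENNReal.ofReal (outerBound B ε R) with hf
    have hfull := lintegral_fullField_ne_top hη hη' (L₁ : ℝ) R W
    have hftop : ∀ t, f t ≠ ∞ := fun t => by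
      have h1 := hfull t
      have h2 := ne_top_of_le_ne_top h1 (lintegral_mono_set hzone)
      simp only [hf]
      finiteness
    have hm : Measurable fun q : ℝ × Cyl k => ‖fullField η L₁ W q.1 q.2‖ₑ ^ 2 :=
      ((measurable_fullField hη hη' L₁ W).enorm).pow_const 2
    have hm1 : Measurable fun t : ℝ => ∫⁻ z in slab k 0 R, ‖fullField η L₁ W t z‖ₑ ^ 2 := hm.lintegral_prod_right'
    have hm2 : Measurable fun t : ℝ => ∫⁻ z in cutZone k s R, ‖fullField η L₁ W t z‖ₑ ^ 2 := hm.lintegral_prod_right'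
    have hfm : Measurable f := (hm1.add (hm2.const_mul _)).add_const _
    have hΦ : ∀ t, screeningEnergy C B (elField η (W : Set (Bridge k β)) (slab k L₁ L₂) t) ε R s = (f t).toNNReal :=
      fun t => by rw [screeningEnergy, if_pos hcase, hint t Subset.rfl, hint t hzone]
    refine ⟨s, ⟨by linarith [hs.1], by linarith [hs.2]⟩, ωscr, E, hscr, fun t _ => ?_, ?_, ?_⟩
    · rw [hΦ, ENNReal.coe_toNNReal (hftop t)]
      exact hE t
    · simp_rw [hΦ]
      exact hfm.ennreal_toNNReal
    · simp_rw [hΦ, ENNReal.coe_toNNReal (hftop _), hint _ Subset.rfl]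
      rw [screeningError, if_pos hcase]
      have e : ∫⁻ t in Icc 0 β, f t = (∫⁻ t in Icc 0 β, ∫⁻ z in slab k 0 R, ‖fullField η L₁ W t z‖ₑ ^ 2)
          + (C * (∫⁻ t in Icc 0 β, ∫⁻ z in cutZone k s R, ‖fullField η L₁ W t z‖ₑ ^ 2)
            + C * ENNReal.ofReal (outerBound B ε R) * ENNReal.ofReal β) := by
        simp only [hf]
        rw [lintegral_add_right _ measurable_const, lintegral_add_left hm1, lintegral_const_mul _ hm2,
          lintegral_const_Icc β, add_assoc]
      rw [e, mul_add]
      refine add_le_add le_rfl ?_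
      refine ofReal_div_mul_le (x := C * (cutBound ε + outerBound B ε R)) hR0 hβ ?_ hM
      refine (add_le_add_left (mul_le_mul_right hZ _) _).trans_eq ?_
      rw [mul_assoc, ← ENNReal.ofReal_mul hO, ← mul_add, ← ENNReal.ofReal_add (by positivity) (by positivity),
        ← ENNReal.ofReal_coe_nnreal, ← ENNReal.ofReal_mul (NNReal.coe_nonneg C)]
      congr 1
      ring
  · have hbig := large_iff_pow hε hR
    have hq := quarter_of_lt hM hεM
    have h4 : 4 ≤ 1 / ε := by rw [le_div_iff₀ hε]; linarith
    have h1 : (1 : ℝ) ≤ (1 / ε) ^ 7 := one_le_pow₀ (by linarith)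
    have hw : 256 ≤ ε * R := by linarith
    have hwR : ε * R ≤ R := by nlinarith
    set I := W.filter fun b => b 0 ∈ slab k (10 * ε * R) (R - 10 * ε * R) with hI
    have hIt : ∀ b ∈ I, (∀ t : AddCircle β, (b t).1 ∈ Icc (1 / 2 : ℝ) (R - 1 / 2)) ∧ I.card ≤ R := by
      intro b hb
      have hb0 := (Finset.mem_filter.1 hb).2
      -- For `ε > 1/20` the region to be preserved is empty, so the mere existence of a bridge in
      -- `I` forces `ε ≤ 1/20`.
      have hε20 : ε ≤ 1 / 20 := by
        have h5 : 10 * ε * R ≤ R - 10 * ε * R := hb0.1.trans hb0.2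
        have h6 : 20 * ε ≤ 1 := by
          by_contra hc
          nlinarith
        linarith
      have hcut : CutData η ε R L₁ W := cutData_of_isNearOptimal hβ hη hη' hM hε hεM hε20 hR hω h hcard
      have hw1 := hcut.eps_mul_ge
      have hw1' : (2097152 : ℝ) ≤ ε * R := by norm_num at hw1; exact hw1
      have hclose : ∀ b ∈ I, ∀ t : AddCircle β, (b t).1 ∈ Icc (5 * (ε * R) + 1) (R - 5 * (ε * R) - 1) := by
        intro b hb t
        obtain ⟨hbW, h5, h6⟩ := Finset.mem_filter.1 hb
        have h7 := abs_le.1 ((abs_sub_le_xRange hβ b t).trans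
          (hcut.xRange_le hβ hbW ⟨by linarith, by linarith⟩))
        exact ⟨by linarith [h7.1], by linarith [h7.2]⟩
      refine ⟨fun t => ⟨by linarith [(hclose b hb t).1], by linarith [(hclose b hb t).2]⟩, ?_⟩
      refine le_trans (Finset.card_le_card fun b hb => ?_) (hcut.card_interior_le hβ hη hη')
      exact Finset.mem_filter.2 ⟨(Finset.mem_filter.1 hb).1, hclose b hb⟩
    have hIR : I.card ≤ R := by
      rcases I.eq_empty_or_nonempty with h0 | ⟨b, hb⟩
      · rw [h0]; simp
      · exact (hIt b hb).2
    obtain ⟨ωscr, E, hscr, hE⟩ := exists_crude_screening hη hη' hB (c := 10 * ε * R) (R := R) (by linarith)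
      (by exact_mod_cast (show (2 : ℝ) ≤ R by linarith)) (ω := (W : Set (Bridge k β))) (I := I)
      (fun b => by rw [hI, Finset.mem_filter]; rfl) (fun b hb => (hIt b hb).1) hIR
    have hΦ : ∀ t, screeningEnergy C B (elField η (W : Set (Bridge k β)) (slab k L₁ L₂) t) ε R (6 * ε * R)
        = ((R + R * B) ^ 2 * (R - 0)).toNNReal := fun t => by rw [screeningEnergy, if_neg hcase]
    -- No cut is made here, so any admissible abscissa serves.
    refine ⟨6 * ε * R, ⟨le_rfl, by linarith⟩, ωscr, E, hscr, fun t _ => ?_, ?_, ?_⟩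
    · rw [hΦ]
      exact hE t
    · simp_rw [hΦ]
      exact measurable_const
    · simp_rw [hΦ]
      rw [screeningError, if_neg hcase, lintegral_const_Icc β]
      -- The crude energy is charged entirely to the error term.
      refine le_add_left ?_
      refine ofReal_div_mul_le hR0 hβ ?_ hM
      rw [mul_comm, ENNReal.ofReal_mul hβ.le]
      rfl

end

end

end Jellium

/-- Energy change from screening electric fields. The dimension `k`, the time length `β` of the
bridges and the smearing radius `η` are fixed. The error `φ` depends on `ε` and `R` only; the energy
bound `Φ₀` is one functional of the time slice of the original field, of `ε`, `R` and of the
boundary abscissa `x₀` at which the field is cut. -/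
theorem proposition5p3 (k : ℕ) (β η : ℝ) (hβ : 0 < β) (hη : 0 < η) (hη' : η < 1 / 4) :
    ∃ (φ : ℝ → ℕ → ℝ≥0) (Φ₀ : (Cyl k → Vec k) → ℝ → ℕ → ℝ → ℝ≥0),
      limsup (fun ε : ℝ => limsup (fun R : ℕ => (φ ε R : ℝ≥0∞)) atTop) (𝓝[>] 0) = 0 ∧
      ∀ (M ε : ℝ) (R : ℕ), 2 < M → 0 < ε → ε < 1 / M ^ 2 → (2 / ε) ^ 8 < (R : ℝ) →
      ∀ ω : Set (Bridge k β), IsBridgeRegular η M ε R ω →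
      ∀ (L₁ L₂ : ℤ) (ω' : Set (Bridge k β)), IsNearOptimal η ε R ω L₁ L₂ ω' →
      ∃ x₀ ∈ Icc (6 * ε * R) (10 * ε * R),
      ∃ (ωscr : Set (Bridge k β)) (Escr : ℝ → Cyl k → Vec k),
        IsNeutral (slab k 0 R) ωscr ∧
        AEStronglyMeasurable (Function.uncurry Escr)
          ((volume.restrict (Icc 0 β)).prod (volume.restrict (slab k 0 R))) ∧
        proj ω (slab k (10 * ε * R) (R - 10 * ε * R))
          = proj ωscr (slab k (10 * ε * R) (R - 10 * ε * R)) ∧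
        IsCompatible η R ωscr Escr ∧
        IsScreened β R Escr ∧
        (∀ t ∈ Icc 0 β, ∫⁻ z in slab k 0 R, ‖Escr t z‖ₑ ^ 2
          ≤ Φ₀ (elField η ω' (slab k L₁ L₂) t) ε R x₀) ∧
        Measurable (fun t : ℝ => Φ₀ (elField η ω' (slab k L₁ L₂) t) ε R x₀) ∧
        ENNReal.ofReal (1 / (2 * R * β))
            * ∫⁻ t in Icc 0 β, (Φ₀ (elField η ω' (slab k L₁ L₂) t) ε R x₀ : ℝ≥0∞)
          ≤ ENNReal.ofReal (1 / (2 * R * β))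
              * (∫⁻ t in Icc 0 β, ∫⁻ z in slab k 0 R,
                  ‖elField η ω' (slab k L₁ L₂) t z‖ₑ ^ 2)
            + φ ε R * ENNReal.ofReal M := by
  obtain ⟨C, B, h⟩ := exists_screening_of_isNearOptimal k β η hβ hη hη'
  refine ⟨screeningError C B, screeningEnergy C B, limsup_screeningError C B, ?_⟩
  intro M ε R hM hε hεM hR ω hω L₁ L₂ ω' hopt
  obtain ⟨x₀, hx₀, ωscr, E, hscr, hE, hmeas, hint⟩ := h M ε R hM hε hεM hR ω hω L₁ L₂ ω' hopt
  refine ⟨x₀, hx₀, ωscr, E, hscr.neutral, hscr.measurable, ?_, hscr.compatible, hscr.screened, hE, hmeas, hint⟩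
  -- The screening preserves bridges of the competitor, which has the same bridges as `ω` in all of
  -- `[0, R] × D`.
  rw [← hscr.agree]
  have hsub : slab k (10 * ε * R) (R - 10 * ε * R) ⊆ slab k 0 R := fun z hz => by
    have h0 : 0 ≤ 10 * ε * R := by positivity
    exact ⟨h0.trans hz.1, hz.2.trans (by linarith)⟩
  have hag := hopt.competitor.agree
  ext b
  exact ⟨fun hb => ⟨(hag.superset ⟨hb.1, hsub hb.2⟩).1, hb.2⟩, fun hb => ⟨(hag.subset ⟨hb.1, hsub hb.2⟩).1, hb.2⟩⟩
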